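/- Let $k$ be an algebraically closed field of characteristic $0$, let $X$ be a smooth projective variety over $k$, let $K=k((\varpi))$ with valuation ring $K^\circ=k[[\varpi]]$ and absolute value $|\cdot|_K=e^{-\mathrm{ord}_\varpi}$, and let $X_K$ be the base change of $X$ to $K$. Let $X^{\mathrm{an}}$ and $X_K^{\mathrm{an}}$ be the Berkovich analytifications of $X$ with respect to the trivial absolute value on $k$ and of $X_K$ with respect to $|\cdot|_K$; their points are viewed as (additive, real-valued) semivaluations, and $C^0(\cdot)$ denotes real-valued continuous functions. Let $\sigma\colon X^{\mathrm{an}}\to X_K^{\mathrm{an}}$ be the Gauss extension, characterized by $$\sigma(v)\Big(\sum_n a_n\varpi^n\Big)=\min_n\,(v(a_n)+n)$$ for local functions on $X_K$ expanded as Laurent series in $\varpi$, where the $a_n$ are local functions on $X$. *PL functions on $X^{\mathrm{an}}$.* For an ideal $\mathfrak b\subset\mathcal O_X$ put $\log|\mathfrak b|(v)=-v(\mathfrak b)\in[-\infty,0]$. Let $\mathrm{PL}^+_{\hom}(X)$ be the set of $\mathbb Q_{\ge0}$-linear combinations of functions $\log|\mathfrak b|$ with $\mathfrak b\neq0$; let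 $\mathrm{PL}^+(X)$ be the set of $\varphi\in C^0(X^{\mathrm{an}})$ of the form $\varphi=\max_i(\psi_i+\lambda_i)$ for a finite nonempty family $\psi_i\in\mathrm{PL}^+_{\hom}(X)$, $\lambda_i\in\mathbb Q$; and let $\mathrm{PL}(X)$ be the set of differences of functions in $\mathrm{PL}^+(X)$. Let $\mathbb R\mathrm{PL}^+(X)$ be the set of finite (nonempty) maxima of $\mathbb R_{\ge0}$-linear combinations of functions in $\mathrm{PL}^+(X)$, and let $\mathbb R\mathrm{PL}(X)$ be the set of differences of functions in $\mathbb R\mathrm{PL}^+(X)$. *PL functions on $X_K^{\mathrm{an}}$.* A model of $X_K$ is a normal, flat, projective $K^\circ$-scheme $\mathcal X$ together with an isomorphism of its generic fiber with $X_K$. A $\mathbb Q$-Cartier $\mathbb Q$-divisor $D$ on $\mathcal X$ supported in the special fiber defines a function $w\mapsto w(D)$ on $X_K^{\mathrm{an}}$, where $w(D)=\frac1m w(f)$ for any $m\ge1$ such that $mD$ is Cartier and any local equation $f$ of $mD$ at the center of $w$ on $\mathcal X$. Let $\mathrm{PL}(X_K)\subset C^0(X_K^{\mathrm{an}})$ be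 the set of all functions obtained in this way from all models, and let $\mathbb R\mathrm{PL}(X_K)$ be the smallest $\mathbb R$-linear subspace of $C^0(X_K^{\mathrm{an}})$ that contains $\mathrm{PL}(X_K)$ and is stable under $\max$. **Theorem.** With $\sigma^\star\varphi=\varphi\circ\sigma$, we have $$\sigma^\star\mathrm{PL}(X_K)=\mathrm{PL}(X)\qquad\text{and}\qquad \sigma^\star\mathbb R\mathrm{PL}(X_K)=\mathbb R\mathrm{PL}(X).$$ -/

import Mathlib

open CategoryTheory CategoryTheory.Limits AlgebraicGeometry
open scoped NNReal

universe u

noncomputable section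

namespace NAPL

/-! ## Absolute values on the base fields -/

/-- The trivial absolute value. -/
def trivialAbs {k : Type u} [Field k] (a : k) : ℝ≥0 :=
  open Classical in if a = 0 then 0 else 1

/-- The real number `e^{-n}`. -/
def expNeg (n : ℤ) : ℝ≥0 := Real.toNNReal (Real.exp (-(n : ℝ)))

/-- The absolute value `e^{-ord}` on the field `K = k((ϖ))` of formal Laurent series. -/
def laurentAbs {k : Type u} [Field k] (a : LaurentSeries k) : ℝ≥0 :=
  open Classical in if a = 0 then 0 else expNeg a.order

/-! ## Projective schemes and varieties -/

attribute [local instance] MvPolynomial.gradedAlgebra in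
/-- Projective space of dimension `n` over `R`. -/
def ProjSpace (R : Type u) [CommRing R] (n : ℕ) : Scheme.{u} :=
  Proj (MvPolynomial.homogeneousSubmodule (Fin (n + 1)) R)

attribute [local instance] MvPolynomial.gradedAlgebra in
/-- The structure morphism of projective space. -/
def ProjSpace.str (R : Type u) [CommRing R] (n : ℕ) :
    ProjSpace R n ⟶ Spec (CommRingCat.of R) :=
  Proj.toSpecZero (MvPolynomial.homogeneousSubmodule (Fin (n + 1)) R) ≫
    Spec.map (CommRingCat.ofHom
      (algebraMap R (MvPolynomial.homogeneousSubmodule (Fin (n + 1)) R 0)))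

/-- A scheme over an affine base is projective if it is a closed subscheme of some
projective space over that base. -/
def IsProjective {R : Type u} [CommRing R] {X : Scheme.{u}}
    (f : X ⟶ Spec (CommRingCat.of R)) : Prop :=
  ∃ (n : ℕ) (i : X ⟶ ProjSpace R n), IsClosedImmersion i ∧ i ≫ ProjSpace.str R n = f

/-- A smooth projective variety over a field. -/
structure IsSmoothProjectiveVariety {F : Type u} [Field F] {X : Scheme.{u}}
    (f : X ⟶ Spec (CommRingCat.of F)) : Prop where
  projective : IsProjective f
  smooth : Smooth f
  integral : GeometricallyIntegral f

/-- A scheme is normal if all its local rings are integrally closed domains. -/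
def IsNormalScheme (X : Scheme.{u}) : Prop :=
  ∀ x : X, IsDomain (X.presheaf.stalk x) ∧ IsIntegrallyClosed (X.presheaf.stalk x)

/-! ## Berkovich analytification -/

/-- The homomorphism `F → κ(x)` for a point `x` of an `F`-scheme. -/
def toResidueField {F : Type u} [Field F] {X : Scheme.{u}}
    (f : X ⟶ Spec (CommRingCat.of F)) (x : X) : F →+* X.residueField x :=
  (Spec.preimage (X.fromSpecResidueField x ≫ f)).hom

/-- The underlying set of the Berkovich analytification of an `F`-scheme `f : X ⟶ Spec F`, where
`F` carries the (non-archimedean) absolute value `ν`. Its elements are the semivaluations: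
pairs consisting of a point `x` of `X` (the generic point of a subvariety) and a
non-archimedean absolute value on the residue field `κ(x)` extending `ν`. We use multiplicative
notation; the corresponding additive valuation is `v = -log |·|`. -/
structure Berk {F : Type u} [Field F] (ν : F → ℝ≥0) {X : Scheme.{u}}
    (f : X ⟶ Spec (CommRingCat.of F)) where
  /-- the kernel of the semivaluation -/
  pt : X
  /-- the absolute value on the residue field -/
  val : Valuation (X.residueField pt) ℝ≥0
  val_base : ∀ a : F, val (toResidueField f pt a) = ν a

namespace Berk

variable {F : Type u} [Field F] {ν : F → ℝ≥0} {X : Scheme.{u}}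
  {f : X ⟶ Spec (CommRingCat.of F)}

/-- The value `|s|(v)` of a function `s` defined on an open set containing the kernel of `v`. -/
def abs (v : Berk ν f) {U : X.Opens} (s : Γ(X, U)) (h : v.pt ∈ U) : ℝ≥0 :=
  v.val (X.evaluation U v.pt h s)

/-- The Berkovich topology: the coarsest one such that for every open `U ⊆ X`, the set
`{v | v.pt ∈ U}` is open and `v ↦ |s|(v)` is continuous on it for all `s ∈ Γ(X, U)`. -/
instance : TopologicalSpace (Berk ν f) :=
  TopologicalSpace.generateFrom
    {S | ∃ (U : X.Opens) (s : Γ(X, U)) (V : Set ℝ≥0), IsOpen V ∧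
      S = {v | ∃ h : v.pt ∈ U, v.abs s h ∈ V}}

/-- The semivaluation on `X` induced by a morphism `g : Spec L ⟶ X` and an absolute value on the
field `L`. -/
def ofSpec {L : Type u} [Field L] (w : Valuation L ℝ≥0) (g : Spec (CommRingCat.of L) ⟶ X)
    (h : ∀ a : F, w ((Spec.preimage (g ≫ f)).hom a) = ν a) : Berk ν f where
  pt := (Scheme.SpecToEquivOfField L X g).1
  val := w.comap (Scheme.SpecToEquivOfField L X g).2.hom
  val_base a := by
    rw [← h a]
    have key : Spec.preimage (X.fromSpecResidueField (Scheme.SpecToEquivOfField L X g).1 ≫ f) ≫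
        (Scheme.SpecToEquivOfField L X g).2 = Spec.preimage (g ≫ f) := by
      apply Spec.map_injective
      rw [Spec.map_comp, Spec.map_preimage, Spec.map_preimage, ← Category.assoc]
      congr 1
      exact (Scheme.SpecToEquivOfField L X).left_inv g
    rw [← key]
    rfl

end Berk

/-! ## The Gauss norm -/

section Gauss

lemma coe_expNeg (n : ℤ) : (expNeg n : ℝ) = Real.exp (-(n : ℝ)) :=
  Real.coe_toNNReal _ (Real.exp_pos _).le

lemma expNeg_pos (n : ℤ) : 0 < expNeg n := Real.toNNReal_pos.2 (Real.exp_pos _)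

lemma expNeg_zero : expNeg 0 = 1 := by
  apply NNReal.eq; simp [coe_expNeg]

lemma expNeg_add (m n : ℤ) : expNeg (m + n) = expNeg m * expNeg n := by
  apply NNReal.eq
  rw [NNReal.coe_mul, coe_expNeg, coe_expNeg, coe_expNeg, ← Real.exp_add]
  congr 1; push_cast; ring

lemma expNeg_anti {m n : ℤ} (h : m ≤ n) : expNeg n ≤ expNeg m := by
  rw [← NNReal.coe_le_coe, coe_expNeg, coe_expNeg, Real.exp_le_exp]
  exact neg_le_neg (by exact_mod_cast h)

lemma exists_mul_expNeg_lt (C : ℝ≥0) {ε : ℝ≥0} (hε : 0 < ε) :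
    ∃ N : ℤ, ∀ n, N ≤ n → C * expNeg n < ε := by
  obtain ⟨N, hN⟩ := exists_nat_gt ((C : ℝ) / ε)
  refine ⟨N, fun n hn => ?_⟩
  have hε' : (0 : ℝ) < ε := hε
  have h1 : (C : ℝ) < N * ε := by rwa [div_lt_iff₀ hε'] at hN
  have h2 : (N : ℝ) < Real.exp n := by
    have h3 : (N : ℝ) ≤ n := by exact_mod_cast hn
    linarith [Real.add_one_le_exp (n : ℝ)]
  rw [← NNReal.coe_lt_coe]
  rw [NNReal.coe_mul, coe_expNeg, Real.exp_neg]
  rw [← div_eq_mul_inv, div_lt_iff₀ (Real.exp_pos _)]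
  nlinarith

variable {κ : Type u} [Field κ] (v : Valuation κ ℝ≥0)

/-- The ring of Laurent series over `κ` with bounded coefficients. -/
def boundedLaurent : Subring (LaurentSeries κ) where
  carrier := {f | ∃ C : ℝ≥0, ∀ n, v (f.coeff n) ≤ C}
  zero_mem' := ⟨0, fun n => by simp⟩
  one_mem' := ⟨1, fun n => by
    rw [HahnSeries.coeff_one]; split_ifs <;> simp⟩
  add_mem' := by
    rintro f g ⟨C, hC⟩ ⟨D, hD⟩
    refine ⟨max C D, fun n => ?_⟩
    rw [HahnSeries.coeff_add]
    exact (v.map_add _ _).trans (max_le_max (hC n) (hD n))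
  neg_mem' := by
    rintro f ⟨C, hC⟩
    exact ⟨C, fun n => by rw [HahnSeries.coeff_neg, Valuation.map_neg]; exact hC n⟩
  mul_mem' := by
    rintro f g ⟨C, hC⟩ ⟨D, hD⟩
    refine ⟨C * D, fun n => ?_⟩
    rw [HahnSeries.coeff_mul]
    refine v.map_sum_le fun i _ => ?_
    rw [map_mul]
    exact mul_le_mul' (hC _) (hD _)

/-- The Gauss norm `sup_n |a_n| e^{-n}` of a Laurent series `∑ a_n ϖ^n`. -/
def gaussNorm (f : LaurentSeries κ) : ℝ≥0 := ⨆ n : ℤ, v (f.coeff n) * expNeg n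

variable {v}

lemma term_le {f : LaurentSeries κ} {C : ℝ≥0} (hC : ∀ n, v (f.coeff n) ≤ C) (n : ℤ) :
    v (f.coeff n) * expNeg n ≤ C * expNeg f.order := by
  by_cases h : f.coeff n = 0
  · simp [h]
  · exact mul_le_mul' (hC n) (expNeg_anti (HahnSeries.order_le_of_coeff_ne_zero h))

lemma bddAbove_terms {f : LaurentSeries κ} (hf : f ∈ boundedLaurent v) :
    BddAbove (Set.range fun n : ℤ => v (f.coeff n) * expNeg n) := by
  obtain ⟨C, hC⟩ := hf
  exact ⟨_, by rintro _ ⟨n, rfl⟩; exact term_le hC n⟩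

lemma le_gaussNorm {f : LaurentSeries κ} (hf : f ∈ boundedLaurent v) (n : ℤ) :
    v (f.coeff n) * expNeg n ≤ gaussNorm v f :=
  le_ciSup (bddAbove_terms hf) n

lemma gaussNorm_le {f : LaurentSeries κ} {c : ℝ≥0}
    (h : ∀ n, v (f.coeff n) * expNeg n ≤ c) : gaussNorm v f ≤ c :=
  ciSup_le h

lemma exists_dominant {f : LaurentSeries κ} (hf : f ∈ boundedLaurent v) (h0 : f ≠ 0) :
    ∃ i : ℤ, f.coeff i ≠ 0 ∧ gaussNorm v f = v (f.coeff i) * expNeg i ∧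
      ∀ n < i, v (f.coeff n) * expNeg n < v (f.coeff i) * expNeg i := by
  obtain ⟨C, hC⟩ := hf
  set j := f.order
  have hj : f.coeff j ≠ 0 := HahnSeries.coeff_order_eq_zero.not.2 h0
  have hjpos : 0 < v (f.coeff j) * expNeg j :=
    mul_pos ((v.pos_iff).2 hj) (expNeg_pos j)
  obtain ⟨N, hN⟩ := exists_mul_expNeg_lt C hjpos
  have hjS : j ∈ Finset.Icc j (max j N) := by simp
  obtain ⟨i, hiS, hi⟩ := Finset.exists_max_image (Finset.Icc j (max j N))
    (fun n : ℤ => toLex (v (f.coeff n) * expNeg n, OrderDual.toDual n)) ⟨j, hjS⟩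
  have hi' : ∀ n ∈ Finset.Icc j (max j N), v (f.coeff n) * expNeg n < v (f.coeff i) * expNeg i ∨
      (v (f.coeff n) * expNeg n = v (f.coeff i) * expNeg i ∧ i ≤ n) := by
    intro n hn
    simpa [Prod.Lex.toLex_le_toLex] using hi n hn
  have hji : v (f.coeff j) * expNeg j ≤ v (f.coeff i) * expNeg i := by
    rcases hi' j hjS with h | h
    · exact h.le
    · exact h.1.le
  have hipos := hjpos.trans_le hji
  have hall : ∀ n, v (f.coeff n) * expNeg n < v (f.coeff i) * expNeg i ∨
      (v (f.coeff n) * expNeg n = v (f.coeff i) * expNeg i ∧ i ≤ n) := by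
    intro n
    by_cases hn : n ∈ Finset.Icc j (max j N)
    · exact hi' n hn
    · left
      by_cases hlt : n < j
      · rw [HahnSeries.coeff_eq_zero_of_lt_order hlt]
        simpa using hipos
      · have hNn : N ≤ n := by
          simp only [Finset.mem_Icc, not_and, not_le] at hn
          exact (le_max_right j N).trans (hn (not_lt.1 hlt)).le
        calc v (f.coeff n) * expNeg n ≤ C * expNeg n := mul_le_mul' (hC n) le_rfl
          _ < _ := hN n hNn
          _ ≤ _ := hji
  refine ⟨i, fun h => ?_, le_antisymm (gaussNorm_le fun n => ?_) (le_gaussNorm ⟨C, hC⟩ i), ?_⟩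
  · simp [h] at hipos
  · rcases hall n with h | h
    · exact h.le
    · exact h.1.le
  · intro n hn
    rcases hall n with h | h
    · exact h
    · exact absurd h.2 (not_le.2 hn)

lemma gaussNorm_zero : gaussNorm v 0 = 0 := by simp [gaussNorm]

lemma gaussNorm_eq_zero {f : LaurentSeries κ} (hf : f ∈ boundedLaurent v)
    (h : gaussNorm v f = 0) : f = 0 := by
  by_contra h0
  obtain ⟨i, hi, he, -⟩ := exists_dominant hf h0
  rw [h] at he
  exact (mul_pos ((v.pos_iff).2 hi) (expNeg_pos i)).ne he

lemma gaussNorm_mul {f g : LaurentSeries κ} (hf : f ∈ boundedLaurent v)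
    (hg : g ∈ boundedLaurent v) : gaussNorm v (f * g) = gaussNorm v f * gaussNorm v g := by
  classical
  by_cases hf0 : f = 0
  · simp [hf0, gaussNorm_zero]
  by_cases hg0 : g = 0
  · simp [hg0, gaussNorm_zero]
  apply le_antisymm
  · refine gaussNorm_le fun n => ?_
    have hpos := expNeg_pos n
    rw [← le_div_iff₀ hpos, HahnSeries.coeff_mul]
    refine v.map_sum_le fun ij hij => ?_
    rw [le_div_iff₀ hpos, map_mul]
    have hn : ij.1 + ij.2 = n := by
      have := hij
      simp at this
      tauto
    calc v (f.coeff ij.1) * v (g.coeff ij.2) * expNeg n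
        = (v (f.coeff ij.1) * expNeg ij.1) * (v (g.coeff ij.2) * expNeg ij.2) := by
          rw [← hn, expNeg_add]; ring
      _ ≤ _ := mul_le_mul' (le_gaussNorm hf _) (le_gaussNorm hg _)
  · obtain ⟨i, hi, hei, hli⟩ := exists_dominant hf hf0
    obtain ⟨j, hj, hej, hlj⟩ := exists_dominant hg hg0
    have hcoeff : v ((f * g).coeff (i + j)) = v (f.coeff i * g.coeff j) := by
      rw [HahnSeries.coeff_mul]
      refine v.map_sum_eq_of_lt (j := (i, j)) (f := fun ij : ℤ × ℤ => f.coeff ij.1 * g.coeff ij.2)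
        ?_ ?_
      · simp [hi, hj]
      · intro ab hab
        simp only [Finset.mem_sdiff, Finset.mem_singleton] at hab
        obtain ⟨hab, hne⟩ := hab
        have hsum : ab.1 + ab.2 = i + j := by
          simp at hab
          tauto
        rw [← mul_lt_mul_iff_left₀ (expNeg_pos (i + j)), map_mul, map_mul]
        have e1 : v (f.coeff ab.1) * v (g.coeff ab.2) * expNeg (i + j) =
            (v (f.coeff ab.1) * expNeg ab.1) * (v (g.coeff ab.2) * expNeg ab.2) := by
          rw [← hsum, expNeg_add]; ring
        have e2 : v (f.coeff i) * v (g.coeff j) * expNeg (i + j) =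
            (v (f.coeff i) * expNeg i) * (v (g.coeff j) * expNeg j) := by
          rw [expNeg_add]; ring
        rw [e1, e2]
        have pi := mul_pos ((v.pos_iff).2 hi) (expNeg_pos i)
        have pj := mul_pos ((v.pos_iff).2 hj) (expNeg_pos j)
        rcases lt_trichotomy ab.1 i with h | h | h
        · exact mul_lt_mul_of_lt_of_le_of_nonneg_of_pos (hli _ h)
            (hej ▸ le_gaussNorm hg _) zero_le pj
        · exact absurd (Prod.ext h (by omega)) hne
        · exact (mul_le_mul' (hei ▸ le_gaussNorm hf _) le_rfl).trans_lt
            (mul_lt_mul_of_pos_left (hlj _ (by omega)) pi)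
    have := le_gaussNorm ((boundedLaurent v).mul_mem hf hg) (i + j)
    rw [hcoeff, map_mul, expNeg_add] at this
    rw [hei, hej]
    calc _ = _ := by ring
      _ ≤ _ := this

lemma gaussNorm_add {f g : LaurentSeries κ} (hf : f ∈ boundedLaurent v)
    (hg : g ∈ boundedLaurent v) :
    gaussNorm v (f + g) ≤ max (gaussNorm v f) (gaussNorm v g) := by
  refine gaussNorm_le fun n => ?_
  rw [HahnSeries.coeff_add]
  calc v (f.coeff n + g.coeff n) * expNeg n
      ≤ max (v (f.coeff n)) (v (g.coeff n)) * expNeg n := mul_le_mul' (v.map_add _ _) le_rfl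
    _ = max (v (f.coeff n) * expNeg n) (v (g.coeff n) * expNeg n) := max_mul_of_nonneg _ _ zero_le
    _ ≤ _ := max_le_max (le_gaussNorm hf n) (le_gaussNorm hg n)

lemma C_mem_boundedLaurent (a : κ) : HahnSeries.C a ∈ boundedLaurent v :=
  ⟨v a, fun n => by
    rw [HahnSeries.C_apply, HahnSeries.coeff_single]; split_ifs <;> simp⟩

lemma gaussNorm_C (a : κ) : gaussNorm v (HahnSeries.C a) = v a := by
  apply le_antisymm
  · refine gaussNorm_le fun n => ?_
    rw [HahnSeries.C_apply, HahnSeries.coeff_single]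
    split_ifs with h
    · simp [h, expNeg_zero]
    · simp
  · have := le_gaussNorm (v := v) (C_mem_boundedLaurent a) 0
    simpa [expNeg_zero] using this

variable (v)

/-- The Gauss norm as a (multiplicative, real-valued) valuation. -/
def gaussValuation : Valuation (boundedLaurent v) ℝ≥0 where
  toFun f := gaussNorm v f.1
  map_zero' := gaussNorm_zero
  map_one' := by
    have := gaussNorm_C (v := v) 1
    rwa [map_one, map_one] at this
  map_mul' f g := gaussNorm_mul f.2 g.2
  map_add_le_max' f g := gaussNorm_add f.2 g.2

lemma nonZeroDivisors_le :
    nonZeroDivisors (boundedLaurent v) ≤ (gaussValuation v).supp.primeCompl := by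
  intro f hf h
  have h' : gaussNorm v f.1 = 0 := h
  have : f = 0 := Subtype.ext (gaussNorm_eq_zero f.2 h')
  exact nonZeroDivisors.ne_zero hf this

/-- The fraction field of the ring of bounded Laurent series. -/
abbrev GaussField : Type u := FractionRing (boundedLaurent v)

/-- The Gauss norm on the fraction field. -/
def gaussFieldValuation : Valuation (GaussField v) ℝ≥0 :=
  (gaussValuation v).extendToLocalization (nonZeroDivisors_le v) (GaussField v)

/-- The inclusion of the coefficient field. -/
def coeffToGauss : κ →+* GaussField v :=
  (algebraMap (boundedLaurent v) (GaussField v)).comp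
    (HahnSeries.C.codRestrict (boundedLaurent v) C_mem_boundedLaurent)

variable {k : Type u} [Field k]

/-- The homomorphism `k((ϖ)) → κ((ϖ))` induced by `k → κ`. -/
def mapLaurent (i : k →+* κ) : LaurentSeries k →+* LaurentSeries κ where
  toFun f := f.map i
  map_zero' := by ext n; simp
  map_one' := by
    ext n; simp only [HahnSeries.map_coeff, HahnSeries.coeff_one]; split_ifs <;> simp
  map_add' f g := by ext n; simp
  map_mul' f g := by
    ext n
    rw [HahnSeries.map_coeff, HahnSeries.coeff_mul, map_sum,
      HahnSeries.coeff_mul_left' f.isPWO_support (by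
        intro m hm; simp at hm; simpa using hm),
      ]
    refine Finset.sum_congr ?_ ?_
    · ext ab; simp
    · intro ab _; simp

variable {v}

lemma mapLaurent_mem {i : k →+* κ} (hi : ∀ a, v (i a) = trivialAbs a) (f : LaurentSeries k) :
    mapLaurent i f ∈ boundedLaurent v :=
  ⟨1, fun n => by
    change v (i (f.coeff n)) ≤ 1
    rw [hi, trivialAbs]; split_ifs <;> simp⟩

lemma gaussNorm_mapLaurent {i : k →+* κ} (hi : ∀ a, v (i a) = trivialAbs a)
    (f : LaurentSeries k) : gaussNorm v (mapLaurent i f) = laurentAbs f := by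
  have hc : ∀ n, (mapLaurent i f).coeff n = i (f.coeff n) := fun n => rfl
  by_cases h0 : f = 0
  · simp [h0, gaussNorm_zero, laurentAbs]
  rw [laurentAbs, if_neg h0]
  apply le_antisymm
  · refine gaussNorm_le fun n => ?_
    rw [hc, hi, trivialAbs]
    split_ifs with h
    · simp
    · rw [one_mul]
      exact expNeg_anti (HahnSeries.order_le_of_coeff_ne_zero h)
  · have := le_gaussNorm (mapLaurent_mem hi f) f.order
    rwa [hc, hi, trivialAbs, if_neg (HahnSeries.coeff_order_eq_zero.not.2 h0), one_mul] at this

/-- The inclusion of `K = k((ϖ))`, when the absolute value on `κ` is trivial on `k`. -/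
def laurentToGauss {i : k →+* κ} (hi : ∀ a, v (i a) = trivialAbs a) :
    LaurentSeries k →+* GaussField v :=
  (algebraMap (boundedLaurent v) (GaussField v)).comp
    ((mapLaurent i).codRestrict (boundedLaurent v) (mapLaurent_mem hi))

lemma gaussFieldValuation_laurent {i : k →+* κ} (hi : ∀ a, v (i a) = trivialAbs a)
    (f : LaurentSeries k) : gaussFieldValuation v (laurentToGauss hi f) = laurentAbs f := by
  rw [← gaussNorm_mapLaurent hi f]
  exact Valuation.extendToLocalization_apply_map_apply _ (nonZeroDivisors_le v) _ _

lemma gaussFieldValuation_coeff (a : κ) : gaussFieldValuation v (coeffToGauss v a) = v a := by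
  rw [← gaussNorm_C (v := v) a]
  exact Valuation.extendToLocalization_apply_map_apply _ (nonZeroDivisors_le v) _ _

lemma toGauss_comm {i : k →+* κ} (hi : ∀ a, v (i a) = trivialAbs a) :
    (coeffToGauss v).comp i = (laurentToGauss hi).comp HahnSeries.C := by
  ext a
  simp only [coeffToGauss, laurentToGauss, RingHom.comp_apply]
  congr 1
  apply Subtype.ext
  ext n
  change (HahnSeries.C (i a) : LaurentSeries κ).coeff n =
    i ((HahnSeries.C a : LaurentSeries k).coeff n)
  simp only [HahnSeries.C_apply, HahnSeries.coeff_single]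
  split_ifs <;> simp

end Gauss

/-! ## Base change and Gauss extension -/

section BaseChange

variable {k : Type u} [Field k] {X : Scheme.{u}} (f : X ⟶ Spec (CommRingCat.of k))

variable (k) in
/-- The morphism `Spec K ⟶ Spec k`, where `K = k((ϖ))`. -/
def specLaurent : Spec (CommRingCat.of (LaurentSeries k)) ⟶ Spec (CommRingCat.of k) :=
  Spec.map (CommRingCat.ofHom HahnSeries.C)

/-- The base change `X_K`. -/
abbrev baseChange : Scheme.{u} := pullback f (specLaurent k)

/-- The structure morphism of `X_K`. -/
abbrev baseChangeStr : baseChange f ⟶ Spec (CommRingCat.of (LaurentSeries k)) :=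
  pullback.snd f (specLaurent k)

variable {f}

/-- The morphism `Spec L ⟶ X_K` defining the Gauss extension of `v`, where `L` is the fraction
field of the ring of bounded Laurent series over the residue field of the kernel of `v`. -/
def gaussPoint (v : Berk (trivialAbs (k := k)) f) :
    Spec (CommRingCat.of (GaussField v.val)) ⟶ baseChange f :=
  pullback.lift
    (Spec.map (CommRingCat.ofHom (coeffToGauss v.val)) ≫ X.fromSpecResidueField v.pt)
    (Spec.map (CommRingCat.ofHom (laurentToGauss v.val_base)))
    (by
      have h := toGauss_comm v.val_base
      rw [Category.assoc, specLaurent, ← Spec.map_comp, ← CommRingCat.ofHom_comp, ← h,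
        CommRingCat.ofHom_comp, Spec.map_comp]
      congr 1
      exact (Spec.map_preimage _).symm)

/-- Gauss extension `σ : X^an → X_K^an`: the semivaluation `σ(v)` satisfies
`|∑ a_n ϖ^n|(σ(v)) = max_n |a_n|(v) e^{-n}`. -/
def gaussExt (v : Berk (trivialAbs (k := k)) f) :
    Berk (laurentAbs (k := k)) (baseChangeStr f) :=
  Berk.ofSpec (gaussFieldValuation v.val) (gaussPoint v) (by
    intro a
    rw [← gaussFieldValuation_laurent v.val_base a, gaussPoint, pullback.lift_snd,
      Spec.preimage_map]
    rfl)

end BaseChange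

/-! ## PL functions over the trivially valued field `k` -/

section Trivial

variable {k : Type u} [Field k] {X : Scheme.{u}} (f : X ⟶ Spec (CommRingCat.of k))

/-- The Berkovich space `X^an` with respect to the trivial absolute value of `k`. -/
abbrev TrivAn : Type u := Berk (trivialAbs (k := k)) f

variable {f}

/-- The affine open set `U` contains the center of `v` on `X`, i.e. `v` is defined and
nonnegative on `Γ(X, U)`. -/
def CenteredIn (v : TrivAn f) (U : X.affineOpens) : Prop :=
  ∃ h : v.pt ∈ U.1, ∀ s : Γ(X, U.1), v.abs s h ≤ 1

/-- The function `log |𝔟| : X^an → [-∞, 0]`, `log |𝔟|(v) = -v(𝔟)` for an ideal `𝔟` of `O_X`,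
computed by the sections of `𝔟` on affine neighborhoods of the center of `v`. -/
def logIdeal (b : X.IdealSheafData) (v : TrivAn f) : EReal :=
  ⨆ (U : X.affineOpens) (_ : CenteredIn v U) (h : v.pt ∈ U.1) (s : Γ(X, U.1))
    (_ : s ∈ b.ideal U), ENNReal.log (v.abs s h : ENNReal)

variable (f)

/-- `PL⁺_hom(X)`: `ℚ₊`-linear combinations of functions `log |𝔟|`, with `𝔟` a nonzero ideal. -/
def PLhomPlus : Set (TrivAn f → EReal) :=
  {ψ | ∃ (r : ℕ) (c : Fin r → ℚ) (b : Fin r → X.IdealSheafData),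
    (∀ i, 0 ≤ c i) ∧ (∀ i, b i ≠ ⊥) ∧
    ∀ v, ψ v = ∑ i, ((c i : ℝ) : EReal) * logIdeal (b i) v}

/-- `PL⁺(X)`: continuous functions `max_i (ψ_i + λ_i)` with `ψ_i ∈ PL⁺_hom(X)`, `λ_i ∈ ℚ`. -/
def PLPlus : Set C(TrivAn f, ℝ) :=
  {φ | ∃ (r : ℕ) (ψ : Fin (r + 1) → TrivAn f → EReal) (c : Fin (r + 1) → ℚ),
    (∀ i, ψ i ∈ PLhomPlus f) ∧
    ∀ v, ((φ v : ℝ) : EReal) = ⨆ i, (ψ i v + ((c i : ℝ) : EReal))}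

/-- `PL(X)`: rational piecewise linear functions, i.e. differences of functions in `PL⁺(X)`. -/
def PL : Set C(TrivAn f, ℝ) :=
  {φ | ∃ φ₁ ∈ PLPlus f, ∃ φ₂ ∈ PLPlus f, φ = φ₁ - φ₂}

/-- `PL⁺(X)_ℝ`: `ℝ₊`-linear combinations of functions in `PL⁺(X)`. -/
def PLPlusReal : Set C(TrivAn f, ℝ) :=
  {φ | ∃ (r : ℕ) (c : Fin r → ℝ) (g : Fin r → C(TrivAn f, ℝ)),
    (∀ i, 0 ≤ c i) ∧ (∀ i, g i ∈ PLPlus f) ∧ φ = ∑ i, c i • g i}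

/-- `ℝPL⁺(X)`: finite maxima of functions in `PL⁺(X)_ℝ`. -/
def RPLPlus : Set C(TrivAn f, ℝ) :=
  {φ | ∃ (s : Finset C(TrivAn f, ℝ)) (hs : s.Nonempty),
    (∀ g ∈ s, g ∈ PLPlusReal f) ∧ φ = s.sup' hs id}

/-- `ℝPL(X)`: real piecewise linear functions, i.e. differences of functions in `ℝPL⁺(X)`. -/
def RPL : Set C(TrivAn f, ℝ) :=
  {φ | ∃ φ₁ ∈ RPLPlus f, ∃ φ₂ ∈ RPLPlus f, φ = φ₁ - φ₂}

end Trivial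

/-! ## Models and PL functions over `K = k((ϖ))` -/

section Laurent

variable {k : Type u} [Field k] {Y : Scheme.{u}}
  (f : Y ⟶ Spec (CommRingCat.of (LaurentSeries k)))

/-- The Berkovich space `Y^an` of a `K`-scheme `Y`, for the absolute value `e^{-ord}` of `K`. -/
abbrev LaurentAn : Type u := Berk (laurentAbs (k := k)) f

/-- A model of the `K`-scheme `Y`: a normal, flat, projective scheme over `K° = k[[ϖ]]` together
with an identification of its generic fiber with `Y`. -/
structure Model where
  /-- the model as a scheme -/
  scheme : Scheme.{u}
  /-- the structure morphism to `Spec K°` -/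
  str : scheme ⟶ Spec (CommRingCat.of (PowerSeries k))
  normal : IsNormalScheme scheme
  flat : Flat str
  projective : IsProjective str
  /-- the inclusion of the generic fiber -/
  gen : Y ⟶ scheme
  isPullback : IsPullback gen f str
    (Spec.map (CommRingCat.ofHom (HahnSeries.ofPowerSeries ℤ k)))

variable {f}

/-- A vertical Cartier divisor on a model, i.e. a Cartier divisor that is trivial on the generic
fiber. It is given by local equations on an affine open cover `U_i`: these are invertible functions
on the generic fiber of `U_i`, and any two of them differ on `U_i ∩ U_j` by a unit. -/
structure VerticalCartierDivisor (M : Model f) where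
  /-- the index set of the cover -/
  ι : Type u
  /-- the open cover -/
  U : ι → M.scheme.Opens
  affine : ∀ i, IsAffineOpen (U i)
  cover : ⨆ i, U i = ⊤
  /-- the local equations -/
  eqn : ∀ i, (Γ(Y, M.gen ⁻¹ᵁ U i))ˣ
  compat : ∀ i j, ∃ t : (Γ(M.scheme, U i ⊓ U j))ˣ,
    Y.presheaf.map (homOfLE (M.gen.preimage_mono inf_le_left)).op (eqn i : Γ(Y, M.gen ⁻¹ᵁ U i)) =
      M.gen.app (U i ⊓ U j) (t : Γ(M.scheme, U i ⊓ U j)) *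
      Y.presheaf.map (homOfLE (M.gen.preimage_mono inf_le_right)).op
        (eqn j : Γ(Y, M.gen ⁻¹ᵁ U j))

/-- Given an affine open subset `U` of the model whose generic fiber contains the kernel of `w`:
the center (reduction) of `w` lies in `U`, i.e. `w` is nonnegative on `Γ(M, U)`. -/
def ReducesIn {M : Model f} (w : LaurentAn f) (U : M.scheme.Opens)
    (h : w.pt ∈ M.gen ⁻¹ᵁ U) : Prop :=
  ∀ s : Γ(M.scheme, U), w.abs (M.gen.app U s) h ≤ 1

/-- `φ` is the model function `w ↦ w(D)` defined by the vertical `ℚ`-Cartier divisor `m⁻¹ D`: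
if the center of `w` lies in `U_i`, then `w(D)` is the value of `w = -log |·|` at the
local equation of `D` on `U_i`. -/
def IsModelFunction {M : Model f} (D : VerticalCartierDivisor M) (m : ℕ)
    (φ : LaurentAn f → ℝ) : Prop :=
  ∀ (w : LaurentAn f) (i : D.ι) (h : w.pt ∈ M.gen ⁻¹ᵁ D.U i), ReducesIn w (D.U i) h →
    φ w = (m : ℝ)⁻¹ * -Real.log (w.abs (D.eqn i : Γ(Y, M.gen ⁻¹ᵁ D.U i)) h)

variable (f)

/-- `PL(Y)`: the functions defined by vertical `ℚ`-Cartier `ℚ`-divisors on models of `Y`. -/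
def PLK : Set C(LaurentAn f, ℝ) :=
  {φ | ∃ (M : Model f) (D : VerticalCartierDivisor M) (m : ℕ), 0 < m ∧ IsModelFunction D m φ}

/-- `ℝPL(Y)`: the smallest `ℝ`-linear subspace of `C⁰(Y^an)` containing `PL(Y)` and stable
under max. -/
def RPLK : Submodule ℝ C(LaurentAn f, ℝ) :=
  sInf {S | PLK f ⊆ S ∧ ∀ φ ∈ S, ∀ ψ ∈ S, φ ⊔ ψ ∈ S}

end Laurent

end NAPL

end

/-!
The proof works with homogeneous coordinates throughout. If `η : Spec L ⟶ Z` is a dominant point of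
a reduced scheme, the sections of `Z` around `η` embed into the field `L` (`pull`). For `Z`
projective over a ring `A`, a closed embedding into projective space yields finitely many elements
`x l` of `L` (`ProjCharts`) such that the charts of `Z` have the rings `A[x l / x j]`. A form of
degree `d` is a homogeneous polynomial expression in the `x l`, and a semivaluation `w` assigns to
it a norm `nrm w d P`, namely `|P / x j ^ d|` for a coordinate `x j` of maximal absolute value. On
`X` the point `η` is the generic point, and on `X_K` it is a point with values in `E((ϖ))`, where
`E` is the function field of `X`; both carry the same coordinates.

Forms describe PL functions globally. An ideal sheaf, twisted by a large degree, is generated by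
forms, so the PL functions on `X` are, up to a rational factor, the differences
`log max |P_a| e^{-n_a} - log max |Q_b| e^{-m_b}` with finite families of forms over `k`, both
maxima being nowhere zero (`mem_PL_iff`). The converse direction of this criterion uses that the
ideal of the functions divisible by given forms is again an ideal sheaf.

*Pullbacks of model functions are PL.* A vertical Cartier divisor on a model has finitely many
local equations. A cover of the model by nonvanishing loci of forms serves to write the model
function as a difference of logarithms of maxima of norms of forms over `K`
(`exists_ratioData`, `RatioData.exists_forms`). The value of the Gauss extension of `v` at a form
`∑ P_n ϖ ^ n` over `K` is `max |P_n|(v) e^{-n}`, and as the maxima are bounded from below, only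
finitely many coefficients contribute (`isFormMax_gaussExt`). By the criterion the pullback is PL
(`exists_mem_PL_of_mem_PLK`).

*PL functions are pullbacks of model functions.* Given forms `P_a` and `Q_b` as above, put
`p_a = P_a ϖ ^ n_a` and `q_b = Q_b ϖ ^ m_b`. The products `x l * p_a * q_b` are homogeneous
coordinates of a projective scheme over `K°` with generic fiber `X_K`. On each chart some `p_a`
divides all others and so does some `q_b`; the quotients `q_b / p_a` are the local equations of a
vertical Cartier divisor, and the associated function restricts to the given one
(`exists_divisor_of_forms`, `exists_mem_PLK_of_mem_PL`). Models are required to be normal, so this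
scheme has to be normalized without losing projectivity. The coordinates are monomials in `ϖ`, so
the charts are obtained from the finitely generated graded algebras `k[ϖ, u]`, and finiteness of
the integral closure over `K°` follows from Noether normalization in characteristic zero
(`exists_finset_integral_laurent`). Generators of the integral closures, multiplied by `m`-th powers
of the coordinates, together with all monomials of degree `m` are homogeneous coordinates of the
normalization (`exists_normal_coord`, `exists_model`). It has the same generic fiber as `X_K` is
smooth, hence normal (`isIntegrallyClosed_of_smooth`).

The statement on real PL functions is a formal consequence (`image_RPLK_eq`): `ℝPL(X)` is the
smallest real vector space of functions that contains `PL(X)` and is stable under maxima.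
-/

open CategoryTheory CategoryTheory.Limits AlgebraicGeometry
open scoped NNReal

noncomputable section

namespace NAPL

/-! ### Sections at a field-valued point -/

section Pull

variable {L : Type u} [Field L] {Z Z' : Scheme.{u}}

/-- Evaluation of sections at an `L`-valued point `η`, viewed as a map to `L`. -/
def pull (η : Spec (CommRingCat.of L) ⟶ Z) (U : Z.Opens) (e : ⊤ ≤ η ⁻¹ᵁ U) : Γ(Z, U) →+* L :=
  (η.appLE U ⊤ e ≫ (Scheme.ΓSpecIso (CommRingCat.of L)).hom).hom

variable (η : Spec (CommRingCat.of L) ⟶ Z)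

/-- The point of the scheme underlying an `L`-valued point. -/
def ptOf : Z := η (IsLocalRing.closedPoint L)

lemma top_le_preimage_iff (U : Z.Opens) : ⊤ ≤ η ⁻¹ᵁ U ↔ ptOf η ∈ U := by
  constructor
  · intro h
    exact h (Set.mem_univ _)
  · intro h x _
    have : x = IsLocalRing.closedPoint L := Subsingleton.elim _ _
    rw [this]; exact h

variable {η}

lemma top_le_preimage_inf {U V : Z.Opens} (hU : ⊤ ≤ η ⁻¹ᵁ U) (hV : ⊤ ≤ η ⁻¹ᵁ V) :
    ⊤ ≤ η ⁻¹ᵁ (U ⊓ V) := fun _ h => ⟨hU h, hV h⟩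

lemma pull_map {U V : Z.Opens} (e : ⊤ ≤ η ⁻¹ᵁ V) (i : Opposite.op U ⟶ Opposite.op V) (s : Γ(Z, U)) :
    pull η V e (Z.presheaf.map i s) =
      pull η U (e.trans (η.preimage_mono i.unop.le)) s := by
  have := congr($(η.map_appLE e i) s)
  simp only [CommRingCat.comp_apply] at this
  simp only [pull, CommRingCat.hom_comp, RingHom.comp_apply, this]

lemma pull_comp (g : Z ⟶ Z') (U : Z'.Opens) (e : ⊤ ≤ η ⁻¹ᵁ (g ⁻¹ᵁ U)) (s : Γ(Z', U)) :
    pull η (g ⁻¹ᵁ U) e (g.app U s) = pull (η ≫ g) U e s := by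
  have := congr($(η.comp_appLE g U ⊤ e) s)
  simp only [CommRingCat.comp_apply] at this
  simp only [pull, CommRingCat.hom_comp, RingHom.comp_apply, this]

lemma mem_basicOpen_iff_pull_ne_zero {U : Z.Opens} (e : ⊤ ≤ η ⁻¹ᵁ U) (s : Γ(Z, U)) :
    ptOf η ∈ Z.basicOpen s ↔ pull η U e s ≠ 0 := by
  rw [← top_le_preimage_iff]
  rw [Scheme.preimage_basicOpen]
  have h1 : (Spec (CommRingCat.of L)).basicOpen (η.appLE U ⊤ e s) =
      ⊤ ⊓ (Spec (CommRingCat.of L)).basicOpen (η.app U s) := by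
    rw [Scheme.Hom.appLE, CommRingCat.comp_apply, Scheme.basicOpen_res]
  rw [top_inf_eq] at h1
  rw [← h1]
  constructor
  -- a section of `Spec L` whose basic open set is nonempty is not zero
  · intro h h0
    have h2 : η.appLE U ⊤ e s = 0 := by
      have : (Scheme.ΓSpecIso (CommRingCat.of L)).hom (η.appLE U ⊤ e s) = 0 := h0
      rw [← map_zero (Scheme.ΓSpecIso (CommRingCat.of L)).hom.hom] at this
      exact (ConcreteCategory.bijective_of_isIso (Scheme.ΓSpecIso (CommRingCat.of L)).hom).1 this
    rw [h2, Scheme.basicOpen_zero] at h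
    exact h (Set.mem_univ (IsLocalRing.closedPoint L))
  · intro h
    have h2 : IsUnit (η.appLE U ⊤ e s) := by
      have : IsUnit ((Scheme.ΓSpecIso (CommRingCat.of L)).hom (η.appLE U ⊤ e s)) :=
        IsUnit.mk0 (G₀ := L) _ h
      have h3 := this.map (Scheme.ΓSpecIso (CommRingCat.of L)).inv.hom
      simpa using h3
    rw [Scheme.basicOpen_of_isUnit _ h2]

lemma ptOf_specializes [IsDominant η] (z : Z) : ptOf η ⤳ z := by
  rw [specializes_iff_forall_open]
  intro U hU hz
  obtain ⟨_, hy, y, rfl⟩ := (IsDominant.denseRange (f := η)).inter_open_nonempty U hU ⟨z, hz⟩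
  rwa [Subsingleton.elim y (IsLocalRing.closedPoint L)] at hy

lemma top_le_preimage_of_mem [IsDominant η] {z : Z} {U : Z.Opens} (h : z ∈ U) : ⊤ ≤ η ⁻¹ᵁ U :=
  (top_le_preimage_iff η U).2 ((ptOf_specializes z).mem_open U.2 h)

/-- Over a dominant point of a reduced scheme, sections may be identified with elements of `L`. -/
lemma pull_injective [IsReduced Z] [IsDominant η] (U : Z.Opens) (e : ⊤ ≤ η ⁻¹ᵁ U) :
    Function.Injective (pull η U e) := by
  rw [injective_iff_map_eq_zero]
  intro s hs
  rw [← basicOpen_eq_bot_iff]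
  by_contra h
  obtain ⟨z, hz⟩ := (Z.basicOpen s).ne_bot_iff_nonempty.1 h
  exact (mem_basicOpen_iff_pull_ne_zero e s).1 ((ptOf_specializes z).mem_open (Z.basicOpen s).2 hz)
    hs

end Pull

/-! ### Semivaluations as seminorms on local rings inside a field -/

section LocVal

/-- A local subring `O` of a field `L` with an absolute value on its residue field: `abs` is a
multiplicative seminorm on `O`, the elements of nonzero absolute value being units of `O`. Outside
`O` the values of `abs` carry no meaning. -/
structure LocVal (L : Type u) [Field L] where
  /-- the local ring -/
  O : Subring L
  /-- the seminorm -/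
  abs : L → ℝ≥0
  abs_zero : abs 0 = 0
  abs_one : abs 1 = 1
  abs_mul : ∀ {a b}, a ∈ O → b ∈ O → abs (a * b) = abs a * abs b
  abs_add : ∀ {a b}, a ∈ O → b ∈ O → abs (a + b) ≤ max (abs a) (abs b)
  inv_mem : ∀ {a}, a ∈ O → abs a ≠ 0 → a⁻¹ ∈ O

variable {F : Type u} [Field F] {ν : F → ℝ≥0} {Z : Scheme.{u}}
  {f : Z ⟶ Spec (CommRingCat.of F)}

lemma Berk.abs_map (w : Berk ν f) {U V : Z.Opens} (i : Opposite.op U ⟶ Opposite.op V)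
    (h : w.pt ∈ V) (s : Γ(Z, U)) :
    w.abs (Z.presheaf.map i s) h = w.abs s (i.unop.le h) := by
  simp only [Berk.abs, Scheme.evaluation, CommRingCat.comp_apply]
  congr 2
  exact Z.presheaf.germ_res_apply i.unop _ h s

lemma Berk.abs_ne_zero_iff (w : Berk ν f) {U : Z.Opens} (h : w.pt ∈ U) (s : Γ(Z, U)) :
    w.abs s h ≠ 0 ↔ w.pt ∈ Z.basicOpen s := by
  rw [← Scheme.evaluation_ne_zero_iff_mem_basicOpen Z w.pt h s, Berk.abs, Valuation.ne_zero_iff]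

variable {L : Type u} [Field L] (η : Spec (CommRingCat.of L) ⟶ Z)

/-- `g ∈ L` is the image of a section over a neighborhood of `z`. -/
def IsRegAt (z : Z) (g : L) : Prop :=
  ∃ (U : Z.Opens) (_ : z ∈ U) (e : ⊤ ≤ η ⁻¹ᵁ U) (s : Γ(Z, U)), pull η U e s = g

variable {η}

lemma IsRegAt.exists_pair {z : Z} {a b : L} (ha : IsRegAt η z a) (hb : IsRegAt η z b) :
    ∃ (U : Z.Opens) (_ : z ∈ U) (e : ⊤ ≤ η ⁻¹ᵁ U) (s t : Γ(Z, U)),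
      pull η U e s = a ∧ pull η U e t = b := by
  obtain ⟨U, hU, eU, s, rfl⟩ := ha
  obtain ⟨V, hV, eV, t, rfl⟩ := hb
  refine ⟨U ⊓ V, ⟨hU, hV⟩, le_inf eU eV, Z.presheaf.map (homOfLE inf_le_left).op s,
    Z.presheaf.map (homOfLE inf_le_right).op t, pull_map _ _ _, pull_map _ _ _⟩

variable (η)

/-- The local ring of `Z` at `z`, as a subring of `L`. -/
def locRing (z : Z) : Subring L where
  carrier := {g | IsRegAt η z g}
  zero_mem' := ⟨⊤, trivial, le_top, 0, map_zero _⟩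
  one_mem' := ⟨⊤, trivial, le_top, 1, map_one _⟩
  add_mem' := by
    intro a b ha hb
    obtain ⟨U, hU, e, s, t, rfl, rfl⟩ := IsRegAt.exists_pair ha hb
    exact ⟨U, hU, e, s + t, map_add _ _ _⟩
  mul_mem' := by
    intro a b ha hb
    obtain ⟨U, hU, e, s, t, rfl, rfl⟩ := IsRegAt.exists_pair ha hb
    exact ⟨U, hU, e, s * t, map_mul _ _ _⟩
  neg_mem' := by
    rintro a ⟨U, hU, e, s, rfl⟩
    exact ⟨U, hU, e, -s, map_neg _ _⟩

variable {η}

lemma pull_mem_locRing {z : Z} {U : Z.Opens} (h : z ∈ U) (e : ⊤ ≤ η ⁻¹ᵁ U) (s : Γ(Z, U)) :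
    pull η U e s ∈ locRing η z := ⟨U, h, e, s, rfl⟩

/-- A section that does not vanish at `z` is invertible in the local ring at `z`. -/
lemma inv_pull_mem_locRing {z : Z} {U : Z.Opens} (e : ⊤ ≤ η ⁻¹ᵁ U) (s : Γ(Z, U))
    (hs : z ∈ Z.basicOpen s) (e' : ⊤ ≤ η ⁻¹ᵁ Z.basicOpen s) :
    (pull η U e s)⁻¹ ∈ locRing η z := by
  have hu : IsUnit (Z.presheaf.map (homOfLE (Z.basicOpen_le s)).op s) :=
    RingedSpace.isUnit_res_basicOpen _ s
  obtain ⟨t, ht⟩ := hu.exists_right_inv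
  refine ⟨Z.basicOpen s, hs, e', t, ?_⟩
  have := congr(pull η _ e' $ht)
  rw [map_mul, map_one, pull_map] at this
  exact eq_inv_of_mul_eq_one_right this

/-- The value of a semivaluation at a section depends only on the image of the section in `L`. -/
lemma Berk.abs_eq_of_pull_eq [IsReduced Z] [IsDominant η] (w : Berk ν f) {U V : Z.Opens}
    (hU : w.pt ∈ U) (hV : w.pt ∈ V) (eU : ⊤ ≤ η ⁻¹ᵁ U) (eV : ⊤ ≤ η ⁻¹ᵁ V)
    (s : Γ(Z, U)) (t : Γ(Z, V)) (h : pull η U eU s = pull η V eV t) :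
    w.abs s hU = w.abs t hV := by
  have e : ⊤ ≤ η ⁻¹ᵁ (U ⊓ V) := le_inf eU eV
  have hUV : w.pt ∈ U ⊓ V := ⟨hU, hV⟩
  have : Z.presheaf.map (homOfLE inf_le_left : U ⊓ V ⟶ U).op s =
      Z.presheaf.map (homOfLE inf_le_right : U ⊓ V ⟶ V).op t :=
    pull_injective (U ⊓ V) e ((pull_map e _ _).trans (h.trans (pull_map e _ _).symm))
  exact (w.abs_map (homOfLE inf_le_left : U ⊓ V ⟶ U).op hUV s).symm.trans
    ((congr(w.abs $this hUV)).trans (w.abs_map _ hUV t))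

variable (η)

open Classical in
/-- The value of a semivaluation at an element of `L` that is regular at its kernel. -/
def Berk.absAt (w : Berk ν f) (g : L) : ℝ≥0 :=
  if h : IsRegAt η w.pt g then
    w.abs h.choose_spec.choose_spec.choose_spec.choose h.choose_spec.choose else 0

variable {η}

lemma Berk.absAt_pull [IsReduced Z] [IsDominant η] (w : Berk ν f) {U : Z.Opens}
    (hU : w.pt ∈ U) (e : ⊤ ≤ η ⁻¹ᵁ U) (s : Γ(Z, U)) :
    w.absAt η (pull η U e s) = w.abs s hU := by
  have h : IsRegAt η w.pt (pull η U e s) := ⟨U, hU, e, s, rfl⟩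
  rw [Berk.absAt, dif_pos h]
  exact w.abs_eq_of_pull_eq _ hU h.choose_spec.choose_spec.choose e _ s
      h.choose_spec.choose_spec.choose_spec.choose_spec

variable (η)

/-- The local ring at the kernel of a semivaluation, with the seminorm given by the semivaluation. -/
def Berk.locVal [IsReduced Z] [IsDominant η] (w : Berk ν f) : LocVal L where
  O := locRing η w.pt
  abs := w.absAt η
  abs_zero := by
    have := w.absAt_pull (η := η) (U := ⊤) (Set.mem_univ _) le_top 0
    rw [map_zero] at this
    rw [this]; simp [Berk.abs]
  abs_one := by
    have := w.absAt_pull (η := η) (U := ⊤) (Set.mem_univ _) le_top 1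
    rw [map_one] at this
    rw [this]; simp [Berk.abs]
  abs_mul {a b} ha hb := by
    obtain ⟨U, hU, e, s, t, rfl, rfl⟩ := IsRegAt.exists_pair ha hb
    rw [← map_mul, w.absAt_pull hU, w.absAt_pull hU, w.absAt_pull hU]
    simp [Berk.abs]
  abs_add {a b} ha hb := by
    obtain ⟨U, hU, e, s, t, rfl, rfl⟩ := IsRegAt.exists_pair ha hb
    rw [← map_add, w.absAt_pull hU, w.absAt_pull hU, w.absAt_pull hU]
    simp only [Berk.abs, map_add]
    exact Valuation.map_add _ _ _
  inv_mem {a} ha h0 := by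
    obtain ⟨U, hU, e, s, rfl⟩ := ha
    rw [w.absAt_pull hU, Berk.abs_ne_zero_iff] at h0
    exact inv_pull_mem_locRing e s h0 (top_le_preimage_of_mem h0)

lemma Berk.locVal_O [IsReduced Z] [IsDominant η] (w : Berk ν f) :
    (w.locVal η).O = locRing η w.pt := rfl

lemma Berk.locVal_abs_pull [IsReduced Z] [IsDominant η] (w : Berk ν f) {U : Z.Opens}
    (hU : w.pt ∈ U) (e : ⊤ ≤ η ⁻¹ᵁ U) (s : Γ(Z, U)) :
    (w.locVal η).abs (pull η U e s) = w.abs s hU := w.absAt_pull hU e s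

/-- The absolute value of a section under the semivaluation defined by a field-valued point. -/
lemma Berk.abs_ofSpec {κ : Type u} [Field κ] (v : Valuation κ ℝ≥0)
    (g : Spec (CommRingCat.of κ) ⟶ Z)
    (h : ∀ a : F, v ((Spec.preimage (g ≫ f)).hom a) = ν a) {U : Z.Opens} (s : Γ(Z, U))
    (hU : (Berk.ofSpec v g h).pt ∈ U) (e : ⊤ ≤ g ⁻¹ᵁ U) :
    (Berk.ofSpec v g h).abs s hU = v (pull g U e s) := by
  change v (Scheme.descResidueField (Scheme.stalkClosedPointTo g)
    (Z.residue _ (Z.presheaf.germ U _ hU s))) = _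
  congr 1
  have h1 := congr($(Scheme.residue_descResidueField (Scheme.stalkClosedPointTo g))
    (Z.presheaf.germ U _ hU s))
  refine Eq.trans h1 ?_
  have h2 := congr($(Scheme.germ_stalkClosedPointTo g U hU) s)
  refine Eq.trans h2 ?_
  rfl

end LocVal

/-! ### Field-valued points of projective space -/

section ProjectiveSpace

open HomogeneousLocalization

attribute [local instance] MvPolynomial.gradedAlgebra

variable {σ : Type*} {A₀ : Type u} [CommRing A₀] [SetLike σ A₀] [AddSubgroupClass σ A₀]
  (𝒜 : ℕ → σ) [GradedRing 𝒜]

lemma awayι_appLE_awayToSection {f : A₀} {m : ℕ} (hf : f ∈ 𝒜 m) (hm : 0 < m) (a : Away 𝒜 f)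
    (e : ⊤ ≤ Proj.awayι 𝒜 f hf hm ⁻¹ᵁ Proj.basicOpen 𝒜 f) :
    (Proj.awayι 𝒜 f hf hm).appLE (Proj.basicOpen 𝒜 f) ⊤ e (Proj.awayToSection 𝒜 f a) =
      (Scheme.ΓSpecIso (CommRingCat.of (Away 𝒜 f))).inv a := by
  have h1 : Proj.basicOpenToSpec 𝒜 f ≫ Proj.awayι 𝒜 f hf hm = (Proj.basicOpen 𝒜 f).ι := by
    rw [← Proj.basicOpenIsoSpec_hom 𝒜 f hf hm, Proj.awayι, Iso.hom_inv_id_assoc]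
  have : IsIso (Proj.basicOpenToSpec 𝒜 f) := by
    rw [← Proj.basicOpenIsoSpec_hom 𝒜 f hf hm]; infer_instance
  apply (ConcreteCategory.bijective_of_isIso ((Proj.basicOpenToSpec 𝒜 f).app ⊤)).1
  have h2 := congr($(Scheme.Hom.appLE_comp_appLE (Proj.basicOpenToSpec 𝒜 f)
    (Proj.awayι 𝒜 f hf hm) (Proj.basicOpen 𝒜 f) ⊤ ⊤ e le_top) (Proj.awayToSection 𝒜 f a))
  rw [CommRingCat.comp_apply] at h2
  have h3 := congr($(Proj.basicOpenToSpec_app_top 𝒜 f)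
    ((Scheme.ΓSpecIso (CommRingCat.of (Away 𝒜 f))).inv a))
  simp only [CommRingCat.comp_apply] at h3
  rw [h3]
  rw [Scheme.Hom.app_eq_appLE]
  refine h2.trans ?_
  have h4 : (Scheme.ΓSpecIso (CommRingCat.of (Away 𝒜 f))).hom
      ((Scheme.ΓSpecIso (CommRingCat.of (Away 𝒜 f))).inv a) = a := by simp
  rw [h4]
  simp only [h1]
  rw [Scheme.Opens.ι_appLE, Scheme.Opens.topIso_inv]
  rfl

variable {L : Type u} [Field L]

/-- Evaluation of the functions on a standard chart of `Proj` at an `L`-valued point of it. -/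
lemma pull_awayToSection {f : A₀} {m : ℕ} (hf : f ∈ 𝒜 m) (hm : 0 < m) (a : Away 𝒜 f)
    (φ : CommRingCat.of (Away 𝒜 f) ⟶ CommRingCat.of L)
    (e : ⊤ ≤ (Spec.map φ ≫ Proj.awayι 𝒜 f hf hm) ⁻¹ᵁ Proj.basicOpen 𝒜 f) :
    pull (Spec.map φ ≫ Proj.awayι 𝒜 f hf hm) (Proj.basicOpen 𝒜 f) e (Proj.awayToSection 𝒜 f a) =
      φ a := by
  have e1 : ⊤ ≤ Proj.awayι 𝒜 f hf hm ⁻¹ᵁ Proj.basicOpen 𝒜 f := by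
    rw [← Proj.opensRange_awayι 𝒜 f hf hm, Scheme.Hom.preimage_opensRange]
  have h2 := congr($(Scheme.Hom.appLE_comp_appLE (Spec.map φ)
    (Proj.awayι 𝒜 f hf hm) (Proj.basicOpen 𝒜 f) ⊤ ⊤ e1 le_top) (Proj.awayToSection 𝒜 f a))
  rw [CommRingCat.comp_apply, awayι_appLE_awayToSection] at h2
  simp only [pull, CommRingCat.hom_comp, RingHom.comp_apply]
  have h3 := congr($(Scheme.ΓSpecIso_inv_naturality φ) a)
  have h5 : (Spec.map φ).appTop = (Spec.map φ).appLE ⊤ ⊤ le_top := Scheme.Hom.app_eq_appLE _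
  rw [h5] at h3
  refine (congr((Scheme.ΓSpecIso (CommRingCat.of L)).hom $(h2.symm.trans h3.symm))).trans ?_
  rw [CommRingCat.comp_apply]
  exact congr($((Scheme.ΓSpecIso (CommRingCat.of L)).inv_hom_id) (φ a))

lemma exists_eq_specMap_awayι (θ : Spec (CommRingCat.of L) ⟶ Proj 𝒜) {f : A₀} {m : ℕ}
    (hf : f ∈ 𝒜 m) (hm : 0 < m) (h : ptOf θ ∈ Proj.basicOpen 𝒜 f) :
    ∃ φ : CommRingCat.of (Away 𝒜 f) ⟶ CommRingCat.of L,
      θ = Spec.map φ ≫ Proj.awayι 𝒜 f hf hm := by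
  have hr : Set.range θ ⊆ Set.range (Proj.awayι 𝒜 f hf hm) := by
    rintro _ ⟨x, rfl⟩
    have : θ x ∈ Proj.basicOpen 𝒜 f := by
      rwa [Subsingleton.elim x (IsLocalRing.closedPoint L)]
    rw [← Proj.opensRange_awayι 𝒜 f hf hm] at this
    exact this
  refine ⟨Spec.preimage (IsOpenImmersion.lift (Proj.awayι 𝒜 f hf hm) θ hr), ?_⟩
  rw [Spec.map_preimage, IsOpenImmersion.lift_fac]

lemma basicOpen_awayToSection {f g : A₀} (hf : f ∈ 𝒜 1) (hg : g ∈ 𝒜 1) :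
    (Proj 𝒜).basicOpen (Proj.awayToSection 𝒜 f (Away.mk 𝒜 hf 1 g (by simpa using hg))) =
      Proj.basicOpen 𝒜 f ⊓ Proj.basicOpen 𝒜 g := by
  have h1 : Proj.basicOpenToSpec 𝒜 f ≫ Proj.awayι 𝒜 f hf one_pos = (Proj.basicOpen 𝒜 f).ι := by
    rw [← Proj.basicOpenIsoSpec_hom 𝒜 f hf one_pos, Proj.awayι, Iso.hom_inv_id_assoc]
  have h2 := Proj.awayι_preimage_basicOpen 𝒜 hf one_pos hg one_pos
  have h3 : Away.isLocalizationElem hf hg = Away.mk 𝒜 hf 1 g (by simpa using hg) := by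
    apply HomogeneousLocalization.val_injective
    simp [Away.isLocalizationElem, Away.val_mk]
  rw [h3] at h2
  have h4 : (Proj.basicOpen 𝒜 f).ι ⁻¹ᵁ Proj.basicOpen 𝒜 g =
      (Proj.basicOpen 𝒜 f).ι ⁻¹ᵁ (Proj 𝒜).basicOpen
        (Proj.awayToSection 𝒜 f (Away.mk 𝒜 hf 1 g (by simpa using hg))) := by
    rw [← Scheme.Opens.toSpecΓ_preimage_basicOpen]
    have h5 : (Proj.basicOpen 𝒜 f).ι ⁻¹ᵁ Proj.basicOpen 𝒜 g = Proj.basicOpenToSpec 𝒜 f ⁻¹ᵁ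
      (Proj.awayι 𝒜 f hf one_pos ⁻¹ᵁ Proj.basicOpen 𝒜 g) := by
      rw [← Scheme.Hom.comp_preimage, h1]
    rw [h5, h2]
    rfl
  have h6 := congr((Proj.basicOpen 𝒜 f).ι ''ᵁ $h4)
  rw [Scheme.Hom.image_preimage_eq_opensRange_inf, Scheme.Hom.image_preimage_eq_opensRange_inf,
    Scheme.Opens.opensRange_ι] at h6
  rw [h6]
  exact (inf_eq_right.2 (Scheme.basicOpen_le _ _)).symm

variable {A : Type u} [CommRing A] [Algebra A L] {n : ℕ}

lemma X_mem (j : Fin (n + 1)) : (MvPolynomial.X j : MvPolynomial (Fin (n + 1)) A) ∈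
    MvPolynomial.homogeneousSubmodule (Fin (n + 1)) A 1 :=
  MvPolynomial.isHomogeneous_X A j

/-- The coordinate `X_l / X_j` on the chart `X_j ≠ 0` of projective space. -/
def coordAway (A : Type u) [CommRing A] {n : ℕ} (j l : Fin (n + 1)) :
    Away (MvPolynomial.homogeneousSubmodule (Fin (n + 1)) A) (MvPolynomial.X j) :=
  Away.mk _ (X_mem j) 1 (MvPolynomial.X l) (by simpa using X_mem l)

/-- The constants in the coordinate ring of a chart of projective space. -/
def constAway (A : Type u) [CommRing A] {n : ℕ} (j : Fin (n + 1)) :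
    A →+* Away (MvPolynomial.homogeneousSubmodule (Fin (n + 1)) A) (MvPolynomial.X j) :=
  (fromZeroRingHom _ _).comp (algebraMap A (MvPolynomial.homogeneousSubmodule (Fin (n + 1)) A 0))

lemma val_constAway (j : Fin (n + 1)) (a : A) :
    (constAway A j a).val = algebraMap _ _ (MvPolynomial.C a : MvPolynomial (Fin (n + 1)) A) := by
  rfl

lemma val_coordAway (j l : Fin (n + 1)) :
    (coordAway A j l).val * algebraMap _ _ (MvPolynomial.X j : MvPolynomial (Fin (n + 1)) A) =
      algebraMap _ _ (MvPolynomial.X l : MvPolynomial (Fin (n + 1)) A) := by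
  rw [coordAway, Away.val_mk, Localization.mk_eq_mk', ← IsLocalization.mk'_spec _ (MvPolynomial.X l)
    (⟨MvPolynomial.X j ^ 1, 1, rfl⟩ : Submonoid.powers (MvPolynomial.X j : MvPolynomial
      (Fin (n + 1)) A))]
  simp

lemma eval₂_mul_of_isHomogeneous {S : Type*} [CommRing S] (φ : A →+* S) (x : Fin (n + 1) → S)
    (c : S)
    {P : MvPolynomial (Fin (n + 1)) A} {d : ℕ} (hP : P.IsHomogeneous d) :
    P.eval₂ φ (fun i => c * x i) = c ^ d * P.eval₂ φ x := by
  rw [MvPolynomial.eval₂_eq', MvPolynomial.eval₂_eq', Finset.mul_sum]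
  refine Finset.sum_congr rfl fun m hm => ?_
  have h1 := hP (MvPolynomial.mem_support_iff.1 hm)
  simp only [mul_pow, Finset.prod_mul_distrib, Finset.prod_pow_eq_pow_sum]
  have h2 : ∑ i, m i = d := by
    rw [← h1, Finsupp.weight_apply, Finsupp.sum_fintype _ _ (by simp)]
    simp
  rw [h2]; ring

/-- The localization map of the polynomial ring at a variable. -/
abbrev locX (A : Type u) [CommRing A] {n : ℕ} (j : Fin (n + 1)) :
    MvPolynomial (Fin (n + 1)) A →+*
      Localization.Away (MvPolynomial.X j : MvPolynomial (Fin (n + 1)) A) := algebraMap _ _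

lemma isUnit_locX (j : Fin (n + 1)) : IsUnit (locX A j (MvPolynomial.X j)) :=
  IsLocalization.Away.algebraMap_isUnit _

lemma coordAway_self (j : Fin (n + 1)) : coordAway A j j = 1 := by
  apply HomogeneousLocalization.val_injective
  apply (isUnit_locX j).mul_left_injective
  beta_reduce
  rw [val_coordAway]
  simp

/-- The chart ring of projective space is generated by the coordinates. -/
lemma exists_eval₂_eq (j : Fin (n + 1))
    (a : Away (MvPolynomial.homogeneousSubmodule (Fin (n + 1)) A) (MvPolynomial.X j)) :
    ∃ P : MvPolynomial (Fin (n + 1)) A, P.eval₂ (constAway A j) (coordAway A j) = a := by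
  obtain ⟨d, P, hP, rfl⟩ := Away.mk_surjective _ (X_mem j) a
  refine ⟨P, HomogeneousLocalization.val_injective _ ?_⟩
  apply ((isUnit_locX j).pow d).mul_right_injective
  beta_reduce
  have hP' : P.IsHomogeneous d := by simpa using hP
  have h1 : (P.eval₂ (constAway A j) (coordAway A j)).val =
      P.eval₂ ((locX A j).comp MvPolynomial.C) (fun l => (coordAway A j l).val) :=
    MvPolynomial.hom_eval₂ P (constAway A j) (algebraMap _ (Localization.Away
        (MvPolynomial.X j : MvPolynomial (Fin (n + 1)) A))) (coordAway A j)
  rw [h1, ← eval₂_mul_of_isHomogeneous _ _ _ hP']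
  have h2 : (fun l => locX A j (MvPolynomial.X j) * (coordAway A j l).val) =
      fun l => locX A j (MvPolynomial.X l) := by
    funext l; rw [mul_comm]; exact val_coordAway j l
  rw [h2]
  have h3 := MvPolynomial.hom_eval₂ P MvPolynomial.C (locX A j) MvPolynomial.X
  rw [MvPolynomial.eval₂_eta] at h3
  refine h3.symm.trans ?_
  rw [Away.val_mk, Localization.mk_eq_mk', ← map_pow]
  exact (IsLocalization.mk'_spec' _ P
    (⟨MvPolynomial.X j ^ d, d, rfl⟩ :
      Submonoid.powers (MvPolynomial.X j : MvPolynomial (Fin (n + 1)) A))).symm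

end ProjectiveSpace

/-! ### Affine charts of projective type -/

section Charts

open HomogeneousLocalization

attribute [local instance] MvPolynomial.gradedAlgebra

/-- Affine charts of projective type at a point `η : Spec L ⟶ Z`: the homogeneous coordinates of
`η` are `x j`, `j ∈ ι`, all of them nonzero, and `U j` is the locus where the `j`-th coordinate does
not vanish. Only the points in the closure of the image of `η` are required to be covered. -/
structure ProjCharts (A : Type u) [CommRing A] {L : Type u} [Field L] [Algebra A L]
    {Z : Scheme.{u}} (η : Spec (CommRingCat.of L) ⟶ Z) where
  /-- the index set of the charts -/
  ι : Type
  [fintype : Fintype ι]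
  /-- the homogeneous coordinates -/
  x : ι → L
  x_ne : ∀ j, x j ≠ 0
  /-- the charts -/
  U : ι → Z.Opens
  affine : ∀ j, IsAffineOpen (U j)
  mem : ∀ j, ⊤ ≤ η ⁻¹ᵁ U j
  cover : ∀ z, ptOf η ⤳ z → ∃ j, z ∈ U j
  /-- the section `x l / x j` over the chart `U j` -/
  t : ∀ j, ι → Γ(Z, U j)
  pull_t : ∀ j l, pull η (U j) (mem j) (t j l) = x l / x j
  basicOpen_t : ∀ j l, Z.basicOpen (t j l) = U j ⊓ U l
  range_pull : ∀ j, (pull η (U j) (mem j)).range =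
    (Algebra.adjoin A (Set.range fun l => x l / x j)).toSubring

attribute [instance] ProjCharts.fintype

variable {A : Type u} [CommRing A] {L : Type u} [Field L] [Algebra A L] {n : ℕ}

/-- The grading of `A[X_0, …, X_n]` by degree, whose `Proj` is `ProjSpace A n`. -/
abbrev gr (A : Type u) [CommRing A] (n : ℕ) :
    ℕ → Submodule A (MvPolynomial (Fin (n + 1)) A) :=
  MvPolynomial.homogeneousSubmodule (Fin (n + 1)) A

lemma iSup_basicOpen_X :
    ⨆ j : Fin (n + 1), Proj.basicOpen (gr A n) (MvPolynomial.X j) = ⊤ := by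
  apply Proj.iSup_basicOpen_eq_top' _ _ (fun i => ⟨1, X_mem i⟩)
  rw [eq_top_iff]
  intro P _
  induction P using MvPolynomial.induction_on with
  | C a =>
    exact Subalgebra.algebraMap_mem _ (⟨MvPolynomial.C a, MvPolynomial.isHomogeneous_C _ _⟩ : gr A n
      0)
  | add p q hp hq => exact add_mem (hp trivial) (hq trivial)
  | mul_X p i hp => exact mul_mem (hp trivial) (Algebra.subset_adjoin ⟨i, rfl⟩)

/-- An `L`-valued point over `A` evaluates constants by `algebraMap A L`. -/
lemma specMap_awayι_str (j : Fin (n + 1)) (φ : CommRingCat.of (Away (gr A n) (MvPolynomial.X j)) ⟶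
      CommRingCat.of L)
    (h : (Spec.map φ ≫ Proj.awayι (gr A n) (MvPolynomial.X j) (X_mem j) one_pos) ≫ ProjSpace.str A
      n =
      Spec.map (CommRingCat.ofHom (algebraMap A L))) (a : A) :
    φ (constAway A j a) = algebraMap A L a := by
  have h0 : (Spec.map φ ≫ Proj.awayι (gr A n) (MvPolynomial.X j) (X_mem j) one_pos) ≫ ProjSpace.str
      A n =
      Spec.map φ ≫ (Proj.awayι (gr A n) (MvPolynomial.X j) (X_mem j) one_pos ≫ Proj.toSpecZero
        (gr A n)) ≫
        Spec.map (CommRingCat.ofHom (algebraMap A (gr A n 0))) :=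
    (Category.assoc (Spec.map φ) (Proj.awayι (gr A n) (MvPolynomial.X j) (X_mem j) one_pos)
      (Proj.toSpecZero (gr A n) ≫ Spec.map (CommRingCat.ofHom (algebraMap A (gr A n 0))))).trans
      (congr(Spec.map φ ≫ $((Category.assoc _ _ _).symm)))
  have h1 : Spec.map (CommRingCat.ofHom (constAway A j) ≫ φ) =
      Spec.map (CommRingCat.ofHom (algebraMap A L)) := by
    rw [← h, h0, Proj.awayι_toSpecZero, ← Spec.map_comp, ← Spec.map_comp]
    rfl
  exact congr($(Spec.map_injective h1) a)

/-- The cocycle relation `r / p = (q / p) * (r / q)` of fractions in a ring where `p` and `q` are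
invertible. -/
lemma eq_mul_of_isUnit_mul {B S : Type*} [CommRing B] [CommRing S] (ρ : B →+* S) (p q : B)
    (hu : IsUnit (ρ (p * q))) {r : B} {a b c : S} (k1 : a * ρ p = ρ r) (k2 : b * ρ p = ρ q)
    (k3 : c * ρ q = ρ r) : a = b * c := by
  apply hu.mul_left_injective
  beta_reduce
  rw [map_mul]
  linear_combination ρ q * k1 - ρ q * k3 - ρ q * c * k2

omit [Algebra A L] in
/-- Compatibility of the coordinates on two charts, at an `L`-valued point. -/
lemma coord_cocycle (j l m : Fin (n + 1))
    (φ : CommRingCat.of (Away (gr A n) (MvPolynomial.X j)) ⟶ CommRingCat.of L)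
    (ψ : CommRingCat.of (Away (gr A n) (MvPolynomial.X l)) ⟶ CommRingCat.of L)
    (h : Spec.map φ ≫ Proj.awayι (gr A n) (MvPolynomial.X j) (X_mem j) one_pos =
      Spec.map ψ ≫ Proj.awayι (gr A n) (MvPolynomial.X l) (X_mem l) one_pos) :
    φ (coordAway A j m) = φ (coordAway A j l) * ψ (coordAway A l m) := by
  set θ := Spec.map φ ≫ Proj.awayι (gr A n) (MvPolynomial.X j) (X_mem j) one_pos with hθ
  have hj : ptOf θ ∈ Proj.basicOpen (gr A n) (MvPolynomial.X j) := by
    rw [← Proj.opensRange_awayι (gr A n) (MvPolynomial.X j) (X_mem j) one_pos]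
    exact ⟨_, rfl⟩
  have hl : ptOf θ ∈ Proj.basicOpen (gr A n) (MvPolynomial.X l) := by
    rw [← Proj.opensRange_awayι (gr A n) (MvPolynomial.X l) (X_mem l) one_pos, h]
    exact ⟨_, rfl⟩
  have hjl : ptOf θ ∈ Proj.basicOpen (gr A n) (MvPolynomial.X j * MvPolynomial.X l) := by
    rw [Proj.basicOpen_mul]; exact ⟨hj, hl⟩
  have hmem : (MvPolynomial.X j * MvPolynomial.X l : MvPolynomial (Fin (n + 1)) A) ∈ gr A n
      (1 + 1) :=
    SetLike.mul_mem_graded (X_mem j) (X_mem l)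
  obtain ⟨χ, hχ⟩ := exists_eq_specMap_awayι (gr A n) θ hmem two_pos hjl
  have e1 : φ = CommRingCat.ofHom (awayMap (gr A n) (X_mem l) rfl) ≫ χ := by
    apply Spec.map_injective
    rw [← cancel_mono (Proj.awayι (gr A n) (MvPolynomial.X j) (X_mem j) one_pos), ← hθ, hχ,
      Spec.map_comp, Category.assoc, Proj.SpecMap_awayMap_awayι]
  have e2 : ψ = CommRingCat.ofHom (awayMap (gr A n) (X_mem j) (mul_comm _ _)) ≫ χ := by
    apply Spec.map_injective
    rw [← cancel_mono (Proj.awayι (gr A n) (MvPolynomial.X l) (X_mem l) one_pos), ← h, hχ,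
      Spec.map_comp, Category.assoc, Proj.SpecMap_awayMap_awayι]
  rw [e1, e2]
  change χ (awayMap (gr A n) (X_mem l) rfl (coordAway A j m)) =
    χ (awayMap (gr A n) (X_mem l) rfl (coordAway A j l)) *
      χ (awayMap (gr A n) (X_mem j) (mul_comm _ _) (coordAway A l m))
  rw [← map_mul]
  congr 1
  apply HomogeneousLocalization.val_injective
  rw [HomogeneousLocalization.val_mul, val_awayMap, val_awayMap, val_awayMap]
  have hu : IsUnit (algebraMap (MvPolynomial (Fin (n + 1)) A) (Localization.Away
      (MvPolynomial.X j * MvPolynomial.X l : MvPolynomial (Fin (n + 1)) A))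
      (MvPolynomial.X j * MvPolynomial.X l)) := IsLocalization.Away.algebraMap_isUnit _
  set ρ := algebraMap (MvPolynomial (Fin (n + 1)) A) (Localization.Away
      (MvPolynomial.X j * MvPolynomial.X l : MvPolynomial (Fin (n + 1)) A))
  have key : ∀ (i i' : Fin (n + 1)) (g : Localization.Away
      (MvPolynomial.X i : MvPolynomial (Fin (n + 1)) A) →+* Localization.Away
      (MvPolynomial.X j * MvPolynomial.X l : MvPolynomial (Fin (n + 1)) A)),
      (∀ P, g (locX A i P) = ρ P) →
      g (coordAway A i i').val * ρ (MvPolynomial.X i) = ρ (MvPolynomial.X i') := by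
    intro i i' g hg
    rw [← hg, ← map_mul, ← hg]
    congr 1
    exact val_coordAway i i'
  have k1 := key j m (Localization.awayLift ρ _ (isUnit_of_dvd_unit (map_dvd ρ ⟨_, rfl⟩) hu))
    (fun P => IsLocalization.Away.lift_eq _ _ _)
  have k2 := key j l (Localization.awayLift ρ _ (isUnit_of_dvd_unit (map_dvd ρ ⟨_, rfl⟩) hu))
    (fun P => IsLocalization.Away.lift_eq _ _ _)
  have k3 := key l m (Localization.awayLift ρ _ (isUnit_of_dvd_unit (map_dvd ρ ⟨_, mul_comm _ _⟩)
      hu))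
    (fun P => IsLocalization.Away.lift_eq _ _ _)
  exact eq_mul_of_isUnit_mul ρ _ _ hu k1 k2 k3

/-- Charts of a closed subscheme of projective space at a point whose homogeneous coordinates are
read off from the chart `X_j₀ ≠ 0`. -/
lemma exists_projCharts_of_coord {Z : Scheme.{u}} (i' : Z ⟶ Proj (gr A n))
    (hi' : IsClosedImmersion i') (η : Spec (CommRingCat.of L) ⟶ Z)
    (hη : η ≫ i' ≫ ProjSpace.str A n = Spec.map (CommRingCat.ofHom (algebraMap A L)))
    (j0 : Fin (n + 1))
    (φ₀ : CommRingCat.of (Away (gr A n) (MvPolynomial.X j0)) ⟶ CommRingCat.of L)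
    (hφ₀ : η ≫ i' = Spec.map φ₀ ≫ Proj.awayι (gr A n) (MvPolynomial.X j0) (X_mem j0) one_pos) :
    ∃ (C : ProjCharts A η) (e : {l // φ₀ (coordAway A j0 l) ≠ 0} ≃ C.ι),
      ∀ l, C.x (e l) = φ₀ (coordAway A j0 l.1) := by
  let D : Fin (n + 1) → (Proj (gr A n)).Opens := fun j => Proj.basicOpen (gr A n) (MvPolynomial.X j)
  have hD : ∀ j, IsAffineOpen (D j) := fun j => Proj.isAffineOpen_basicOpen (gr A n) _ (X_mem j)
      one_pos
  let θ : Spec (CommRingCat.of L) ⟶ Proj (gr A n) := η ≫ i'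
  have hcov : ∀ z : Proj (gr A n), ∃ j, z ∈ D j := by
    intro z
    have : z ∈ ⨆ j : Fin (n + 1), D j := by
      rw [iSup_basicOpen_X]; trivial
    exact TopologicalSpace.Opens.mem_iSup.1 this
  have hφ : ∀ j, ptOf θ ∈ D j → ∃ φ : CommRingCat.of (Away (gr A n) (MvPolynomial.X j)) ⟶
      CommRingCat.of L, θ = Spec.map φ ≫ Proj.awayι (gr A n) (MvPolynomial.X j) (X_mem j) one_pos :=
    fun j hj => exists_eq_specMap_awayι (gr A n) θ (X_mem j) one_pos hj
  choose φ hφ using hφ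
  let τ : ∀ j l, Γ(Proj (gr A n), D j) := fun j l => Proj.awayToSection (gr A n) _ (coordAway A j l)
  have hτ : ∀ j l, (Proj (gr A n)).basicOpen (τ j l) = D j ⊓ D l := fun j l =>
    basicOpen_awayToSection (gr A n) (X_mem j) (X_mem l)
  have hpull : ∀ j (hj : ptOf θ ∈ D j) (e : ⊤ ≤ η ⁻¹ᵁ (i' ⁻¹ᵁ D j))
      (a : Away (gr A n) (MvPolynomial.X j)),
      pull η (i' ⁻¹ᵁ D j) e (i'.app (D j) (Proj.awayToSection (gr A n) _ a)) = φ j hj a := by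
    intro j hj e a
    rw [pull_comp]
    have := pull_awayToSection (gr A n) (X_mem j) one_pos a (φ j hj)
      (by rw [← hφ]; exact e)
    rw [← this]
    congr 2
    exact hφ j hj
  have hcoc : ∀ j l m (hj : ptOf θ ∈ D j) (hl : ptOf θ ∈ D l),
      φ j hj (coordAway A j m) = φ j hj (coordAway A j l) * φ l hl (coordAway A l m) := by
    intro j l m hj hl
    apply coord_cocycle
    rw [← hφ, ← hφ]
  have hone : ∀ j (hj : ptOf θ ∈ D j), φ j hj (coordAway A j j) = 1 := by
    intro j hj
    rw [coordAway_self, map_one]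
  have hj0 : ptOf θ ∈ D j0 := by
    change ptOf (η ≫ i') ∈ Proj.basicOpen (gr A n) (MvPolynomial.X j0)
    rw [← Proj.opensRange_awayι (gr A n) (MvPolynomial.X j0) (X_mem j0) one_pos, hφ₀]
    exact ⟨_, rfl⟩
  have hφj0 : φ j0 hj0 = φ₀ := by
    apply Spec.map_injective
    rw [← cancel_mono (Proj.awayι (gr A n) (MvPolynomial.X j0) (X_mem j0) one_pos), ← hφ, ← hφ₀]
  -- the homogeneous coordinates, normalized by the `j0`-th one; only the nonzero ones index charts,
  -- since the other standard open sets do not contain the given point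
  let x : Fin (n + 1) → L := fun l => φ₀ (coordAway A j0 l)
  have hx : ∀ j, x j ≠ 0 ↔ ptOf θ ∈ D j := by
    intro j
    constructor
    · intro h
      have e : ⊤ ≤ η ⁻¹ᵁ (i' ⁻¹ᵁ D j0) := (top_le_preimage_iff _ _).2 hj0
      have h2 := (mem_basicOpen_iff_pull_ne_zero e (i'.app (D j0) (τ j0 j))).2
        (by rw [hpull j0 hj0, hφj0]; exact h)
      rw [← Scheme.preimage_basicOpen, hτ] at h2
      exact h2.2
    · intro hj h0
      have := hcoc j0 j j0 hj0 hj
      rw [hone, hφj0] at this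
      rw [show φ₀ (coordAway A j0 j) = 0 from h0, zero_mul] at this
      exact one_ne_zero this
  have hxx : ∀ j l (hj : ptOf θ ∈ D j), φ j hj (coordAway A j l) = x l / x j := by
    intro j l hj
    rw [eq_div_iff ((hx j).2 hj), mul_comm]
    have h := (hcoc j0 j l hj0 hj).symm
    rwa [hφj0] at h
  have hmem : ∀ j : {j // x j ≠ 0}, ⊤ ≤ η ⁻¹ᵁ (i' ⁻¹ᵁ D j.1) := fun j =>
    (top_le_preimage_iff _ _).2 ((hx j.1).1 j.2)
  classical
  refine ⟨ProjCharts.mk (ι := {j // x j ≠ 0}) (fun j => x j.1) (fun j => j.2)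
    (fun j => i' ⁻¹ᵁ D j.1) (fun j => (hD j.1).preimage i') hmem ?_
    (fun j l => i'.app (D j.1) (τ j.1 l.1)) ?_ ?_ ?_, Equiv.refl _, fun _ => rfl⟩
  · intro z hz
    obtain ⟨j, hj⟩ := hcov (i' z)
    have h1 : ptOf η ∈ i' ⁻¹ᵁ D j := hz.mem_open (i' ⁻¹ᵁ D j).2 hj
    exact ⟨⟨j, (hx j).2 h1⟩, hj⟩
  · intro j l
    rw [hpull j.1 ((hx j.1).1 j.2), hxx]
  · intro j l
    rw [← Scheme.preimage_basicOpen, hτ]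
    rfl
  · intro j
    have hj := (hx j.1).1 j.2
    have hA : ∀ a : A, φ j.1 hj (constAway A j.1 a) = algebraMap A L a := by
      apply specMap_awayι_str
      rw [← hφ]
      exact (Category.assoc _ _ _).trans hη
    ext g
    constructor
    · rintro ⟨s, rfl⟩
      obtain ⟨s', rfl⟩ := Scheme.Hom.app_surjective i' (D j.1) (hD j.1) s
      obtain ⟨a, rfl⟩ := (ConcreteCategory.bijective_of_isIso
        (Proj.basicOpenIsoAway (gr A n) (MvPolynomial.X j.1) (X_mem j.1) one_pos).hom).2 s'
      rw [Proj.basicOpenIsoAway_hom, hpull j.1 hj]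
      obtain ⟨P, rfl⟩ := exists_eval₂_eq j.1 a
      have h2 : φ j.1 hj (P.eval₂ (constAway A j.1) (coordAway A j.1)) =
          P.eval₂ ((φ j.1 hj).hom.comp (constAway A j.1)) ((φ j.1 hj).hom ∘ coordAway A j.1) :=
        MvPolynomial.hom_eval₂ P _ (φ j.1 hj).hom _
      rw [h2]
      -- every function on the chart is a polynomial in the ratios of the coordinates, of which those
      -- with numerator zero may be dropped
      have h3 : (φ j.1 hj).hom.comp (constAway A j.1) = algebraMap A L := RingHom.ext hA
      rw [h3]
      change MvPolynomial.aeval _ P ∈ _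
      have h4 : MvPolynomial.aeval ((φ j.1 hj).hom ∘ coordAway A j.1) P ∈
          Algebra.adjoin A (Set.range ((φ j.1 hj).hom ∘ coordAway A j.1)) := by
        rw [Algebra.adjoin_range_eq_range_aeval]; exact ⟨P, rfl⟩
      refine (Algebra.adjoin_le ?_ :
        Algebra.adjoin A (Set.range ((φ j.1 hj).hom ∘ coordAway A j.1)) ≤ _) h4
      rintro _ ⟨l, rfl⟩
      have h5 : ((φ j.1 hj).hom ∘ coordAway A j.1) l = x l / x j.1 := hxx j.1 l hj
      rw [h5]
      by_cases hl : x l = 0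
      · rw [hl, zero_div]; exact zero_mem _
      · exact Algebra.subset_adjoin ⟨⟨l, hl⟩, rfl⟩
    · intro hg
      have hconst : ∀ a : A, algebraMap A L a ∈ (pull η (i' ⁻¹ᵁ D j.1) (hmem j)).range :=
        fun a => ⟨i'.app (D j.1) (Proj.awayToSection (gr A n) _ (constAway A j.1 a)),
          by rw [hpull j.1 hj, hA]⟩
      have : Algebra.adjoin A (Set.range fun l : {j // x j ≠ 0} => x l.1 / x j.1) ≤
          ({ __ := (pull η (i' ⁻¹ᵁ D j.1) (hmem j)).range
             algebraMap_mem' := fun a => hconst a } : Subalgebra A L) := by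
        refine Algebra.adjoin_le ?_
        rintro _ ⟨l, rfl⟩
        exact ⟨i'.app (D j.1) (τ j.1 l.1), by rw [hpull j.1 hj, hxx]⟩
      exact this hg

lemma exists_projCharts_of_isClosedImmersion {Z : Scheme.{u}} (i : Z ⟶ ProjSpace A n)
    (hi : IsClosedImmersion i) (η : Spec (CommRingCat.of L) ⟶ Z)
    (hη : η ≫ i ≫ ProjSpace.str A n = Spec.map (CommRingCat.ofHom (algebraMap A L))) :
    Nonempty (ProjCharts A η) := by
  let i' : Z ⟶ Proj (gr A n) := i
  have h : ptOf (η ≫ i') ∈ ⨆ j : Fin (n + 1), Proj.basicOpen (gr A n) (MvPolynomial.X j) := by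
    rw [iSup_basicOpen_X]; trivial
  obtain ⟨j0, hj0⟩ := TopologicalSpace.Opens.mem_iSup.1 h
  obtain ⟨φ₀, hφ₀⟩ := exists_eq_specMap_awayι (gr A n) (η ≫ i') (X_mem j0) one_pos hj0
  obtain ⟨C, -⟩ := exists_projCharts_of_coord i' hi η hη j0 φ₀ hφ₀
  exact ⟨C⟩

theorem IsProjective.exists_projCharts {Z : Scheme.{u}} {f : Z ⟶ Spec (CommRingCat.of A)}
    (hf : IsProjective f) (η : Spec (CommRingCat.of L) ⟶ Z)
    (hη : η ≫ f = Spec.map (CommRingCat.ofHom (algebraMap A L))) :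
    Nonempty (ProjCharts A η) := by
  obtain ⟨n, i, hi, rfl⟩ := hf
  exact exists_projCharts_of_isClosedImmersion i hi η hη

end Charts

/-! ### Homogeneous forms and their norms -/

section Forms

variable (A : Type u) [CommRing A] {L : Type u} [Field L] [Algebra A L] {ι : Type*} (x : ι → L)

/-- Homogeneous forms of degree `d` with coefficients in `A` in the quantities `x j`. -/
def forms (d : ℕ) : Submodule A L := Submodule.span A (Set.range x) ^ d

/-- The `A`-algebra generated by the ratios `x l / x j`. -/
def chartRing (j : ι) : Subalgebra A L := Algebra.adjoin A (Set.range fun l => x l / x j)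

variable {A x}

lemma mul_mem_forms {d e : ℕ} {P Q : L} (hP : P ∈ forms A x d) (hQ : Q ∈ forms A x e) :
    P * Q ∈ forms A x (d + e) := by
  rw [forms, pow_add]; exact Submodule.mul_mem_mul hP hQ

lemma pow_mem_forms {d : ℕ} {P : L} (hP : P ∈ forms A x d) (n : ℕ) :
    P ^ n ∈ forms A x (d * n) := by
  rw [forms, pow_mul]; exact Submodule.pow_mem_pow _ hP n

lemma coord_mem_forms (j : ι) : x j ∈ forms A x 1 := by
  rw [forms, pow_one]; exact Submodule.subset_span ⟨j, rfl⟩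

lemma coord_pow_mem_forms (j : ι) (n : ℕ) : x j ^ n ∈ forms A x n := by
  have := pow_mem_forms (coord_mem_forms (A := A) (x := x) j) n
  rwa [one_mul] at this

lemma algebraMap_mem_forms (a : A) : algebraMap A L a ∈ forms A x 0 := by
  rw [forms, pow_zero]; exact Submodule.mem_one.2 ⟨a, rfl⟩

lemma prod_mem_forms {κ : Type*} (s : Finset κ) (d : κ → ℕ) (P : κ → L)
    (h : ∀ i ∈ s, P i ∈ forms A x (d i)) : ∏ i ∈ s, P i ∈ forms A x (∑ i ∈ s, d i) := by
  classical
  induction s using Finset.induction_on with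
  | empty =>
    have := algebraMap_mem_forms (x := x) (1 : A)
    simpa using this
  | insert a s ha ih =>
    rw [Finset.prod_insert ha, Finset.sum_insert ha]
    exact mul_mem_forms (h _ (Finset.mem_insert_self _ _))
      (ih fun i hi => h i (Finset.mem_insert_of_mem hi))

lemma ratio_mem_chartRing (j l : ι) : x l / x j ∈ chartRing A x j :=
  Algebra.subset_adjoin ⟨l, rfl⟩

lemma div_mem_chartRing (j : ι) {d : ℕ} {P : L} (hP : P ∈ forms A x d) :
    P / x j ^ d ∈ chartRing A x j := by
  induction d generalizing P with
  | zero =>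
    rw [forms, pow_zero] at hP
    obtain ⟨a, rfl⟩ := Submodule.mem_one.1 hP
    rw [pow_zero, div_one]; exact Subalgebra.algebraMap_mem _ a
  | succ d ih =>
    have hP' : P ∈ forms A x d * Submodule.span A (Set.range x) := by
      rw [forms, ← pow_succ]; exact hP
    refine Submodule.mul_induction_on hP' ?_ ?_
    · intro Q hQ y hy
      have : Q * y / x j ^ (d + 1) = (Q / x j ^ d) * (y / x j) := by
        rw [pow_succ, mul_div_mul_comm]
      rw [this]
      refine mul_mem (ih hQ) ?_
      refine Submodule.span_induction ?_ ?_ ?_ ?_ hy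
      · rintro _ ⟨l, rfl⟩; exact ratio_mem_chartRing j l
      · rw [zero_div]; exact zero_mem _
      · intro a b _ _ ha hb; rw [add_div]; exact add_mem ha hb
      · intro c a _ ha; rw [smul_div_assoc]; exact Subalgebra.smul_mem _ ha c
    · intro a b ha hb
      rw [add_div]; exact add_mem ha hb

/-- Elements of a chart ring become forms when a large power of the coordinate clears the
denominators. -/
lemma exists_mul_pow_mem_forms (hx : ∀ j, x j ≠ 0) (j : ι) {a : L} (ha : a ∈ chartRing A x j) :
    ∃ q₀, ∀ q, q₀ ≤ q → a * x j ^ q ∈ forms A x q := by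
  suffices h : ∃ q, a * x j ^ q ∈ forms A x q by
    obtain ⟨q, hq⟩ := h
    refine ⟨q, fun r hr => ?_⟩
    have := mul_mem_forms hq (coord_pow_mem_forms (A := A) (x := x) j (r - q))
    rwa [mul_assoc, ← pow_add, Nat.add_sub_cancel' hr] at this
  refine Algebra.adjoin_induction ?_ ?_ ?_ ?_ ha
  · rintro _ ⟨l, rfl⟩
    refine ⟨1, ?_⟩
    simp only [pow_one]
    rw [div_mul_cancel₀ _ (hx j)]; exact coord_mem_forms l
  · intro r
    exact ⟨0, by rw [pow_zero, mul_one]; exact algebraMap_mem_forms r⟩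
  · rintro a b - - ⟨q, hq⟩ ⟨r, hr⟩
    refine ⟨q + r, ?_⟩
    have h1 := mul_mem_forms hq (coord_pow_mem_forms (A := A) (x := x) j r)
    have h2 := mul_mem_forms hr (coord_pow_mem_forms (A := A) (x := x) j q)
    rw [add_comm r q] at h2
    convert add_mem h1 h2 using 1
    ring
  · rintro a b - - ⟨q, hq⟩ ⟨r, hr⟩
    refine ⟨q + r, ?_⟩
    convert mul_mem_forms hq hr using 1
    ring

lemma exists_mul_pow_mem_forms_of_finset {κ : Type*} (hx : ∀ j, x j ≠ 0) (s : Finset κ) (j : κ → ι)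
    (a : κ → L) (ha : ∀ i ∈ s, a i ∈ chartRing A x (j i)) :
    ∃ q₀, ∀ q, q₀ ≤ q → ∀ i ∈ s, a i * x (j i) ^ q ∈ forms A x q := by
  classical
  choose! q hq using fun i (hi : i ∈ s) => exists_mul_pow_mem_forms hx (j i) (ha i hi)
  refine ⟨s.sup q, fun r hr i hi => hq i hi r ((Finset.le_sup hi).trans hr)⟩

end Forms

section Norm

variable {L : Type u} [Field L]

namespace LocVal

variable (v : LocVal L)

lemma abs_pow {a : L} (ha : a ∈ v.O) (n : ℕ) : v.abs (a ^ n) = v.abs a ^ n := by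
  induction n with
  | zero => rw [pow_zero, pow_zero, v.abs_one]
  | succ n ih => rw [pow_succ, v.abs_mul (pow_mem ha n) ha, ih, pow_succ]

lemma abs_sum_le {κ : Type*} (s : Finset κ) (a : κ → L) (ha : ∀ i ∈ s, a i ∈ v.O) {c : ℝ≥0}
    (hc : ∀ i ∈ s, v.abs (a i) ≤ c) : v.abs (∑ i ∈ s, a i) ≤ c := by
  classical
  induction s using Finset.induction_on with
  | empty => simp [v.abs_zero]
  | insert b s hb ih =>
    rw [Finset.sum_insert hb]
    refine (v.abs_add (ha _ (Finset.mem_insert_self _ _))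
      (sum_mem fun i hi => ha i (Finset.mem_insert_of_mem hi))).trans (max_le ?_ ?_)
    · exact hc _ (Finset.mem_insert_self _ _)
    · exact ih (fun i hi => ha i (Finset.mem_insert_of_mem hi))
        (fun i hi => hc i (Finset.mem_insert_of_mem hi))

lemma abs_div {a b : L} (ha : a ∈ v.O) (hb : b ∈ v.O) (h : v.abs b ≠ 0) :
    v.abs (a / b) = v.abs a / v.abs b := by
  have hb0 : b ≠ 0 := fun h0 => h (by rw [h0, v.abs_zero])
  rw [eq_div_iff h, ← v.abs_mul _ hb, div_mul_cancel₀ _ hb0]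
  rw [div_eq_mul_inv]; exact mul_mem ha (v.inv_mem hb h)

/-- If an element and its inverse lie in the local ring, its absolute value is not zero. -/
lemma abs_ne_zero_of_inv_mem {a : L} (h0 : a ≠ 0) (ha : a ∈ v.O) (ha' : a⁻¹ ∈ v.O) :
    v.abs a ≠ 0 := by
  intro h
  have := v.abs_mul ha ha'
  rw [mul_inv_cancel₀ h0, v.abs_one, h, zero_mul] at this
  exact one_ne_zero this

variable (A : Type u) [CommRing A] [Algebra A L] {ι : Type*} (x : ι → L)

/-- The `j`-th coordinate has maximal absolute value: the `j`-th chart contains the kernel of the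
semivaluation and the ratios `x l / x j` have absolute value at most one. -/
structure MaxAt (j : ι) : Prop where
  mem : ∀ g ∈ chartRing A x j, g ∈ v.O
  le : ∀ l, v.abs (x l / x j) ≤ 1

open Classical in
/-- The norm `|P| / (max_l |x l|) ^ d` of a form `P` of degree `d`. -/
def nrm (d : ℕ) (P : L) : ℝ≥0 :=
  if h : ∃ j, v.MaxAt A x j then v.abs (P / x h.choose ^ d) else 0

variable {v A x}

lemma MaxAt.abs_eq_one (hx : ∀ j, x j ≠ 0) {j l : ι} (hj : v.MaxAt A x j) (hl : v.MaxAt A x l) :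
    v.abs (x l / x j) = 1 := by
  have h := v.abs_mul (hj.mem _ (ratio_mem_chartRing j l)) (hl.mem _ (ratio_mem_chartRing l j))
  rw [div_mul_div_cancel₀ (hx j), div_self (hx l), v.abs_one] at h
  refine le_antisymm (hj.le l) ?_
  rw [h]
  exact mul_le_of_le_one_right zero_le (hl.le j)

/-- The norm does not depend on the choice of a coordinate of maximal absolute value. -/
lemma nrm_eq (hx : ∀ j, x j ≠ 0) {j : ι} (hj : v.MaxAt A x j) {d : ℕ} {P : L}
    (hP : P ∈ forms A x d) : v.nrm A x d P = v.abs (P / x j ^ d) := by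
  have h : ∃ j, v.MaxAt A x j := ⟨j, hj⟩
  rw [nrm, dif_pos h]
  have hl := h.choose_spec
  set l := h.choose
  have e : P / x l ^ d = (P / x j ^ d) * (x j / x l) ^ d := by
    rw [div_pow]; field_simp [hx j, hx l]
  have m := hl.mem _ (ratio_mem_chartRing l j)
  rw [e, v.abs_mul (hj.mem _ (div_mem_chartRing j hP)) (pow_mem m d), v.abs_pow m,
    hl.abs_eq_one hx hj, one_pow, mul_one]

variable (hv : ∃ j, v.MaxAt A x j) (hx : ∀ j, x j ≠ 0)

include hv hx

lemma nrm_mul {d e : ℕ} {P Q : L} (hP : P ∈ forms A x d) (hQ : Q ∈ forms A x e) :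
    v.nrm A x (d + e) (P * Q) = v.nrm A x d P * v.nrm A x e Q := by
  obtain ⟨j, hj⟩ := hv
  rw [nrm_eq hx hj hP, nrm_eq hx hj hQ, nrm_eq hx hj (mul_mem_forms hP hQ), pow_add,
    mul_div_mul_comm,
    v.abs_mul (hj.mem _ (div_mem_chartRing j hP)) (hj.mem _ (div_mem_chartRing j hQ))]

lemma nrm_one : v.nrm A x 0 1 = 1 := by
  obtain ⟨j, hj⟩ := hv
  have : (1 : L) ∈ forms A x 0 := by
    have := algebraMap_mem_forms (x := x) (1 : A)
    rwa [map_one] at this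
  rw [nrm_eq hx hj this, pow_zero, div_one, v.abs_one]

lemma nrm_pow {d : ℕ} {P : L} (hP : P ∈ forms A x d) (n : ℕ) :
    v.nrm A x (d * n) (P ^ n) = v.nrm A x d P ^ n := by
  induction n with
  | zero => rw [mul_zero, pow_zero, pow_zero, nrm_one hv hx]
  | succ n ih =>
    rw [mul_add, mul_one, pow_succ, nrm_mul hv hx (pow_mem_forms hP n) hP, ih, pow_succ]

lemma nrm_coord_le (l : ι) : v.nrm A x 1 (x l) ≤ 1 := by
  obtain ⟨j, hj⟩ := hv
  rw [nrm_eq hx hj (coord_mem_forms l), pow_one]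
  exact hj.le l

omit hv in
lemma nrm_coord_eq_one {j : ι} (hj : v.MaxAt A x j) : v.nrm A x 1 (x j) = 1 := by
  rw [nrm_eq hx hj (coord_mem_forms j), pow_one, div_self (hx j), v.abs_one]

end LocVal

end Norm

section Charts

variable {A : Type u} [CommRing A] {L : Type u} [Field L] [Algebra A L] {Z : Scheme.{u}}
  {η : Spec (CommRingCat.of L) ⟶ Z} (C : ProjCharts A η)

lemma ProjCharts.pull_mem (j : C.ι) (s : Γ(Z, C.U j)) :
    pull η (C.U j) (C.mem j) s ∈ chartRing A C.x j := by
  have : pull η (C.U j) (C.mem j) s ∈ (pull η (C.U j) (C.mem j)).range := ⟨s, rfl⟩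
  rw [C.range_pull] at this
  exact this

lemma ProjCharts.exists_pull (j : C.ι) {g : L} (hg : g ∈ chartRing A C.x j) :
    ∃ s : Γ(Z, C.U j), pull η (C.U j) (C.mem j) s = g := by
  have : g ∈ (pull η (C.U j) (C.mem j)).range := by
    rw [C.range_pull]; exact hg
  exact this

variable {F : Type u} [Field F] {ν : F → ℝ≥0} {f : Z ⟶ Spec (CommRingCat.of F)}
  [IsReduced Z] [IsDominant η]

lemma ProjCharts.mem_O (w : Berk ν f) {j : C.ι} (h : w.pt ∈ C.U j) {g : L}
    (hg : g ∈ chartRing A C.x j) : g ∈ (w.locVal η).O := by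
  obtain ⟨s, rfl⟩ := C.exists_pull j hg
  exact pull_mem_locRing h _ _

/-- Passing from a chart containing the kernel to another one. -/
lemma ProjCharts.mem_U_of_abs_ne_zero (w : Berk ν f) {j l : C.ι} (h : w.pt ∈ C.U j)
    (h0 : (w.locVal η).abs (C.x l / C.x j) ≠ 0) : w.pt ∈ C.U l := by
  rw [← C.pull_t, Berk.locVal_abs_pull η w h, Berk.abs_ne_zero_iff, C.basicOpen_t] at h0
  exact h0.2

/-- Properness: every semivaluation has a coordinate of maximal absolute value, and the
corresponding chart contains its kernel. -/
lemma ProjCharts.exists_maxAt (w : Berk ν f) :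
    ∃ j, w.pt ∈ C.U j ∧ (w.locVal η).MaxAt A C.x j := by
  obtain ⟨j, hj⟩ := C.cover w.pt (ptOf_specializes _)
  obtain ⟨l, -, hl⟩ := Finset.exists_max_image Finset.univ
    (fun l => (w.locVal η).abs (C.x l / C.x j)) ⟨j, Finset.mem_univ _⟩
  have h1 : (w.locVal η).abs (C.x l / C.x j) ≠ 0 := by
    have := hl j (Finset.mem_univ _)
    rw [div_self (C.x_ne j), LocVal.abs_one] at this
    exact (zero_lt_one.trans_le this).ne'
  have h2 := C.mem_U_of_abs_ne_zero w hj h1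
  refine ⟨l, h2, fun g hg => C.mem_O w h2 hg, fun m => ?_⟩
  have e : C.x m / C.x l = (C.x m / C.x j) / (C.x l / C.x j) := by
    field_simp [C.x_ne]
  rw [e, LocVal.abs_div _ (C.mem_O w hj (ratio_mem_chartRing j m))
    (C.mem_O w hj (ratio_mem_chartRing j l)) h1]
  exact div_le_one_of_le₀ (hl m (Finset.mem_univ _)) zero_le

lemma ProjCharts.exists_maxAt' (w : Berk ν f) : ∃ j, (w.locVal η).MaxAt A C.x j :=
  let ⟨j, _, hj⟩ := C.exists_maxAt w
  ⟨j, hj⟩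

lemma ProjCharts.mem_U_of_maxAt (w : Berk ν f) {j : C.ι} (hj : (w.locVal η).MaxAt A C.x j) :
    w.pt ∈ C.U j := by
  obtain ⟨l, hl, hl'⟩ := C.exists_maxAt w
  refine C.mem_U_of_abs_ne_zero w hl ?_
  rw [hl'.abs_eq_one C.x_ne hj]
  exact one_ne_zero

/-- The norm of a form at a semivaluation. -/
def ProjCharts.nrm (w : Berk ν f) (d : ℕ) (P : L) : ℝ≥0 := (w.locVal η).nrm A C.x d P

/-- The norm of a form, computed in an arbitrary chart containing the kernel. -/
lemma ProjCharts.nrm_eq_div (w : Berk ν f) {j : C.ι} (hj : w.pt ∈ C.U j) {d : ℕ} {P : L}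
    (hP : P ∈ forms A C.x d) :
    C.nrm w d P = (w.locVal η).abs (P / C.x j ^ d) /
      (Finset.univ.sup fun l => (w.locVal η).abs (C.x l / C.x j)) ^ d := by
  obtain ⟨l, hl, hl'⟩ := C.exists_maxAt w
  have hm := C.mem_O w hj (ratio_mem_chartRing (A := A) j l)
  have hm' := C.mem_O w hl (ratio_mem_chartRing (A := A) l j)
  have h0 : (w.locVal η).abs (C.x l / C.x j) ≠ 0 := by
    refine LocVal.abs_ne_zero_of_inv_mem _ (div_ne_zero (C.x_ne l) (C.x_ne j)) hm ?_
    rw [inv_div]; exact hm'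
  have h1 : (Finset.univ.sup fun l => (w.locVal η).abs (C.x l / C.x j)) =
      (w.locVal η).abs (C.x l / C.x j) := by
    refine le_antisymm (Finset.sup_le fun m _ => ?_)
      (Finset.le_sup (f := fun l => (w.locVal η).abs (C.x l / C.x j)) (Finset.mem_univ l))
    have e : C.x m / C.x j = (C.x m / C.x l) * (C.x l / C.x j) := by
      field_simp [C.x_ne]
    rw [e, LocVal.abs_mul _ (C.mem_O w hl (ratio_mem_chartRing l m)) hm]
    exact mul_le_of_le_one_left zero_le (hl'.le m)
  rw [ProjCharts.nrm, LocVal.nrm_eq C.x_ne hl' hP, h1, eq_div_iff (pow_ne_zero _ h0),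
    ← LocVal.abs_pow _ hm, ← LocVal.abs_mul _ (C.mem_O w hl (div_mem_chartRing l hP))
    (pow_mem hm d)]
  congr 1
  rw [div_pow]; field_simp [C.x_ne]

omit [IsReduced Z] in
lemma Berk.isOpen_pt_mem (U : Z.Opens) : IsOpen {w : Berk ν f | w.pt ∈ U} := by
  apply TopologicalSpace.isOpen_generateFrom_of_mem
  refine ⟨U, 0, Set.univ, isOpen_univ, ?_⟩
  ext w; simp

omit [IsReduced Z] in
lemma Berk.continuousOn_of_abs {U : Z.Opens} (s : Γ(Z, U)) (g : Berk ν f → ℝ≥0)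
    (hg : ∀ w (h : w.pt ∈ U), g w = w.abs s h) : ContinuousOn g {w | w.pt ∈ U} := by
  rw [continuousOn_iff']
  intro V hV
  refine ⟨{w | ∃ h : w.pt ∈ U, w.abs s h ∈ V}, ?_, ?_⟩
  · exact TopologicalSpace.isOpen_generateFrom_of_mem ⟨U, s, V, hV, rfl⟩
  · ext w
    constructor
    · rintro ⟨h1, h2⟩
      refine ⟨⟨h2, ?_⟩, h2⟩
      rw [← hg w h2]; exact h1
    · rintro ⟨⟨h, h1⟩, h2⟩
      refine ⟨?_, h2⟩
      change g w ∈ V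
      rw [hg w h2]; exact h1

/-- The norm of a form is a continuous function on the Berkovich space. -/
lemma ProjCharts.continuous_nrm {d : ℕ} {P : L} (hP : P ∈ forms A C.x d) :
    Continuous fun w : Berk ν f => C.nrm w d P := by
  rw [continuous_iff_continuousAt]
  intro w
  obtain ⟨j, hj⟩ := C.cover w.pt (ptOf_specializes _)
  have hopen : IsOpen {w : Berk ν f | w.pt ∈ C.U j} := Berk.isOpen_pt_mem _
  have habs : ∀ g ∈ chartRing A C.x j,
      ContinuousOn (fun w : Berk ν f => (w.locVal η).abs g) {w | w.pt ∈ C.U j} := by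
    intro g hg
    obtain ⟨s, rfl⟩ := C.exists_pull j hg
    exact Berk.continuousOn_of_abs s _ fun w h => Berk.locVal_abs_pull η w h _ _
  have h2 : ContinuousOn (fun w : Berk ν f =>
      (Finset.univ.sup fun l => (w.locVal η).abs (C.x l / C.x j))) {w | w.pt ∈ C.U j} :=
    ContinuousOn.finset_sup_apply fun l _ => habs _ (ratio_mem_chartRing j l)
  have h3 : ContinuousOn (fun w : Berk ν f => C.nrm w d P) {w | w.pt ∈ C.U j} := by
    refine ContinuousOn.congr (f := fun w : Berk ν f => (w.locVal η).abs (P / C.x j ^ d) /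
      (Finset.univ.sup fun l => (w.locVal η).abs (C.x l / C.x j)) ^ d) ?_
      fun w hw => C.nrm_eq_div w hw hP
    refine (habs _ (div_mem_chartRing j hP)).div (h2.pow d) fun w hw => ?_
    refine pow_ne_zero _ (ne_of_gt (zero_lt_one.trans_le ?_))
    have := Finset.le_sup (f := fun l => (w.locVal η).abs (C.x l / C.x j)) (Finset.mem_univ j)
    rwa [div_self (C.x_ne j), LocVal.abs_one] at this
  exact h3.continuousAt (hopen.mem_nhds hj)

end Charts

/-! ### The function attached to an ideal -/

section SpecPull

variable {L : Type u} [Field L] {X : Scheme.{u}}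

lemma pull_specMap {R : CommRingCat.{u}} (φ : R ⟶ CommRingCat.of L) (s : Γ(Spec R, ⊤)) :
    pull (Spec.map φ) ⊤ le_top s = φ ((Scheme.ΓSpecIso R).hom s) := by
  have h3 := congr($(Scheme.ΓSpecIso_naturality φ) s)
  have h5 : (Spec.map φ).appTop = (Spec.map φ).appLE ⊤ ⊤ le_top := Scheme.Hom.app_eq_appLE _
  rw [h5] at h3
  exact h3

lemma pull_comp_specMap {R : CommRingCat.{u}} (φ : R ⟶ CommRingCat.of L) (g : Spec R ⟶ X)
    (U : X.Opens) (e : ⊤ ≤ g ⁻¹ᵁ U) (e' : ⊤ ≤ (Spec.map φ ≫ g) ⁻¹ᵁ U) (s : Γ(X, U)) :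
    pull (Spec.map φ ≫ g) U e' s = φ ((Scheme.ΓSpecIso R).hom (g.appLE U ⊤ e s)) := by
  rw [← pull_specMap]
  have := congr($(Scheme.Hom.appLE_comp_appLE (Spec.map φ) g U ⊤ ⊤ e le_top) s)
  exact congr((Scheme.ΓSpecIso (CommRingCat.of L)).hom $(this.symm))

/-- An `L`-valued point of an affine open subset is determined by its evaluation map. -/
lemma specMap_pull_fromSpec (g : Spec (CommRingCat.of L) ⟶ X) {U : X.Opens} (hU : IsAffineOpen U)
    (e : ⊤ ≤ g ⁻¹ᵁ U) : Spec.map (CommRingCat.ofHom (pull g U e)) ≫ hU.fromSpec = g := by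
  have h := IsAffineOpen.SpecMap_appLE_fromSpec g hU (isAffineOpen_top _) e
  have h1 : CommRingCat.ofHom (pull g U e) =
      g.appLE U ⊤ e ≫ (Scheme.ΓSpecIso (CommRingCat.of L)).hom := rfl
  rw [h1, Spec.map_comp, Category.assoc, h, IsAffineOpen.fromSpec_top]
  rw [Scheme.isoSpec_Spec_inv, ← Category.assoc, ← Spec.map_comp]
  simp

/-- Evaluation in the residue field of `x` is evaluation at the point `Spec κ(x) ⟶ X`. -/
lemma evaluation_eq_pull (x : X) {U : X.Opens} (h : x ∈ U)
    (e : ⊤ ≤ X.fromSpecResidueField x ⁻¹ᵁ U) (s : Γ(X, U)) :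
    X.evaluation U x h s = pull (L := X.residueField x) (X.fromSpecResidueField x) U e s := by
  have e' : ⊤ ≤ X.fromSpecStalk x ⁻¹ᵁ U := by
    intro y _
    have h1 : X.fromSpecStalk x y ⤳ x := by
      have h2 : X.fromSpecStalk x y ∈ Set.range (X.fromSpecStalk x) := ⟨y, rfl⟩
      rwa [Scheme.range_fromSpecStalk] at h2
    exact h1.mem_open U.2 h
  refine Eq.trans ?_ (pull_comp_specMap (L := X.residueField x) (X.residue x)
    (X.fromSpecStalk x) U e' e s).symm
  change X.residue x (X.presheaf.germ U x h s) = _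
  congr 1
  rw [Scheme.Hom.appLE, Scheme.fromSpecStalk_app h]
  simp only [Category.assoc, ← Functor.map_comp]
  have : (homOfLE le_top).op ≫ (homOfLE e').op = 𝟙 (Opposite.op
      (⊤ : (Spec (X.presheaf.stalk x)).Opens)) := Subsingleton.elim _ _
  rw [this]
  simp only [CategoryTheory.Functor.map_id, Category.comp_id]
  exact congr($((Scheme.ΓSpecIso (X.presheaf.stalk x)).inv_hom_id) (X.presheaf.germ U x h s)).symm

lemma top_le_fromSpecResidueField {x : X} {U : X.Opens} (h : x ∈ U) :
    ⊤ ≤ X.fromSpecResidueField x ⁻¹ᵁ U := by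
  intro y _
  change X.fromSpecResidueField x y ∈ U
  rwa [Scheme.fromSpecResidueField_apply]

/-- If a valuation is bounded by one on two affine open subsets of a separated scheme, then it is
so on their intersection: this is the uniqueness part of the valuative criterion. -/
lemma abs_le_one_inf [X.IsSeparated] (v : Valuation L ℝ≥0) (g : Spec (CommRingCat.of L) ⟶ X)
    {U V : X.Opens} (hU : IsAffineOpen U) (hV : IsAffineOpen V) (eU : ⊤ ≤ g ⁻¹ᵁ U)
    (eV : ⊤ ≤ g ⁻¹ᵁ V) (vU : ∀ s, v (pull g U eU s) ≤ 1) (vV : ∀ s, v (pull g V eV s) ≤ 1)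
    (s : Γ(X, U ⊓ V)) : v (pull g (U ⊓ V) (le_inf eU eV) s) ≤ 1 := by
  let O : Subring L := v.integer
  let j : CommRingCat.of O ⟶ CommRingCat.of L := CommRingCat.ofHom O.subtype
  let a : Spec (CommRingCat.of O) ⟶ X :=
    Spec.map (CommRingCat.ofHom ((pull g U eU).codRestrict O vU)) ≫ hU.fromSpec
  let b : Spec (CommRingCat.of O) ⟶ X :=
    Spec.map (CommRingCat.ofHom ((pull g V eV).codRestrict O vV)) ≫ hV.fromSpec
  have ha : Spec.map j ≫ a = g := by
    refine Eq.trans ?_ (specMap_pull_fromSpec g hU eU)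
    rw [← Category.assoc, ← Spec.map_comp]; rfl
  have hb : Spec.map j ≫ b = g := by
    refine Eq.trans ?_ (specMap_pull_fromSpec g hV eV)
    rw [← Category.assoc, ← Spec.map_comp]; rfl
  -- two extensions of `g` to the spectrum of the valuation ring agree, as the scheme is separated
  have hdom : IsDominant (Spec.map j) := by
    refine ⟨?_⟩
    apply (PrimeSpectrum.denseRange_comap_iff_ker_le_nilRadical _).2
    intro x hx
    have : x = 0 := Subtype.ext hx
    rw [this]; exact zero_mem _
  have hab : a = b := ext_of_isDominant (Spec.map j) (ha.trans hb.symm)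
  have h1 : ⊤ ≤ a ⁻¹ᵁ (U ⊓ V) := by
    intro y _
    refine ⟨?_, ?_⟩
    · have : a y ∈ Set.range hU.fromSpec := ⟨_, rfl⟩
      rw [IsAffineOpen.range_fromSpec] at this
      exact this
    · have : b y ∈ Set.range hV.fromSpec := ⟨_, rfl⟩
      rw [IsAffineOpen.range_fromSpec, ← hab] at this
      exact this
  have h2 : pull (Spec.map j ≫ a) (U ⊓ V) (by rw [ha]; exact le_inf eU eV) s =
      pull g (U ⊓ V) (le_inf eU eV) s := by
    congr 2
  rw [← h2, pull_comp_specMap j a _ h1]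
  exact ((Scheme.ΓSpecIso (CommRingCat.of O)).hom (a.appLE (U ⊓ V) ⊤ h1 s)).2

end SpecPull

section Base

variable {F : Type u} [Field F] {ν : F → ℝ≥0} {Z : Scheme.{u}}
  {f : Z ⟶ Spec (CommRingCat.of F)}

lemma Berk.abs_eq_val_pull (w : Berk ν f) {U : Z.Opens} (h : w.pt ∈ U) (s : Γ(Z, U)) :
    w.abs s h = w.val (pull (L := Z.residueField w.pt) (Z.fromSpecResidueField w.pt) U
      (top_le_fromSpecResidueField h) s) := by
  rw [Berk.abs, evaluation_eq_pull]

variable {L : Type u} [Field L] [Algebra F L] {η : Spec (CommRingCat.of L) ⟶ Z}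

/-- The section given by a constant. -/
def constSec (f : Z ⟶ Spec (CommRingCat.of F)) (a : F) : Γ(Z, f ⁻¹ᵁ ⊤) :=
  f.app ⊤ ((Scheme.ΓSpecIso (CommRingCat.of F)).inv a)

lemma pull_constSec {L : Type u} [Field L] (g : Spec (CommRingCat.of L) ⟶ Z) (φ : F →+* L)
    (h : g ≫ f = Spec.map (CommRingCat.ofHom φ)) (a : F) (e : ⊤ ≤ g ⁻¹ᵁ f ⁻¹ᵁ ⊤) :
    pull g (f ⁻¹ᵁ ⊤) e (constSec f a) = φ a := by
  rw [constSec, pull_comp]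
  have h1 : pull (g ≫ f) ⊤ e ((Scheme.ΓSpecIso (CommRingCat.of F)).inv a) =
      pull (Spec.map (CommRingCat.ofHom φ)) ⊤ le_top ((Scheme.ΓSpecIso (CommRingCat.of F)).inv
        a) := by
    congr 2
  rw [h1, pull_specMap]
  simp

lemma Berk.locVal_abs_algebraMap [IsReduced Z] [IsDominant η] (w : Berk ν f)
    (hη : η ≫ f = Spec.map (CommRingCat.ofHom (algebraMap F L))) (a : F) :
    (w.locVal η).abs (algebraMap F L a) = ν a := by
  have e : ⊤ ≤ η ⁻¹ᵁ f ⁻¹ᵁ ⊤ := fun _ _ => trivial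
  have h : w.pt ∈ f ⁻¹ᵁ ⊤ := trivial
  refine (congr((w.locVal η).abs $((pull_constSec η (algebraMap F L) hη a e).symm))).trans ?_
  refine (Berk.locVal_abs_pull η w h e _).trans ?_
  rw [Berk.abs_eq_val_pull, ← w.val_base a]
  congr 1
  apply pull_constSec
  exact (Spec.map_preimage _).symm

lemma trivialAbs_le_one {k : Type u} [Field k] (a : k) : trivialAbs a ≤ 1 := by
  rw [trivialAbs]; split_ifs <;> simp

/-- On the chart of a coordinate of maximal absolute value all functions are bounded by one. -/
lemma LocVal.MaxAt.abs_le_one {A : Type u} [CommRing A] {L : Type u} [Field L] [Algebra A L]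
    {v : LocVal L} {ι : Type*} {x : ι → L} {j : ι} (hj : v.MaxAt A x j)
    (hA : ∀ a, v.abs (algebraMap A L a) ≤ 1) {g : L} (hg : g ∈ chartRing A x j) :
    v.abs g ≤ 1 := by
  refine Algebra.adjoin_induction (p := fun g _ => v.abs g ≤ 1) ?_ hA ?_ ?_ hg
  · rintro _ ⟨l, rfl⟩; exact hj.le l
  · intro a b ha hb h1 h2
    exact (v.abs_add (hj.mem _ ha) (hj.mem _ hb)).trans (max_le h1 h2)
  · intro a b ha hb h1 h2
    rw [v.abs_mul (hj.mem _ ha) (hj.mem _ hb)]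
    exact mul_le_one' h1 h2

end Base

section LogIdeal

variable {k : Type u} [Field k] {X : Scheme.{u}} {f : X ⟶ Spec (CommRingCat.of k)}

/-- A semivaluation that is centered in two affine open sets is bounded by one on their
intersection. -/
lemma CenteredIn.abs_inf_le_one [X.IsSeparated] {v : TrivAn f} {U V : X.affineOpens}
    (hU : CenteredIn v U) (hV : CenteredIn v V) (h : v.pt ∈ U.1 ⊓ V.1) (s : Γ(X, U.1 ⊓ V.1)) :
    v.abs s h ≤ 1 := by
  obtain ⟨h1, h2⟩ := hU
  obtain ⟨h3, h4⟩ := hV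
  rw [Berk.abs_eq_val_pull]
  refine abs_le_one_inf (L := X.residueField v.pt) v.val (X.fromSpecResidueField v.pt) U.2 V.2
    (top_le_fromSpecResidueField h1) (top_le_fromSpecResidueField h3) ?_ ?_ s
  · intro s; rw [← Berk.abs_eq_val_pull]; exact h2 s
  · intro s; rw [← Berk.abs_eq_val_pull]; exact h4 s

lemma Berk.abs_mul {F : Type u} [Field F] {ν : F → ℝ≥0} {Z : Scheme.{u}}
    {f : Z ⟶ Spec (CommRingCat.of F)} (w : Berk ν f) {U : Z.Opens} (h : w.pt ∈ U) (s t : Γ(Z, U)) :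
    w.abs (s * t) h = w.abs s h * w.abs t h := by simp [Berk.abs]

lemma Berk.abs_le_of_mem_span {F : Type u} [Field F] {ν : F → ℝ≥0} {Z : Scheme.{u}}
    {f : Z ⟶ Spec (CommRingCat.of F)} (w : Berk ν f) {U : Z.Opens} (h : w.pt ∈ U)
    (hU : ∀ s, w.abs s h ≤ 1) (G : Set Γ(Z, U)) (c : ℝ≥0) (hG : ∀ s ∈ G, w.abs s h ≤ c)
    {s : Γ(Z, U)} (hs : s ∈ Ideal.span G) : w.abs s h ≤ c := by
  refine Submodule.span_induction hG ?_ ?_ ?_ hs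
  · simp [Berk.abs]
  · intro a b _ _ ha hb
    simp only [Berk.abs, map_add]
    exact (Valuation.map_add _ _ _).trans (max_le ha hb)
  · intro a b _ hb
    rw [smul_eq_mul, Berk.abs_mul]
    exact (mul_le_of_le_one_left zero_le (hU a)).trans hb

/-- The function `log |𝔟|` may be computed by generators of `𝔟` on one affine open subset
containing the center. -/
lemma logIdeal_eq [X.IsSeparated] (b : X.IdealSheafData) {v : TrivAn f} {V : X.affineOpens}
    (hV : CenteredIn v V) (h : v.pt ∈ V.1) (G : Finset Γ(X, V.1)) (hG : Ideal.span G = b.ideal V) :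
    logIdeal b v = ENNReal.log ((G.sup fun s => v.abs s h : ℝ≥0) : ENNReal) := by
  have hV1 : ∀ s, v.abs s h ≤ 1 := hV.choose_spec
  apply le_antisymm
  · refine iSup_le fun U => iSup_le fun hU => iSup_le fun hU' => iSup_le fun s => iSup_le fun hs =>
      ?_
    apply ENNReal.log_monotone
    rw [ENNReal.coe_le_coe]
    have hUV : v.pt ∈ U.1 ⊓ V.1 := ⟨hU', h⟩
    let W : X.affineOpens := ⟨U.1 ⊓ V.1, U.2.inf V.2⟩
    -- compare the two affine open sets on their intersection, where the ideals of both generate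
    rw [← v.abs_map (homOfLE inf_le_left : U.1 ⊓ V.1 ⟶ U.1).op hUV]
    have h1 : X.presheaf.map (homOfLE inf_le_left : U.1 ⊓ V.1 ⟶ U.1).op s ∈ b.ideal W := by
      have : W ≤ U := inf_le_left (a := U.1) (b := V.1)
      rw [← b.map_ideal this]
      exact Ideal.mem_map_of_mem _ hs
    have hWV : W ≤ V := inf_le_right (a := U.1) (b := V.1)
    rw [← b.map_ideal hWV, ← hG, Ideal.map_span] at h1
    refine v.abs_le_of_mem_span hUV (fun t => hU.abs_inf_le_one hV hUV t) _ _ ?_ h1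
    rintro _ ⟨t, ht, rfl⟩
    refine (v.abs_map (homOfLE inf_le_right : U.1 ⊓ V.1 ⟶ V.1).op hUV t).le.trans ?_
    exact Finset.le_sup (f := fun s => v.abs s h) ht
  · obtain rfl | hne := G.eq_empty_or_nonempty
    · simp
    obtain ⟨s, hs, hs'⟩ := Finset.exists_mem_eq_sup G hne (fun s => v.abs s h)
    rw [hs']
    exact le_iSup_of_le V (le_iSup_of_le hV (le_iSup_of_le h (le_iSup_of_le s
      (le_iSup_of_le (by rw [← hG]; exact Ideal.subset_span hs) le_rfl))))

variable {L : Type u} [Field L] [Algebra k L] {η : Spec (CommRingCat.of L) ⟶ X}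
  (C : ProjCharts k η) [IsReduced X] [IsDominant η]

/-- The chart as an affine open subset. -/
abbrev ProjCharts.affU (j : C.ι) : X.affineOpens := ⟨C.U j, C.affine j⟩

lemma ProjCharts.centeredIn (hη : η ≫ f = Spec.map (CommRingCat.ofHom (algebraMap k L)))
    (v : TrivAn f) {j : C.ι} (hj : (v.locVal η).MaxAt k C.x j) : CenteredIn v (C.affU j) := by
  have key : ∀ s : Γ(X, C.U j), v.abs s (C.mem_U_of_maxAt v hj) ≤ 1 := ?_
  · exact ⟨C.mem_U_of_maxAt v hj, key⟩
  intro s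
  rw [← Berk.locVal_abs_pull η v (C.mem_U_of_maxAt v hj) (C.mem j)]
  refine hj.abs_le_one (fun a => ?_) (C.pull_mem j s)
  rw [Berk.locVal_abs_algebraMap v hη]
  exact trivialAbs_le_one a

end LogIdeal

/-! ### Ideals generated by forms -/

section FormIdeal

variable {X : Scheme.{u}}

/-- The ideal of `Γ(X, U)` of functions whose restriction to `U ⊓ V` is a multiple of `p`. -/
def dvdIdeal {V : X.Opens} (p : Γ(X, V)) (U : X.Opens) : Ideal Γ(X, U) :=
  (Ideal.span {X.presheaf.map (homOfLE (inf_le_right : U ⊓ V ≤ V)).op p}).comap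
    (X.presheaf.map (homOfLE (inf_le_left : U ⊓ V ≤ U)).op).hom

lemma mem_dvdIdeal {V : X.Opens} {p : Γ(X, V)} {U : X.Opens} {s : Γ(X, U)} :
    s ∈ dvdIdeal p U ↔ ∃ c : Γ(X, U ⊓ V), c * X.presheaf.map (homOfLE inf_le_right).op p =
      X.presheaf.map (homOfLE inf_le_left).op s := by
  rw [dvdIdeal, Ideal.mem_comap, Ideal.mem_span_singleton']

lemma map_mem_dvdIdeal {V : X.Opens} {p : Γ(X, V)} {U U' : X.Opens} (i : U' ≤ U) {s : Γ(X, U)}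
    (h : s ∈ dvdIdeal p U) : X.presheaf.map (homOfLE i).op s ∈ dvdIdeal p U' := by
  rw [mem_dvdIdeal] at h ⊢
  obtain ⟨c, hc⟩ := h
  refine ⟨X.presheaf.map (homOfLE (inf_le_inf_right V i)).op c, ?_⟩
  have h1 := congr(X.presheaf.map (homOfLE (inf_le_inf_right V i : U' ⊓ V ≤ U ⊓ V)).op $hc)
  rw [map_mul] at h1
  simp only [← CommRingCat.comp_apply, ← Functor.map_comp, ← op_comp, homOfLE_comp] at h1 ⊢
  exact h1

/-- The ideals `dvdIdeal p U` are compatible with localization: divisibility by `p` over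
`basicOpen h` holds over `U` after multiplication by a power of `h`. -/
lemma exists_mem_dvdIdeal [X.IsSeparated] {U V : X.Opens} (hU : IsAffineOpen U)
    (hV : IsAffineOpen V) (p : Γ(X, V)) (h : Γ(X, U)) (a : Γ(X, U))
    (ha : X.presheaf.map (homOfLE (X.basicOpen_le h)).op a ∈ dvdIdeal p (X.basicOpen h)) :
    ∃ r, h ^ r * a ∈ dvdIdeal p U := by
  have hUV := hU.inf hV
  have i : X.basicOpen h ⊓ V ≤ U ⊓ V := inf_le_inf_right V (X.basicOpen_le h)
  let B := Γ(X, U ⊓ V)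
  let B' := Γ(X, X.basicOpen h ⊓ V)
  let _ : Algebra B B' := (X.presheaf.map (homOfLE i).op).hom.toAlgebra
  have e : X.basicOpen h ⊓ V =
      X.basicOpen (X.presheaf.map (homOfLE (inf_le_left : U ⊓ V ≤ U)).op h) := by
    rw [Scheme.basicOpen_res, inf_right_comm, inf_eq_right.2 (X.basicOpen_le h)]
  have hloc : IsLocalization.Away (R := B)
      (X.presheaf.map (homOfLE (inf_le_left : U ⊓ V ≤ U)).op h) B' :=
    hUV.isLocalization_of_eq_basicOpen _ (homOfLE i) e
  have h1 : algebraMap B B' (X.presheaf.map (homOfLE inf_le_left).op a) ∈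
      (Ideal.span {X.presheaf.map (homOfLE (inf_le_right : U ⊓ V ≤ V)).op p}).map
        (algebraMap B B') := by
    rw [Ideal.map_span, Set.image_singleton]
    have h2 : algebraMap B B' = (X.presheaf.map (homOfLE i).op).hom := rfl
    rw [h2]
    rw [dvdIdeal, Ideal.mem_comap] at ha
    have h3 : (X.presheaf.map (homOfLE i).op).hom (X.presheaf.map (homOfLE inf_le_left).op a) =
        (X.presheaf.map (homOfLE (inf_le_left : X.basicOpen h ⊓ V ≤ _)).op).hom
          (X.presheaf.map (homOfLE (X.basicOpen_le h)).op a) := by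
      simp only [← CommRingCat.comp_apply, ← Functor.map_comp, ← op_comp, homOfLE_comp]
    have h4 : (X.presheaf.map (homOfLE i).op).hom (X.presheaf.map (homOfLE inf_le_right).op p) =
        X.presheaf.map (homOfLE (inf_le_right : X.basicOpen h ⊓ V ≤ _)).op p := by
      simp only [← CommRingCat.comp_apply, ← Functor.map_comp, ← op_comp, homOfLE_comp]
    rw [h3, h4]
    exact ha
  rw [IsLocalization.algebraMap_mem_map_algebraMap_iff (Submonoid.powers
    (X.presheaf.map (homOfLE (inf_le_left : U ⊓ V ≤ U)).op h))] at h1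
  obtain ⟨_, ⟨r, rfl⟩, hr⟩ := h1
  refine ⟨r, ?_⟩
  rw [dvdIdeal, Ideal.mem_comap, map_mul, map_pow]
  exact hr

lemma map_iInf_dvdIdeal [X.IsSeparated] {ι : Type*} [Fintype ι] {V : ι → X.Opens}
    (hV : ∀ j, IsAffineOpen (V j)) (p : ∀ j, Γ(X, V j)) {U : X.Opens} (hU : IsAffineOpen U)
    (h : Γ(X, U)) :
    (⨅ j, dvdIdeal (p j) U).map (X.presheaf.map (homOfLE (X.basicOpen_le h)).op).hom =
      ⨅ j, dvdIdeal (p j) (X.basicOpen h) := by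
  apply le_antisymm
  · rw [Ideal.map_le_iff_le_comap]
    intro s hs
    rw [Ideal.mem_comap, Ideal.mem_iInf]
    rw [Ideal.mem_iInf] at hs
    exact fun j => map_mem_dvdIdeal (X.basicOpen_le h) (hs j)
  · intro s hs
    rw [Ideal.mem_iInf] at hs
    have hloc := hU.isLocalization_basicOpen h
    obtain ⟨n, a, hn⟩ := IsLocalization.Away.surj h s
    have hn' : X.presheaf.map (homOfLE (X.basicOpen_le h)).op a =
      s * X.presheaf.map (homOfLE (X.basicOpen_le h)).op h ^ n := hn.symm
    have key : ∀ j, ∃ r, h ^ r * a ∈ dvdIdeal (p j) U := by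
      intro j
      apply exists_mem_dvdIdeal hU (hV j)
      rw [hn']
      exact Ideal.mul_mem_right _ _ (hs j)
    choose r hr using key
    have h1 : h ^ (Finset.univ.sup r) * a ∈ ⨅ j, dvdIdeal (p j) U := by
      rw [Ideal.mem_iInf]
      intro j
      rw [← Nat.sub_add_cancel (Finset.le_sup (f := r) (Finset.mem_univ j)), pow_add, mul_assoc]
      exact Ideal.mul_mem_left _ _ (hr j)
    have h2 := Ideal.mem_map_of_mem (X.presheaf.map (homOfLE (X.basicOpen_le h)).op).hom h1
    have hu : IsUnit (X.presheaf.map (homOfLE (X.basicOpen_le h)).op h) :=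
      RingedSpace.isUnit_res_basicOpen _ h
    rw [map_mul, map_pow] at h2
    have h2' : X.presheaf.map (homOfLE (X.basicOpen_le h)).op h ^ (Finset.univ.sup r) *
        (s * X.presheaf.map (homOfLE (X.basicOpen_le h)).op h ^ n) ∈
        (⨅ j, dvdIdeal (p j) U).map (X.presheaf.map (homOfLE (X.basicOpen_le h)).op).hom := by
      rw [← hn']; exact h2
    have h3 := (Ideal.unit_mul_mem_iff_mem _ (hu.pow (Finset.univ.sup r))).1 h2'
    rw [mul_comm] at h3
    exact (Ideal.unit_mul_mem_iff_mem _ (hu.pow n)).1 h3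

/-- The ideal sheaf of functions that are multiples of `p j` on `V j`, for finitely many affine
open sets `V j`. -/
def dvdIdealSheaf [X.IsSeparated] {ι : Type*} [Fintype ι] {V : ι → X.Opens}
    (hV : ∀ j, IsAffineOpen (V j)) (p : ∀ j, Γ(X, V j)) : X.IdealSheafData where
  ideal U := ⨅ j, dvdIdeal (p j) U.1
  map_ideal_basicOpen U h := map_iInf_dvdIdeal hV p U.2 h

end FormIdeal

section Forms

variable {k : Type u} [Field k] {X : Scheme.{u}} {f : X ⟶ Spec (CommRingCat.of k)}
  {L : Type u} [Field L] [Algebra k L] {η : Spec (CommRingCat.of L) ⟶ X}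
  (C : ProjCharts k η) [IsReduced X] [IsDominant η]

lemma ProjCharts.nonempty {A : Type u} [CommRing A] [Algebra A L] {Z : Scheme.{u}}
    {η : Spec (CommRingCat.of L) ⟶ Z} (C : ProjCharts A η) : Nonempty C.ι :=
  let ⟨j, _⟩ := C.cover _ specializes_rfl
  ⟨j⟩

variable [X.IsSeparated] (hη : η ≫ f = Spec.map (CommRingCat.ofHom (algebraMap k L)))

include hη in
/-- A nonzero form `P` defines an ideal whose associated function is the norm of `P`. -/
lemma ProjCharts.exists_ideal_of_form {d : ℕ} {P : L} (hP : P ∈ forms k C.x d) (h0 : P ≠ 0) :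
    ∃ b : X.IdealSheafData, b ≠ ⊥ ∧
      ∀ v : TrivAn f, logIdeal b v = ENNReal.log (C.nrm v d P : ENNReal) := by
  choose p hp using fun j => C.exists_pull j (div_mem_chartRing (j := j) hP)
  -- the local equations `P / x j ^ d` differ by the powers `(x j / x m) ^ d`, which are units on the
  -- overlaps; hence each of them generates the ideal on its own chart
  have hb' : ∀ j, (⨅ m, dvdIdeal (p m) (C.U j)) = Ideal.span {p j} := by
    intro j
    apply le_antisymm
    · intro s hs
      rw [Ideal.mem_iInf] at hs
      obtain ⟨c, hc⟩ := mem_dvdIdeal.1 (hs j)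
      have hle : C.U j ≤ C.U j ⊓ C.U j := le_inf le_rfl le_rfl
      rw [Ideal.mem_span_singleton']
      refine ⟨X.presheaf.map (homOfLE hle).op c, pull_injective (C.U j) (C.mem j) ?_⟩
      have := congr(pull η (C.U j ⊓ C.U j) (top_le_preimage_inf (C.mem j) (C.mem j)) $hc)
      rw [map_mul, pull_map, pull_map] at this
      rw [map_mul, pull_map]
      exact this
    · rw [Ideal.span_singleton_le_iff_mem]
      refine Ideal.mem_iInf.2 fun m => ?_
      rw [mem_dvdIdeal]
      refine ⟨X.presheaf.map (homOfLE inf_le_left).op (C.t j m) ^ d,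
        pull_injective (C.U j ⊓ C.U m) (top_le_preimage_inf (C.mem j) (C.mem m)) ?_⟩
      rw [map_mul, map_pow, pull_map, pull_map, pull_map, C.pull_t, hp, hp, div_pow]
      field_simp [C.x_ne]
  have hb : ∀ j, (dvdIdealSheaf C.affine p).ideal (C.affU j) = Ideal.span {p j} := hb'
  obtain ⟨j0⟩ := C.nonempty
  refine ⟨dvdIdealSheaf C.affine p, ?_, fun v => ?_⟩
  · intro h
    have h1 : p j0 ∈ (dvdIdealSheaf C.affine p).ideal (C.affU j0) := by
      rw [hb]; exact Ideal.mem_span_singleton_self _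
    rw [h] at h1
    have h2 : p j0 = 0 := h1
    have h3 := hp j0
    rw [h2, map_zero] at h3
    exact div_ne_zero h0 (pow_ne_zero _ (C.x_ne j0)) h3.symm
  · obtain ⟨j, hj⟩ := C.exists_maxAt' v
    rw [logIdeal_eq (dvdIdealSheaf C.affine p) (C.centeredIn hη v hj) (C.mem_U_of_maxAt v hj) {p j}
      (by rw [hb]; simp), Finset.sup_singleton, ProjCharts.nrm, LocVal.nrm_eq C.x_ne hj hP, ← hp,
      Berk.locVal_abs_pull η v (C.mem_U_of_maxAt v hj)]

omit [X.IsSeparated] in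
lemma ProjCharts.isNoetherianRing (j : C.ι) : IsNoetherianRing Γ(X, C.U j) := by
  have h1 : IsNoetherianRing (chartRing k C.x j) :=
    isNoetherianRing_of_fg (Subalgebra.fg_def.2 ⟨_, Set.finite_range _, rfl⟩)
  let φ : Γ(X, C.U j) →+* chartRing k C.x j :=
    (pull η (C.U j) (C.mem j)).codRestrict _ (C.pull_mem j)
  have hφ : Function.Bijective φ := by
    constructor
    · intro a b hab
      exact pull_injective (C.U j) (C.mem j) congr(($hab).1)
    · rintro ⟨g, hg⟩
      obtain ⟨s, rfl⟩ := C.exists_pull j hg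
      exact ⟨s, rfl⟩
  exact isNoetherianRing_of_ringEquiv _ (RingEquiv.ofBijective φ hφ).symm

omit [IsReduced X] [IsDominant η] [X.IsSeparated] in
/-- A section of an ideal sheaf over one chart, times a large power of the coordinate, gives
sections of the ideal sheaf over all charts. -/
lemma ProjCharts.exists_mul_ratio_pow_mem (b : X.IdealSheafData) (j m : C.ι) {s : Γ(X, C.U j)}
    (hs : s ∈ b.ideal (C.affU j)) :
    ∃ n₀, ∀ n, n₀ ≤ n → ∃ a ∈ b.ideal (C.affU m), pull η (C.U m) (C.mem m) a =
      pull η (C.U j) (C.mem j) s * (C.x j / C.x m) ^ n := by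
  suffices h : ∃ n, ∃ a ∈ b.ideal (C.affU m), pull η (C.U m) (C.mem m) a =
      pull η (C.U j) (C.mem j) s * (C.x j / C.x m) ^ n by
    obtain ⟨n, a, ha, hn⟩ := h
    refine ⟨n, fun r hr => ⟨C.t m j ^ (r - n) * a, Ideal.mul_mem_left _ _ ha, ?_⟩⟩
    have e : (C.x j / C.x m) ^ r = (C.x j / C.x m) ^ (r - n) * (C.x j / C.x m) ^ n := by
      rw [← pow_add, Nat.sub_add_cancel hr]
    exact (map_mul _ _ _).trans (by rw [map_pow, C.pull_t, hn, e]; ring)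
  have e1 : X.basicOpen (C.t m j) ≤ C.U j := by rw [C.basicOpen_t]; exact inf_le_right
  have eη : ⊤ ≤ η ⁻¹ᵁ X.basicOpen (C.t m j) := by
    rw [C.basicOpen_t]; exact le_inf (C.mem m) (C.mem j)
  have h1 : X.presheaf.map (homOfLE e1).op s ∈ b.ideal (X.affineBasicOpen (U := C.affU m)
      (C.t m j)) := by
    have hle : X.affineBasicOpen (U := C.affU m) (C.t m j) ≤ C.affU j := e1
    rw [← b.map_ideal hle]
    exact Ideal.mem_map_of_mem _ hs
  rw [← b.map_ideal_basicOpen] at h1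
  have hloc : IsLocalization.Away (C.t m j) Γ(X, X.basicOpen (C.t m j)) :=
    (C.affine m).isLocalization_basicOpen (C.t m j)
  have h1' : X.presheaf.map (homOfLE e1).op s ∈ Ideal.map
    (algebraMap Γ(X, C.U m) Γ(X, X.basicOpen (C.t m j))) (b.ideal (C.affU m)) := h1
  rw [IsLocalization.mem_map_algebraMap_iff (Submonoid.powers (C.t m j))] at h1'
  obtain ⟨⟨⟨a, ha⟩, ⟨_, n, rfl⟩⟩, h2⟩ := h1'
  refine ⟨n, a, ha, ?_⟩
  have h3 : X.presheaf.map (homOfLE e1).op s * X.presheaf.map (homOfLE (X.basicOpen_le _)).op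
    ((C.t m j) ^ n) = X.presheaf.map (homOfLE (X.basicOpen_le _)).op a := h2
  have h4 := congr(pull η (X.basicOpen (C.t m j)) eη $h3)
  rw [map_mul, pull_map, pull_map, pull_map, map_pow, C.pull_t] at h4
  exact h4.symm

include hη in
/-- The function associated with an ideal is the maximum of the norms of finitely many forms. -/
lemma ProjCharts.exists_forms_of_ideal (b : X.IdealSheafData) :
    ∃ (d : ℕ) (S : Finset L), (∀ P ∈ S, P ∈ forms k C.x d) ∧
      ∀ v : TrivAn f, logIdeal b v = ENNReal.log ((S.sup (C.nrm v d) : ℝ≥0) : ENNReal) := by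
  classical
  have hG : ∀ j, ∃ G : Finset Γ(X, C.U j), Ideal.span G = b.ideal (C.affU j) := by
    intro j
    have := C.isNoetherianRing j
    exact (isNoetherianRing_iff_ideal_fg _).1 this (b.ideal (C.affU j))
  choose G hG using hG
  have hmem : ∀ j, ∀ g ∈ G j, g ∈ b.ideal (C.affU j) := fun j g hg => by
    rw [← hG]; exact Ideal.subset_span hg
  choose! n hn using fun j m g (hg : g ∈ G j) => C.exists_mul_ratio_pow_mem b j m (hmem j g hg)
  choose! q hq using fun j g (_ : g ∈ G j) =>
    exists_mul_pow_mem_forms C.x_ne j (C.pull_mem j g)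
  -- the forms are `g * x j ^ d`, for `g` among the generators over the `j`-th chart; `d` is large
  -- enough for them to be forms, and for `g * (x j / x m) ^ d` to lie in the ideal over every chart
  let d := (Finset.univ.sup fun j => Finset.univ.sup fun m => (G j).sup (n j m)) ⊔
    Finset.univ.sup fun j => (G j).sup (q j)
  have hd1 : ∀ j m, ∀ g ∈ G j, n j m g ≤ d := fun j m g hg =>
    le_trans (le_trans (Finset.le_sup hg) (le_trans
      (Finset.le_sup (f := fun m => (G j).sup (n j m)) (Finset.mem_univ m))
      (Finset.le_sup (f := fun j => Finset.univ.sup fun m => (G j).sup (n j m))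
        (Finset.mem_univ j)))) le_sup_left
  have hd2 : ∀ j, ∀ g ∈ G j, q j g ≤ d := fun j g hg =>
    le_trans (le_trans (Finset.le_sup hg)
      (Finset.le_sup (f := fun j => (G j).sup (q j)) (Finset.mem_univ j))) le_sup_right
  refine ⟨d, Finset.univ.biUnion fun j => (G j).image
    fun g => pull η (C.U j) (C.mem j) g * C.x j ^ d, ?_, ?_⟩
  · intro P hP
    simp only [Finset.mem_biUnion, Finset.mem_image, Finset.mem_univ, true_and] at hP
    obtain ⟨j, g, hg, rfl⟩ := hP
    exact hq j g hg d (hd2 j g hg)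
  · intro v
    obtain ⟨j, hj⟩ := C.exists_maxAt' v
    have hjU := C.mem_U_of_maxAt v hj
    have hcent := C.centeredIn hη v hj
    rw [logIdeal_eq b hcent hjU (G j) (hG j)]
    congr 2
    apply le_antisymm
    · refine Finset.sup_le fun g hg => ?_
      refine le_trans (le_of_eq ?_) (Finset.le_sup (f := C.nrm v d)
        (Finset.mem_biUnion.2 ⟨j, Finset.mem_univ j, Finset.mem_image.2 ⟨g, hg, rfl⟩⟩))
      rw [ProjCharts.nrm, LocVal.nrm_eq C.x_ne hj (hq j g hg d (hd2 j g hg)),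
        mul_div_cancel_right₀ _ (pow_ne_zero _ (C.x_ne j)), Berk.locVal_abs_pull η v hjU]
    · refine Finset.sup_le fun P hP => ?_
      simp only [Finset.mem_biUnion, Finset.mem_image, Finset.mem_univ, true_and] at hP
      obtain ⟨m, g, hg, rfl⟩ := hP
      obtain ⟨a, ha, hag⟩ := hn m j g hg d (hd1 m j g hg)
      rw [ProjCharts.nrm, LocVal.nrm_eq C.x_ne hj (hq m g hg d (hd2 m g hg)), mul_div_assoc,
        ← div_pow, ← hag, Berk.locVal_abs_pull η v hjU]
      refine v.abs_le_of_mem_span hjU hcent.choose_spec (G j) _ (fun s hs => ?_) ?_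
      · exact Finset.le_sup (f := fun s => v.abs s hjU) hs
      · have ha' : a ∈ Ideal.span (G j : Set Γ(X, C.U j)) := by rw [hG j]; exact ha
        exact ha'

end Forms

/-! ### PL functions and maxima of norms of forms -/

section FormMax

variable {k : Type u} [Field k] {X : Scheme.{u}} {f : X ⟶ Spec (CommRingCat.of k)}
  {L : Type u} [Field L] [Algebra k L] {η : Spec (CommRingCat.of L) ⟶ X}
  (C : ProjCharts k η) [IsReduced X] [IsDominant η]

/-- Functions `v ↦ max_a |P_a|(v) e^{-n_a}` for a finite family of forms `P_a` of degree `d` and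
integers `n_a`. -/
def IsFormMax (d : ℕ) (h : TrivAn f → ℝ≥0) : Prop :=
  ∃ S : Finset (L × ℤ), (∀ a ∈ S, a.1 ∈ forms k C.x d) ∧
    ∀ v, h v = S.sup fun a => C.nrm v d a.1 * expNeg a.2

variable {C}

lemma expNeg_ne_zero (n : ℤ) : expNeg n ≠ 0 := (expNeg_pos n).ne'

lemma isFormMax_expNeg (n : ℤ) : IsFormMax (f := f) C 0 fun _ => expNeg n := by
  refine ⟨{(1, n)}, ?_, fun v => ?_⟩
  · intro a ha
    rw [Finset.mem_singleton] at ha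
    subst ha
    have := algebraMap_mem_forms (x := C.x) (1 : k)
    rwa [map_one] at this
  · rw [Finset.sup_singleton, ProjCharts.nrm, LocVal.nrm_one (C.exists_maxAt' v) C.x_ne, one_mul]

/-- The constant one is the maximum of the norms of the coordinates. -/
lemma isFormMax_one_one : IsFormMax (f := f) C 1 fun _ => 1 := by
  classical
  refine ⟨Finset.univ.image fun j => (C.x j, 0), ?_, fun v => ?_⟩
  · intro a ha
    rw [Finset.mem_image] at ha
    obtain ⟨j, -, rfl⟩ := ha
    exact coord_mem_forms j
  · rw [Finset.sup_image]
    obtain ⟨j, hj⟩ := C.exists_maxAt' v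
    apply le_antisymm
    · refine le_trans (le_of_eq ?_) (Finset.le_sup (Finset.mem_univ j))
      simp only [Function.comp, ProjCharts.nrm, LocVal.nrm_coord_eq_one C.x_ne hj, expNeg_zero,
        mul_one]
    · refine Finset.sup_le fun l _ => ?_
      simp only [Function.comp, expNeg_zero, mul_one]
      exact LocVal.nrm_coord_le (C.exists_maxAt' v) C.x_ne l

lemma IsFormMax.mul {d e : ℕ} {h g : TrivAn f → ℝ≥0} (hh : IsFormMax C d h)
    (hg : IsFormMax C e g) : IsFormMax C (d + e) fun v => h v * g v := by
  classical
  obtain ⟨S, hS, hS'⟩ := hh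
  obtain ⟨T, hT, hT'⟩ := hg
  refine ⟨(S ×ˢ T).image fun ab => (ab.1.1 * ab.2.1, ab.1.2 + ab.2.2), ?_, fun v => ?_⟩
  · intro a ha
    rw [Finset.mem_image] at ha
    obtain ⟨⟨a, b⟩, hab, rfl⟩ := ha
    rw [Finset.mem_product] at hab
    exact mul_mem_forms (hS _ hab.1) (hT _ hab.2)
  · beta_reduce
    rw [hS', hT', Finset.sup_image, Finset.sup_product_left, NNReal.finset_sup_mul]
    refine Finset.sup_congr rfl fun a ha => ?_
    rw [NNReal.mul_finset_sup]
    refine Finset.sup_congr rfl fun b hb => ?_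
    simp only [Function.comp, ProjCharts.nrm]
    rw [LocVal.nrm_mul (C.exists_maxAt' v) C.x_ne (hS _ ha) (hT _ hb), expNeg_add]
    ring

lemma IsFormMax.congr {d : ℕ} {h g : TrivAn f → ℝ≥0} (hh : IsFormMax C d h)
    (e : ∀ v, g v = h v) : IsFormMax C d g := by
  rwa [show g = h from funext e]

lemma IsFormMax.pow {d : ℕ} {h : TrivAn f → ℝ≥0} (hh : IsFormMax C d h) (n : ℕ) :
    IsFormMax C (d * n) fun v => h v ^ n := by
  induction n with
  | zero => exact (isFormMax_expNeg 0).congr fun v => by rw [pow_zero, expNeg_zero]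
  | succ n ih => exact (ih.mul hh).congr fun v => pow_succ _ _

/-- The degree can be raised, multiplying all forms by all monomials of the missing degree. -/
lemma IsFormMax.raise {d : ℕ} {h : TrivAn f → ℝ≥0} (hh : IsFormMax C d h) {e : ℕ} (hde : d ≤ e) :
    IsFormMax C e h := by
  have h1 := hh.mul ((isFormMax_one_one (f := f) (C := C)).pow (e - d))
  rw [one_mul, Nat.add_sub_cancel' hde] at h1
  exact h1.congr fun v => by rw [one_pow, mul_one]

lemma IsFormMax.sup {d : ℕ} {h g : TrivAn f → ℝ≥0} (hh : IsFormMax C d h)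
    (hg : IsFormMax C d g) : IsFormMax C d fun v => h v ⊔ g v := by
  classical
  obtain ⟨S, hS, hS'⟩ := hh
  obtain ⟨T, hT, hT'⟩ := hg
  refine ⟨S ∪ T, fun a ha => ?_, fun v => by beta_reduce; rw [hS', hT', Finset.sup_union]⟩
  rcases Finset.mem_union.1 ha with h | h
  exacts [hS a h, hT a h]

lemma IsFormMax.continuous {d : ℕ} {h : TrivAn f → ℝ≥0} (hh : IsFormMax C d h) :
    Continuous h := by
  obtain ⟨S, hS, hS'⟩ := hh
  rw [show h = _ from funext hS']
  exact Continuous.finset_sup_apply fun a ha =>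
    (C.continuous_nrm (hS a ha)).mul continuous_const

variable (C) in
/-- Functions some power of which is a maximum of norms of forms. -/
def IsRootFormMax (h : TrivAn f → ℝ≥0) : Prop :=
  ∃ M : ℕ, 0 < M ∧ ∃ d, IsFormMax C d fun v => h v ^ M

lemma IsFormMax.isRootFormMax {d : ℕ} {h : TrivAn f → ℝ≥0} (hh : IsFormMax C d h) :
    IsRootFormMax C h := ⟨1, one_pos, d, hh.congr fun _ => pow_one _⟩

lemma IsRootFormMax.mul {h g : TrivAn f → ℝ≥0} (hh : IsRootFormMax C h)
    (hg : IsRootFormMax C g) : IsRootFormMax C fun v => h v * g v := by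
  obtain ⟨M, hM, d, hd⟩ := hh
  obtain ⟨N, hN, e, he⟩ := hg
  exact ⟨M * N, mul_pos hM hN, _, ((hd.pow N).mul (he.pow M)).congr fun v => by
    rw [mul_pow, pow_mul, mul_comm M N, pow_mul (g v)]⟩

lemma IsRootFormMax.sup {h g : TrivAn f → ℝ≥0} (hh : IsRootFormMax C h)
    (hg : IsRootFormMax C g) : IsRootFormMax C fun v => h v ⊔ g v := by
  obtain ⟨M, hM, d, hd⟩ := hh
  obtain ⟨N, hN, e, he⟩ := hg
  refine ⟨M * N, mul_pos hM hN, _, (((hd.pow N).raise (le_max_left _ (e * M))).sup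
    ((he.pow M).raise (le_max_right _ _))).congr fun v => ?_⟩
  rw [← pow_mul, ← pow_mul, mul_comm N M]
  exact (pow_left_mono (M * N)).map_max

lemma isRootFormMax_const (q : ℚ) :
    IsRootFormMax (f := f) C fun _ => Real.toNNReal (Real.exp q) := by
  refine ⟨q.den, q.den_pos, 0, (isFormMax_expNeg (-q.num)).congr fun _ => ?_⟩
  rw [← Real.toNNReal_pow (Real.exp_pos _).le, ← Real.exp_nat_mul, expNeg]
  congr 2
  push_cast
  rw [neg_neg, mul_comm]
  exact_mod_cast Rat.mul_den_eq_num q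

lemma IsRootFormMax.rpow {h : TrivAn f → ℝ≥0} (hh : IsRootFormMax C h) {c : ℚ} (hc : 0 ≤ c) :
    IsRootFormMax C fun v => h v ^ (c : ℝ) := by
  obtain ⟨M, hM, d, hd⟩ := hh
  refine ⟨c.den * M, mul_pos c.den_pos hM, _, (hd.pow c.num.toNat).congr fun v => ?_⟩
  have h1 : (h v ^ (c : ℝ)) ^ c.den = h v ^ c.num.toNat := by
    rw [← NNReal.rpow_natCast, ← NNReal.rpow_mul, ← NNReal.rpow_natCast]
    congr 1
    have h2 : (c.num.toNat : ℤ) = c.num := Int.toNat_of_nonneg (Rat.num_nonneg.2 hc)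
    have h3 : ((c.num.toNat : ℕ) : ℝ) = ((c.num : ℤ) : ℝ) := by exact_mod_cast h2
    rw [h3]
    exact_mod_cast Rat.mul_den_eq_num c
  rw [pow_mul, h1, ← pow_mul, ← pow_mul, mul_comm]

lemma isRootFormMax_prod {κ : Type*} (s : Finset κ) (h : κ → TrivAn f → ℝ≥0)
    (hh : ∀ i ∈ s, IsRootFormMax C (h i)) : IsRootFormMax C fun v => ∏ i ∈ s, h i v := by
  classical
  induction s using Finset.induction_on with
  | empty =>
    obtain ⟨M, hM, d, hd⟩ := isRootFormMax_const (f := f) (C := C) 0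
    exact ⟨M, hM, d, hd.congr fun v => by simp⟩
  | insert a s ha ih =>
    obtain ⟨M, hM, d, hd⟩ := (hh a (Finset.mem_insert_self _ _)).mul
      (ih fun i hi => hh i (Finset.mem_insert_of_mem hi))
    exact ⟨M, hM, d, hd.congr fun v => by beta_reduce; rw [Finset.prod_insert ha]⟩

lemma isRootFormMax_sup {κ : Type*} (s : Finset κ) (hs : s.Nonempty) (h : κ → TrivAn f → ℝ≥0)
    (hh : ∀ i ∈ s, IsRootFormMax C (h i)) : IsRootFormMax C fun v => s.sup fun i => h i v := by
  classical
  induction hs using Finset.Nonempty.cons_induction with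
  | singleton a => simpa using hh a (Finset.mem_singleton_self a)
  | cons a s ha hs ih =>
    obtain ⟨M, hM, d, hd⟩ := (hh a (Finset.mem_cons_self _ _)).sup
      (ih fun i hi => hh i (Finset.mem_cons_of_mem hi))
    exact ⟨M, hM, d, hd.congr fun v => by beta_reduce; rw [Finset.sup_cons]⟩

variable [X.IsSeparated] (hη : η ≫ f = Spec.map (CommRingCat.ofHom (algebraMap k L)))

include hη

/-- Positive homogeneous PL functions are logarithms of roots of maxima of norms of forms. -/
lemma exists_isRootFormMax_of_mem_PLhomPlus {ψ : TrivAn f → EReal} (hψ : ψ ∈ PLhomPlus f) :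
    ∃ h, IsRootFormMax C h ∧ ∀ v, ψ v = ENNReal.log (h v : ENNReal) := by
  obtain ⟨r, c, b, hc, -, hψ⟩ := hψ
  choose d S hS hS' using fun i => C.exists_forms_of_ideal hη (b i)
  have hb : ∀ i, IsFormMax (f := f) C (d i) fun v => (S i).sup (C.nrm v (d i)) := by
    classical
    intro i
    refine ⟨(S i).image fun P => (P, 0), fun a ha => ?_, fun v => ?_⟩
    · rw [Finset.mem_image] at ha
      obtain ⟨P, hP, rfl⟩ := ha
      exact hS i P hP
    · rw [Finset.sup_image]
      refine Finset.sup_congr rfl fun P _ => ?_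
      simp [expNeg_zero]
  refine ⟨_, isRootFormMax_prod Finset.univ _ fun i _ => (hb i).isRootFormMax.rpow (hc i),
    fun v => ?_⟩
  rw [hψ, ENNReal.ofNNReal_finsetProd]
  have hlog : ∀ (s : Finset (Fin r)) (g : Fin r → ENNReal),
      ENNReal.log (∏ i ∈ s, g i) = ∑ i ∈ s, ENNReal.log (g i) := by
    intro s g
    induction s using Finset.induction_on with
    | empty => simp
    | insert a s ha ih =>
      rw [Finset.prod_insert ha, Finset.sum_insert ha, ENNReal.log_mul_add, ih]
  rw [hlog]
  refine Finset.sum_congr rfl fun i _ => ?_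
  rw [hS' i v, ENNReal.coe_rpow_of_nonneg _ (by exact_mod_cast hc i), ENNReal.log_rpow]

lemma isRootFormMax_of_mem_PLPlus {φ : C(TrivAn f, ℝ)} (hφ : φ ∈ PLPlus f) :
    IsRootFormMax C fun v => Real.toNNReal (Real.exp (φ v)) := by
  obtain ⟨r, ψ, c, hψ, hφ⟩ := hφ
  choose h hh hh' using fun i => exists_isRootFormMax_of_mem_PLhomPlus (C := C) hη (hψ i)
  have key := isRootFormMax_sup Finset.univ Finset.univ_nonempty _
    fun i _ => (hh i).mul (isRootFormMax_const (c i))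
  obtain ⟨M, hM, d, hd⟩ := key
  refine ⟨M, hM, d, hd.congr fun v => ?_⟩
  congr 1
  rw [← ENNReal.coe_inj, ← ENNReal.log_eq_iff]
  beta_reduce
  rw [ENNReal.coe_finset_sup, Finset.sup_univ_eq_iSup]
  have hr : ∀ q : ℝ, ENNReal.log ((Real.toNNReal (Real.exp q) : ℝ≥0) : ENNReal) = (q : EReal) := by
    intro q
    have := ENNReal.log_ofReal_of_pos (Real.exp_pos q)
    rw [Real.log_exp] at this
    exact this
  rw [hr, hφ]
  have h3 := (ENNReal.logOrderIso.map_iSup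
    fun i => ((h i v * Real.toNNReal (Real.exp (c i)) : ℝ≥0) : ENNReal))
  refine Eq.trans ?_ h3.symm
  refine iSup_congr fun i => ?_
  change _ = ENNReal.log _
  rw [ENNReal.coe_mul, ENNReal.log_mul_add, hh', hr]

lemma mem_PLPlus_of_isFormMax {φ : C(TrivAn f, ℝ)} {M d : ℕ} (hM : 0 < M)
    (h : IsFormMax C d fun v => Real.toNNReal (Real.exp (φ v)) ^ M) : φ ∈ PLPlus f := by
  classical
  obtain ⟨S, hS, hS'⟩ := h
  -- the zero form does not contribute to the maximum, and defines the zero ideal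
  let T := S.filter fun a => a.1 ≠ 0
  have hT : ∀ v, Real.toNNReal (Real.exp (φ v)) ^ M = T.sup fun a => C.nrm v d a.1 * expNeg
      a.2 := by
    intro v
    refine (hS' v).trans ?_
    apply le_antisymm
    · refine Finset.sup_le fun a ha => ?_
      by_cases h0 : a.1 = 0
      · have : C.nrm v d a.1 = 0 := by
          obtain ⟨j, hj⟩ := C.exists_maxAt' v
          rw [h0, ProjCharts.nrm, LocVal.nrm_eq C.x_ne hj (zero_mem _), zero_div, LocVal.abs_zero]
        rw [this, zero_mul]
        exact zero_le
      · exact Finset.le_sup (f := fun a : L × ℤ => C.nrm v d a.1 * expNeg a.2)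
          (Finset.mem_filter.2 ⟨ha, h0⟩)
    · exact Finset.sup_mono (Finset.filter_subset _ _)
  have hpos : ∀ v, 0 < Real.toNNReal (Real.exp (φ v)) ^ M := fun v =>
    pow_pos (Real.toNNReal_pos.2 (Real.exp_pos _)) _
  rcases T.eq_empty_or_nonempty with hT0 | hT0
  · have hempty : IsEmpty (TrivAn f) := ⟨fun v => by
      have := hpos v
      rw [hT, hT0, Finset.sup_empty] at this
      exact absurd this (lt_irrefl _)⟩
    exact ⟨0, fun _ _ => 0, fun _ => 0, fun _ => ⟨0, Fin.elim0, Fin.elim0, fun i => i.elim0,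
      fun i => i.elim0, fun v => (hempty.false v).elim⟩, fun v => (hempty.false v).elim⟩
  choose! b hb hb' using fun (a : L × ℤ) (ha : a ∈ T) =>
    C.exists_ideal_of_form hη (hS a (Finset.mem_filter.1 ha).1) (Finset.mem_filter.1 ha).2
  obtain ⟨r, hr⟩ : ∃ r, T.card = r + 1 := Nat.exists_eq_succ_of_ne_zero (Finset.card_ne_zero.2 hT0)
  let e : Fin (r + 1) ≃ T := (T.equivFinOfCardEq hr).symm
  have hM' : (0 : ℝ) < M := by exact_mod_cast hM
  refine ⟨r, fun i v => (((1 / M : ℚ) : ℝ) : EReal) * logIdeal (b (e i)) v,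
    fun i => (1 / M : ℚ) * -((e i).1.2 : ℚ), fun i => ?_, fun v => ?_⟩
  · refine ⟨1, fun _ => 1 / M, fun _ => b (e i), fun _ => by positivity, fun _ => hb _ (e i).2,
      fun v => by simp⟩
  · have h1 : ENNReal.log ((Real.toNNReal (Real.exp (φ v)) : ℝ≥0) : ENNReal) = (φ v : EReal) := by
      have := ENNReal.log_ofReal_of_pos (Real.exp_pos (φ v))
      rw [Real.log_exp] at this
      exact this
    have h2 : Real.toNNReal (Real.exp (φ v)) =
        (T.sup fun a => C.nrm v d a.1 * expNeg a.2) ^ ((1 / M : ℚ) : ℝ) := by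
      rw [← hT, ← NNReal.rpow_natCast, ← NNReal.rpow_mul]
      push_cast
      rw [mul_one_div_cancel hM'.ne', NNReal.rpow_one]
    have hq : (0 : ℝ) ≤ ((1 / M : ℚ) : ℝ) := by positivity
    rw [← h1, h2, ENNReal.coe_rpow_of_nonneg _ hq]
    have h3 : ((T.sup fun a => C.nrm v d a.1 * expNeg a.2 : ℝ≥0) : ENNReal) =
        ⨆ i, ((C.nrm v d (e i).1.1 * expNeg (e i).1.2 : ℝ≥0) : ENNReal) := by
      rw [ENNReal.coe_finset_sup, Finset.sup_eq_iSup]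
      rw [e.iSup_comp (g := fun a : T => ((C.nrm v d a.1.1 * expNeg a.1.2 : ℝ≥0) : ENNReal)),
        iSup_subtype]
    rw [h3]
    have hmono : Monotone fun y : ENNReal => y ^ ((1 / M : ℚ) : ℝ) :=
        ENNReal.monotone_rpow_of_nonneg hq
    have h4 : (⨆ i, ((C.nrm v d (e i).1.1 * expNeg (e i).1.2 : ℝ≥0) : ENNReal)) ^
        ((1 / M : ℚ) : ℝ) = ⨆ i, ((C.nrm v d (e i).1.1 * expNeg (e i).1.2 : ℝ≥0) : ENNReal) ^
        ((1 / M : ℚ) : ℝ) := by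
      have hq' : (0 : ℝ) < ((1 / M : ℚ) : ℝ) := by positivity
      exact (ENNReal.orderIsoRpow _ hq').map_iSup _
    rw [h4]
    refine (ENNReal.logOrderIso.map_iSup _).trans (iSup_congr fun i => ?_)
    change ENNReal.log _ = _
    beta_reduce
    rw [ENNReal.log_rpow, ENNReal.coe_mul, ENNReal.log_mul_add, hb' _ (e i).2]
    have h5 : ENNReal.log (expNeg (e i).1.2 : ENNReal) = ((-((e i).1.2 : ℝ) : ℝ) : EReal) := by
      have := ENNReal.log_ofReal_of_pos (Real.exp_pos (-((e i).1.2 : ℝ)))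
      rw [Real.log_exp] at this
      exact this
    rw [h5, EReal.left_distrib_of_nonneg_of_ne_top (by exact_mod_cast hq) (EReal.coe_ne_top _)]
    congr 1
    rw [← EReal.coe_mul]
    push_cast
    rfl

/-- Rational PL functions on `X` are, up to a rational factor, differences of logarithms of maxima of
norms of forms. -/
theorem mem_PL_iff (ψ : C(TrivAn f, ℝ)) : ψ ∈ PL f ↔ ∃ (M d : ℕ) (h₁ h₂ : TrivAn f → ℝ≥0), 0 < M ∧
    IsFormMax C d h₁ ∧ IsFormMax C d h₂ ∧ (∀ v, h₁ v ≠ 0) ∧ (∀ v, h₂ v ≠ 0) ∧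
    ∀ v, ψ v = (M : ℝ)⁻¹ * (Real.log (h₁ v) - Real.log (h₂ v)) := by
  constructor
  · rintro ⟨φ₁, hφ₁, φ₂, hφ₂, rfl⟩
    obtain ⟨M, hM, d, hd⟩ := isRootFormMax_of_mem_PLPlus (C := C) hη hφ₁
    obtain ⟨N, hN, e, he⟩ := isRootFormMax_of_mem_PLPlus (C := C) hη hφ₂
    have hpos : ∀ q : ℝ, Real.toNNReal (Real.exp q) ≠ 0 := fun q =>
      (Real.toNNReal_pos.2 (Real.exp_pos q)).ne'
    refine ⟨M * N, max (d * N) (e * M), _, _, mul_pos hM hN, (hd.pow N).raise (le_max_left _ _),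
      (he.pow M).raise (le_max_right _ _), fun v => pow_ne_zero _ (pow_ne_zero _ (hpos _)),
      fun v => pow_ne_zero _ (pow_ne_zero _ (hpos _)), fun v => ?_⟩
    push_cast
    rw [Real.coe_toNNReal _ (Real.exp_pos _).le, Real.coe_toNNReal _ (Real.exp_pos _).le]
    simp only [Real.log_pow, Real.log_exp]
    have hM' : (M : ℝ) ≠ 0 := by exact_mod_cast hM.ne'
    have hN' : (N : ℝ) ≠ 0 := by exact_mod_cast hN.ne'
    rw [Pi.sub_apply]
    field_simp
  · rintro ⟨M, d, h₁, h₂, hM, hh₁, hh₂, hz₁, hz₂, hψ⟩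
    have hM' : (M : ℝ) ≠ 0 := by exact_mod_cast hM.ne'
    have hc : ∀ {h : TrivAn f → ℝ≥0}, IsFormMax C d h → (∀ v, h v ≠ 0) →
        Continuous fun v => (M : ℝ)⁻¹ * Real.log (h v) := fun {h} hh hz =>
      continuous_const.mul ((NNReal.continuous_coe.comp hh.continuous).log
        fun v => NNReal.coe_ne_zero.2 (hz v))
    have hmem : ∀ {h : TrivAn f → ℝ≥0} (hh : IsFormMax C d h) (hz : ∀ v, h v ≠ 0),
        (⟨_, hc hh hz⟩ : C(TrivAn f, ℝ)) ∈ PLPlus f := fun {h} hh hz => by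
      refine mem_PLPlus_of_isFormMax hη (C := C) hM (d := d) (hh.congr fun v => ?_)
      apply NNReal.eq
      have : (0 : ℝ) < h v := NNReal.coe_pos.2 (pos_iff_ne_zero.2 (hz v))
      simp only [ContinuousMap.coe_mk]
      rw [NNReal.coe_pow, Real.coe_toNNReal _ (Real.exp_pos _).le, ← Real.exp_nat_mul,
        mul_inv_cancel_left₀ hM', Real.exp_log this]
    refine ⟨_, hmem hh₁ hz₁, _, hmem hh₂ hz₂, ?_⟩
    ext v
    rw [hψ, mul_sub]
    rfl

end FormMax

/-! ### Base change to Laurent series -/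

section LaurentAlgebra

variable {k : Type u} [Field k] {E : Type u} [Field E] [Algebra k E]

/-- The field `E((ϖ))` as an algebra over `k((ϖ))`. -/
@[reducible] def laurentAlgebra (k E : Type u) [Field k] [Field E] [Algebra k E] :
    Algebra (LaurentSeries k) (LaurentSeries E) := (mapLaurent (algebraMap k E)).toAlgebra

attribute [local instance] laurentAlgebra

lemma algebraMap_laurent (a : LaurentSeries k) :
    algebraMap (LaurentSeries k) (LaurentSeries E) a = mapLaurent (algebraMap k E) a := rfl

lemma C_algebraMap (a : k) : (HahnSeries.C (algebraMap k E a) : LaurentSeries E) =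
    algebraMap (LaurentSeries k) (LaurentSeries E) (HahnSeries.C a) := by
  rw [algebraMap_laurent]
  ext n
  change _ = algebraMap k E ((HahnSeries.C a : LaurentSeries k).coeff n)
  simp only [HahnSeries.C_apply, HahnSeries.coeff_single]
  split_ifs <;> simp

lemma coeff_mapLaurent_mul_C {κ : Type u} [Field κ] (i : k →+* κ) (a : LaurentSeries k) (b : κ)
    (n : ℤ) : (mapLaurent i a * HahnSeries.C b).coeff n = i (a.coeff n) * b := by
  rw [HahnSeries.C_apply, HahnSeries.coeff_mul_single_zero]
  rfl

lemma coeff_sum_mapLaurent_mul_C {κ : Type u} [Field κ] (i : k →+* κ) {ι : Type*} (s : Finset ι)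
    (a : ι → LaurentSeries k) (b : ι → κ) (n : ℤ) :
    (∑ j ∈ s, mapLaurent i (a j) * HahnSeries.C (b j)).coeff n =
      ∑ j ∈ s, i ((a j).coeff n) * b j := by
  rw [HahnSeries.coeff_sum]
  exact Finset.sum_congr rfl fun j _ => coeff_mapLaurent_mul_C i _ _ _

/-- A `k`-basis of `B` is a `K`-basis of the base change `P` of `B` to `K`; only the independence
over `k` and the generation over `K` are recorded. -/
lemma exists_basis_of_isPushout {K : Type u} [CommRing K] {c : k →+* K} {B P : CommRingCat.{u}}
    {b₀ : CommRingCat.of k ⟶ B} {β : B ⟶ P} {γ : CommRingCat.of K ⟶ P}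
    (H : IsPushout b₀ (CommRingCat.ofHom c) β γ) :
    ∃ (ι : Type u) (v : ι → B),
      (∀ (s : Finset ι) (a : ι → k), ∑ i ∈ s, b₀ (a i) * v i = 0 → ∀ i ∈ s, a i = 0) ∧
      ∀ p : P, ∃ (s : Finset ι) (a : ι → K), p = ∑ i ∈ s, γ (a i) * β (v i) := by
  let _ := b₀.hom.toAlgebra
  let _ := c.toAlgebra
  let i := (CommRingCat.isPushout_tensorProduct k K B).isoIsPushout _ _ H.flip
  let e := i.commRingCatIsoToRingEquiv
  have he : ∀ a b, e (a ⊗ₜ[k] b) = γ a * β b := by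
    intro a b
    have h1 : ∀ a : K, i.hom (a ⊗ₜ[k] 1) = γ a := fun a =>
      congr($((CommRingCat.isPushout_tensorProduct k K B).inl_isoIsPushout_hom _ _ H.flip) a)
    have h2 : ∀ b : B, i.hom ((1 : K) ⊗ₜ[k] b) = β b := fun b =>
      congr($((CommRingCat.isPushout_tensorProduct k K B).inr_isoIsPushout_hom _ _ H.flip) b)
    change i.hom (a ⊗ₜ[k] b) = _
    rw [← h1, ← h2, ← map_mul, Algebra.TensorProduct.tmul_mul_tmul, mul_one, one_mul]
  let v := Module.Basis.ofVectorSpace k B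
  let V := Algebra.TensorProduct.basis K v
  refine ⟨_, v, fun s a h => ?_, fun p => ?_⟩
  · refine linearIndependent_iff'.1 v.linearIndependent s a ?_
    rw [← h]
    exact Finset.sum_congr rfl fun j _ => Algebra.smul_def _ _
  · obtain ⟨x, rfl⟩ := e.surjective p
    refine ⟨(V.repr x).support, V.repr x, ?_⟩
    have hx := V.linearCombination_repr x
    rw [Finsupp.linearCombination_apply, Finsupp.sum] at hx
    conv_lhs => rw [← hx]
    rw [map_sum]
    refine Finset.sum_congr rfl fun j _ => ?_
    rw [Algebra.TensorProduct.basis_apply, TensorProduct.smul_tmul', smul_eq_mul, mul_one, he]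

/-- The map from the base change of `B ⊆ E` to `k((ϖ))` into `E((ϖ))` is injective: a relation
between elements of a `k`-basis of `B` vanishes coefficient by coefficient. -/
lemma injective_of_isPushout {B P : CommRingCat.{u}}
    {b₀ : CommRingCat.of k ⟶ B} {β : B ⟶ P} {γ : CommRingCat.of (LaurentSeries k) ⟶ P}
    (H : IsPushout b₀ (CommRingCat.ofHom (HahnSeries.C : k →+* LaurentSeries k)) β γ)
    (ρ : B →+* E) (hρ : Function.Injective ρ) (hρ₀ : ∀ a, ρ (b₀ a) = algebraMap k E a)
    (χ : P →+* LaurentSeries E) (hβ : ∀ b, χ (β b) = HahnSeries.C (ρ b))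
    (hγ : ∀ a, χ (γ a) = mapLaurent (algebraMap k E) a) : Function.Injective χ := by
  obtain ⟨ι, v, hv, hP⟩ := exists_basis_of_isPushout H
  rw [injective_iff_map_eq_zero]
  intro p hp
  obtain ⟨s, a, rfl⟩ := hP p
  have ha : ∀ i ∈ s, a i = 0 := by
    intro i hi
    ext n
    refine hv s (fun j => (a j).coeff n) ?_ i hi
    apply hρ
    rw [map_zero, map_sum]
    have h2 := congr(HahnSeries.coeff $hp n)
    simp only [map_sum, map_mul, hβ, hγ] at h2
    rw [coeff_sum_mapLaurent_mul_C, HahnSeries.coeff_zero] at h2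
    rw [← h2]
    exact Finset.sum_congr rfl fun j _ => by rw [map_mul, hρ₀]
  exact Finset.sum_eq_zero fun i hi => by rw [ha i hi, map_zero, zero_mul]

end LaurentAlgebra

section BaseChangeCharts

attribute [local instance] laurentAlgebra

variable {k : Type u} [Field k] {X : Scheme.{u}} {f : X ⟶ Spec (CommRingCat.of k)}
  {E : Type u} [Field E] [Algebra k E] {η : Spec (CommRingCat.of E) ⟶ X}
  (hη : η ≫ f = Spec.map (CommRingCat.ofHom (algebraMap k E)))

/-- The `E((ϖ))`-valued point of `X_K` induced by an `E`-valued point of `X`. -/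
def laurentPoint : Spec (CommRingCat.of (LaurentSeries E)) ⟶ baseChange f :=
  pullback.lift (Spec.map (CommRingCat.ofHom HahnSeries.C) ≫ η)
    (Spec.map (CommRingCat.ofHom (algebraMap (LaurentSeries k) (LaurentSeries E))))
    (by
      rw [Category.assoc, hη, specLaurent, ← Spec.map_comp, ← Spec.map_comp]
      congr 1
      ext a n
      change (HahnSeries.C (algebraMap k E a) : LaurentSeries E).coeff n =
        algebraMap k E ((HahnSeries.C a : LaurentSeries k).coeff n)
      simp only [HahnSeries.C_apply, HahnSeries.coeff_single]
      split_ifs <;> simp)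

/-- The projection `X_K ⟶ X`. -/
abbrev baseProj (f : X ⟶ Spec (CommRingCat.of k)) : baseChange f ⟶ X :=
  pullback.fst f (specLaurent k)

instance : IsAffineHom (baseProj f) := by
  have : IsAffineHom (specLaurent k) := by
    unfold specLaurent
    infer_instance
  exact isAffineHom_isStableUnderBaseChange.of_isPullback
    (IsPullback.of_hasPullback f (specLaurent k)).flip this

lemma laurentPoint_fst : laurentPoint hη ≫ baseProj f =
    Spec.map (CommRingCat.ofHom HahnSeries.C) ≫ η := pullback.lift_fst _ _ _

lemma laurentPoint_snd : laurentPoint hη ≫ baseChangeStr f =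
    Spec.map (CommRingCat.ofHom (algebraMap (LaurentSeries k) (LaurentSeries E))) :=
  pullback.lift_snd _ _ _

lemma pull_specMap_comp {L M : Type u} [Field L] [Field M] (φ : L →+* M) {Z : Scheme.{u}}
    (η : Spec (CommRingCat.of L) ⟶ Z) {U : Z.Opens} (e : ⊤ ≤ η ⁻¹ᵁ U)
    (e' : ⊤ ≤ (Spec.map (CommRingCat.ofHom φ) ≫ η) ⁻¹ᵁ U) (s : Γ(Z, U)) :
    pull (Spec.map (CommRingCat.ofHom φ) ≫ η) U e' s = φ (pull η U e s) :=
  pull_comp_specMap (CommRingCat.ofHom φ) η U e e' s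

lemma pull_congr {L : Type u} [Field L] {Z : Scheme.{u}} {η η' : Spec (CommRingCat.of L) ⟶ Z}
    (h : η = η') {U : Z.Opens} (e : ⊤ ≤ η ⁻¹ᵁ U) (e' : ⊤ ≤ η' ⁻¹ᵁ U) (s : Γ(Z, U)) :
    pull η U e s = pull η' U e' s := by
  subst h; rfl

lemma top_le_laurentPoint {U : X.Opens} (e : ⊤ ≤ η ⁻¹ᵁ U) :
    ⊤ ≤ laurentPoint hη ⁻¹ᵁ (baseProj f ⁻¹ᵁ U) := by
  rw [← Scheme.Hom.comp_preimage, laurentPoint_fst]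
  exact fun _ _ => e trivial

lemma pull_laurentPoint {U : X.Opens} (e : ⊤ ≤ η ⁻¹ᵁ U) (s : Γ(X, U)) :
    pull (laurentPoint hη) (baseProj f ⁻¹ᵁ U) (top_le_laurentPoint hη e) ((baseProj f).app U s) =
      HahnSeries.C (pull η U e s) := by
  rw [pull_comp]
  refine (pull_congr (laurentPoint_fst hη) _ (fun _ _ => e trivial) s).trans ?_
  exact pull_specMap_comp _ η e _ s

/-- Constants as sections over an arbitrary open set. -/
def constAt {F : Type u} [Field F] {Z : Scheme.{u}} (f : Z ⟶ Spec (CommRingCat.of F))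
    (U : Z.Opens) : F →+* Γ(Z, U) :=
  ((Scheme.ΓSpecIso (CommRingCat.of F)).inv ≫ f.appLE ⊤ U le_top).hom

lemma pull_constAt {F : Type u} [Field F] {Z : Scheme.{u}} {f : Z ⟶ Spec (CommRingCat.of F)}
    {L : Type u} [Field L] (g : Spec (CommRingCat.of L) ⟶ Z) (φ : F →+* L)
    (h : g ≫ f = Spec.map (CommRingCat.ofHom φ)) (U : Z.Opens) (a : F) (e : ⊤ ≤ g ⁻¹ᵁ U) :
    pull g U e (constAt f U a) = φ a := by
  have e' : ⊤ ≤ g ⁻¹ᵁ f ⁻¹ᵁ ⊤ := fun _ _ => trivial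
  rw [← pull_constSec g φ h a e']
  have i : U ≤ f ⁻¹ᵁ ⊤ := fun _ _ => trivial
  exact pull_map e (homOfLE i).op (constSec f a)

variable (f) in
/-- The sections of `X_K` over the preimage of an affine open set `U` are the base change of the
sections over `U`. -/
lemma isPushout_baseChange {U : X.Opens} (hU : IsAffineOpen U) :
    IsPushout (CommRingCat.ofHom (constAt f U))
      (CommRingCat.ofHom (HahnSeries.C : k →+* LaurentSeries k)) ((baseProj f).app U)
      (CommRingCat.ofHom (constAt (baseChangeStr f) (baseProj f ⁻¹ᵁ U))) := by
  have H := IsPullback.of_hasPullback f (specLaurent k)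
  have h1 : (⊤ : (Spec (CommRingCat.of (LaurentSeries k))).Opens) ≤ specLaurent k ⁻¹ᵁ ⊤ :=
    fun _ _ => trivial
  have h2 : U ≤ f ⁻¹ᵁ ⊤ := le_top
  have h3 : baseProj f ⁻¹ᵁ U = baseProj f ⁻¹ᵁ U ⊓ baseChangeStr f ⁻¹ᵁ ⊤ := by
    ext x; simp
  have h4 := (isIso_pushoutSection_iff H h1 h2 h3).1
    (isIso_pushoutSection_of_isAffineOpen H h1 h2 h3 (isAffineOpen_top _) (isAffineOpen_top _) hU)
  refine h4.of_iso (Scheme.ΓSpecIso (CommRingCat.of k)) (Iso.refl _)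
    (Scheme.ΓSpecIso (CommRingCat.of (LaurentSeries k))) (Iso.refl _) ?_ ?_ ?_ ?_
  · exact (Iso.hom_inv_id_assoc _ _).symm
  · have := Scheme.ΓSpecIso_naturality (CommRingCat.ofHom (HahnSeries.C : k →+* LaurentSeries k))
    rw [← this]
    congr 1
  · simp [Scheme.Hom.app_eq_appLE]
  · exact (Iso.hom_inv_id_assoc _ _).symm

lemma pull_laurentPoint_injective [IsReduced X] [IsDominant η] {U : X.Opens} (hU : IsAffineOpen U)
    (e : ⊤ ≤ η ⁻¹ᵁ U) : Function.Injective (pull (laurentPoint hη) (baseProj f ⁻¹ᵁ U)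
      (top_le_laurentPoint hη e)) :=
  injective_of_isPushout (isPushout_baseChange f hU) (pull η U e) (pull_injective U e)
    (fun a => pull_constAt η _ hη U a e) _ (fun b => pull_laurentPoint hη e b)
    (fun a => pull_constAt _ _ (laurentPoint_snd hη) _ a _)

variable (C : ProjCharts k η)

lemma isDominant_laurentPoint [IsReduced X] [IsDominant η] (C : ProjCharts k η) :
    IsDominant (laurentPoint hη) := by
  refine ⟨?_⟩
  rw [DenseRange, dense_iff_inter_open]
  rintro V hV ⟨y, hy⟩
  obtain ⟨j, hj⟩ := C.cover (baseProj f y) (ptOf_specializes _)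
  have haff : IsAffineOpen (baseProj f ⁻¹ᵁ C.U j) := (C.affine j).preimage _
  obtain ⟨s, hs, hys⟩ := haff.exists_basicOpen_le (V := ⟨V, hV⟩) ⟨y, hy⟩ hj
  have h0 : s ≠ 0 := by
    rintro rfl
    rw [Scheme.basicOpen_zero] at hys
    exact hys
  have h1 : pull (laurentPoint hη) _ (top_le_laurentPoint hη (C.mem j)) s ≠ 0 := by
    rw [← map_zero (pull (laurentPoint hη) _ (top_le_laurentPoint hη (C.mem j)))]
    exact (pull_laurentPoint_injective hη (C.affine j) (C.mem j)).ne h0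
  rw [← mem_basicOpen_iff_pull_ne_zero] at h1
  exact ⟨_, hs h1, _, rfl⟩

lemma C_mem_chartRing {j : C.ι} {g : E} (hg : g ∈ chartRing k C.x j) :
    (HahnSeries.C g : LaurentSeries E) ∈
      chartRing (LaurentSeries k) (fun l => (HahnSeries.C (C.x l) : LaurentSeries E)) j := by
  refine Algebra.adjoin_induction (p := fun g _ => (HahnSeries.C g : LaurentSeries E) ∈
      chartRing (LaurentSeries k) (fun l => (HahnSeries.C (C.x l) : LaurentSeries E)) j)
      ?_ ?_ ?_ ?_ hg
  · rintro _ ⟨l, rfl⟩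
    change HahnSeries.C (C.x l / C.x j) ∈ _
    rw [map_div₀]
    exact ratio_mem_chartRing j l
  · intro a
    rw [C_algebraMap]
    exact Subalgebra.algebraMap_mem _ _
  · intro a b _ _ ha hb; rw [map_add]; exact add_mem ha hb
  · intro a b _ _ ha hb; rw [map_mul]; exact mul_mem ha hb

lemma exists_eq_sum_baseChange {U : X.Opens} (hU : IsAffineOpen U)
    (s : Γ(baseChange f, baseProj f ⁻¹ᵁ U)) :
    ∃ (ι : Type u) (I : Finset ι) (a : ι → LaurentSeries k) (b : ι → Γ(X, U)),
      s = ∑ i ∈ I, constAt (baseChangeStr f) _ (a i) * (baseProj f).app U (b i) := by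
  obtain ⟨ι, v, -, h⟩ := exists_basis_of_isPushout (isPushout_baseChange f hU)
  obtain ⟨I, a, ha⟩ := h s
  exact ⟨ι, I, a, v, ha⟩

/-- The charts of `X_K` obtained by base change from charts of `X`. -/
def ProjCharts.baseChange : ProjCharts (LaurentSeries k) (laurentPoint hη) where
  ι := C.ι
  x l := HahnSeries.C (C.x l)
  x_ne l := by
    rw [← map_zero HahnSeries.C]
    exact HahnSeries.C_injective.ne (C.x_ne l)
  U j := baseProj f ⁻¹ᵁ C.U j
  affine j := (C.affine j).preimage _
  mem j := top_le_laurentPoint hη (C.mem j)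
  cover z hz := by
    refine C.cover (baseProj f z) ?_
    have h1 := hz.map (baseProj f).continuous
    have h2 : baseProj f (ptOf (laurentPoint hη)) = ptOf η := by
      have h3 : baseProj f (ptOf (laurentPoint hη)) =
          (laurentPoint hη ≫ baseProj f) (IsLocalRing.closedPoint (LaurentSeries E)) := rfl
      rw [h3, laurentPoint_fst]
      change η _ = η _
      congr 1
      exact Subsingleton.elim (α := PrimeSpectrum E) _ _
    rwa [h2] at h1
  t j l := (baseProj f).app (C.U j) (C.t j l)
  pull_t j l := by
    rw [pull_laurentPoint hη (C.mem j), C.pull_t, map_div₀]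
  basicOpen_t j l := by
    rw [← Scheme.preimage_basicOpen, C.basicOpen_t]; rfl
  range_pull j := by
    ext g
    constructor
    · rintro ⟨s, rfl⟩
      obtain ⟨ι, I, a, b, rfl⟩ := exists_eq_sum_baseChange (C.affine j) s
      rw [map_sum]
      refine Subring.sum_mem _ fun i _ => ?_
      rw [map_mul, pull_laurentPoint hη (C.mem j),
        pull_constAt _ _ (laurentPoint_snd hη)]
      exact mul_mem (Subalgebra.algebraMap_mem _ _) (C_mem_chartRing C (C.pull_mem j _))
    · intro hg
      have hsub : Algebra.adjoin (LaurentSeries k) (Set.range fun l =>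
          (HahnSeries.C (C.x l) : LaurentSeries E) / HahnSeries.C (C.x j)) ≤
          ({ __ := (pull (laurentPoint hη) (baseProj f ⁻¹ᵁ C.U j)
              (top_le_laurentPoint hη (C.mem j))).range
             algebraMap_mem' := fun a => ⟨constAt (baseChangeStr f) _ a,
               pull_constAt _ _ (laurentPoint_snd hη) _ _ _⟩ } :
            Subalgebra (LaurentSeries k) (LaurentSeries E)) := by
        refine Algebra.adjoin_le ?_
        rintro _ ⟨l, rfl⟩
        exact ⟨(baseProj f).app (C.U j) (C.t j l), by
          rw [pull_laurentPoint hη (C.mem j), C.pull_t, map_div₀]⟩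
      exact hsub hg

end BaseChangeCharts

/-! ### The Gauss extension in terms of coefficients -/

section GaussFormula

attribute [local instance] laurentAlgebra

variable {k : Type u} [Field k] {X : Scheme.{u}} {f : X ⟶ Spec (CommRingCat.of k)}

lemma gaussPoint_fst (v : TrivAn f) : gaussPoint v ≫ baseProj f =
    Spec.map (CommRingCat.ofHom (coeffToGauss v.val)) ≫ X.fromSpecResidueField v.pt :=
  pullback.lift_fst _ _ _

lemma gaussPoint_snd (v : TrivAn f) : gaussPoint v ≫ baseChangeStr f =
    Spec.map (CommRingCat.ofHom (laurentToGauss v.val_base)) := pullback.lift_snd _ _ _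

lemma top_le_gaussPoint {v : TrivAn f} {U : X.Opens} (h : v.pt ∈ U) :
    ⊤ ≤ gaussPoint v ⁻¹ᵁ (baseProj f ⁻¹ᵁ U) := by
  rw [← Scheme.Hom.comp_preimage, gaussPoint_fst]
  exact fun _ _ => top_le_fromSpecResidueField h trivial

lemma gaussExt_pt_mem_iff {v : TrivAn f} {U : X.Opens} :
    (gaussExt v).pt ∈ baseProj f ⁻¹ᵁ U ↔ v.pt ∈ U := by
  have h : baseProj f (gaussExt v).pt = v.pt := by
    have h3 : ∀ y : Spec (CommRingCat.of (GaussField v.val)),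
        baseProj f (gaussPoint v y) = v.pt := by
      intro y
      rw [← Scheme.Hom.comp_apply, gaussPoint_fst, Scheme.Hom.comp_apply]
      generalize (Spec.map (CommRingCat.ofHom (coeffToGauss v.val))) y = z
      exact Scheme.fromSpecResidueField_apply v.pt z
    exact h3 _
  change baseProj f (gaussExt v).pt ∈ U ↔ _
  rw [h]

variable {E : Type u} [Field E] [Algebra k E] {η : Spec (CommRingCat.of E) ⟶ X}
  (hη : η ≫ f = Spec.map (CommRingCat.ofHom (algebraMap k E)))

/-- The Gauss extension of `v` is computed on an affine open subset of `X` by the coefficients in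
the expansion with respect to the uniformizer. -/
lemma exists_coeff_gaussExt {U : X.Opens} (hU : IsAffineOpen U) (e : ⊤ ≤ η ⁻¹ᵁ U)
    (s : Γ(baseChange f, baseProj f ⁻¹ᵁ U)) :
    ∃ t : ℤ → Γ(X, U),
      (∀ n, pull η U e (t n) =
        (pull (laurentPoint hη) (baseProj f ⁻¹ᵁ U) (top_le_laurentPoint hη e) s).coeff n) ∧
      ∀ (v : TrivAn f) (h : v.pt ∈ U),
        (∀ n, v.abs (t n) h * expNeg n ≤ (gaussExt v).abs s (gaussExt_pt_mem_iff.2 h)) ∧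
        ∀ c, (∀ n, v.abs (t n) h * expNeg n ≤ c) →
          (gaussExt v).abs s (gaussExt_pt_mem_iff.2 h) ≤ c := by
  obtain ⟨ι, I, a, b, rfl⟩ := exists_eq_sum_baseChange hU s
  refine ⟨fun n => ∑ i ∈ I, constAt f U ((a i).coeff n) * b i, fun n => ?_, fun v h => ?_⟩
  · rw [map_sum, map_sum]
    have h1 : ∀ i, pull (laurentPoint hη) (baseProj f ⁻¹ᵁ U) (top_le_laurentPoint hη e)
        (constAt (baseChangeStr f) _ (a i) * (baseProj f).app U (b i)) =
        mapLaurent (algebraMap k E) (a i) * HahnSeries.C (pull η U e (b i)) := by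
      intro i
      rw [map_mul, pull_laurentPoint hη e, pull_constAt _ _ (laurentPoint_snd hη)]
      rfl
    rw [Finset.sum_congr rfl fun i _ => h1 i, coeff_sum_mapLaurent_mul_C]
    exact Finset.sum_congr rfl fun i _ => by rw [map_mul, pull_constAt _ _ hη]
  · let ρ := pull (L := X.residueField v.pt) (X.fromSpecResidueField v.pt) U
      (top_le_fromSpecResidueField h)
    let P : LaurentSeries (X.residueField v.pt) :=
      ∑ i ∈ I, mapLaurent (toResidueField f v.pt) (a i) * HahnSeries.C (ρ (b i))
    have hP : P ∈ boundedLaurent v.val := sum_mem fun i _ =>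
      mul_mem (mapLaurent_mem v.val_base _) (C_mem_boundedLaurent _)
    have hcoeff : ∀ n, v.val (P.coeff n) =
        v.abs (∑ i ∈ I, constAt f U ((a i).coeff n) * b i) h := by
      intro n
      rw [Berk.abs_eq_val_pull, coeff_sum_mapLaurent_mul_C]
      congr 1
      rw [map_sum]
      refine Finset.sum_congr rfl fun i _ => ?_
      rw [map_mul]
      congr 1
      exact (pull_constAt _ _ (Spec.map_preimage _).symm U _ _).symm
    have hnorm : (gaussExt v).abs
        (∑ i ∈ I, constAt (baseChangeStr f) _ (a i) * (baseProj f).app U (b i))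
        (gaussExt_pt_mem_iff.2 h) = gaussNorm v.val P := by
      refine (Berk.abs_ofSpec _ _ _ _ _ (top_le_gaussPoint h)).trans ?_
      have h2 : pull (gaussPoint v) (baseProj f ⁻¹ᵁ U) (top_le_gaussPoint h)
          (∑ i ∈ I, constAt (baseChangeStr f) _ (a i) * (baseProj f).app U (b i)) =
          algebraMap (boundedLaurent v.val) (GaussField v.val) ⟨P, hP⟩ := by
        have h3 : (⟨P, hP⟩ : boundedLaurent v.val) = ∑ i ∈ I,
            (⟨mapLaurent (toResidueField f v.pt) (a i), mapLaurent_mem v.val_base _⟩ *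
              ⟨HahnSeries.C (ρ (b i)), C_mem_boundedLaurent _⟩ : boundedLaurent v.val) := by
          apply Subtype.ext
          rw [AddSubmonoidClass.coe_finsetSum]
          rfl
        rw [h3, map_sum, map_sum]
        refine Finset.sum_congr rfl fun i _ => ?_
        rw [map_mul, map_mul, pull_constAt _ _ (gaussPoint_snd v), pull_comp]
        congr 1
        refine (pull_congr (gaussPoint_fst v) _
          (fun _ _ => top_le_fromSpecResidueField h trivial) _).trans ?_
        exact pull_specMap_comp _ _ (top_le_fromSpecResidueField h) _ _
      rw [h2]
      exact Valuation.extendToLocalization_apply_map_apply _ (nonZeroDivisors_le _) _ _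
    rw [hnorm]
    refine ⟨fun n => ?_, fun c hc => ?_⟩
    · rw [← hcoeff]; exact le_gaussNorm hP n
    · refine gaussNorm_le fun n => ?_
      rw [hcoeff]; exact hc n

end GaussFormula

section CoeffForms

attribute [local instance] laurentAlgebra

variable {k : Type u} [Field k] {E : Type u} [Field E] [Algebra k E] {ι : Type*} {x : ι → E}

/-- The coefficients of a form over `K` are forms over `k`. -/
lemma coeff_mem_forms {d : ℕ} {P : LaurentSeries E}
    (hP : P ∈ forms (LaurentSeries k) (fun l => (HahnSeries.C (x l) : LaurentSeries E)) d) (n : ℤ) :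
    P.coeff n ∈ forms k x d := by
  induction d generalizing P n with
  | zero =>
    rw [forms, pow_zero] at hP
    obtain ⟨a, rfl⟩ := Submodule.mem_one.1 hP
    exact algebraMap_mem_forms (x := x) (a.coeff n)
  | succ d ih =>
    have hP' : P ∈ forms (LaurentSeries k) (fun l => (HahnSeries.C (x l) : LaurentSeries E)) d *
        Submodule.span (LaurentSeries k) (Set.range fun l =>
          (HahnSeries.C (x l) : LaurentSeries E)) := by
      rw [forms, ← pow_succ]; exact hP
    refine Submodule.mul_induction_on hP' ?_ ?_
    · intro Q hQ y hy
      refine Submodule.span_induction (p := fun y _ => ∀ Q ∈ forms (LaurentSeries k)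
        (fun l => (HahnSeries.C (x l) : LaurentSeries E)) d, (Q * y).coeff n ∈ forms k x (d + 1))
        ?_ ?_ ?_ ?_ hy Q hQ
      · rintro _ ⟨l, rfl⟩ Q hQ
        beta_reduce
        rw [HahnSeries.C_apply, HahnSeries.coeff_mul_single_zero]
        exact mul_mem_forms (ih hQ n) (coord_mem_forms l)
      · intro Q _
        rw [mul_zero]; exact zero_mem _
      · intro a b _ _ ha hb Q hQ
        rw [mul_add, HahnSeries.coeff_add]
        exact add_mem (ha Q hQ) (hb Q hQ)
      · intro c a _ ha Q hQ
        rw [mul_smul_comm, ← smul_mul_assoc]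
        exact ha _ (Submodule.smul_mem _ c hQ)
    · intro a b ha hb
      rw [HahnSeries.coeff_add]; exact add_mem ha hb

end CoeffForms

section GaussNorms

attribute [local instance] laurentAlgebra

variable {k : Type u} [Field k] {X : Scheme.{u}} {f : X ⟶ Spec (CommRingCat.of k)}
  {E : Type u} [Field E] [Algebra k E] {η : Spec (CommRingCat.of E) ⟶ X}
  (hη : η ≫ f = Spec.map (CommRingCat.ofHom (algebraMap k E))) (C : ProjCharts k η)
  [IsReduced X] [IsDominant η]

include hη in
lemma ProjCharts.nrm_le_one (v : TrivAn f) {d : ℕ} {P : E} (hP : P ∈ forms k C.x d) :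
    C.nrm v d P ≤ 1 := by
  obtain ⟨j, hj⟩ := C.exists_maxAt' v
  rw [ProjCharts.nrm, LocVal.nrm_eq C.x_ne hj hP]
  refine hj.abs_le_one (fun a => ?_) (div_mem_chartRing j hP)
  rw [Berk.locVal_abs_algebraMap v hη]
  exact trivialAbs_le_one a

variable [IsReduced (baseChange f)] [IsDominant (laurentPoint hη)]

/-- On a chart the value of the Gauss extension at `g` is the supremum of the terms
`|g_n| e^{-n}`, expressed by its two defining inequalities. -/
lemma gaussExt_locVal_abs (v : TrivAn f) {j : C.ι} (hj : v.pt ∈ C.U j) {g : LaurentSeries E}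
    (hg : g ∈ chartRing (LaurentSeries k) (C.baseChange hη).x j) :
    (∀ n, (v.locVal η).abs (g.coeff n) * expNeg n ≤
      ((gaussExt v).locVal (laurentPoint hη)).abs g) ∧
    ∀ c, (∀ n, (v.locVal η).abs (g.coeff n) * expNeg n ≤ c) →
      ((gaussExt v).locVal (laurentPoint hη)).abs g ≤ c := by
  obtain ⟨s, rfl⟩ := (C.baseChange hη).exists_pull j hg
  obtain ⟨t, ht, h⟩ := exists_coeff_gaussExt hη (C.affine j) (C.mem j) s
  have h1 : ((gaussExt v).locVal (laurentPoint hη)).abs (pull (laurentPoint hη)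
      ((C.baseChange hη).U j) ((C.baseChange hη).mem j) s) =
      (gaussExt v).abs s (gaussExt_pt_mem_iff.2 hj) :=
    Berk.locVal_abs_pull (laurentPoint hη) _ (gaussExt_pt_mem_iff.2 hj) _ s
  have h2 : ∀ n, (v.locVal η).abs ((pull (laurentPoint hη)
      ((C.baseChange hη).U j) ((C.baseChange hη).mem j) s).coeff n) = v.abs (t n) hj := by
    intro n
    refine (congr((v.locVal η).abs $(ht n)).symm).trans ?_
    exact Berk.locVal_abs_pull η v hj _ _
  simp only [h1, h2]
  exact h v hj

/-- The Gauss extension of `v` has the same maximal coordinate as `v`. -/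
lemma maxAt_gaussExt (v : TrivAn f) {j : C.ι} (hj : (v.locVal η).MaxAt k C.x j) :
    ((gaussExt v).locVal (laurentPoint hη)).MaxAt (LaurentSeries k) (C.baseChange hη).x j := by
  have hjU := C.mem_U_of_maxAt v hj
  refine ⟨fun g hg => (C.baseChange hη).mem_O _ (gaussExt_pt_mem_iff.2 hjU) hg, fun l => ?_⟩
  refine (gaussExt_locVal_abs hη C v hjU (ratio_mem_chartRing j l)).2 _ fun n => ?_
  have e : (C.baseChange hη).x l / (C.baseChange hη).x j = HahnSeries.C (C.x l / C.x j) :=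
    (map_div₀ _ _ _).symm
  rw [e, HahnSeries.C_apply, HahnSeries.coeff_single]
  split_ifs with h
  · rw [h, expNeg_zero, mul_one]; exact hj.le l
  · rw [LocVal.abs_zero, zero_mul]; exact zero_le

/-- The norm of a form over `K` at the Gauss extension of `v` is the Gauss norm of the sequence of
the norms of its coefficients at `v`. -/
lemma nrm_gaussExt (v : TrivAn f) {d : ℕ} {P : LaurentSeries E}
    (hP : P ∈ forms (LaurentSeries k) (C.baseChange hη).x d) :
    (∀ n, C.nrm v d (P.coeff n) * expNeg n ≤ (C.baseChange hη).nrm (gaussExt v) d P) ∧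
    ∀ c, (∀ n, C.nrm v d (P.coeff n) * expNeg n ≤ c) →
      (C.baseChange hη).nrm (gaussExt v) d P ≤ c := by
  obtain ⟨j, hj⟩ := C.exists_maxAt' v
  have e : ∀ n, (P / (C.baseChange hη).x j ^ d).coeff n = P.coeff n / C.x j ^ d := by
    intro n
    have h1 : P / (C.baseChange hη).x j ^ d = P * HahnSeries.C ((C.x j ^ d)⁻¹) := by
      rw [div_eq_mul_inv, map_inv₀, map_pow]; rfl
    rw [h1, HahnSeries.C_apply, HahnSeries.coeff_mul_single_zero, div_eq_mul_inv]
  have h1 := gaussExt_locVal_abs hη C v (C.mem_U_of_maxAt v hj) (div_mem_chartRing j hP)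
  have h2 : (C.baseChange hη).nrm (gaussExt v) d P =
      ((gaussExt v).locVal (laurentPoint hη)).abs (P / (C.baseChange hη).x j ^ d) :=
    LocVal.nrm_eq (C.baseChange hη).x_ne (maxAt_gaussExt hη C v hj) hP
  have h3 : ∀ n, C.nrm v d (P.coeff n) = (v.locVal η).abs (P.coeff n / C.x j ^ d) := fun n =>
    LocVal.nrm_eq C.x_ne hj (coeff_mem_forms hP n)
  simp only [h2, h3, ← e]
  exact h1

/-- A maximum of norms of forms over `K` that is bounded from below involves only finitely many
coefficients of the forms. -/
lemma isFormMax_gaussExt {d : ℕ} (S : Finset (LaurentSeries E))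
    (hS : ∀ P ∈ S, P ∈ forms (LaurentSeries k) (C.baseChange hη).x d) {δ : ℝ≥0} (hδ : 0 < δ)
    (h : ∀ v : TrivAn f, δ ≤ S.sup ((C.baseChange hη).nrm (gaussExt v) d)) :
    IsFormMax C d fun v : TrivAn f => S.sup ((C.baseChange hη).nrm (gaussExt v) d) := by
  classical
  -- the norms of the coefficients are at most one, so those of index larger than `N` contribute less
  -- than `δ`; those of index smaller than all orders vanish
  obtain ⟨N, hN⟩ := exists_mul_expNeg_lt 1 hδ
  obtain ⟨N', hN'⟩ : ∃ N' : ℤ, ∀ P ∈ S, N' ≤ P.order := by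
    obtain ⟨N', hN'⟩ := (S.image HahnSeries.order).bddBelow
    exact ⟨N', fun P hP => hN' (Finset.mem_coe.2 (Finset.mem_image_of_mem _ hP))⟩
  refine ⟨(S ×ˢ Finset.Icc N' N).image fun a => (a.1.coeff a.2, a.2), fun a ha => ?_, fun v => ?_⟩
  · rw [Finset.mem_image] at ha
    obtain ⟨b, hb, rfl⟩ := ha
    exact coeff_mem_forms (hS _ (Finset.mem_product.1 hb).1) _
  · rw [Finset.sup_image]
    apply le_antisymm
    · by_contra! hlt
      have key : ∀ P ∈ S, (C.baseChange hη).nrm (gaussExt v) d P ≤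
          max (((S ×ˢ Finset.Icc N' N).sup ((fun a : E × ℤ => C.nrm v d a.1 * expNeg a.2) ∘
            fun a : LaurentSeries E × ℤ => (a.1.coeff a.2, a.2)))) (expNeg N) := by
        intro P hP
        refine (nrm_gaussExt hη C v (hS P hP)).2 _ fun n => ?_
        by_cases hn : n < N'
        · rw [HahnSeries.coeff_eq_zero_of_lt_order (hn.trans_le (hN' P hP))]
          have h0 : C.nrm v d 0 = 0 := by
            obtain ⟨j, hj⟩ := C.exists_maxAt' v
            rw [ProjCharts.nrm, LocVal.nrm_eq C.x_ne hj (zero_mem _), zero_div, LocVal.abs_zero]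
          rw [h0, zero_mul]; exact zero_le
        by_cases hn' : n ≤ N
        · refine le_max_of_le_left ?_
          exact Finset.le_sup (f := (fun a : E × ℤ => C.nrm v d a.1 * expNeg a.2) ∘
            fun a : LaurentSeries E × ℤ => (a.1.coeff a.2, a.2)) (b := (P, n))
            (Finset.mem_product.2 ⟨hP, Finset.mem_Icc.2 ⟨not_lt.1 hn, hn'⟩⟩)
        · refine le_max_of_le_right ?_
          refine (mul_le_of_le_one_left zero_le
            (C.nrm_le_one hη v (coeff_mem_forms (hS P hP) n))).trans ?_
          exact expNeg_anti (not_le.1 hn').le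
      have h1 := Finset.sup_le key
      have h2 := hN N le_rfl
      rw [one_mul] at h2
      exact absurd h1 (not_le.2 (max_lt hlt (h2.trans_le (h v))))
    · refine Finset.sup_le fun a ha => ?_
      have ha' := (Finset.mem_product.1 ha).1
      exact ((nrm_gaussExt hη C v (hS _ ha')).1 a.2).trans (Finset.le_sup ha')

end GaussNorms

/-! ### Refining open covers by nonvanishing loci of forms -/

section Sections

variable {L : Type u} [Field L] {Z : Scheme.{u}} (η : Spec (CommRingCat.of L) ⟶ Z)

/-- `g ∈ L` is the image of a section over `U`. -/
def IsSec (U : Z.Opens) (g : L) : Prop := ∃ (e : ⊤ ≤ η ⁻¹ᵁ U) (s : Γ(Z, U)), pull η U e s = g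

variable {η}

lemma isSec_pull {U : Z.Opens} (e : ⊤ ≤ η ⁻¹ᵁ U) (s : Γ(Z, U)) : IsSec η U (pull η U e s) :=
  ⟨e, s, rfl⟩

lemma IsSec.mono {U V : Z.Opens} {g : L} (h : IsSec η U g) (i : V ≤ U) (e : ⊤ ≤ η ⁻¹ᵁ V) :
    IsSec η V g := by
  obtain ⟨e', s, rfl⟩ := h
  exact ⟨e, Z.presheaf.map (homOfLE i).op s, pull_map _ _ _⟩

lemma IsSec.mul {U : Z.Opens} {g h : L} (hg : IsSec η U g) (hh : IsSec η U h) :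
    IsSec η U (g * h) := by
  obtain ⟨e, s, rfl⟩ := hg
  obtain ⟨_, t, rfl⟩ := hh
  exact ⟨e, s * t, map_mul _ _ _⟩

lemma IsSec.pow {U : Z.Opens} {g : L} (hg : IsSec η U g) (n : ℕ) : IsSec η U (g ^ n) := by
  obtain ⟨e, s, rfl⟩ := hg
  exact ⟨e, s ^ n, map_pow _ _ _⟩

lemma IsSec.mem_locRing {U : Z.Opens} {g : L} (hg : IsSec η U g) {z : Z} (hz : z ∈ U) :
    g ∈ locRing η z := by
  obtain ⟨e, s, rfl⟩ := hg
  exact pull_mem_locRing hz e s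

lemma IsSec.of_comp {Y : Scheme.{u}} {η' : Spec (CommRingCat.of L) ⟶ Y} {g : Y ⟶ Z} {U : Z.Opens}
    {a : L} (h : IsSec (η' ≫ g) U a) : IsSec η' (g ⁻¹ᵁ U) a := by
  obtain ⟨e, s, rfl⟩ := h
  exact ⟨e, g.app U s, pull_comp g U e s⟩

/-- A section is invertible over the open set where it does not vanish. -/
lemma isSec_inv_pull {U : Z.Opens} (e : ⊤ ≤ η ⁻¹ᵁ U) (s : Γ(Z, U))
    (e' : ⊤ ≤ η ⁻¹ᵁ Z.basicOpen s) : IsSec η (Z.basicOpen s) (pull η U e s)⁻¹ := by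
  have hu : IsUnit (Z.presheaf.map (homOfLE (Z.basicOpen_le s)).op s) :=
    RingedSpace.isUnit_res_basicOpen _ s
  obtain ⟨t, ht⟩ := hu.exists_right_inv
  refine ⟨e', t, ?_⟩
  have := congr(pull η _ e' $ht)
  rw [map_mul, map_one, pull_map] at this
  exact eq_inv_of_mul_eq_one_right this

/-- A section over a basic open set of an affine open set extends after multiplication by a power
of the equation. -/
lemma IsSec.exists_pow_mul {U : Z.Opens} (hU : IsAffineOpen U) (e : ⊤ ≤ η ⁻¹ᵁ U) (s : Γ(Z, U))
    {g : L} (hg : IsSec η (Z.basicOpen s) g) :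
    ∃ (n : ℕ) (t : Γ(Z, U)), pull η U e t = pull η U e s ^ n * g := by
  obtain ⟨e', a, rfl⟩ := hg
  obtain ⟨n, t, ht⟩ := exists_eq_pow_mul_of_isAffineOpen Z U hU s a
  refine ⟨n, t, ?_⟩
  have h1 := congr(pull η _ e' $ht)
  rw [map_mul, map_pow] at h1
  have h2 : ∀ r : Γ(Z, U), pull η _ e' (TopCat.Presheaf.restrictOpen r (Z.basicOpen s)
      (Z.basicOpen_le s)) = pull η U e r := fun r =>
    pull_map e' (homOfLE (Z.basicOpen_le s)).op r
  exact (h2 t).symm.trans (h1.trans congr($(h2 s) ^ n * _))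

end Sections

section Refinement

variable {A : Type u} [CommRing A] {L : Type u} [Field L] [Algebra A L] {Z : Scheme.{u}}
  {η : Spec (CommRingCat.of L) ⟶ Z} (C : ProjCharts A η)

/-- Sections over the set where a form does not vanish become forms after multiplication by a
high power of the form. -/
lemma ProjCharts.exists_mul_pow_mem_forms {j : C.ι} {d : ℕ} {D : L} (hD : D ∈ forms A C.x d)
    (s : Γ(Z, C.U j)) (hs : pull η (C.U j) (C.mem j) s = D / C.x j ^ d) {g : L}
    (hg : IsSec η (Z.basicOpen s) g) :
    ∃ n₀, ∀ n, n₀ ≤ n → g * (C.x j * D) ^ n ∈ forms A C.x ((d + 1) * n) := by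
  obtain ⟨r, t, ht⟩ := hg.exists_pow_mul (C.affine j) (C.mem j) s
  obtain ⟨q, hq⟩ := NAPL.exists_mul_pow_mem_forms C.x_ne j (C.pull_mem j t)
  refine ⟨max q r, fun n hn => ?_⟩
  obtain ⟨m, rfl⟩ := Nat.exists_eq_add_of_le ((le_max_right _ _).trans hn)
  have h1 := mul_mem_forms (hq (r + m + d * r)
    (by have := (le_max_left _ _).trans hn; omega)) (pow_mem_forms hD m)
  rw [ht, hs] at h1
  have hx := C.x_ne j
  have e1 : (d + 1) * (r + m) = r + m + d * r + d * m := by ring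
  have e2 : g * (C.x j * D) ^ (r + m) =
      (D / C.x j ^ d) ^ r * g * C.x j ^ (r + m + d * r) * D ^ m := by
    rw [div_pow, ← pow_mul, pow_add _ (r + m)]
    field_simp
    ring
  rw [e1, e2]
  exact h1

/-- A finite open cover by sets `N c` of the form `H c ≠ 0`, for forms `H c` of the same degree,
that refines a given open cover `V`. Sections over `N c` and its intersections with the other
members are described by forms: a form divided by a power of `H c` of the same degree is a section
over `N c`, and conversely `clear` says that powers of `H c * H c'` clear the denominators of
sections over `N c ⊓ N c'`. On each chart the forms generate the unit ideal. -/
structure ProjCharts.Refinement {I : Type u} (V : I → Z.Opens) where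
  /-- the index set -/
  κ : Type u
  [fintype : Fintype κ]
  /-- the degree of the forms -/
  deg : ℕ
  H : κ → L
  mem_forms : ∀ c, H c ∈ forms A C.x deg
  H_ne : ∀ c, H c ≠ 0
  N : κ → Z.Opens
  mem : ∀ c, ⊤ ≤ η ⁻¹ᵁ N c
  /-- a member of the given cover that contains `N c` -/
  i : κ → I
  le : ∀ c, N c ≤ V (i c)
  cover : ∀ z, ∃ c, z ∈ N c
  basic : ∀ c j, ∃ s : Γ(Z, C.U j), pull η (C.U j) (C.mem j) s = H c / C.x j ^ deg ∧
    Z.basicOpen s = C.U j ⊓ N c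
  isSec_div : ∀ c n P, P ∈ forms A C.x (deg * n) → IsSec η (N c) (P / H c ^ n)
  unit : ∀ j, ∃ a : κ → L, (∀ c, a c ∈ chartRing A C.x j) ∧ ∑ c, a c * (H c / C.x j ^ deg) = 1
  clear : ∀ c c' g, IsSec η (N c ⊓ N c') g →
    ∃ n₀, ∀ n, n₀ ≤ n → g * (H c * H c') ^ n ∈ forms A C.x (2 * deg * n)

attribute [instance] ProjCharts.Refinement.fintype

variable [IsReduced Z] [IsDominant η]

/-- If the form `B` is a section `s` in the chart `m`, then the form `B * x m` does not vanish
exactly where `s` does not vanish, in every chart. -/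
lemma ProjCharts.exists_section_of_form {m : C.ι} (l : C.ι) {b : ℕ} (hb : 0 < b) (s : Γ(Z, C.U m))
    {B : L} (hB : B ∈ forms A C.x b) (hs : pull η (C.U m) (C.mem m) s = B / C.x m ^ b) :
    ∃ σ : Γ(Z, C.U l), pull η (C.U l) (C.mem l) σ = B * C.x m / C.x l ^ (b + 1) ∧
      Z.basicOpen σ = C.U l ⊓ Z.basicOpen s := by
  obtain ⟨β, hβ⟩ := C.exists_pull l (div_mem_chartRing l hB)
  refine ⟨β * C.t l m, ?_, ?_⟩
  · refine (map_mul _ _ _).trans ?_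
    rw [hβ, C.pull_t, pow_succ (C.x l) b, mul_div_mul_comm]
  · have e : ⊤ ≤ η ⁻¹ᵁ (C.U l ⊓ C.U m) := top_le_preimage_inf (C.mem l) (C.mem _)
    have h1 : Z.presheaf.map (homOfLE (inf_le_right : C.U l ⊓ C.U m ≤ C.U m)).op s =
        Z.presheaf.map (homOfLE (inf_le_left : C.U l ⊓ C.U m ≤ C.U l)).op β *
        Z.presheaf.map (homOfLE (inf_le_right : C.U l ⊓ C.U m ≤ C.U m)).op (C.t m l) ^ b := by
      refine pull_injective _ e ?_
      refine (pull_map e _ _).trans ?_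
      refine Eq.trans ?_ (map_mul _ _ _).symm
      rw [map_pow]
      refine Eq.trans ?_ congr($((pull_map e
        (homOfLE (inf_le_left : C.U l ⊓ C.U m ≤ C.U l)).op β).symm) *
        $((pull_map e (homOfLE (inf_le_right : C.U l ⊓ C.U m ≤ C.U m)).op (C.t m l)).symm) ^ b)
      refine hs.trans (Eq.trans ?_ congr($hβ.symm * $((C.pull_t m l).symm) ^ b))
      have := C.x_ne l
      rw [div_pow, div_mul_div_cancel₀ (pow_ne_zero _ this)]
    have h2 := congr(Z.basicOpen $h1)
    rw [Scheme.basicOpen_mul, Scheme.basicOpen_pow Z _ hb, Scheme.basicOpen_res,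
      Scheme.basicOpen_res, Scheme.basicOpen_res, C.basicOpen_t] at h2
    rw [Scheme.basicOpen_mul, C.basicOpen_t]
    have h3 := Z.basicOpen_le s
    have h4 := Z.basicOpen_le β
    ext z
    have h5 := congr(z ∈ $h2)
    simp only [TopologicalSpace.Opens.coe_inf, Set.mem_inter_iff, SetLike.mem_coe]
    have h6 := @h3 z
    have h7 := @h4 z
    simp only [TopologicalSpace.Opens.mem_inf, eq_iff_iff] at h5
    tauto

/-- By quasi-compactness every open cover has a refinement by nonvanishing loci of forms. -/
lemma ProjCharts.exists_refinement {I : Type u} (V : I → Z.Opens) (hV : ⨆ i, V i = ⊤) :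
    Nonempty (C.Refinement V) := by
  classical
  have h1 : ∀ z : Z, ∃ (j : C.ι) (i : I) (s : Γ(Z, C.U j)), z ∈ Z.basicOpen s ∧
      Z.basicOpen s ≤ V i := by
    intro z
    obtain ⟨j, hj⟩ := C.cover z (ptOf_specializes z)
    have hz : z ∈ ⨆ i, V i := by rw [hV]; trivial
    obtain ⟨i, hi⟩ := TopologicalSpace.Opens.mem_iSup.1 hz
    obtain ⟨s, hs, hz⟩ := (C.affine j).exists_basicOpen_le ⟨z, hi⟩ hj
    exact ⟨j, i, s, hz, hs⟩
  choose j i s hs hsV using h1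
  have hcomp : IsCompact (Set.univ : Set Z) := by
    have h : (Set.univ : Set Z) = ⋃ j, (C.U j : Set Z) := by
      symm
      rw [Set.eq_univ_iff_forall]
      intro z
      obtain ⟨j, hj⟩ := C.cover z (ptOf_specializes z)
      exact Set.mem_iUnion.2 ⟨j, hj⟩
    rw [h]
    exact isCompact_iUnion fun j => (C.affine j).isCompact
  obtain ⟨F, hF⟩ := hcomp.elim_finite_subcover (fun z => (Z.basicOpen (s z) : Set Z))
    (fun z => (Z.basicOpen (s z)).2) fun z _ => Set.mem_iUnion.2 ⟨z, hs z⟩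
  have hcov : ∀ z, ∃ c : F, z ∈ Z.basicOpen (s c) := by
    intro z
    obtain ⟨c, hc, hz⟩ := Set.mem_iUnion₂.1 (hF (Set.mem_univ z))
    exact ⟨⟨c, hc⟩, hz⟩
  obtain ⟨q, hq⟩ := exists_mul_pow_mem_forms_of_finset C.x_ne F j
    (fun z => pull η _ (C.mem (j z)) (s z)) fun z _ => C.pull_mem _ _
  -- the section `s c`, homogenized to a form of positive degree; multiplication by one more
  -- coordinate yields the form `H c` that vanishes outside the chart
  let B : F → L := fun c => pull η _ (C.mem (j c)) (s c) * C.x (j c) ^ (q + 1)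
  have hB : ∀ c, B c ∈ forms A C.x (q + 1) := fun c => hq (q + 1) (Nat.le_succ q) c c.2
  have hsB : ∀ c : F, pull η _ (C.mem (j c)) (s c) = B c / C.x (j c) ^ (q + 1) := fun c =>
    (mul_div_cancel_right₀ _ (pow_ne_zero _ (C.x_ne _))).symm
  have hN : ∀ c : F, ⊤ ≤ η ⁻¹ᵁ Z.basicOpen (s c) := fun c => top_le_preimage_of_mem (hs c)
  have hs0 : ∀ c : F, pull η _ (C.mem (j c)) (s c) ≠ 0 := fun c =>
    (mem_basicOpen_iff_pull_ne_zero _ _).1 ((top_le_preimage_iff _ _).1 (hN c))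
  have hH0 : ∀ c : F, B c * C.x (j c) ≠ 0 := fun c =>
    mul_ne_zero (mul_ne_zero (hs0 c) (pow_ne_zero _ (C.x_ne _))) (C.x_ne _)
  have hH : ∀ c : F, B c * C.x (j c) ∈ forms A C.x (q + 1 + 1) := fun c =>
    mul_mem_forms (hB c) (coord_mem_forms _)
  have basic : ∀ (c : F) l, ∃ σ : Γ(Z, C.U l),
      pull η (C.U l) (C.mem l) σ = B c * C.x (j c) / C.x l ^ (q + 2) ∧
      Z.basicOpen σ = C.U l ⊓ Z.basicOpen (s c) := fun c l =>
    C.exists_section_of_form l (Nat.succ_pos q) (s c) (hB c) (hsB c)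
  refine ⟨{ κ := F, deg := q + 2, H := fun c => B c * C.x (j c), mem_forms := hH, H_ne := hH0,
            N := fun c => Z.basicOpen (s c), mem := hN, i := fun c => i c,
            le := fun c => hsV c, cover := hcov, basic := basic, isSec_div := ?_, unit := ?_,
            clear := ?_ }⟩
  · intro c n P hP
    obtain ⟨σ, hσ, hσ'⟩ := basic c (j c)
    rw [inf_eq_right.2 (Z.basicOpen_le (s c))] at hσ'
    have e : ⊤ ≤ η ⁻¹ᵁ Z.basicOpen σ := by rw [hσ']; exact hN c
    have h1 := (isSec_inv_pull (C.mem (j c)) σ e).pow n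
    obtain ⟨p, hp⟩ := C.exists_pull (j c) (div_mem_chartRing (j c) hP)
    have h2 := ((isSec_pull (C.mem (j c)) p).mono (Z.basicOpen_le σ) e).mul h1
    rw [hσ, hp, hσ', inv_div, div_pow, ← pow_mul,
      div_mul_div_cancel₀ (pow_ne_zero _ (C.x_ne _))] at h2
    exact h2
  · intro l
    choose σ hσ hσ' using fun c => basic c l
    have hspan : Ideal.span (Set.range σ) = ⊤ := by
      rw [← (C.affine l).self_le_iSup_basicOpen_iff]
      intro z hz
      obtain ⟨c, hc⟩ := hcov z
      refine TopologicalSpace.Opens.mem_iSup.2 ⟨⟨σ c, c, rfl⟩, ?_⟩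
      change z ∈ Z.basicOpen (σ c)
      rw [hσ']
      exact ⟨hz, hc⟩
    have h1 : (1 : Γ(Z, C.U l)) ∈ Ideal.span (Set.range σ) := by rw [hspan]; trivial
    obtain ⟨a, ha⟩ := Ideal.mem_span_range_iff_exists_fun.1 h1
    refine ⟨fun c => pull η (C.U l) (C.mem l) (a c), fun c => C.pull_mem l _, ?_⟩
    rw [← map_one (pull η (C.U l) (C.mem l)), ← ha, map_sum]
    exact Finset.sum_congr rfl fun c _ => by rw [map_mul, hσ]
  · intro c c' g hg
    obtain ⟨σ, hσ, hσ'⟩ := basic c' (j c)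
    have h1 : Z.basicOpen (s c * σ) = Z.basicOpen (s c) ⊓ Z.basicOpen (s c') := by
      rw [Scheme.basicOpen_mul, hσ', ← inf_assoc, inf_eq_left.2 (Z.basicOpen_le (s c))]
    rw [← h1] at hg
    obtain ⟨n₀, hn⟩ := C.exists_mul_pow_mem_forms (mul_mem_forms (hB c) (hH c')) (s c * σ) (by
      refine (map_mul _ _ _).trans (congr($(hsB c) * $hσ).trans ?_)
      rw [pow_add _ (q + 1), mul_div_mul_comm]) hg
    refine ⟨n₀, fun n h => ?_⟩
    convert hn n h using 2 <;> ring

end Refinement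

/-! ### Semivaluations on a model -/

section ModelGeneric

variable {k : Type u} [Field k] {Y : Scheme.{u}}
  {f : Y ⟶ Spec (CommRingCat.of (LaurentSeries k))}

lemma IsNormalScheme.isReduced {X : Scheme.{u}} (h : IsNormalScheme X) : IsReduced X := by
  have : ∀ x : X, _root_.IsReduced (X.presheaf.stalk x) := fun x =>
    have := (h x).1
    inferInstance
  exact isReduced_of_isReduced_stalk X

/-- A point of the model where the uniformizer does not vanish lies on the generic fiber. -/
lemma Model.mem_range_gen (M : Model f) {z : M.scheme}
    (hz : M.str z ∈ (PrimeSpectrum.basicOpen (PowerSeries.X : PowerSeries k) :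
      Set (PrimeSpectrum (PowerSeries k)))) : z ∈ Set.range M.gen := by
  have h1 : M.str z ∈ Set.range (Spec.map (CommRingCat.ofHom (HahnSeries.ofPowerSeries ℤ k))) := by
    have := PrimeSpectrum.localization_away_comap_range (LaurentSeries k)
      (PowerSeries.X : PowerSeries k)
    rw [← this] at hz
    exact hz
  have h2 : z ∈ Set.range (pullback.fst M.str
      (Spec.map (CommRingCat.ofHom (HahnSeries.ofPowerSeries ℤ k)))) := by
    rw [Scheme.Pullback.range_fst]; exact h1
  obtain ⟨y, rfl⟩ := h2
  refine ⟨M.isPullback.isoPullback.inv y, ?_⟩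
  rw [← Scheme.Hom.comp_apply, IsPullback.isoPullback_inv_fst]

lemma _root_.RingHom.Flat.map_ne_zero {A B : Type*} [CommRing A] [CommRing B] {φ : A →+* B}
    (hφ : φ.Flat) {a : A} (ha : a ∈ nonZeroDivisors A) (h1 : (1 : B) ≠ 0) : φ a ≠ 0 := by
  intro h0
  let _ := φ.toAlgebra
  have : Module.Flat A B := hφ
  have h2 : IsSMulRegular B a := Module.Flat.isSMulRegular_of_nonZeroDivisors ha
  refine h1 (h2 ?_)
  beta_reduce
  rw [smul_zero, Algebra.smul_def, mul_one]
  exact h0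

/-- The generic fiber of a model is dense, since the uniformizer is not a zero divisor. -/
lemma Model.isDominant_gen (M : Model f) : IsDominant M.gen := by
  have hred := M.normal.isReduced
  refine ⟨?_⟩
  rw [DenseRange, dense_iff_inter_open]
  rintro V hV ⟨y, hy⟩
  obtain ⟨_, ⟨W, hW, rfl⟩, hyW, hWV⟩ :=
    M.scheme.isBasis_affineOpens.exists_subset_of_mem_open hy hV
  have e : W ≤ M.str ⁻¹ᵁ ⊤ := le_top
  have hflat := M.flat
  have h1 : (M.str.appLE ⊤ W e).hom.Flat := Flat.flat_appLE (f := M.str) (isAffineOpen_top _) hW e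
  let ϖ : Γ(Spec (CommRingCat.of (PowerSeries k)), ⊤) :=
    (Scheme.ΓSpecIso (CommRingCat.of (PowerSeries k))).inv PowerSeries.X
  have hreg : ϖ ∈ nonZeroDivisors Γ(Spec (CommRingCat.of (PowerSeries k)), ⊤) := by
    refine mem_nonZeroDivisors_iff_right.2 fun a ha => ?_
    have := congr((Scheme.ΓSpecIso (CommRingCat.of (PowerSeries k))).hom $ha)
    rw [map_mul, map_zero, ← CommRingCat.comp_apply, Iso.inv_hom_id] at this
    have h3 := (mul_eq_zero (M₀ := PowerSeries k)).1 this
    have h4 := h3.resolve_right PowerSeries.X_ne_zero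
    rw [← map_zero (Scheme.ΓSpecIso (CommRingCat.of (PowerSeries k))).hom.hom] at h4
    exact (ConcreteCategory.bijective_of_isIso (Scheme.ΓSpecIso
      (CommRingCat.of (PowerSeries k))).hom).1 h4
  have hϖ : M.str.appLE ⊤ W e ϖ ≠ 0 := by
    refine h1.map_ne_zero hreg fun h2 => ?_
    have h3 : M.scheme.basicOpen (1 : Γ(M.scheme, W)) = M.scheme.basicOpen (0 : Γ(M.scheme, W)) :=
      by rw [h2]
    rw [Scheme.basicOpen_zero, Scheme.basicOpen_of_isUnit _ isUnit_one] at h3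
    rw [h3] at hyW
    exact hyW
  rw [Ne, ← basicOpen_eq_bot_iff] at hϖ
  obtain ⟨z, hz⟩ := (M.scheme.basicOpen _).ne_bot_iff_nonempty.1 hϖ
  have hzW : z ∈ W := M.scheme.basicOpen_le _ hz
  refine ⟨z, hWV hzW, M.mem_range_gen ?_⟩
  rw [Scheme.Hom.appLE, CommRingCat.comp_apply, Scheme.basicOpen_res] at hz
  have hz2 := hz.2
  rw [← Scheme.preimage_basicOpen] at hz2
  have : (Spec (CommRingCat.of (PowerSeries k))).basicOpen ϖ = PrimeSpectrum.basicOpen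
      (PowerSeries.X : PowerSeries k) := basicOpen_eq_of_affine _
  change M.str z ∈ (Spec (CommRingCat.of (PowerSeries k))).basicOpen ϖ at hz2
  rw [this] at hz2
  exact hz2

lemma laurentAbs_ofPowerSeries_le_one (a : PowerSeries k) :
    laurentAbs (HahnSeries.ofPowerSeries ℤ k a) ≤ 1 := by
  rw [laurentAbs]
  split_ifs with h
  · exact zero_le
  · rw [← expNeg_zero]
    refine expNeg_anti ?_
    by_contra! hlt
    have h1 := HahnSeries.coeff_order_eq_zero.not.2 h
    rw [PowerSeries.coeff_coe, if_pos hlt] at h1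
    exact h1 rfl

end ModelGeneric

section ModelCharts

variable {k : Type u} [Field k] {Y : Scheme.{u}}
  {f : Y ⟶ Spec (CommRingCat.of (LaurentSeries k))}
  {L : Type u} [Field L] [Algebra (LaurentSeries k) L]

/-- A `k((ϖ))`-algebra as an algebra over `k[[ϖ]]`. -/
@[reducible] def powerSeriesAlgebra (k L : Type u) [Field k] [Field L]
    [Algebra (LaurentSeries k) L] : Algebra (PowerSeries k) L :=
  ((algebraMap (LaurentSeries k) L).comp (HahnSeries.ofPowerSeries ℤ k)).toAlgebra

attribute [local instance] powerSeriesAlgebra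

variable {η : Spec (CommRingCat.of L) ⟶ Y}
  (hη : η ≫ f = Spec.map (CommRingCat.ofHom (algebraMap (LaurentSeries k) L)))

include hη in
lemma Model.comp_str (M : Model f) : (η ≫ M.gen) ≫ M.str =
    Spec.map (CommRingCat.ofHom (algebraMap (PowerSeries k) L)) := by
  rw [Category.assoc, M.isPullback.w, ← Category.assoc, hη, ← Spec.map_comp]
  rfl

variable [IsReduced Y] [IsDominant η] {M : Model f} (C : ProjCharts (PowerSeries k) (η ≫ M.gen))

omit [Algebra (LaurentSeries k) L] in
lemma mem_O_of_isSec (w : LaurentAn f) {U : M.scheme.Opens} (hU : w.pt ∈ M.gen ⁻¹ᵁ U) {g : L}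
    (hg : IsSec (η ≫ M.gen) U g) : g ∈ (w.locVal η).O := by
  rw [Berk.locVal_O]
  exact hg.of_comp.mem_locRing hU

omit [Algebra (LaurentSeries k) L] in
lemma pt_mem_of_abs_ne_zero (w : LaurentAn f) {U : M.scheme.Opens} (e : ⊤ ≤ (η ≫ M.gen) ⁻¹ᵁ U)
    (hU : w.pt ∈ M.gen ⁻¹ᵁ U) (s : Γ(M.scheme, U))
    (h : (w.locVal η).abs (pull (η ≫ M.gen) U e s) ≠ 0) :
    w.pt ∈ M.gen ⁻¹ᵁ M.scheme.basicOpen s := by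
  have e' : ⊤ ≤ η ⁻¹ᵁ (M.gen ⁻¹ᵁ U) := e
  have h1 : (w.locVal η).abs (pull (η ≫ M.gen) U e s) = w.abs (M.gen.app U s) hU := by
    rw [← pull_comp M.gen U e', Berk.locVal_abs_pull η w hU]
  rw [h1, Berk.abs_ne_zero_iff, ← Scheme.preimage_basicOpen] at h
  exact h

include hη in
lemma locVal_abs_powerSeries_le_one (w : LaurentAn f) (a : PowerSeries k) :
    (w.locVal η).abs (algebraMap (PowerSeries k) L a) ≤ 1 := by
  have := Berk.locVal_abs_algebraMap w hη (HahnSeries.ofPowerSeries ℤ k a)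
  exact this.le.trans (laurentAbs_ofPowerSeries_le_one a)

/-- Among the homogeneous coordinates on a model, one has maximal absolute value. -/
lemma exists_maxAt_model (w : LaurentAn f) (hgen : IsDominant M.gen) :
    ∃ j, w.pt ∈ M.gen ⁻¹ᵁ C.U j ∧ (w.locVal η).MaxAt (PowerSeries k) C.x j := by
  obtain ⟨j, hj⟩ := C.cover (M.gen w.pt) (ptOf_specializes _)
  have hO : ∀ j, w.pt ∈ M.gen ⁻¹ᵁ C.U j → ∀ g ∈ chartRing (PowerSeries k) C.x j,
      g ∈ (w.locVal η).O := by
    intro j hj g hg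
    obtain ⟨s, rfl⟩ := C.exists_pull j hg
    exact mem_O_of_isSec w hj (isSec_pull _ _)
  obtain ⟨l, -, hl⟩ := Finset.exists_max_image Finset.univ
    (fun l => (w.locVal η).abs (C.x l / C.x j)) ⟨j, Finset.mem_univ _⟩
  have h1 : (w.locVal η).abs (C.x l / C.x j) ≠ 0 := by
    have := hl j (Finset.mem_univ _)
    rw [div_self (C.x_ne j), LocVal.abs_one] at this
    exact (zero_lt_one.trans_le this).ne'
  have h2 : w.pt ∈ M.gen ⁻¹ᵁ C.U l := by
    rw [← C.pull_t] at h1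
    have h2 := pt_mem_of_abs_ne_zero w (C.mem j) hj (C.t j l) h1
    rw [C.basicOpen_t] at h2
    exact h2.2
  refine ⟨l, h2, hO l h2, fun m => ?_⟩
  have e : C.x m / C.x l = (C.x m / C.x j) / (C.x l / C.x j) := by
    field_simp [C.x_ne]
  rw [e, LocVal.abs_div _ (hO j hj _ (ratio_mem_chartRing j m))
    (hO j hj _ (ratio_mem_chartRing j l)) h1]
  exact div_le_one_of_le₀ (hl m (Finset.mem_univ _)) zero_le

include hη in
/-- Every semivaluation is centered on a member of a refined cover of a model. -/
lemma exists_center (w : LaurentAn f) (hgen : IsDominant M.gen) {I : Type u}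
    {V : I → M.scheme.Opens} (r : C.Refinement V) :
    ∃ c, w.pt ∈ M.gen ⁻¹ᵁ r.N c ∧
      ∀ U g, IsSec (η ≫ M.gen) U g → r.N c ≤ U → (w.locVal η).abs g ≤ 1 := by
  obtain ⟨j, hj, hmax⟩ := exists_maxAt_model C w hgen
  obtain ⟨a, ha, ha1⟩ := r.unit j
  have hA := locVal_abs_powerSeries_le_one hη w
  have hH := fun c => div_mem_chartRing (A := PowerSeries k) j (r.mem_forms c)
  -- the functions `H c / x j ^ deg` are bounded by one and generate the unit ideal of the chart
  obtain ⟨c, hc⟩ : ∃ c, (w.locVal η).abs (r.H c / C.x j ^ r.deg) = 1 := by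
    by_contra! hne
    have hlt : ∀ c, (w.locVal η).abs (r.H c / C.x j ^ r.deg) < 1 := fun c =>
      lt_of_le_of_ne (hmax.abs_le_one hA (hH c)) (hne c)
    have h1 := (w.locVal η).abs_sum_le Finset.univ _
      (fun c _ => mul_mem (hmax.mem _ (ha c)) (hmax.mem _ (hH c)))
      (c := Finset.univ.sup fun c => (w.locVal η).abs (r.H c / C.x j ^ r.deg)) (by
        intro c _
        rw [LocVal.abs_mul _ (hmax.mem _ (ha c)) (hmax.mem _ (hH c))]
        refine (mul_le_of_le_one_left zero_le (hmax.abs_le_one hA (ha c))).trans ?_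
        exact Finset.le_sup (f := fun c => (w.locVal η).abs (r.H c / C.x j ^ r.deg))
          (Finset.mem_univ c))
    rw [ha1, LocVal.abs_one] at h1
    exact absurd h1 (not_le.2 ((Finset.sup_lt_iff zero_lt_one).2 fun c _ => hlt c))
  have hcN : w.pt ∈ M.gen ⁻¹ᵁ r.N c := by
    obtain ⟨σ, hσ, hσ'⟩ := r.basic c j
    have h1 := pt_mem_of_abs_ne_zero w (C.mem j) hj σ (by rw [hσ, hc]; exact one_ne_zero)
    rw [hσ'] at h1
    exact h1.2
  refine ⟨c, hcN, fun U g hg hU => ?_⟩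
  have hgO := mem_O_of_isSec w (M.gen.preimage_mono hU hcN) hg
  obtain ⟨n, hn⟩ := r.clear c c g (hg.mono (inf_le_left.trans hU)
    (top_le_preimage_inf (r.mem c) (r.mem c)))
  have h1 := hmax.abs_le_one hA (div_mem_chartRing j (hn n le_rfl))
  have h2 : g * (r.H c * r.H c) ^ n / C.x j ^ (2 * r.deg * n) =
      g * (r.H c / C.x j ^ r.deg) ^ (2 * n) := by
    rw [div_pow, ← pow_mul, mul_div_assoc]
    congr 2 <;> ring
  rwa [h2, LocVal.abs_mul _ hgO (pow_mem (hmax.mem _ (hH c)) _),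
    LocVal.abs_pow _ (hmax.mem _ (hH c)), hc, one_pow, mul_one] at h1

end ModelCharts

/-! ### Model functions as quotients of generators of ideals -/

section LocalData

variable {k : Type u} [Field k] {Y : Scheme.{u}}
  {f : Y ⟶ Spec (CommRingCat.of (LaurentSeries k))}
  {L : Type u} [Field L] (η : Spec (CommRingCat.of L) ⟶ Y) [IsReduced Y] [IsDominant η]

/-- A description of a model function `φ` on the generic fiber, `m` being the denominator of the
divisor: on the open set `N c` the divisor has the invertible equation `F c`, and the functions
`T c'` and `F c' * T c'` are generators of two invertible fractional ideals of the model whose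
quotient is the divisor; `N c` is the trace on the generic fiber of the open set where `T c` is a
generator. Every semivaluation `w` is centered on such an open set, and there `T c` and
`F c * T c` have maximal absolute value among the generators. -/
structure RatioData (m : ℕ) (φ : LaurentAn f → ℝ) where
  /-- the index set -/
  κ : Type u
  [fintype : Fintype κ]
  N : κ → Y.Opens
  F : κ → L
  T : κ → L
  cover : ⨆ c, N c = ⊤
  T_ne : ∀ c, T c ≠ 0
  F_ne : ∀ c, F c ≠ 0
  isSec_F : ∀ c, IsSec η (N c) (F c)
  isSec_inv : ∀ c, IsSec η (N c) (F c)⁻¹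
  isSec_T : ∀ c c', IsSec η (N c) (T c' / T c)
  isSec_FT : ∀ c c', IsSec η (N c) (F c' * (T c' / T c))
  exists_center : ∀ w : LaurentAn f, ∃ c, w.pt ∈ N c ∧
    φ w = (m : ℝ)⁻¹ * -Real.log ((w.locVal η).abs (F c)) ∧
    ∀ c', (w.locVal η).abs (T c' / T c) ≤ 1 ∧
      (w.locVal η).abs (F c' * (T c' / T c)) ≤ (w.locVal η).abs (F c)

attribute [instance] RatioData.fintype

end LocalData

section PLKData

variable {k : Type u} [Field k] {Y : Scheme.{u}}
  {f : Y ⟶ Spec (CommRingCat.of (LaurentSeries k))}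
  {L : Type u} [Field L] [Algebra (LaurentSeries k) L]

variable {η : Spec (CommRingCat.of L) ⟶ Y}
  (hη : η ≫ f = Spec.map (CommRingCat.ofHom (algebraMap (LaurentSeries k) L)))
  [IsReduced Y] [IsDominant η]

attribute [local instance] powerSeriesAlgebra

include hη in
/-- Every model function has such a description: `N` comes from a refinement of the open cover on
which the divisor is given by equations, and `T c` is a large power of the form `H c`. -/
lemma exists_ratioData {φ : C(LaurentAn f, ℝ)} (hφ : φ ∈ PLK f) :
    ∃ m, 0 < m ∧ Nonempty (RatioData η m φ) := by
  obtain ⟨M, D, m, hm, hD⟩ := hφ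
  refine ⟨m, hm, ?_⟩
  have hred := M.normal.isReduced
  have hgen := M.isDominant_gen
  obtain ⟨C⟩ := M.projective.exists_projCharts (η ≫ M.gen) (M.comp_str hη)
  obtain ⟨r⟩ := C.exists_refinement D.U D.cover
  have eU : ∀ c, ⊤ ≤ (η ≫ M.gen) ⁻¹ᵁ D.U (r.i c) := fun c =>
    (r.mem c).trans ((η ≫ M.gen).preimage_mono (r.le c))
  have eU' : ∀ c, ⊤ ≤ η ⁻¹ᵁ (M.gen ⁻¹ᵁ D.U (r.i c)) := eU
  have eN : ∀ c, ⊤ ≤ η ⁻¹ᵁ (M.gen ⁻¹ᵁ r.N c) := r.mem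
  let G : ∀ c, (Γ(Y, M.gen ⁻¹ᵁ D.U (r.i c)))ˣ := fun c => D.eqn (r.i c)
  let F : r.κ → L := fun c => pull η _ (eU' c) (G c).val
  have hFinv : ∀ c, (F c)⁻¹ = pull η _ (eU' c) ((G c)⁻¹ : (Γ(Y, M.gen ⁻¹ᵁ D.U (r.i c)))ˣ).val := by
    intro c
    have h1 := congr(pull η _ (eU' c) $((G c).mul_inv))
    rw [map_mul, map_one] at h1
    exact (eq_inv_of_mul_eq_one_right h1).symm
  have hF0 : ∀ c, F c ≠ 0 := by
    intro c h0
    have h1 := congr(pull η _ (eU' c) $((G c).mul_inv))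
    rw [map_mul, map_one] at h1
    rw [show pull η _ (eU' c) (G c).val = 0 from h0, zero_mul] at h1
    exact zero_ne_one h1
  have hle : ∀ c, M.gen ⁻¹ᵁ r.N c ≤ M.gen ⁻¹ᵁ D.U (r.i c) := fun c => M.gen.preimage_mono (r.le c)
  have hcompat : ∀ c c', IsSec (η ≫ M.gen) (r.N c ⊓ r.N c') (F c' / F c) := by
    intro c c'
    obtain ⟨t, ht⟩ := D.compat (r.i c') (r.i c)
    have e1 : ⊤ ≤ (η ≫ M.gen) ⁻¹ᵁ (D.U (r.i c') ⊓ D.U (r.i c)) :=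
      top_le_preimage_inf (eU c') (eU c)
    have e2 : ⊤ ≤ η ⁻¹ᵁ (M.gen ⁻¹ᵁ (D.U (r.i c') ⊓ D.U (r.i c))) := e1
    have h1 := congr(pull η _ e2 $ht)
    have h2 := (pull_map e2 (homOfLE (M.gen.preimage_mono inf_le_left)).op (G c').val).symm.trans
      (h1.trans ((map_mul _ _ _).trans congr($(pull_comp M.gen _ e2 t.val) *
        $(pull_map e2 (homOfLE (M.gen.preimage_mono inf_le_right)).op (G c).val))))
    have h3 : F c' / F c = pull (η ≫ M.gen) _ e1 t.val := by
      rw [div_eq_iff (hF0 c)]; exact h2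
    rw [h3]
    refine (isSec_pull e1 t.val).mono ?_ (top_le_preimage_inf (r.mem c) (r.mem c'))
    exact le_inf (inf_le_right.trans (r.le c')) (inf_le_left.trans (r.le c))
  -- for a large exponent `n`, multiplication by `(H c * H c') ^ n` clears the denominators of all
  -- ratios of local equations
  choose n₀ hn₀ using fun c c' => r.clear c c' _ (hcompat c c')
  obtain ⟨n, hn⟩ : ∃ n, ∀ c c', n₀ c c' ≤ n :=
    ⟨Finset.univ.sup fun c => Finset.univ.sup fun c' => n₀ c c', fun c c' =>
      (Finset.le_sup (f := fun c' => n₀ c c') (Finset.mem_univ c')).trans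
        (Finset.le_sup (f := fun c => Finset.univ.sup fun c' => n₀ c c') (Finset.mem_univ c))⟩
  have hT : ∀ c c', IsSec (η ≫ M.gen) (r.N c) (r.H c' ^ n / r.H c ^ n) := fun c c' =>
    r.isSec_div c n _ (pow_mem_forms (r.mem_forms c') n)
  have hFT : ∀ c c', IsSec (η ≫ M.gen) (r.N c) (F c' / F c * (r.H c' ^ n / r.H c ^ n)) := by
    intro c c'
    have h1 : F c' / F c * (r.H c * r.H c') ^ n ∈ forms (PowerSeries k) C.x (r.deg * (2 * n)) := by
      have := hn₀ c c' n (hn c c')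
      rwa [show 2 * r.deg * n = r.deg * (2 * n) by ring] at this
    have h2 := r.isSec_div c (2 * n) _ h1
    have h3 : F c' / F c * (r.H c * r.H c') ^ n / r.H c ^ (2 * n) =
        F c' / F c * (r.H c' ^ n / r.H c ^ n) := by
      have := pow_ne_zero n (r.H_ne c)
      rw [two_mul, pow_add, mul_pow]
      field_simp
    rwa [h3] at h2
  have hFT' : ∀ c c', F c' * (r.H c' ^ n / r.H c ^ n) =
      F c * (F c' / F c * (r.H c' ^ n / r.H c ^ n)) := by
    intro c c'
    rw [← mul_assoc, mul_div_cancel₀ _ (hF0 c)]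
  have hsecF : ∀ c, IsSec η (M.gen ⁻¹ᵁ r.N c) (F c) := fun c =>
    (isSec_pull (eU' c) _).mono (hle c) (eN c)
  refine ⟨{ κ := r.κ, N := fun c => M.gen ⁻¹ᵁ r.N c, F := F, T := fun c => r.H c ^ n, cover := ?_,
            T_ne := fun c => pow_ne_zero _ (r.H_ne c), F_ne := hF0, isSec_F := hsecF,
            isSec_inv := fun c => ?_, isSec_T := fun c c' => (hT c c').of_comp,
            isSec_FT := fun c c' => ?_, exists_center := fun w => ?_ }⟩
  · rw [eq_top_iff]
    intro y _
    obtain ⟨c, hc⟩ := r.cover (M.gen y)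
    exact TopologicalSpace.Opens.mem_iSup.2 ⟨c, hc⟩
  · rw [hFinv]
    exact (isSec_pull (eU' c) _).mono (hle c) (eN c)
  · rw [hFT']
    exact (hsecF c).mul (hFT c c').of_comp
  · obtain ⟨c, hc, hc'⟩ := exists_center hη C w hgen r
    refine ⟨c, hc, ?_, fun c' => ⟨hc' _ _ (hT c c') le_rfl, ?_⟩⟩
    · have h1 : w.pt ∈ M.gen ⁻¹ᵁ D.U (r.i c) := hle c hc
      rw [hD w (r.i c) h1, ← Berk.locVal_abs_pull η w h1 (eU' c)]
      intro s
      rw [← Berk.locVal_abs_pull η w h1 (eU' c), pull_comp]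
      exact hc' _ _ (isSec_pull (eU c) s) (r.le c)
    · rw [hFT', LocVal.abs_mul _ ((hsecF c).mem_locRing hc)
        ((hFT c c').of_comp.mem_locRing hc)]
      exact mul_le_of_le_one_right zero_le (hc' _ _ (hFT c c') le_rfl)

end PLKData

/-! ### Restricting model functions to Gauss extensions -/

section RefinementNorm

variable {A : Type u} [CommRing A] {L : Type u} [Field L] [Algebra A L] {Z : Scheme.{u}}
  {η : Spec (CommRingCat.of L) ⟶ Z} [IsReduced Z] [IsDominant η] {C : ProjCharts A η}
  {F : Type u} [Field F] {ν : F → ℝ≥0} {f : Z ⟶ Spec (CommRingCat.of F)}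
  {I : Type u} {V : I → Z.Opens} (r : C.Refinement V)

/-- The open set `N b` is the locus where the form `H b` does not vanish. -/
lemma ProjCharts.Refinement.pt_mem_iff (w : Berk ν f) (b : r.κ) :
    w.pt ∈ r.N b ↔ C.nrm w r.deg (r.H b) ≠ 0 := by
  obtain ⟨j, hj⟩ := C.exists_maxAt' w
  have hjU := C.mem_U_of_maxAt w hj
  obtain ⟨σ, hσ, hσ'⟩ := r.basic b j
  rw [ProjCharts.nrm, LocVal.nrm_eq C.x_ne hj (r.mem_forms b), ← hσ,
    Berk.locVal_abs_pull η w hjU, Berk.abs_ne_zero_iff, hσ']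
  exact ⟨fun h => ⟨hjU, h⟩, fun h => h.2⟩

omit [IsReduced Z] [IsDominant η] in
lemma sq_pow_mem_forms {d : ℕ} {x : C.ι → L} {H : L} (hH : H ∈ forms A x d) (n : ℕ) :
    (H * H) ^ n ∈ forms A x (2 * d * n) := by
  rw [two_mul]
  exact pow_mem_forms (mul_mem_forms hH hH) n

lemma ProjCharts.Refinement.nrm_sq_pow (w : Berk ν f) (b : r.κ) (n : ℕ) :
    C.nrm w (2 * r.deg * n) ((r.H b * r.H b) ^ n) = C.nrm w r.deg (r.H b) ^ (2 * n) := by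
  have hv := C.exists_maxAt' w
  have h1 := LocVal.nrm_pow hv C.x_ne (mul_mem_forms (r.mem_forms b) (r.mem_forms b)) n
  rw [LocVal.nrm_mul hv C.x_ne (r.mem_forms b) (r.mem_forms b), ← two_mul] at h1
  rw [pow_mul, pow_two]
  exact h1

/-- For a section `u` over `N b`, the form `u * H b ^ (2 (n + 1))` has norm `|u| |H b| ^ (2 (n + 1))`
on `N b` and vanishes outside; the last power of `H b` serves to force the vanishing. -/
lemma ProjCharts.Refinement.nrm_mul_sq_pow (w : Berk ν f) {b : r.κ} {u : L}
    (hu : IsSec η (r.N b) u) {n : ℕ}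
    (hn : ∀ m, n ≤ m → u * (r.H b * r.H b) ^ m ∈ forms A C.x (2 * r.deg * m)) :
    C.nrm w (2 * r.deg * (n + 1)) (u * (r.H b * r.H b) ^ (n + 1)) =
      open Classical in if w.pt ∈ r.N b then
        (w.locVal η).abs u * C.nrm w r.deg (r.H b) ^ (2 * (n + 1)) else 0 := by
  have hv := C.exists_maxAt' w
  split_ifs with h
  · obtain ⟨j, hj⟩ := hv
    rw [← r.nrm_sq_pow, ProjCharts.nrm, ProjCharts.nrm,
      LocVal.nrm_eq C.x_ne hj (hn _ (Nat.le_succ n)),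
      LocVal.nrm_eq C.x_ne hj (sq_pow_mem_forms (C := C) (r.mem_forms b) _), mul_div_assoc,
      LocVal.abs_mul _ (hu.mem_locRing h)
        (hj.mem _ (div_mem_chartRing j (sq_pow_mem_forms (C := C) (r.mem_forms b) _)))]
  · have h1 := LocVal.nrm_mul hv C.x_ne (hn n le_rfl)
      (sq_pow_mem_forms (C := C) (r.mem_forms b) 1)
    rw [mul_assoc u, ← pow_add, ← mul_add] at h1
    refine h1.trans ?_
    have h2 := r.nrm_sq_pow w b 1
    rw [ProjCharts.nrm] at h2
    rw [h2, not_not.1 ((r.pt_mem_iff w b).not.1 h), zero_pow two_ne_zero, mul_zero]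

end RefinementNorm

section RatioForms

variable {k : Type u} [Field k] {Y : Scheme.{u}}
  {f : Y ⟶ Spec (CommRingCat.of (LaurentSeries k))}
  {L : Type u} [Field L] {A : Type u} [CommRing A] [Algebra A L]
  {η : Spec (CommRingCat.of L) ⟶ Y} [IsReduced Y] [IsDominant η] (C : ProjCharts A η)

/-- A model function is a difference of logarithms of maxima of norms of forms. -/
lemma RatioData.exists_forms {m : ℕ} {φ : LaurentAn f → ℝ} (d : RatioData η m φ)
    (r : C.Refinement d.N) :
    ∃ (D n : ℕ) (S T : Finset L) (J : r.κ → L), (∀ P ∈ S, P ∈ forms A C.x D) ∧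
      (∀ P ∈ T, P ∈ forms A C.x D) ∧ (∀ b, J b ∈ forms A C.x D) ∧
      (∀ w : LaurentAn f, ∃ t : ℝ≥0, t ≠ 0 ∧ φ w = (m : ℝ)⁻¹ * -Real.log t ∧
        S.sup (C.nrm w D) = t * T.sup (C.nrm w D)) ∧
      (∀ (w : LaurentAn f) b, C.nrm w r.deg (r.H b) ^ n ≤ T.sup (C.nrm w D)) ∧
      ∀ (w : LaurentAn f) b, C.nrm w r.deg (r.H b) ^ (n + n) ≤
        S.sup (C.nrm w D) * C.nrm w D (J b) := by
  classical
  have hle : ∀ b, r.N b ≤ d.N (r.i b) := r.le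
  have h1 : ∀ b c, IsSec η (r.N b) (d.T c / d.T (r.i b)) := fun b c =>
    (d.isSec_T (r.i b) c).mono (hle b) (r.mem b)
  have h2 : ∀ b c, IsSec η (r.N b) (d.F c * (d.T c / d.T (r.i b))) := fun b c =>
    (d.isSec_FT (r.i b) c).mono (hle b) (r.mem b)
  have h3 : ∀ b, IsSec η (r.N b) (d.F (r.i b))⁻¹ := fun b =>
    (d.isSec_inv (r.i b)).mono (hle b) (r.mem b)
  have hclear : ∀ b g, IsSec η (r.N b) g → ∃ n₀, ∀ n, n₀ ≤ n →
      g * (r.H b * r.H b) ^ n ∈ forms A C.x (2 * r.deg * n) := fun b g hg =>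
    r.clear b b g (hg.mono inf_le_left (top_le_preimage_inf (r.mem b) (r.mem b)))
  -- on `N b` the generators are divided by `T (i b)`, and denominators are cleared by powers of
  -- the form `H b`
  choose n₁ hn₁ using fun b c => hclear b _ (h1 b c)
  choose n₂ hn₂ using fun b c => hclear b _ (h2 b c)
  choose n₃ hn₃ using fun b => hclear b _ (h3 b)
  obtain ⟨n, hn⟩ : ∃ n, ∀ b c, n₁ b c ≤ n ∧ n₂ b c ≤ n ∧ n₃ b ≤ n := by
    refine ⟨Finset.univ.sup fun bc : r.κ × d.κ => max (n₁ bc.1 bc.2) (max (n₂ bc.1 bc.2) (n₃ bc.1)),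
      fun b c => ?_⟩
    have := Finset.le_sup (f := fun bc : r.κ × d.κ =>
      max (n₁ bc.1 bc.2) (max (n₂ bc.1 bc.2) (n₃ bc.1))) (Finset.mem_univ (b, c))
    simpa using this
  have hT : ∀ b c m, n ≤ m → d.T c / d.T (r.i b) * (r.H b * r.H b) ^ m ∈
      forms A C.x (2 * r.deg * m) := fun b c m hm => hn₁ b c m ((hn b c).1.trans hm)
  have hS : ∀ b c m, n ≤ m → d.F c * (d.T c / d.T (r.i b)) * (r.H b * r.H b) ^ m ∈
      forms A C.x (2 * r.deg * m) := fun b c m hm => hn₂ b c m ((hn b c).2.1.trans hm)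
  have hJ : ∀ b m, n ≤ m → (d.F (r.i b))⁻¹ * (r.H b * r.H b) ^ m ∈
      forms A C.x (2 * r.deg * m) := fun b m hm => hn₃ b m ((hn b (r.i b)).2.2.trans hm)
  let PT : r.κ × d.κ → L := fun a => d.T a.2 / d.T (r.i a.1) * (r.H a.1 * r.H a.1) ^ (n + 1)
  let PS : r.κ × d.κ → L := fun a =>
    d.F a.2 * (d.T a.2 / d.T (r.i a.1)) * (r.H a.1 * r.H a.1) ^ (n + 1)
  refine ⟨2 * r.deg * (n + 1), 2 * (n + 1), Finset.univ.image PS, Finset.univ.image PT,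
    fun b => (d.F (r.i b))⁻¹ * (r.H b * r.H b) ^ (n + 1), ?_, ?_,
    fun b => hJ b _ (Nat.le_succ n), fun w => ?_, fun w b => ?_, fun w b => ?_⟩
  · intro P hP
    obtain ⟨a, -, rfl⟩ := Finset.mem_image.1 hP
    exact hS _ _ _ (Nat.le_succ n)
  · intro P hP
    obtain ⟨a, -, rfl⟩ := Finset.mem_image.1 hP
    exact hT _ _ _ (Nat.le_succ n)
  · obtain ⟨c, hc, hφ, hc'⟩ := d.exists_center w
    have hcO : ∀ g, IsSec η (d.N c) g → g ∈ (w.locVal η).O := fun g hg => hg.mem_locRing hc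
    refine ⟨_, ?_, hφ, ?_⟩
    · exact LocVal.abs_ne_zero_of_inv_mem _ (d.F_ne c) (hcO _ (d.isSec_F c)) (hcO _ (d.isSec_inv c))
    -- Every norm is a factor depending only on `b` times the value relative to the generator
    -- at the center.
    let a : r.κ → ℝ≥0 := fun b => if w.pt ∈ r.N b then
      (w.locVal η).abs (d.T c / d.T (r.i b)) * C.nrm w r.deg (r.H b) ^ (2 * (n + 1)) else 0
    have hmulO : ∀ b, w.pt ∈ r.N b → d.T c / d.T (r.i b) ∈ (w.locVal η).O := fun b hb =>
      (h1 b c).mem_locRing hb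
    have eT : ∀ b c', C.nrm w (2 * r.deg * (n + 1)) (PT (b, c')) =
        a b * (w.locVal η).abs (d.T c' / d.T c) := by
      intro b c'
      rw [r.nrm_mul_sq_pow w (h1 b c') (hT b c')]
      simp only [a]
      split_ifs with hb
      · have : d.T c' / d.T (r.i b) = d.T c' / d.T c * (d.T c / d.T (r.i b)) :=
          (div_mul_div_cancel₀ (d.T_ne c)).symm
        rw [this, LocVal.abs_mul _ (hcO _ (d.isSec_T c c')) (hmulO b hb)]
        ring
      · rw [zero_mul]
    have eS : ∀ b c', C.nrm w (2 * r.deg * (n + 1)) (PS (b, c')) =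
        a b * (w.locVal η).abs (d.F c' * (d.T c' / d.T c)) := by
      intro b c'
      rw [r.nrm_mul_sq_pow w (h2 b c') (hS b c')]
      simp only [a]
      split_ifs with hb
      · have : d.F c' * (d.T c' / d.T (r.i b)) =
            d.F c' * (d.T c' / d.T c) * (d.T c / d.T (r.i b)) := by
          rw [mul_assoc, div_mul_div_cancel₀ (d.T_ne c)]
        rw [this, LocVal.abs_mul _ (hcO _ (d.isSec_FT c c')) (hmulO b hb)]
        ring
      · rw [zero_mul]
    have supT : (Finset.univ.image PT).sup (C.nrm w (2 * r.deg * (n + 1))) = Finset.univ.sup a := by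
      rw [Finset.sup_image]
      apply le_antisymm
      · refine Finset.sup_le fun bc _ => ?_
        rw [Function.comp_apply, eT]
        exact (mul_le_of_le_one_right zero_le (hc' _).1).trans (Finset.le_sup (Finset.mem_univ _))
      · refine Finset.sup_le fun b _ => ?_
        refine le_trans (le_of_eq ?_) (Finset.le_sup (Finset.mem_univ (b, c)))
        rw [Function.comp_apply, eT, div_self (d.T_ne c), LocVal.abs_one, mul_one]
    have supS : (Finset.univ.image PS).sup (C.nrm w (2 * r.deg * (n + 1))) =
        Finset.univ.sup fun b => (w.locVal η).abs (d.F c) * a b := by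
      rw [Finset.sup_image]
      apply le_antisymm
      · refine Finset.sup_le fun bc _ => ?_
        rw [Function.comp_apply, eS, mul_comm]
        exact (mul_le_mul_left (hc' _).2 _).trans
          (Finset.le_sup (f := fun b => (w.locVal η).abs (d.F c) * a b) (Finset.mem_univ _))
      · refine Finset.sup_le fun b _ => ?_
        refine le_trans (le_of_eq ?_) (Finset.le_sup (Finset.mem_univ (b, c)))
        rw [Function.comp_apply, eS, div_self (d.T_ne c), mul_one, mul_comm]
    rw [supT, supS, NNReal.mul_finset_sup]
  · refine le_trans (le_of_eq ?_)
      (Finset.le_sup (Finset.mem_image_of_mem PT (Finset.mem_univ (b, r.i b))))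
    rw [r.nrm_mul_sq_pow w (h1 b _) (hT b _), div_self (d.T_ne _), LocVal.abs_one, one_mul]
    split_ifs with h
    · rfl
    · rw [not_not.1 ((r.pt_mem_iff w b).not.1 h), zero_pow (by omega)]
  · have hv := C.exists_maxAt' w
    have h4 : C.nrm w r.deg (r.H b) ^ (2 * (n + 1) + 2 * (n + 1)) =
        C.nrm w (2 * r.deg * (n + 1)) (PS (b, r.i b)) * C.nrm w (2 * r.deg * (n + 1))
          ((d.F (r.i b))⁻¹ * (r.H b * r.H b) ^ (n + 1)) := by
      have h5 := LocVal.nrm_mul hv C.x_ne (hS b (r.i b) (n + 1) (Nat.le_succ n))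
        (hJ b (n + 1) (Nat.le_succ n))
      have h6 := LocVal.nrm_mul hv C.x_ne (sq_pow_mem_forms (C := C) (r.mem_forms b) (n + 1))
        (sq_pow_mem_forms (C := C) (r.mem_forms b) (n + 1))
      have h7 := r.nrm_sq_pow w b (n + 1)
      rw [ProjCharts.nrm] at h7
      rw [h7] at h6
      rw [pow_add]
      refine h6.symm.trans (Eq.trans ?_ h5)
      congr 1
      rw [div_self (d.T_ne _), mul_one]
      have := d.F_ne (r.i b)
      field_simp
    rw [h4]
    exact mul_le_mul_left (Finset.le_sup (f := C.nrm w (2 * r.deg * (n + 1)))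
      (Finset.mem_image_of_mem PS (Finset.mem_univ (b, r.i b)))) _

end RatioForms

section Main

attribute [local instance] laurentAlgebra

variable {k : Type u} [Field k] {X : Scheme.{u}} {f : X ⟶ Spec (CommRingCat.of k)}
  {E : Type u} [Field E] [Algebra k E] {η : Spec (CommRingCat.of E) ⟶ X}
  (hη : η ≫ f = Spec.map (CommRingCat.ofHom (algebraMap k E))) (C : ProjCharts k η)
  [IsReduced X] [IsDominant η] [IsReduced (baseChange f)] [IsDominant (laurentPoint hη)]

lemma nrm_gaussExt_le_expNeg (v : TrivAn f) {d : ℕ} {P : LaurentSeries E}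
    (hP : P ∈ forms (LaurentSeries k) (C.baseChange hη).x d) :
    (C.baseChange hη).nrm (gaussExt v) d P ≤ expNeg P.order := by
  refine (nrm_gaussExt hη C v hP).2 _ fun n => ?_
  by_cases h0 : P.coeff n = 0
  · have : C.nrm v d 0 = 0 := by
      obtain ⟨j, hj⟩ := C.exists_maxAt' v
      rw [ProjCharts.nrm, LocVal.nrm_eq C.x_ne hj (zero_mem _), zero_div, LocVal.abs_zero]
    rw [h0, this, zero_mul]; exact zero_le
  · exact (mul_le_of_le_one_left zero_le (C.nrm_le_one hη v (coeff_mem_forms hP n))).trans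
      (expNeg_anti (HahnSeries.order_le_of_coeff_ne_zero h0))

/-- A function that is regular on a chart is bounded on the Gauss extensions of the semivaluations
centered on the chart. -/
lemma exists_gaussExt_abs_le (j : C.ι) {g : LaurentSeries E}
    (hg : g ∈ chartRing (LaurentSeries k) (C.baseChange hη).x j) :
    ∃ B : ℝ≥0, ∀ v : TrivAn f, (v.locVal η).MaxAt k C.x j →
      ((gaussExt v).locVal (laurentPoint hη)).abs g ≤ B := by
  obtain ⟨q, hq⟩ := exists_mul_pow_mem_forms (C.baseChange hη).x_ne j hg
  refine ⟨_, fun v hj => le_trans (le_of_eq ?_) (nrm_gaussExt_le_expNeg hη C v (hq q le_rfl))⟩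
  rw [ProjCharts.nrm, LocVal.nrm_eq (C.baseChange hη).x_ne (maxAt_gaussExt hη C v hj) (hq q le_rfl),
    mul_div_cancel_right₀ _ (pow_ne_zero _ ((C.baseChange hη).x_ne j))]

/-- The norms of forms without common zero do not become small simultaneously. -/
lemma exists_le_nrm_gaussExt {I : Type u} {V : I → (baseChange f).Opens}
    (r : (C.baseChange hη).Refinement V) :
    ∃ δ : ℝ≥0, 0 < δ ∧ ∀ v : TrivAn f, ∃ b, δ ≤ (C.baseChange hη).nrm (gaussExt v) r.deg
      (r.H b) := by
  choose a ha ha1 using r.unit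
  choose B hB using fun (j : C.ι) (b : r.κ) => exists_gaussExt_abs_le hη C j (ha j b)
  -- if all `H b` were small, so would be the sum `∑ b, a b * (H b / x j ^ deg) = 1`
  let G : ℝ≥0 := max 1 (Finset.univ.sup fun j => Finset.univ.sup fun b => B j b)
  have hG : ∀ j b, B j b ≤ G := fun j b => le_max_of_le_right
    ((Finset.le_sup (f := fun b => B j b) (Finset.mem_univ b)).trans
      (Finset.le_sup (f := fun j => Finset.univ.sup fun b => B j b) (Finset.mem_univ j)))
  have hG0 : 0 < G := zero_lt_one.trans_le (le_max_left _ _)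
  refine ⟨G⁻¹, inv_pos.2 hG0, fun v => ?_⟩
  by_contra! hlt
  obtain ⟨j, hj⟩ := C.exists_maxAt' v
  have hmax := maxAt_gaussExt hη C v hj
  have hH := fun b => div_mem_chartRing (A := LaurentSeries k) j (r.mem_forms b)
  have h1 := ((gaussExt v).locVal (laurentPoint hη)).abs_sum_le Finset.univ _
    (fun b _ => mul_mem (hmax.mem _ (ha j b)) (hmax.mem _ (hH b)))
    (c := G * Finset.univ.sup fun b => (C.baseChange hη).nrm (gaussExt v) r.deg (r.H b)) (by
      intro b _
      rw [LocVal.abs_mul _ (hmax.mem _ (ha j b)) (hmax.mem _ (hH b))]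
      refine mul_le_mul' ((hB j b v hj).trans (hG j b)) ?_
      refine le_trans (le_of_eq ?_) (Finset.le_sup (Finset.mem_univ b))
      rw [ProjCharts.nrm, LocVal.nrm_eq (C.baseChange hη).x_ne hmax (r.mem_forms b)])
  have h4 := (LocVal.abs_one _).symm.trans (congr(((gaussExt v).locVal (laurentPoint hη)).abs
    $((ha1 j).symm)))
  replace h1 := h4.le.trans h1
  have h2 := (Finset.sup_lt_iff (inv_pos.2 hG0)).2 fun b (_ : b ∈ Finset.univ) => hlt b
  have h3 := mul_lt_mul_of_pos_left h2 hG0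
  rw [mul_inv_cancel₀ hG0.ne'] at h3
  exact absurd h1 (not_le.2 h3)

include hη C in
/-- Model functions restrict to piecewise linear functions under the Gauss extension. -/
theorem exists_mem_PL_of_mem_PLK [X.IsSeparated] {φ : C(LaurentAn (baseChangeStr f), ℝ)}
    (hφ : φ ∈ PLK (baseChangeStr f)) : ∃ ψ ∈ PL f, ⇑ψ = ⇑φ ∘ gaussExt := by
  obtain ⟨m, hm, ⟨d⟩⟩ := exists_ratioData (laurentPoint_snd hη) hφ
  obtain ⟨r⟩ := (C.baseChange hη).exists_refinement d.N d.cover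
  obtain ⟨D, n, S, T, J, hS, hT, hJ, hw, hTn, hSn⟩ := d.exists_forms (C.baseChange hη) r
  obtain ⟨δ, hδ, hδ'⟩ := exists_le_nrm_gaussExt hη C r
  -- both maxima are bounded from below on Gauss extensions, hence involve finitely many coefficients
  let G : ℝ≥0 := max 1 (Finset.univ.sup fun b => expNeg (J b).order)
  have hG0 : 0 < G := zero_lt_one.trans_le (le_max_left _ _)
  have hG : ∀ (v : TrivAn f) b, (C.baseChange hη).nrm (gaussExt v) D (J b) ≤ G := fun v b =>
    (nrm_gaussExt_le_expNeg hη C v (hJ b)).trans (le_max_of_le_right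
      (Finset.le_sup (f := fun b => expNeg (J b).order) (Finset.mem_univ b)))
  have hTl : ∀ v : TrivAn f, δ ^ n ≤ T.sup ((C.baseChange hη).nrm (gaussExt v) D) := by
    intro v
    obtain ⟨b, hb⟩ := hδ' v
    exact (pow_le_pow_left' hb n).trans (hTn _ b)
  have hSl : ∀ v : TrivAn f, δ ^ (n + n) * G⁻¹ ≤ S.sup ((C.baseChange hη).nrm (gaussExt v) D) := by
    intro v
    obtain ⟨b, hb⟩ := hδ' v
    rw [mul_inv_le_iff₀ hG0]
    exact (pow_le_pow_left' hb _).trans ((hSn _ b).trans (mul_le_mul_right (hG v b) _))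
  have hT0 : 0 < δ ^ n := pow_pos hδ _
  have hS0 : 0 < δ ^ (n + n) * G⁻¹ := mul_pos (pow_pos hδ _) (inv_pos.2 hG0)
  have mT := isFormMax_gaussExt hη C T hT hT0 hTl
  have mS := isFormMax_gaussExt hη C S hS hS0 hSl
  have neT := fun v : TrivAn f => (hT0.trans_le (hTl v)).ne'
  have neS := fun v : TrivAn f => (hS0.trans_le (hSl v)).ne'
  let ψ : C(TrivAn f, ℝ) :=
    ⟨fun v => (m : ℝ)⁻¹ * (Real.log (T.sup ((C.baseChange hη).nrm (gaussExt v) D) : ℝ≥0) -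
      Real.log (S.sup ((C.baseChange hη).nrm (gaussExt v) D) : ℝ≥0)),
      continuous_const.mul (((NNReal.continuous_coe.comp mT.continuous).log
        fun v => NNReal.coe_ne_zero.2 (neT v)).sub
        ((NNReal.continuous_coe.comp mS.continuous).log fun v => NNReal.coe_ne_zero.2 (neS v)))⟩
  refine ⟨ψ, (mem_PL_iff (C := C) hη ψ).2 ⟨m, D, _, _, hm, mT, mS, neT, neS, fun v => rfl⟩, ?_⟩
  funext v
  obtain ⟨t, ht, hφ, hST⟩ := hw (gaussExt v)
  rw [Function.comp_apply, hφ]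
  change (m : ℝ)⁻¹ * (Real.log (T.sup ((C.baseChange hη).nrm (gaussExt v) D) : ℝ≥0) -
      Real.log (S.sup ((C.baseChange hη).nrm (gaussExt v) D) : ℝ≥0)) = _
  rw [hST, NNReal.coe_mul, Real.log_mul (NNReal.coe_ne_zero.2 ht) (NNReal.coe_ne_zero.2 (neT v))]
  ring

end Main

/-! ### Projective schemes with prescribed generic coordinates -/

section Reindex

variable {A : Type u} [CommRing A] {L : Type u} [Field L] [Algebra A L] {Z : Scheme.{u}}
  {η : Spec (CommRingCat.of L) ⟶ Z}

/-- Reindexing and rescaling the homogeneous coordinates. -/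
def ProjCharts.reindex (C : ProjCharts A η) {κ : Type} [Fintype κ] (e : κ ≃ C.ι) (z : κ → L)
    (hz : ∀ l, z l ≠ 0) (h : ∀ j l, C.x (e l) / C.x (e j) = z l / z j) : ProjCharts A η where
  ι := κ
  x := z
  x_ne := hz
  U j := C.U (e j)
  affine j := C.affine _
  mem j := C.mem _
  cover w hw := by
    obtain ⟨j, hj⟩ := C.cover w hw
    exact ⟨e.symm j, by rwa [e.apply_symm_apply]⟩
  t j l := C.t (e j) (e l)
  pull_t j l := by rw [C.pull_t, h]
  basicOpen_t j l := C.basicOpen_t _ _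
  range_pull j := by
    rw [C.range_pull]
    congr 2
    ext g
    constructor
    · rintro ⟨l, rfl⟩
      exact ⟨e.symm l, by beta_reduce; rw [← h, e.apply_symm_apply]⟩
    · rintro ⟨l, rfl⟩
      exact ⟨e l, h _ _⟩

end Reindex

section Image

open HomogeneousLocalization

attribute [local instance] MvPolynomial.gradedAlgebra

variable {A : Type u} [CommRing A] {L : Type u} [Field L] [Algebra A L] {n : ℕ}

/-- The evaluation of functions on a standard chart of projective space at the point with
homogeneous coordinates `z`. -/
lemma exists_awayHom (z : Fin (n + 1) → L) (j : Fin (n + 1)) (hz : z j ≠ 0) :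
    ∃ φ : Away (gr A n) (MvPolynomial.X j) →+* L, (∀ l, φ (coordAway A j l) = z l / z j) ∧
      ∀ a, φ (constAway A j a) = algebraMap A L a := by
  let ρ : MvPolynomial (Fin (n + 1)) A →+* L := (MvPolynomial.aeval z).toRingHom
  have hρ : ∀ l, ρ (MvPolynomial.X l) = z l := fun l => MvPolynomial.aeval_X _ _
  have hu : IsUnit (ρ (MvPolynomial.X j)) := by rw [hρ]; exact IsUnit.mk0 _ hz
  let ψ := Localization.awayLift ρ (MvPolynomial.X j) hu
  have hψ : ∀ P, ψ (locX A j P) = ρ P := fun P => IsLocalization.Away.lift_eq _ _ _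
  refine ⟨ψ.comp (algebraMap (Away (gr A n) (MvPolynomial.X j)) _), fun l => ?_, fun a => ?_⟩
  · rw [eq_div_iff hz, ← hρ j, ← hψ, ← hρ l, ← hψ]
    have := congr(ψ $(val_coordAway (A := A) j l))
    rwa [map_mul] at this
  · have := congr(ψ $(val_constAway (A := A) j a))
    refine this.trans ((hψ _).trans ?_)
    exact MvPolynomial.aeval_C _ _

/-- The `L`-valued point of projective space over `A` with homogeneous coordinates `z`. -/
lemma exists_specMap_awayι_of_coord (z : Fin (n + 1) → L) (j : Fin (n + 1)) (hz : z j ≠ 0) :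
    ∃ φ : CommRingCat.of (Away (gr A n) (MvPolynomial.X j)) ⟶ CommRingCat.of L,
      (∀ l, φ (coordAway A j l) = z l / z j) ∧
      (Spec.map φ ≫ Proj.awayι (gr A n) (MvPolynomial.X j) (X_mem j) one_pos) ≫ ProjSpace.str A n =
        Spec.map (CommRingCat.ofHom (algebraMap A L)) := by
  obtain ⟨φ, hφ, hφA⟩ := exists_awayHom (A := A) z j hz
  refine ⟨CommRingCat.ofHom φ, hφ, ?_⟩
  have h0 : (Spec.map (CommRingCat.ofHom φ) ≫
      Proj.awayι (gr A n) (MvPolynomial.X j) (X_mem j) one_pos) ≫ ProjSpace.str A n =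
      Spec.map (CommRingCat.ofHom φ) ≫
        (Proj.awayι (gr A n) (MvPolynomial.X j) (X_mem j) one_pos ≫ Proj.toSpecZero (gr A n)) ≫
        Spec.map (CommRingCat.ofHom (algebraMap A (gr A n 0))) :=
    (Category.assoc _ (Proj.awayι (gr A n) (MvPolynomial.X j) (X_mem j) one_pos)
      (Proj.toSpecZero (gr A n) ≫ Spec.map (CommRingCat.ofHom (algebraMap A (gr A n 0))))).trans
      (congr(Spec.map (CommRingCat.ofHom φ) ≫ $((Category.assoc _ _ _).symm)))
  rw [h0, Proj.awayι_toSpecZero, ← Spec.map_comp, ← Spec.map_comp]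
  congr 1
  ext a
  exact hφA a

lemma isClosedImmersion_imageι {Z Z' : Scheme.{u}} (θ : Z ⟶ Z') : IsClosedImmersion θ.imageι :=
  inferInstanceAs (IsClosedImmersion θ.ker.subschemeι)

/-- The scheme-theoretic image of a reduced scheme is reduced. -/
lemma isReduced_image {Z Z' : Scheme.{u}} (θ : Z ⟶ Z') [IsReduced Z] [QuasiCompact θ] :
    IsReduced θ.image := by
  have hcov : TopologicalSpace.IsOpenCover fun U : Z'.affineOpens => θ.imageι ⁻¹ᵁ U.1 := by
    rw [TopologicalSpace.IsOpenCover, eq_top_iff]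
    intro x _
    obtain ⟨U, hU, hx, -⟩ := exists_isAffineOpen_mem_and_subset (U := ⊤) (x := θ.imageι x) trivial
    exact TopologicalSpace.Opens.mem_iSup.2 ⟨⟨U, hU⟩, hx⟩
  let 𝒰 := θ.image.openCoverOfIsOpenCover _ hcov
  have : ∀ U, IsReduced (𝒰.X U) := by
    intro U
    have h1 : _root_.IsReduced Γ(θ.image, θ.imageι ⁻¹ᵁ U.1) :=
      isReduced_of_injective (θ.toImage.app (θ.imageι ⁻¹ᵁ U.1)).hom (θ.toImage_app_injective U)
    have h2 : _root_.IsReduced Γ((θ.imageι ⁻¹ᵁ U.1 : θ.image.Opens), ⊤) :=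
      isReduced_of_injective (θ.imageι ⁻¹ᵁ U.1 : θ.image.Opens).topIso.hom.hom
        (ConcreteCategory.bijective_of_isIso _).1
    have h3 : IsAffine (θ.imageι ⁻¹ᵁ U.1 : θ.image.Opens) := U.2.preimage θ.imageι
    exact isReduced_of_isAffine_isReduced (θ.imageι ⁻¹ᵁ U.1 : θ.image.Opens)
  exact IsReduced.of_openCover _ 𝒰

lemma exists_projective_of_fin (z : Fin (n + 1) → L) (hz : ∀ l, z l ≠ 0) :
    ∃ (M : Scheme.{u}) (str : M ⟶ Spec (CommRingCat.of A)) (η : Spec (CommRingCat.of L) ⟶ M)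
      (C : ProjCharts A η) (e : Fin (n + 1) ≃ C.ι), IsProjective str ∧ IsReduced M ∧
        IsDominant η ∧ η ≫ str = Spec.map (CommRingCat.ofHom (algebraMap A L)) ∧
        ∀ l, C.x (e l) = z l := by
  obtain ⟨φ, hφ, hφA⟩ := exists_specMap_awayι_of_coord (A := A) z 0 (hz 0)
  generalize hθ : Spec.map φ ≫ Proj.awayι (gr A n) (MvPolynomial.X 0) (X_mem 0) one_pos = θ at hφA
  have hη : θ.toImage ≫ θ.imageι ≫ ProjSpace.str A n =
      Spec.map (CommRingCat.ofHom (algebraMap A L)) := by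
    rw [← hφA]
    exact (Category.assoc _ _ _).symm.trans congr($(θ.toImage_imageι) ≫ ProjSpace.str A n)
  obtain ⟨C, e', hC⟩ := exists_projCharts_of_coord θ.imageι (isClosedImmersion_imageι θ) θ.toImage
      hη 0
    φ (θ.toImage_imageι.trans hθ.symm)
  have hne : ∀ l, φ (coordAway A 0 l) ≠ 0 := fun l => by
    rw [hφ]; exact div_ne_zero (hz _) (hz _)
  let e1 : Fin (n + 1) ≃ C.ι := (Equiv.subtypeUnivEquiv hne).symm.trans e'
  have hx : ∀ l, C.x (e1 l) = z l / z 0 := fun l => (hC _).trans (hφ _)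
  refine ⟨θ.image, θ.imageι ≫ ProjSpace.str A n, θ.toImage, C.reindex e1 z hz ?_, Equiv.refl _,
    ⟨n, θ.imageι, isClosedImmersion_imageι θ, rfl⟩, isReduced_image θ, inferInstance, hη, fun _ =>
      rfl⟩
  intro j l
  rw [hx, hx, div_div_div_cancel_right₀ (hz _)]

/-- The projective `A`-scheme with generic point `Spec L` and prescribed homogeneous coordinates:
the closure of the corresponding `L`-valued point of projective space. -/
theorem exists_projective_of_coord {κ : Type} [Fintype κ] [Nonempty κ] (z : κ → L)
    (hz : ∀ l, z l ≠ 0) :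
    ∃ (M : Scheme.{u}) (str : M ⟶ Spec (CommRingCat.of A)) (η : Spec (CommRingCat.of L) ⟶ M)
      (C : ProjCharts A η) (e : κ ≃ C.ι), IsProjective str ∧ IsReduced M ∧ IsDominant η ∧
        η ≫ str = Spec.map (CommRingCat.ofHom (algebraMap A L)) ∧ ∀ l, C.x (e l) = z l := by
  obtain ⟨n, hn⟩ := Nat.exists_eq_succ_of_ne_zero (Fintype.card_ne_zero (α := κ))
  let e : κ ≃ Fin (n + 1) := Fintype.equivFinOfCardEq hn
  obtain ⟨M, str, η, C, e', h1, h2, h3, h4, h5⟩ :=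
    exists_projective_of_fin (A := A) (z ∘ e.symm) (fun _ => hz _)
  refine ⟨M, str, η, C, e.trans e', h1, h2, h3, h4, fun l => ?_⟩
  simp [h5]

end Image

/-! ### Gluing morphisms along charts -/

section Glue

variable {L : Type u} [Field L] {Z M : Scheme.{u}} {η : Spec (CommRingCat.of L) ⟶ Z}
  {η' : Spec (CommRingCat.of L) ⟶ M}

lemma isDominant_of_comp_isOpenImmersion {P : Scheme.{u}} (p : Spec (CommRingCat.of L) ⟶ P)
    (j : P ⟶ Z) [IsOpenImmersion j] [IsDominant (p ≫ j)] : IsDominant p := by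
  refine ⟨dense_iff_inter_open.2 fun O hO hne => ?_⟩
  let O' : P.Opens := ⟨O, hO⟩
  obtain ⟨y, hy⟩ := hne
  have h1 : j y ∈ j ''ᵁ O' := ⟨y, hy, rfl⟩
  obtain ⟨_, ⟨y', hy', e⟩, x, rfl⟩ :=
    (IsDominant.denseRange (f := p ≫ j)).inter_open_nonempty _ (j ''ᵁ O').2 ⟨_, h1⟩
  have : y' = p x := j.isOpenEmbedding.injective (e.trans (Scheme.Hom.comp_apply _ _ _))
  exact ⟨p x, this ▸ hy', x, rfl⟩

/-- The open cover by the spectra of the rings of functions on affine charts. -/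
def chartCover {ι : Type} {V : ι → Z.Opens} (hV : ∀ i, IsAffineOpen (V i))
    (hcov : ∀ z, ∃ i, z ∈ V i) : Z.OpenCover :=
  Scheme.Cover.mkOfCovers ι (fun i => Spec Γ(Z, V i)) (fun i => (hV i).fromSpec) (fun x => by
      obtain ⟨i, hi⟩ := hcov x
      rw [← SetLike.mem_coe, ← (hV i).range_fromSpec] at hi
      exact ⟨i, hi⟩) (fun i => inferInstance)

/-- Gluing morphisms given on affine charts by inclusions of rings of functions. -/
lemma exists_hom_of_charts [IsReduced Z] [IsDominant η] [M.IsSeparated] {ι : Type}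
    {V : ι → Z.Opens} (hV : ∀ i, IsAffineOpen (V i)) (hcov : ∀ z, ∃ i, z ∈ V i)
    (e : ∀ i, ⊤ ≤ η ⁻¹ᵁ V i) {U : ι → M.Opens} (hU : ∀ i, IsAffineOpen (U i))
    (e' : ∀ i, ⊤ ≤ η' ⁻¹ᵁ U i)
    (h : ∀ i s, ∃ t, pull η (V i) (e i) t = pull η' (U i) (e' i) s) :
    ∃ g : Z ⟶ M, η ≫ g = η' ∧ ∀ i, V i ≤ g ⁻¹ᵁ U i := by
  have hr : ∀ i, ∃ r : Γ(M, U i) →+* Γ(Z, V i),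
      (pull η (V i) (e i)).comp r = pull η' (U i) (e' i) := by
    intro i
    choose r hr using h i
    have hinj := pull_injective (η := η) (V i) (e i)
    refine ⟨{ toFun := r, map_one' := hinj ?_, map_mul' := fun a b => hinj ?_,
              map_zero' := hinj ?_, map_add' := fun a b => hinj ?_ }, RingHom.ext (hr)⟩
    · rw [hr, map_one, map_one]
    · rw [map_mul, hr, hr, hr, map_mul]
    · rw [hr, map_zero, map_zero]
    · rw [map_add, hr, hr, hr, map_add]
  choose r hr using hr
  let 𝒰 : Z.OpenCover := chartCover hV hcov
  let g : ∀ i, 𝒰.X i ⟶ M := fun i => Spec.map (CommRingCat.ofHom (r i)) ≫ (hU i).fromSpec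
  let p : ∀ i, Spec (CommRingCat.of L) ⟶ 𝒰.X i := fun i =>
    Spec.map (CommRingCat.ofHom (pull η (V i) (e i)))
  have hp : ∀ i, p i ≫ 𝒰.f i = η := fun i => specMap_pull_fromSpec η (hV i) (e i)
  have hg : ∀ i, p i ≫ g i = η' := by
    intro i
    rw [← specMap_pull_fromSpec η' (hU i) (e' i), ← hr i]
    change Spec.map _ ≫ Spec.map _ ≫ _ = _
    rw [← Category.assoc, ← Spec.map_comp]
    rfl
  -- the two restrictions to an overlap agree at the dominant point, hence agree
  have hglue : ∀ i j, pullback.fst (𝒰.f i) (𝒰.f j) ≫ g i = pullback.snd (𝒰.f i) (𝒰.f j) ≫ g j := by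
    intro i j
    let q : Spec (CommRingCat.of L) ⟶ pullback (𝒰.f i) (𝒰.f j) :=
      pullback.lift (p i) (p j) (by rw [hp, hp])
    have hq : q ≫ pullback.fst (𝒰.f i) (𝒰.f j) ≫ 𝒰.f i = η := by
      rw [← Category.assoc, pullback.lift_fst, hp]
    have : IsDominant (q ≫ pullback.fst (𝒰.f i) (𝒰.f j) ≫ 𝒰.f i) := by rw [hq]; infer_instance
    have : IsDominant q := isDominant_of_comp_isOpenImmersion q (pullback.fst _ _ ≫ 𝒰.f i)
    have : IsReduced (pullback (𝒰.f i) (𝒰.f j)) :=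
      isReduced_of_isOpenImmersion (pullback.fst _ _ ≫ 𝒰.f i)
    apply ext_of_isDominant q
    rw [← Category.assoc, ← Category.assoc, pullback.lift_fst, pullback.lift_snd, hg, hg]
  refine ⟨𝒰.glueMorphisms g hglue, ?_, ?_⟩
  · obtain ⟨i, -⟩ := hcov (ptOf η)
    have h1 : 𝒰.f i ≫ 𝒰.glueMorphisms g hglue = g i := 𝒰.ι_glueMorphisms g hglue i
    exact (congr($(hp i) ≫ 𝒰.glueMorphisms g hglue)).symm.trans
      ((Category.assoc _ _ _).trans ((congr(p i ≫ $h1)).trans (hg i)))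
  · intro i z hz
    rw [← SetLike.mem_coe, ← (hV i).range_fromSpec] at hz
    obtain ⟨y, rfl⟩ := hz
    have h1 : 𝒰.f i ≫ 𝒰.glueMorphisms g hglue = g i := 𝒰.ι_glueMorphisms g hglue i
    have h2 : (𝒰.glueMorphisms g hglue) (𝒰.f i y) = g i y :=
      (Scheme.Hom.comp_apply (𝒰.f i) _ y).symm.trans congr($h1 y)
    change (𝒰.glueMorphisms g hglue) (𝒰.f i y) ∈ U i
    rw [h2, ← SetLike.mem_coe, ← (hU i).range_fromSpec]
    exact ⟨Spec.map (CommRingCat.ofHom (r i)) y, (Scheme.Hom.comp_apply _ _ _).symm⟩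

/-- The stalks at the points of an affine chart are localizations of its ring of functions, hence
normal domains if that ring is integrally closed. -/
lemma isDomain_stalk_and_isIntegrallyClosed [IsReduced Z] [IsDominant η] {U : Z.Opens}
    (hU : IsAffineOpen U) (e : ⊤ ≤ η ⁻¹ᵁ U) {B : Subring L} (hB : (pull η U e).range = B)
    [IsIntegrallyClosed B] {z : Z} (hz : z ∈ U) :
    IsDomain (Z.presheaf.stalk z) ∧ IsIntegrallyClosed (Z.presheaf.stalk z) := by
  subst hB
  let E : Γ(Z, U) ≃+* (pull η U e).range :=
    RingEquiv.ofBijective (pull η U e).rangeRestrict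
      ⟨fun a b h => pull_injective (η := η) U e congr($h.1), (pull η U e).rangeRestrict_surjective⟩
  have h1 : IsDomain Γ(Z, U) := E.injective.isDomain
  have h2 : IsIntegrallyClosed Γ(Z, U) := IsIntegrallyClosed.of_equiv E.symm
  let _ := (Z.presheaf.germ U z hz).hom.toAlgebra
  have h3 : IsLocalization.AtPrime (Z.presheaf.stalk z) (hU.primeIdealOf ⟨z, hz⟩).asIdeal :=
    hU.isLocalization_stalk ⟨z, hz⟩
  exact ⟨IsLocalization.isDomain_of_le_nonZeroDivisors _
      (hU.primeIdealOf ⟨z, hz⟩).asIdeal.primeCompl_le_nonZeroDivisors,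
    isIntegrallyClosed_of_isLocalization _ _
      (hU.primeIdealOf ⟨z, hz⟩).asIdeal.primeCompl_le_nonZeroDivisors⟩

/-- Torsion-freeness of function rings gives flatness over a principal ideal domain. -/
lemma flat_of_charts {A : Type u} [CommRing A] [IsDomain A] [IsPrincipalIdealRing A] [Algebra A L]
    [IsReduced Z] [IsDominant η] {str : Z ⟶ Spec (CommRingCat.of A)}
    (hstr : η ≫ str = Spec.map (CommRingCat.ofHom (algebraMap A L)))
    (hA : Function.Injective (algebraMap A L)) {ι : Type}
    {V : ι → Z.Opens} (hV : ∀ i, IsAffineOpen (V i)) (hcov : ∀ z, ∃ i, z ∈ V i)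
    (e : ∀ i, ⊤ ≤ η ⁻¹ᵁ V i) : Flat str := by
  have : ∀ i, IsAffine ((chartCover hV hcov).X i) := fun i => inferInstanceAs (IsAffine (Spec _))
  refine HasRingHomProperty.of_source_openCover (P := @Flat.{u}) (chartCover hV hcov) fun i =>
    (HasRingHomProperty.iff_of_isAffine (P := @Flat.{u})).1 ?_
  change Flat ((hV i).fromSpec ≫ str)
  rw [← Spec.map_preimage ((hV i).fromSpec ≫ str), Flat.SpecMap_iff]
  have h1 : Spec.preimage ((hV i).fromSpec ≫ str) ≫ CommRingCat.ofHom (pull η (V i) (e i)) =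
      CommRingCat.ofHom (algebraMap A L) := by
    apply Spec.map_injective
    rw [Spec.map_comp, Spec.map_preimage, ← Category.assoc, specMap_pull_fromSpec η (hV i) (e i),
      hstr]
  generalize Spec.preimage ((hV i).fromSpec ≫ str) = r at h1
  let _ := r.hom.toAlgebra
  have h2 : Function.Injective (algebraMap A Γ(Z, V i)) := by
    have h3 : (pull η (V i) (e i)) ∘ (algebraMap A Γ(Z, V i)) = algebraMap A L :=
      funext fun a => congr($h1 a)
    exact Function.Injective.of_comp (h3 ▸ hA)
  have : IsDomain Γ(Z, V i) := (pull_injective (η := η) (V i) (e i)).isDomain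
  have : Module.IsTorsionFree A Γ(Z, V i) := Module.isTorsionFree_iff_algebraMap_injective.2 h2
  exact (inferInstance : Module.Flat A Γ(Z, V i))

end Glue

/-! ### Models from homogeneous coordinates -/

attribute [local instance] powerSeriesAlgebra

lemma IsProjective.isSeparated {R : Type u} [CommRing R] {X : Scheme.{u}}
    {f : X ⟶ Spec (CommRingCat.of R)} (hf : IsProjective f) : X.IsSeparated := by
  obtain ⟨n, i, hi, -⟩ := hf
  have h : (ProjSpace R n).IsSeparated := by
    delta ProjSpace; infer_instance
  have : IsSeparated (i ≫ terminal.from _) := inferInstance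
  rw [terminal.comp_from] at this
  exact ⟨this⟩

/-- The residue field of a point of a chart receives the ring of functions of the chart. -/
lemma ProjCharts.exists_evaluation {A : Type u} [CommRing A] {L : Type u} [Field L] [Algebra A L]
    {Z : Scheme.{u}} {η : Spec (CommRingCat.of L) ⟶ Z} [IsReduced Z] [IsDominant η]
    (C : ProjCharts A η) {b : C.ι} {w : Z} (hw : w ∈ C.U b) :
    ∃ ε : chartRing A C.x b →+* Z.residueField w,
      ∀ l, ε ⟨C.x l / C.x b, ratio_mem_chartRing b l⟩ ≠ 0 → w ∈ C.U l := by
  choose s hs using fun a : chartRing A C.x b => C.exists_pull b a.2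
  have hinj := pull_injective (η := η) (C.U b) (C.mem b)
  let σ : chartRing A C.x b →+* Γ(Z, C.U b) :=
    { toFun := s
      map_one' := hinj (by rw [hs, map_one]; rfl)
      map_mul' := fun _ _ => hinj (by rw [map_mul, hs, hs, hs]; rfl)
      map_zero' := hinj (by rw [hs, map_zero]; rfl)
      map_add' := fun _ _ => hinj (by rw [map_add, hs, hs, hs]; rfl) }
  refine ⟨(Z.evaluation (C.U b) w hw).hom.comp σ, fun l hl => ?_⟩
  have h1 : σ ⟨C.x l / C.x b, ratio_mem_chartRing b l⟩ = C.t b l :=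
    hinj ((hs _).trans (C.pull_t b l).symm)
  have h2 : Z.evaluation (C.U b) w hw (C.t b l) ≠ 0 := by rw [← h1]; exact hl
  rw [Scheme.evaluation_ne_zero_iff_mem_basicOpen, C.basicOpen_t] at h2
  exact h2.2

section Fiber

variable {k : Type u} [Field k]

/-- The inclusion of the generic point of the formal disc. -/
def specFrac (k : Type u) [Field k] :
    Spec (CommRingCat.of (LaurentSeries k)) ⟶ Spec (CommRingCat.of (PowerSeries k)) :=
  Spec.map (CommRingCat.ofHom (HahnSeries.ofPowerSeries ℤ k))

instance isOpenImmersion_specFrac : IsOpenImmersion (specFrac k) :=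
  IsOpenImmersion.of_isLocalization (S := LaurentSeries k) (PowerSeries.X : PowerSeries k)

/-- The uniformizer as a global function. -/
def unif (k : Type u) [Field k] : Γ(Spec (CommRingCat.of (PowerSeries k)), ⊤) :=
  (Scheme.ΓSpecIso (CommRingCat.of (PowerSeries k))).inv PowerSeries.X

lemma opensRange_specFrac : (specFrac k).opensRange =
    (Spec (CommRingCat.of (PowerSeries k))).basicOpen (unif k) := by
  have h : (Spec (CommRingCat.of (PowerSeries k))).basicOpen (unif k) = PrimeSpectrum.basicOpen
      (PowerSeries.X : PowerSeries k) := basicOpen_eq_of_affine _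
  rw [h]
  exact TopologicalSpace.Opens.ext (PrimeSpectrum.localization_away_comap_range (LaurentSeries k)
      (PowerSeries.X : PowerSeries k))

lemma pull_unif {L : Type u} [Field L] [Algebra (PowerSeries k) L] {M : Scheme.{u}}
    {str : M ⟶ Spec (CommRingCat.of (PowerSeries k))} {η : Spec (CommRingCat.of L) ⟶ M}
    (h : η ≫ str = Spec.map (CommRingCat.ofHom (algebraMap (PowerSeries k) L))) {U : M.Opens}
    (e : ⊤ ≤ η ⁻¹ᵁ U) :
    pull η U e (M.presheaf.map (homOfLE (le_top : U ≤ str ⁻¹ᵁ ⊤)).op (str.app ⊤ (unif k))) =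
      algebraMap (PowerSeries k) L PowerSeries.X := by
  refine (pull_map (U := str ⁻¹ᵁ ⊤) e (homOfLE le_top).op (str.app ⊤ (unif k))).trans ?_
  refine (pull_comp str ⊤ le_top (unif k)).trans ?_
  refine (pull_congr h _ le_top _).trans ?_
  rw [pull_specMap]
  have : (Scheme.ΓSpecIso (CommRingCat.of (PowerSeries k))).hom (unif k) = PowerSeries.X :=
    congr($((Scheme.ΓSpecIso (CommRingCat.of (PowerSeries k))).inv_hom_id) PowerSeries.X)
  rw [this]
  rfl

variable {L : Type u} [Field L] [Algebra (LaurentSeries k) L] {Y M : Scheme.{u}}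
  {f : Y ⟶ Spec (CommRingCat.of (LaurentSeries k))} {η : Spec (CommRingCat.of L) ⟶ Y}
  {str : M ⟶ Spec (CommRingCat.of (PowerSeries k))} {η' : Spec (CommRingCat.of L) ⟶ M}

/-- A scheme over the disc whose charts become those of `Y` after inverting the uniformizer has
generic fibre `Y`. The open set `D` below is the locus where the uniformizer is invertible; gluing
along charts gives mutually inverse morphisms between `Y` and `D`. -/
theorem exists_genericFiber
    (hη : η ≫ f = Spec.map (CommRingCat.ofHom (algebraMap (LaurentSeries k) L)))
    [IsReduced Y] [IsDominant η] [Y.IsSeparated]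
    (hη' : η' ≫ str = Spec.map (CommRingCat.ofHom (algebraMap (PowerSeries k) L)))
    [IsReduced M] [IsDominant η'] [M.IsSeparated] {ι : Type}
    {V : ι → Y.Opens} (hV : ∀ i, IsAffineOpen (V i)) (hVc : ∀ z, ∃ i, z ∈ V i)
    (e : ∀ i, ⊤ ≤ η ⁻¹ᵁ V i)
    {U : ι → M.Opens} (hU : ∀ i, IsAffineOpen (U i)) (hUc : ∀ z, ∃ i, z ∈ U i)
    (e' : ∀ i, ⊤ ≤ η' ⁻¹ᵁ U i)
    (hle : ∀ i s, ∃ t, pull η (V i) (e i) t = pull η' (U i) (e' i) s)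
    (hloc : ∀ i t, ∃ (n : ℕ) (s : _), pull η' (U i) (e' i) s =
      algebraMap (PowerSeries k) L PowerSeries.X ^ n * pull η (V i) (e i) t) :
    ∃ gen : Y ⟶ M, η ≫ gen = η' ∧ IsPullback gen f str (specFrac k) ∧
      ∀ i, gen ⁻¹ᵁ U i = V i := by
  obtain ⟨gen, hgen, hVU⟩ := exists_hom_of_charts (η' := η') hV hVc e hU e' hle
  have hϖ : algebraMap (PowerSeries k) L PowerSeries.X ≠ 0 := by
    have h1 : (algebraMap (LaurentSeries k) L) (HahnSeries.ofPowerSeries ℤ k PowerSeries.X) ≠ 0 :=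
      (map_ne_zero _).2 ((map_ne_zero_iff _ HahnSeries.ofPowerSeries_injective).2
        PowerSeries.X_ne_zero)
    exact h1
  have hw : gen ≫ str = f ≫ specFrac k := by
    apply ext_of_isDominant η
    rw [← Category.assoc, hgen, hη', ← Category.assoc, hη, specFrac, ← Spec.map_comp]
    rfl
  -- `D` is the generic fiber of `M`, the locus where the uniformizer is invertible
  let D : M.Opens := str ⁻¹ᵁ (specFrac k).opensRange
  let ϖ : ∀ i, Γ(M, U i) := fun i =>
    M.presheaf.map (homOfLE (le_top : U i ≤ str ⁻¹ᵁ ⊤)).op (str.app ⊤ (unif k))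
  have hpϖ : ∀ i, pull η' (U i) (e' i) (ϖ i) = algebraMap (PowerSeries k) L PowerSeries.X :=
    fun i => pull_unif hη' (e' i)
  have hW : ∀ i, M.basicOpen (ϖ i) = U i ⊓ D := by
    intro i
    have h1 : M.basicOpen (ϖ i) = U i ⊓ M.basicOpen (str.app ⊤ (unif k)) :=
      Scheme.basicOpen_res _ _ _
    rw [h1, ← Scheme.preimage_basicOpen, ← opensRange_specFrac]
  have hgD : ∀ y, gen y ∈ D := by
    intro y
    change str (gen y) ∈ (specFrac k).opensRange
    rw [← Scheme.Hom.comp_apply, hw, Scheme.Hom.comp_apply]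
    exact ⟨_, rfl⟩
  have hr : Set.range gen ⊆ Set.range D.ι := by
    rintro _ ⟨y, rfl⟩
    rw [Scheme.Opens.range_ι]
    exact hgD y
  let gen' : Y ⟶ D := IsOpenImmersion.lift D.ι gen hr
  have hg' : gen' ≫ D.ι = gen := IsOpenImmersion.lift_fac _ _ _
  let ηD : Spec (CommRingCat.of L) ⟶ D := η ≫ gen'
  have hηD : ηD ≫ D.ι = η' := by rw [Category.assoc, hg', hgen]
  have : IsDominant (ηD ≫ D.ι) := by rw [hηD]; infer_instance
  have : IsDominant ηD := isDominant_of_comp_isOpenImmersion ηD D.ι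
  have hWr : ∀ i, M.basicOpen (ϖ i) ≤ D.ι.opensRange := fun i => by
    rw [hW, Scheme.Opens.opensRange_ι]; exact inf_le_right
  have hWa : ∀ i, IsAffineOpen (D.ι ⁻¹ᵁ M.basicOpen (ϖ i)) := fun i =>
    ((hU i).basicOpen (ϖ i)).preimage_of_isOpenImmersion D.ι (hWr i)
  have heW : ∀ i, ⊤ ≤ ηD ⁻¹ᵁ (D.ι ⁻¹ᵁ M.basicOpen (ϖ i)) := by
    intro i
    rw [← Scheme.Hom.comp_preimage, top_le_preimage_iff, hηD,
      mem_basicOpen_iff_pull_ne_zero (e' i), hpϖ]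
    exact hϖ
  have heW' : ∀ i, ⊤ ≤ η' ⁻¹ᵁ M.basicOpen (ϖ i) := by
    intro i
    rw [top_le_preimage_iff, mem_basicOpen_iff_pull_ne_zero (e' i), hpϖ]
    exact hϖ
  have hDc : ∀ z : D, ∃ i, z ∈ D.ι ⁻¹ᵁ M.basicOpen (ϖ i) := by
    intro z
    obtain ⟨i, hi⟩ := hUc (D.ι z)
    refine ⟨i, ?_⟩
    rw [hW]
    exact ⟨hi, z.2⟩
  have hext : ∀ i s, ∃ t, pull ηD (D.ι ⁻¹ᵁ M.basicOpen (ϖ i)) (heW i) t =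
      pull η (V i) (e i) s := by
    intro i s
    obtain ⟨n, t, ht⟩ := hloc i s
    have h1 : IsSec η' (M.basicOpen (ϖ i)) (pull η (V i) (e i) s) := by
      have h2 := ((isSec_inv_pull (e' i) (ϖ i) (heW' i)).pow n).mul
        ((isSec_pull (e' i) t).mono (M.basicOpen_le _) (heW' i))
      rw [ht, hpϖ, ← mul_assoc, ← mul_pow, inv_mul_cancel₀ hϖ, one_pow, one_mul] at h2
      exact h2
    rw [← hηD] at h1
    obtain ⟨_, t', ht'⟩ := h1.of_comp
    exact ⟨t', ht'⟩
  obtain ⟨h, hh, hWV⟩ := exists_hom_of_charts (η := ηD) (η' := η) hWa hDc heW hV e hext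
  have i1 : gen' ≫ h = 𝟙 Y := by
    apply ext_of_isDominant η
    rw [← Category.assoc, hh, Category.comp_id]
  have : D.toScheme.IsSeparated := by
    have : IsSeparated (D.ι ≫ terminal.from M) := inferInstance
    rw [terminal.comp_from] at this
    exact ⟨this⟩
  have i2 : h ≫ gen' = 𝟙 (D : Scheme.{u}) := by
    apply ext_of_isDominant ηD
    rw [← Category.assoc, hh, Category.comp_id]
  have : IsIso gen' := ⟨h, i1, i2⟩
  have : IsOpenImmersion gen := by rw [← hg']; infer_instance
  refine ⟨gen, hgen, ?_, fun i => le_antisymm ?_ (hVU i)⟩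
  · refine (IsOpenImmersion.isPullback f gen (specFrac k) str hw ?_).flip
    refine TopologicalSpace.Opens.ext (Set.Subset.antisymm (fun x hx => ?_) ?_)
    · have h1 : h ≫ gen = D.ι := by rw [← hg', ← Category.assoc, i2, Category.id_comp]
      let x' : D.toScheme := ⟨x, hx⟩
      exact ⟨h x', (Scheme.Hom.comp_apply h gen x').symm.trans congr($h1 x')⟩
    · rintro _ ⟨y, rfl⟩
      exact hgD y
  · intro y hy
    have h1 : gen' y ∈ D.ι ⁻¹ᵁ M.basicOpen (ϖ i) := by
      change D.ι (gen' y) ∈ M.basicOpen (ϖ i)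
      rw [← Scheme.Hom.comp_apply, hg', hW]
      exact ⟨hy, hgD y⟩
    have h2 := hWV i h1
    change h (gen' y) ∈ V i at h2
    rwa [← Scheme.Hom.comp_apply, i1] at h2

/-- A model of `Y` with prescribed homogeneous coordinates `z`: the distinguished charts `β i` are
required to cover, to have integrally closed rings and to become the charts of `Y` after inverting
the uniformizer. -/
theorem exists_model
    (hη : η ≫ f = Spec.map (CommRingCat.ofHom (algebraMap (LaurentSeries k) L)))
    [IsReduced Y] [IsDominant η] [Y.IsSeparated] (C : ProjCharts (LaurentSeries k) η)
    {κ : Type} [Fintype κ] (z : κ → L) (hz : ∀ b, z b ≠ 0) (β : C.ι → κ)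
    (hcov : ∀ (b : κ) (F : Type u) [Field F] (ε : chartRing (PowerSeries k) z b →+* F),
      ∃ i, ε ⟨z (β i) / z b, ratio_mem_chartRing b (β i)⟩ ≠ 0)
    (hle : ∀ i, ∀ a ∈ chartRing (PowerSeries k) z (β i), a ∈ chartRing (LaurentSeries k) C.x i)
    (hloc : ∀ i, ∀ a ∈ chartRing (LaurentSeries k) C.x i, ∃ n : ℕ,
      algebraMap (PowerSeries k) L PowerSeries.X ^ n * a ∈ chartRing (PowerSeries k) z (β i))
    (hic : ∀ i, IsIntegrallyClosed (chartRing (PowerSeries k) z (β i)).toSubring) :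
    ∃ (M : Model f) (U : C.ι → M.scheme.Opens) (e : ∀ i, ⊤ ≤ (η ≫ M.gen) ⁻¹ᵁ U i),
      (∀ i, IsAffineOpen (U i)) ∧ (⨆ i, U i = ⊤) ∧ (∀ i, M.gen ⁻¹ᵁ U i = C.U i) ∧
      ∀ i, (pull (η ≫ M.gen) (U i) (e i)).range =
        (chartRing (PowerSeries k) z (β i)).toSubring := by
  obtain ⟨i0, -⟩ := C.cover (ptOf η) specializes_rfl
  have : Nonempty κ := ⟨β i0⟩
  obtain ⟨M, str, η', C', e, hproj, hred, hdom, hη', hx⟩ :=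
    exists_projective_of_coord (A := PowerSeries k) z hz
  let C'' : ProjCharts (PowerSeries k) η' := C'.reindex e z hz (fun j l => by rw [hx, hx])
  let U : C.ι → M.Opens := fun i => C''.U (β i)
  have hUc : ∀ w, ∃ i, w ∈ U i := by
    intro w
    obtain ⟨b, hb⟩ := C''.cover w (ptOf_specializes w)
    obtain ⟨ε, hε⟩ := C''.exists_evaluation hb
    obtain ⟨i, hi⟩ := hcov b _ ε
    exact ⟨i, hε (β i) hi⟩
  have hsep := hproj.isSeparated
  have hUa : ∀ i, IsAffineOpen (U i) := fun i => C''.affine _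
  have hr : ∀ i, (pull η' (U i) (C''.mem (β i))).range =
      (chartRing (PowerSeries k) z (β i)).toSubring := fun i => C''.range_pull (β i)
  obtain ⟨gen, hgen, hpb, hgU⟩ := exists_genericFiber hη hη' C.affine
    (fun y => C.cover y (ptOf_specializes y)) C.mem hUa hUc (fun i => C''.mem (β i))
    (fun i s => C.exists_pull i (hle i _ (C''.pull_mem (β i) s)))
    (fun i t => by
      obtain ⟨n, hn⟩ := hloc i _ (C.pull_mem i t)
      obtain ⟨s, hs⟩ := C''.exists_pull (β i) hn
      exact ⟨n, s, hs⟩)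
  subst hgen
  have hflat : Flat str := flat_of_charts hη' ((algebraMap (LaurentSeries k) L).injective.comp
    HahnSeries.ofPowerSeries_injective) hUa hUc (fun i => C''.mem (β i))
  have hnorm : IsNormalScheme M := fun w => by
    obtain ⟨i, hi⟩ := hUc w
    have := hic i
    exact isDomain_stalk_and_isIntegrallyClosed (hUa i) (C''.mem (β i)) (hr i) hi
  refine ⟨⟨M, str, hnorm, hflat, hproj, gen, hpb⟩, U, fun i => C''.mem (β i), hUa, ?_, hgU, hr⟩
  rw [eq_top_iff]
  intro w _
  exact TopologicalSpace.Opens.mem_iSup.2 (hUc w)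

end Fiber

/-! ### Coordinates with integrally closed charts -/

section Veronese

variable {A K : Type u} [CommRing A] [CommRing K] {L : Type u} [Field L] [Algebra A L] [Algebra K L]
  {ι : Type} (y : ι → L)

variable (A K) in
/-- `Z` is a form of degree `m` over `K` that is integral over the graded ring of forms over `A`:
it satisfies a homogeneous monic equation. -/
def IsIntegralForm (m : ℕ) (Z : L) : Prop :=
  Z ∈ forms K y m ∧ ∃ (t : ℕ) (b : ℕ → L), Z ^ t = ∑ s ∈ Finset.range t, b s * Z ^ s ∧
    ∀ s ∈ Finset.range t, b s ∈ forms A y (m * (t - s))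

variable {y} (hy : ∀ i, y i ≠ 0)
include hy

/-- Homogenization of an integral element of a chart: multiplication by a large power of the
coordinate clears the denominators in the integral equation. -/
lemma exists_isIntegralForm (i : ι) {g : L} (hg : g ∈ chartRing K y i)
    (hint : IsIntegral (chartRing A y i) g) :
    ∃ m₀, ∀ m, m₀ ≤ m → IsIntegralForm A K y m (y i ^ m * g) := by
  obtain ⟨q₁, hq₁⟩ := exists_mul_pow_mem_forms hy i hg
  obtain ⟨p, hp, hpg⟩ := hint
  obtain ⟨q₂, hq₂⟩ := exists_mul_pow_mem_forms_of_finset hy (Finset.range p.natDegree)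
    (fun _ => i) (fun s => -(p.coeff s : L)) (fun s _ => neg_mem (p.coeff s).2)
  have h1 : g ^ p.natDegree = ∑ s ∈ Finset.range p.natDegree, -(p.coeff s : L) * g ^ s := by
    rw [Polynomial.eval₂_eq_sum_range, Finset.sum_range_succ, hp.coeff_natDegree, map_one,
      one_mul] at hpg
    rw [eq_neg_of_add_eq_zero_right hpg, ← Finset.sum_neg_distrib]
    refine Finset.sum_congr rfl fun s _ => ?_
    rw [neg_mul]; rfl
  refine ⟨max q₁ q₂, fun m hm => ⟨?_, p.natDegree,
    fun s => -(p.coeff s : L) * y i ^ (m * (p.natDegree - s)), ?_, fun s hs => ?_⟩⟩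
  · rw [mul_comm]; exact hq₁ m ((le_max_left _ _).trans hm)
  · beta_reduce
    rw [mul_pow, h1, Finset.mul_sum]
    refine Finset.sum_congr rfl fun s hs => ?_
    obtain ⟨r, hr⟩ := Nat.exists_eq_add_of_lt (Finset.mem_range.1 hs)
    rw [hr, show s + r + 1 - s = r + 1 by omega]
    ring
  · refine hq₂ _ ?_ s hs
    have h2 := Finset.mem_range.1 hs
    have h3 : m * 1 ≤ m * (p.natDegree - s) := Nat.mul_le_mul_left _ (by omega)
    have := (le_max_right q₁ q₂).trans hm
    omega

omit [CommRing K] [Algebra K L] in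
/-- Dehomogenization of an integral form. -/
lemma isIntegral_div_of_eq (i : ι) {m t : ℕ} {Z : L} {b : ℕ → L}
    (h : Z ^ t = ∑ s ∈ Finset.range t, b s * Z ^ s)
    (hb : ∀ s ∈ Finset.range t, b s ∈ forms A y (m * (t - s))) :
    IsIntegral (chartRing A y i) (Z / y i ^ m) := by
  have hb' : ∀ s, ∃ c : chartRing A y i, s ∈ Finset.range t →
      (c : L) = b s / y i ^ (m * (t - s)) := by
    intro s
    by_cases hs : s ∈ Finset.range t
    · exact ⟨⟨_, div_mem_chartRing i (hb s hs)⟩, fun _ => rfl⟩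
    · exact ⟨0, fun h => absurd h hs⟩
  choose c hc using hb'
  refine ⟨Polynomial.X ^ t - ∑ s ∈ Finset.range t, Polynomial.C (c s) * Polynomial.X ^ s, ?_, ?_⟩
  · refine Polynomial.monic_X_pow_sub ?_
    rw [← Fin.sum_univ_eq_sum_range (fun s => Polynomial.C (c s) * Polynomial.X ^ s) t]
    exact Polynomial.degree_sum_fin_lt _
  · rw [Polynomial.eval₂_sub, Polynomial.eval₂_pow, Polynomial.eval₂_X, Polynomial.eval₂_finsetSum,
      sub_eq_zero, div_pow, h, Finset.sum_div]
    refine Finset.sum_congr rfl fun s hs => ?_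
    rw [Polynomial.eval₂_mul, Polynomial.eval₂_C, Polynomial.eval₂_pow, Polynomial.eval₂_X]
    have h1 : algebraMap (chartRing A y i) L (c s) = b s / y i ^ (m * (t - s)) := hc s hs
    obtain ⟨r, rfl⟩ := Nat.exists_eq_add_of_lt (Finset.mem_range.1 hs)
    rw [h1, show s + r + 1 - s = r + 1 by omega, div_pow]
    have := hy i
    field_simp
    ring

omit hy in
lemma forms_le_span_monomials [Fintype ι] (m : ℕ) :
    forms A y m ≤ Submodule.span A (Set.range fun s : Fin m → ι => ∏ t, y (s t)) := by
  induction m with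
  | zero =>
    rw [forms, pow_zero, Submodule.one_le]
    exact Submodule.subset_span ⟨Fin.elim0, by simp⟩
  | succ m ih =>
    rw [forms, pow_succ']
    refine Submodule.mul_le.2 fun a ha b hb => ?_
    replace hb := ih hb
    refine Submodule.span_induction₂ (p := fun a b _ _ => a * b ∈ Submodule.span A
      (Set.range fun s : Fin (m + 1) → ι => ∏ t, y (s t))) ?_ ?_ ?_ ?_ ?_ ?_ ?_ ha hb
    · rintro _ _ ⟨l, rfl⟩ ⟨s, rfl⟩
      exact Submodule.subset_span ⟨Fin.cons l s, by simp [Fin.prod_univ_succ]⟩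
    · intro b _; rw [zero_mul]; exact zero_mem _
    · intro b _; rw [mul_zero]; exact zero_mem _
    · intro _ _ _ _ _ _ h1 h2; rw [add_mul]; exact add_mem h1 h2
    · intro _ _ _ _ _ _ h1 h2; rw [mul_add]; exact add_mem h1 h2
    · intro r _ _ _ _ h; rw [smul_mul_assoc]; exact Submodule.smul_mem _ _ h
    · intro r _ _ _ _ h; rw [mul_smul_comm]; exact Submodule.smul_mem _ _ h

omit hy in
/-- If the monomials of degree `m` vanish at a point of the chart `Z ≠ 0`, so do all forms of
degree `m n` with `0 < n`. -/
lemma eval_forms_eq_zero [Fintype ι] {m : ℕ} {κ : Type} {z : κ → L} {b : κ}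
    {μ : (Fin m → ι) → κ} (hμ : ∀ s, z (μ s) = ∏ t, y (s t)) {F : Type u} [Field F]
    (ε : chartRing A z b →+* F)
    (hε : ∀ s, ε ⟨z (μ s) / z b, ratio_mem_chartRing b (μ s)⟩ = 0) (n : ℕ) {P : L}
    (hP : P ∈ forms A y (m * (n + 1))) :
    ∃ h : P / z b ^ (n + 1) ∈ chartRing A z b, ε ⟨_, h⟩ = 0 := by
  have hm1 : forms A y m ≤ Submodule.span A (Set.range z) := by
    refine (forms_le_span_monomials m).trans (Submodule.span_mono ?_)
    rintro _ ⟨s, rfl⟩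
    exact ⟨μ s, hμ s⟩
  have hmn : ∀ n, forms A y (m * n) ≤ forms A z n := fun n => by
    rw [forms, pow_mul]; exact pow_le_pow_left' hm1 n
  have h1 : ∀ Q ∈ forms A y m, ∃ h : Q / z b ∈ chartRing A z b, ε ⟨_, h⟩ = 0 := by
    intro Q hQ
    replace hQ := forms_le_span_monomials m hQ
    induction hQ using Submodule.span_induction with
    | mem x hx =>
      obtain ⟨s, rfl⟩ := hx
      beta_reduce
      rw [← hμ]
      exact ⟨_, hε s⟩
    | zero => exact ⟨by rw [zero_div]; exact zero_mem _, by
        rw [← map_zero ε]; congr 1; exact Subtype.ext (zero_div _)⟩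
    | add x y _ _ hx hy =>
      obtain ⟨hx, hx'⟩ := hx
      obtain ⟨hy, hy'⟩ := hy
      refine ⟨by rw [add_div]; exact add_mem hx hy, ?_⟩
      rw [← add_zero (0 : F)]
      nth_rw 1 [← hx']
      rw [← hy', ← map_add]
      congr 1
      exact Subtype.ext (add_div _ _ _)
    | smul a x _ hx =>
      obtain ⟨hx, hx'⟩ := hx
      refine ⟨by rw [smul_div_assoc]; exact Subalgebra.smul_mem _ hx a, ?_⟩
      have : (⟨a • x / z b, by rw [smul_div_assoc]; exact Subalgebra.smul_mem _ hx a⟩ :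
          chartRing A z b) = algebraMap A _ a * ⟨_, hx⟩ := Subtype.ext (by
        change a • x / z b = algebraMap A L a * (x / z b)
        rw [smul_div_assoc, Algebra.smul_def])
      rw [this, map_mul, hx', mul_zero]
  have hP' : P ∈ forms A y (m * n) * forms A y m := by
    rw [forms, forms, ← pow_add, ← mul_add_one]; exact hP
  refine Submodule.mul_induction_on hP' ?_ ?_
  · intro Q hQ Q' hQ'
    obtain ⟨h2, h3⟩ := h1 Q' hQ'
    have h4 := div_mem_chartRing b (hmn n hQ)
    have e : Q * Q' / z b ^ (n + 1) = (Q / z b ^ n) * (Q' / z b) := by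
      rw [pow_succ, mul_div_mul_comm]
    refine ⟨by rw [e]; exact mul_mem h4 h2, ?_⟩
    have : (⟨Q * Q' / z b ^ (n + 1), by rw [e]; exact mul_mem h4 h2⟩ : chartRing A z b) =
        ⟨_, h4⟩ * ⟨_, h2⟩ := Subtype.ext e
    rw [this, map_mul, h3, mul_zero]
  · rintro Q Q' ⟨h2, h3⟩ ⟨h4, h5⟩
    refine ⟨by rw [add_div]; exact add_mem h2 h4, ?_⟩
    have : (⟨(Q + Q') / z b ^ (n + 1), by rw [add_div]; exact add_mem h2 h4⟩ : chartRing A z b) =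
        ⟨_, h2⟩ + ⟨_, h4⟩ := Subtype.ext (add_div _ _ _)
    rw [this, map_add, h3, h5, add_zero]

/-- Coordinates of a model all of whose distinguished charts `y i ^ m ≠ 0` have as ring the integral
closure of `chartRing A y i` in `chartRing K y i`: all monomials of degree `m` together with the
products of `y i ^ m` with generators `G i` of the integral closure. These charts cover: where all
`y i ^ m` vanish, all monomials vanish, and so do all forms integral over them. -/
theorem exists_normal_coord [Fintype ι] [Nonempty ι]
    (hAK : ∀ a : A, ∃ c : K, algebraMap K L c = algebraMap A L a) (G : ι → Finset L)
    (hG : ∀ i, ∀ g ∈ G i, g ∈ chartRing K y i)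
    (hGint : ∀ i, ∀ g ∈ G i, IsIntegral (chartRing A y i) g)
    (hGgen : ∀ i, ∀ a ∈ chartRing K y i, IsIntegral (chartRing A y i) a →
      a ∈ Algebra.adjoin A (Set.range (fun l => y l / y i) ∪ (G i : Set L))) :
    ∃ (κ : Type) (_ : Fintype κ) (z : κ → L) (β : ι → κ), (∀ b, z b ≠ 0) ∧
      (∀ (b : κ) (F : Type u) [Field F] (ε : chartRing A z b →+* F),
        ∃ i, ε ⟨z (β i) / z b, ratio_mem_chartRing b (β i)⟩ ≠ 0) ∧
      ∀ i a, a ∈ chartRing A z (β i) ↔ a ∈ chartRing K y i ∧ IsIntegral (chartRing A y i) a := by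
  classical
  have hm : ∃ m₀, ∀ m, m₀ ≤ m → ∀ i, ∀ g ∈ G i, IsIntegralForm A K y m (y i ^ m * g) := by
    choose! q hq using fun i g (hg : g ∈ G i) =>
      exists_isIntegralForm hy i (hG i g hg) (hGint i g hg)
    refine ⟨Finset.univ.sup fun i => (G i).sup (q i), fun m hm i g hg => hq i g hg m ?_⟩
    exact (Finset.le_sup hg).trans ((Finset.le_sup (f := fun i => (G i).sup (q i))
      (Finset.mem_univ i)).trans hm)
  obtain ⟨m₀, hm₀⟩ := hm
  let m := m₀ + 1
  have hint : ∀ i, ∀ g ∈ G i, IsIntegralForm A K y m (y i ^ m * g) := hm₀ m (Nat.le_succ _)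
  let G' : ι → Finset L := fun i => (G i).filter (· ≠ 0)
  -- the new coordinates are the monomials of degree `m` in `y` and the products `y i ^ m * g` with
  -- `0 ≠ g ∈ G i`
  let κ := (Fin m → ι) ⊕ (Σ i, Fin (G' i).card)
  let γ : ∀ i, Fin (G' i).card → L := fun i j => ((G' i).equivFin.symm j : L)
  have hγ : ∀ i j, γ i j ∈ G i ∧ γ i j ≠ 0 := fun i j =>
    Finset.mem_filter.1 ((G' i).equivFin.symm j).2
  let z : κ → L := Sum.elim (fun s => ∏ t, y (s t)) (fun p => y p.1 ^ m * γ p.1 p.2)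
  let β : ι → κ := fun i => Sum.inl fun _ => i
  have hβ : ∀ i, z (β i) = y i ^ m := fun i => by
    change ∏ t : Fin m, y i = _
    rw [Finset.prod_const, Finset.card_univ, Fintype.card_fin]
  have hinl : ∀ s : Fin m → ι, z (Sum.inl s) = ∏ t, y (s t) := fun s => rfl
  have hmono : ∀ (B : Type u) [CommRing B] [Algebra B L] (s : Fin m → ι),
      ∏ t, y (s t) ∈ forms B y m := fun B _ _ s => by
    have := prod_mem_forms (A := B) (x := y) Finset.univ (fun _ : Fin m => 1) (fun t => y (s t))
      (fun t _ => coord_mem_forms _)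
    simpa using this
  have hz0 : ∀ b, z b ≠ 0 := by
    rintro (s | p)
    · exact Finset.prod_ne_zero_iff.2 fun t _ => hy _
    · exact mul_ne_zero (pow_ne_zero _ (hy _)) (hγ _ _).2
  refine ⟨κ, inferInstance, z, β, hz0, ?_, ?_⟩
  · intro b F _ ε
    by_contra! hcon
    -- the `m`-th power of a monomial of degree `m` is a product of the powers `y i ^ m`
    have h1 : ∀ s : Fin m → ι, ε ⟨z (Sum.inl s) / z b, ratio_mem_chartRing b _⟩ = 0 := by
      intro s
      rw [← pow_eq_zero_iff (n := m) (by omega), ← map_pow]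
      have e : (⟨z (Sum.inl s) / z b, ratio_mem_chartRing b _⟩ : chartRing A z b) ^ m =
          ∏ t, ⟨z (β (s t)) / z b, ratio_mem_chartRing b _⟩ := by
        apply Subtype.ext
        rw [SubmonoidClass.coe_pow, SubmonoidClass.coe_finsetProd]
        simp only [hβ, hinl]
        rw [Finset.prod_div_distrib, Finset.prod_pow, Finset.prod_const, Finset.card_univ,
          Fintype.card_fin, div_pow]
      rw [e, map_prod]
      exact Finset.prod_eq_zero (Finset.mem_univ 0) (hcon _)
    rcases b with s | ⟨i, j⟩
    · have e : (⟨z (Sum.inl s) / z (Sum.inl s), ratio_mem_chartRing _ _⟩ :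
          chartRing A z (Sum.inl s)) = 1 := Subtype.ext (div_self (hz0 _))
      have h2 := h1 s
      rw [e, map_one] at h2
      exact one_ne_zero h2
    -- divided by `Z ^ t`, the integral equation of the form `Z` writes `1` as a sum of elements that
    -- `ε` maps to zero
    · obtain ⟨-, t, b, hb, hbf⟩ := hint i _ (hγ i j).1
      set Z := z (Sum.inr ⟨i, j⟩) with hZ
      have hZ' : y i ^ m * γ i j = Z := rfl
      rw [hZ'] at hb
      have hterm : ∀ s ∈ Finset.range t, ∃ h : b s / Z ^ (t - s) ∈ chartRing A z (Sum.inr ⟨i, j⟩),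
          ε ⟨_, h⟩ = 0 := by
        intro s hs
        obtain ⟨r, rfl⟩ := Nat.exists_eq_add_of_lt (Finset.mem_range.1 hs)
        have h3 := hbf s hs
        rw [show s + r + 1 - s = r + 1 by omega] at h3 ⊢
        exact eval_forms_eq_zero (μ := Sum.inl) hinl ε h1 r h3
      have hsum : ∀ S ⊆ Finset.range t, ∃ h : ∑ s ∈ S, b s / Z ^ (t - s) ∈
          chartRing A z (Sum.inr ⟨i, j⟩), ε ⟨_, h⟩ = 0 := by
        intro S hS
        induction S using Finset.induction_on with
        | empty =>
          exact ⟨by rw [Finset.sum_empty]; exact zero_mem _, by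
            rw [← map_zero ε]; congr 1⟩
        | insert a S ha ih =>
          obtain ⟨h4, h5⟩ := ih ((Finset.subset_insert _ _).trans hS)
          obtain ⟨h6, h7⟩ := hterm a (hS (Finset.mem_insert_self _ _))
          refine ⟨by rw [Finset.sum_insert ha]; exact add_mem h6 h4, ?_⟩
          have e : (⟨∑ s ∈ insert a S, b s / Z ^ (t - s),
              by rw [Finset.sum_insert ha]; exact add_mem h6 h4⟩ :
              chartRing A z (Sum.inr ⟨i, j⟩)) = ⟨_, h6⟩ + ⟨_, h4⟩ :=
            Subtype.ext (Finset.sum_insert ha)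
          rw [e, map_add, h5, h7, add_zero]
      obtain ⟨h8, h9⟩ := hsum _ (Finset.Subset.refl _)
      have e : (⟨_, h8⟩ : chartRing A z (Sum.inr ⟨i, j⟩)) = 1 := by
        apply Subtype.ext
        change ∑ s ∈ Finset.range t, b s / Z ^ (t - s) = 1
        have hZ0 : Z ≠ 0 := hz0 _
        rw [← div_self (pow_ne_zero t hZ0), congr($hb / Z ^ t), Finset.sum_div]
        refine Finset.sum_congr rfl fun s hs => ?_
        rw [div_eq_div_iff (pow_ne_zero _ hZ0) (pow_ne_zero _ hZ0), mul_assoc, ← pow_add]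
        congr 2
        have := Finset.mem_range.1 hs
        omega
      rw [e, map_one] at h9
      exact one_ne_zero h9
  · intro i a
    constructor
    · intro ha
      let S : Subalgebra A L :=
        { carrier := {a | a ∈ chartRing K y i ∧ IsIntegral (chartRing A y i) a}
          mul_mem' := fun h1 h2 => ⟨mul_mem h1.1 h2.1, h1.2.mul h2.2⟩
          add_mem' := fun h1 h2 => ⟨add_mem h1.1 h2.1, h1.2.add h2.2⟩
          algebraMap_mem' := fun a => by
            refine ⟨?_, isIntegral_algebraMap (x := algebraMap A (chartRing A y i) a)⟩
            obtain ⟨c, hc⟩ := hAK a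
            rw [← hc]; exact Subalgebra.algebraMap_mem _ c }
      refine (Algebra.adjoin_le ?_ : chartRing A z (β i) ≤ S) ha
      rintro _ ⟨b, rfl⟩
      change z b / z (β i) ∈ chartRing K y i ∧ IsIntegral (chartRing A y i) (z b / z (β i))
      rw [hβ]
      rcases b with s | ⟨l, j⟩
      · exact ⟨div_mem_chartRing i (hmono K s),
          isIntegral_algebraMap (x := (⟨_, div_mem_chartRing i (hmono A s)⟩ : chartRing A y i))⟩
      · obtain ⟨h1, t, b, hb, hbf⟩ := hint l _ (hγ l j).1
        exact ⟨div_mem_chartRing i h1, isIntegral_div_of_eq hy i hb hbf⟩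
    · rintro ⟨h1, h2⟩
      refine (Algebra.adjoin_le ?_ : _ ≤ chartRing A z (β i)) (hGgen i a h1 h2)
      rintro g (⟨l, rfl⟩ | hg)
      · have h3 := ratio_mem_chartRing (A := A) (x := z) (β i)
          (Sum.inl (Fin.cons l fun _ => i : Fin (m₀ + 1) → ι))
        rw [hβ, hinl] at h3
        have e : (∏ t : Fin m, y ((Fin.cons l fun _ => i : Fin (m₀ + 1) → ι) t)) / y i ^ m =
            y l / y i := by
          have e1 : ∏ t : Fin (m₀ + 1), y ((Fin.cons l fun _ => i : Fin (m₀ + 1) → ι) t) =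
              y l * y i ^ m₀ := by
            rw [Fin.prod_univ_succ]
            simp only [Fin.cons_zero, Fin.cons_succ, Finset.prod_const, Finset.card_univ,
              Fintype.card_fin]
          refine congr($e1 / y i ^ (m₀ + 1)).trans ?_
          rw [pow_succ', mul_div_mul_right _ _ (pow_ne_zero _ (hy i))]
        rwa [e] at h3
      · by_cases h0 : g = 0
        · rw [h0]; exact zero_mem _
        have hg' : g ∈ G' i := Finset.mem_filter.2 ⟨hg, h0⟩
        have h3 := ratio_mem_chartRing (A := A) (x := z) (β i)
          (Sum.inr ⟨i, (G' i).equivFin ⟨g, hg'⟩⟩)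
        have e : z (Sum.inr ⟨i, (G' i).equivFin ⟨g, hg'⟩⟩) = y i ^ m * g := by
          change y i ^ m * (((G' i).equivFin.symm ((G' i).equivFin ⟨g, hg'⟩) : G' i) : L) = _
          rw [Equiv.symm_apply_apply]
        rwa [e, hβ, mul_div_cancel_left₀ _ (pow_ne_zero _ (hy i))] at h3

end Veronese

/-! ### Smooth varieties have integrally closed charts -/

section SmoothNormal

open TensorProduct

/-- An étale domain over an integrally closed domain is integrally closed: étale base change
commutes with the formation of integral closures. -/
lemma isIntegrallyClosed_of_etale (P S : Type u) [CommRing P] [IsDomain P] [IsIntegrallyClosed P]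
    [CommRing S] [IsDomain S] [Algebra P S] [Algebra.Etale P S] : IsIntegrallyClosed S := by
  let F := FractionRing P
  have hflat : Module.Flat P S := inferInstance
  have hinj : Function.Injective (algebraMap P S) := by
    rw [injective_iff_map_eq_zero]
    intro a ha
    by_contra h0
    exact RingHom.Flat.map_ne_zero (φ := algebraMap P S)
      (RingHom.flat_algebraMap_iff.2 hflat)
      (mem_nonZeroDivisors_of_ne_zero h0) one_ne_zero ha
  let M := Algebra.algebraMapSubmonoid S (nonZeroDivisors P)
  have hM : M ≤ nonZeroDivisors S := by
    rintro _ ⟨a, ha, rfl⟩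
    exact mem_nonZeroDivisors_of_ne_zero ((map_ne_zero_iff _ hinj).2 (nonZeroDivisors.ne_zero ha))
  have hloc : IsLocalization M (S ⊗[P] F) := inferInstance
  have hdom : IsDomain (S ⊗[P] F) := IsLocalization.isDomain_of_le_nonZeroDivisors _ hM
  have hfin : Module.Finite F (F ⊗[P] S) := Algebra.FormallyUnramified.finite_of_free F _
  have hdom' : IsDomain (F ⊗[P] S) := (Algebra.TensorProduct.comm P F S).injective.isDomain
  have hfield' : IsField (F ⊗[P] S) := isField_of_isIntegral_of_isField' (Field.toIsField F)
  have hfield : IsField (S ⊗[P] F) :=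
    MulEquiv.isField hfield' (Algebra.TensorProduct.comm P S F).toMulEquiv
  let _ : Field (S ⊗[P] F) := hfield.toField
  have hfaith : FaithfulSMul S (S ⊗[P] F) := by
    rw [faithfulSMul_iff_algebraMap_injective]
    exact IsLocalization.injective _ hM
  have hfrac : IsFractionRing S (S ⊗[P] F) := by
    refine IsFractionRing.of_field _ _ fun z => ?_
    obtain ⟨a, b, rfl⟩ := IsLocalization.exists_mk'_eq M z
    refine ⟨a, b, ?_⟩
    rw [eq_div_iff, IsLocalization.mk'_spec]
    exact (map_ne_zero_iff _ (IsLocalization.injective _ hM)).2 (nonZeroDivisors.ne_zero (hM b.2))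
  rw [isIntegrallyClosed_iff (S ⊗[P] F)]
  intro x hx
  obtain ⟨w, hw⟩ := (TensorProduct.toIntegralClosure_bijective_of_smooth (R := P) (S := S)
    (B := F)).2 ⟨x, hx⟩
  have key : ∀ w : S ⊗[P] integralClosure P F, ∃ y, algebraMap S (S ⊗[P] F) y =
      (TensorProduct.toIntegralClosure P S F w : S ⊗[P] F) := by
    intro w
    induction w with
    | zero => exact ⟨0, by simp⟩
    | add x y hx hy =>
      obtain ⟨a, ha⟩ := hx
      obtain ⟨b, hb⟩ := hy
      exact ⟨a + b, by rw [map_add, map_add, ha, hb]; rfl⟩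
    | tmul s c =>
      obtain ⟨p, hp⟩ := IsIntegrallyClosed.isIntegral_iff.1 c.2
      refine ⟨p • s, ?_⟩
      change (p • s) ⊗ₜ[P] (1 : F) = s ⊗ₜ (c : F)
      rw [← hp, TensorProduct.smul_tmul, Algebra.smul_def, mul_one]
  obtain ⟨y, hy⟩ := key w
  exact ⟨y, by rw [hy, hw]⟩

/-- Smooth domains over a field are integrally closed. -/
lemma isIntegrallyClosed_of_smooth (F S : Type u) [Field F] [CommRing S] [IsDomain S] [Algebra F S]
    [Algebra.Smooth F S] : IsIntegrallyClosed S := by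
  refine IsIntegrallyClosed.of_localization_maximal fun p _ hp => ?_
  obtain ⟨f, hf, n, _, _, _⟩ := Algebra.IsSmoothAt.exists_isStandardEtale_mvPolynomial
    (R := F) (p := p)
  have hf0 : Submonoid.powers f ≤ nonZeroDivisors S := by
    refine powers_le_nonZeroDivisors_of_noZeroDivisors ?_
    rintro rfl; exact hf p.zero_mem
  have hdom : IsDomain (Localization.Away f) := IsLocalization.isDomain_of_le_nonZeroDivisors _ hf0
  have hic := isIntegrallyClosed_of_etale (MvPolynomial (Fin n) F) (Localization.Away f)
  have hle : Submonoid.powers f ≤ p.primeCompl := by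
    rw [Submonoid.powers_le]; exact hf
  let _ := IsLocalization.localizationAlgebraOfSubmonoidLe (Localization.Away f)
    (Localization.AtPrime p) _ _ hle
  have := IsLocalization.localization_isScalarTower_of_submonoid_le (Localization.Away f)
    (Localization.AtPrime p) _ _ hle
  have hloc := IsLocalization.isLocalization_of_submonoid_le (Localization.Away f)
    (Localization.AtPrime p) _ _ hle
  refine isIntegrallyClosed_of_isLocalization (R := Localization.Away f) _
    (p.primeCompl.map (algebraMap S (Localization.Away f))) ?_
  rintro _ ⟨a, ha, rfl⟩
  refine mem_nonZeroDivisors_of_ne_zero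
    ((map_ne_zero_iff _ (IsLocalization.injective _ hf0)).2 ?_)
  rintro rfl
  exact ha p.zero_mem

/-- The rings of functions of affine charts of a smooth variety are integrally closed. -/
lemma isIntegrallyClosed_range_pull {F L : Type u} [Field F] [Field L] {Z : Scheme.{u}}
    (str : Z ⟶ Spec (CommRingCat.of F)) [Smooth str] [IsReduced Z]
    (η : Spec (CommRingCat.of L) ⟶ Z) [IsDominant η] {U : Z.Opens} (hU : IsAffineOpen U)
    (e : ⊤ ≤ η ⁻¹ᵁ U) : IsIntegrallyClosed (pull η U e).range := by
  have hinj := pull_injective (η := η) U e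
  have hdom : IsDomain Γ(Z, U) := hinj.isDomain (pull η U e)
  have hF : IsField Γ(Spec (CommRingCat.of F), ⊤) :=
    MulEquiv.isField (Field.toIsField F)
      (Scheme.ΓSpecIso (CommRingCat.of F)).commRingCatIsoToRingEquiv.toMulEquiv
  let _ : Field Γ(Spec (CommRingCat.of F), ⊤) := hF.toField
  have hsm : (str.appLE ⊤ U le_top).hom.Smooth :=
    Smooth.smooth_appLE str (isAffineOpen_top _) hU le_top
  let _ := (str.appLE ⊤ U le_top).hom.toAlgebra
  have hsm' : Algebra.Smooth Γ(Spec (CommRingCat.of F), ⊤) Γ(Z, U) := hsm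
  have := isIntegrallyClosed_of_smooth Γ(Spec (CommRingCat.of F), ⊤) Γ(Z, U)
  exact IsIntegrallyClosed.of_equiv (RingEquiv.ofBijective (pull η U e).rangeRestrict
    ⟨fun a b h => hinj congr(($h : L)), (pull η U e).rangeRestrict_surjective⟩)

end SmoothNormal

/-! ### Finiteness of integral closures -/

section Finiteness

/-- Finiteness of the normalization of a finitely generated domain over a field of characteristic
zero, by Noether normalization. -/
lemma finite_integralClosure (k S Q : Type*) [Field k] [CharZero k] [CommRing S] [IsDomain S]
    [Algebra k S] [Algebra.FiniteType k S] [Field Q] [Algebra S Q] [IsFractionRing S Q] :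
    Module.Finite S (integralClosure S Q) := by
  obtain ⟨n, g, hg, hfin⟩ := exists_finite_inj_algHom_of_fg k S
  let P := MvPolynomial (Fin n) k
  let _ : Algebra P S := g.toRingHom.toAlgebra
  have hPS : Module.Finite P S := hfin
  let _ : Algebra P Q := ((algebraMap S Q).comp (algebraMap P S)).toAlgebra
  have _ : IsScalarTower P S Q := IsScalarTower.of_algebraMap_eq' rfl
  have hinj : Function.Injective (algebraMap P Q) :=
    (IsFractionRing.injective S Q).comp hg
  have _ : FaithfulSMul P Q := by
    rw [faithfulSMul_iff_algebraMap_injective]; exact hinj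
  have _ : Module.IsTorsionFree P Q := inferInstance
  let K := FractionRing P
  let _ : Algebra K Q := FractionRing.liftAlgebra P Q
  have _ : IsScalarTower P K Q := FractionRing.isScalarTower_liftAlgebra P Q
  have halg : Algebra.IsAlgebraic P Q :=
    (IsFractionRing.isAlgebraic_iff' P S Q).1 inferInstance
  have halgK : Algebra.IsAlgebraic K Q := IsFractionRing.comap_isAlgebraic_iff.1 halg
  have hess : Algebra.EssFiniteType S Q := Algebra.EssFiniteType.of_isLocalization Q
    (nonZeroDivisors S)
  have hess' : Algebra.EssFiniteType P Q := Algebra.EssFiniteType.comp P S Q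
  have hessK : Algebra.EssFiniteType K Q := Algebra.EssFiniteType.of_comp P K Q
  have hfd : FiniteDimensional K Q := Algebra.finite_of_essFiniteType_of_isAlgebraic
  have hchar : CharZero P := inferInstance
  have hchar' : CharZero K := inferInstance
  have hC : Module.Finite P (integralClosure P Q) := IsIntegralClosure.finite P K Q _
  let ψ : integralClosure P Q →ₗ[P] Q := (integralClosure P Q).val.toLinearMap
  have hN : IsNoetherian P (integralClosure P Q) := isNoetherian_of_isNoetherianRing_of_finite _ _
  have hle : ∀ q : integralClosure S Q, IsIntegral P (q : Q) := fun q =>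
    isIntegral_trans (A := S) (q : Q) q.2
  let θ : integralClosure S Q →ₗ[P] integralClosure P Q :=
    { toFun := fun q => ⟨q, hle q⟩
      map_add' := fun _ _ => rfl
      map_smul' := fun a q => Subtype.ext (by
        change ((a • q : integralClosure S Q) : Q) = a • (q : Q)
        rfl) }
  have hθ : Function.Injective θ := fun a b h => Subtype.ext congr(($h : Q))
  have : Module.Finite P (integralClosure S Q) := Module.Finite.of_injective θ hθ
  exact Module.Finite.of_restrictScalars_finite P S _

/-- If the subalgebra `V` lies in the field of fractions of the finitely generated subalgebra `S`,
the integral closure of `S` in `V` is finite over `S`. -/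
lemma exists_finset_integral {k L : Type*} [Field k] [CharZero k] [Field L] [Algebra k L]
    (S V : Subalgebra k L) (hS : S.FG)
    (hV : ∀ f ∈ V, ∃ s ∈ S, s ≠ 0 ∧ s * f ∈ S) (hSV : S ≤ V) :
    ∃ G : Finset L, (∀ g ∈ G, g ∈ V ∧ IsIntegral S g) ∧
      ∀ f ∈ V, IsIntegral S f → f ∈ Submodule.span S (G : Set L) := by
  classical
  have hft : Algebra.FiniteType k S := S.fg_iff_finiteType.1 hS
  have hfin := finite_integralClosure k S (FractionRing S)
  have hnoeth : IsNoetherianRing S := Algebra.FiniteType.isNoetherianRing k S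
  have hN : IsNoetherian S (integralClosure S (FractionRing S)) :=
    isNoetherian_of_isNoetherianRing_of_finite _ _
  let φ : FractionRing S →ₐ[S] L := IsFractionRing.liftAlgHom (A := S) (R := S)
    (g := Algebra.ofId S L) Subtype.val_injective
  let ψ : integralClosure S (FractionRing S) →ₗ[S] L :=
    φ.toLinearMap ∘ₗ (integralClosure S (FractionRing S)).val.toLinearMap
  let VS : Submodule S L :=
    { carrier := V
      add_mem' := V.add_mem
      zero_mem' := V.zero_mem
      smul_mem' := fun s f hf => V.mul_mem (hSV s.2) hf }
  obtain ⟨G, hG⟩ := hN.noetherian (VS.comap ψ)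
  refine ⟨G.image ψ, ?_, fun f hf hint => ?_⟩
  · simp only [Finset.mem_image]
    rintro _ ⟨g, hg, rfl⟩
    have h1 : g ∈ VS.comap ψ := by rw [← hG]; exact Submodule.subset_span hg
    exact ⟨h1, g.2.map φ⟩
  · obtain ⟨s, hs, hs0, hsf⟩ := hV f hf
    let q : FractionRing S := algebraMap S _ ⟨s * f, hsf⟩ / algebraMap S _ ⟨s, hs⟩
    have hq : φ q = f := by
      rw [map_div₀, AlgHom.commutes, AlgHom.commutes]
      change s * f / s = f
      rw [mul_div_cancel_left₀ _ hs0]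
    have hqi : IsIntegral S q := by
      rwa [← isIntegral_algHom_iff φ φ.toRingHom.injective, hq]
    have hmem : (⟨q, hqi⟩ : integralClosure S (FractionRing S)) ∈ VS.comap ψ := by
      change φ q ∈ V
      rwa [hq]
    rw [← hG] at hmem
    rw [Finset.coe_image, Submodule.span_image]
    exact ⟨_, hmem, hq⟩

/-- Integrality over a subalgebra `S`, in terms of elements of `S`. -/
lemma isIntegral_iff_exists_pow_eq_sum {A L : Type*} [CommRing A] [Field L] [Algebra A L]
    {S : Subalgebra A L} {v : L} : IsIntegral S v ↔
      ∃ (d : ℕ) (c : ℕ → L), (∀ s, c s ∈ S) ∧ v ^ d = ∑ s ∈ Finset.range d, c s * v ^ s := by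
  constructor
  · rintro ⟨p, hp, hpg⟩
    refine ⟨p.natDegree, fun s => -(p.coeff s : L), fun s => neg_mem (p.coeff s).2, ?_⟩
    rw [Polynomial.eval₂_eq_sum_range, Finset.sum_range_succ, hp.coeff_natDegree, map_one,
      one_mul] at hpg
    rw [eq_neg_of_add_eq_zero_right hpg, ← Finset.sum_neg_distrib]
    refine Finset.sum_congr rfl fun s _ => ?_
    rw [neg_mul]; rfl
  · rintro ⟨d, c, hc, h⟩
    let c' : ℕ → S := fun s => ⟨c s, hc s⟩
    refine ⟨Polynomial.X ^ d - ∑ s ∈ Finset.range d, Polynomial.C (c' s) * Polynomial.X ^ s,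
      ?_, ?_⟩
    · refine Polynomial.monic_X_pow_sub ?_
      rw [← Fin.sum_univ_eq_sum_range (fun s => Polynomial.C (c' s) * Polynomial.X ^ s) d]
      exact Polynomial.degree_sum_fin_lt _
    · rw [Polynomial.eval₂_sub, Polynomial.eval₂_pow, Polynomial.eval₂_X,
        Polynomial.eval₂_finsetSum, sub_eq_zero, h]
      refine Finset.sum_congr rfl fun s hs => ?_
      rw [Polynomial.eval₂_mul, Polynomial.eval₂_C, Polynomial.eval₂_pow, Polynomial.eval₂_X]
      rfl

end Finiteness

section LaurentFiniteness

attribute [local instance] laurentAlgebra powerSeriesAlgebra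

variable {k E : Type u} [Field k] [Field E] [Algebra k E] {ι : Type}

/-- The uniformizer of `E((ϖ))`. -/
def unifL (E : Type u) [Field E] : LaurentSeries E := HahnSeries.single 1 1

lemma unifL_pow (n : ℕ) : unifL E ^ n = HahnSeries.single (n : ℤ) 1 := by
  rw [unifL, HahnSeries.single_pow]; simp

lemma unifL_ne_zero : unifL E ≠ 0 := HahnSeries.single_ne_zero one_ne_zero

lemma coeff_algebraMap_powerSeries (p : PowerSeries k) (n : ℤ) :
    (algebraMap (PowerSeries k) (LaurentSeries E) p).coeff n =
      algebraMap k E ((HahnSeries.ofPowerSeries ℤ k p).coeff n) := rfl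

lemma algebraMap_powerSeries_C (a : k) :
    algebraMap (PowerSeries k) (LaurentSeries E) (PowerSeries.C a) =
      HahnSeries.C (algebraMap k E a) := by
  ext n
  rw [coeff_algebraMap_powerSeries, HahnSeries.ofPowerSeries_C]
  simp only [HahnSeries.C_apply, HahnSeries.coeff_single]
  split_ifs <;> simp

lemma algebraMap_powerSeries_X :
    algebraMap (PowerSeries k) (LaurentSeries E) PowerSeries.X = unifL E := by
  ext n
  rw [coeff_algebraMap_powerSeries, HahnSeries.ofPowerSeries_X, unifL]
  simp only [HahnSeries.coeff_single]
  split_ifs <;> simp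

lemma algebraMap_field_laurent (a : k) :
    algebraMap k (LaurentSeries E) a = HahnSeries.C (algebraMap k E a) := by
  rw [HahnSeries.algebraMap_apply', PowerSeries.algebraMap_apply, HahnSeries.ofPowerSeries_C]

variable (k) in
/-- The graded subalgebra of `E((ϖ))` generated by the uniformizer and the elements `u l`. -/
def polyRing (u : ι → LaurentSeries E) : Subalgebra k (LaurentSeries E) :=
  Algebra.adjoin k (insert (unifL E) (Set.range u))

variable {u : ι → LaurentSeries E}

lemma unifL_mem_polyRing : unifL E ∈ polyRing k u := Algebra.subset_adjoin (Set.mem_insert _ _)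

lemma polyRing_le {a : LaurentSeries E} (ha : a ∈ polyRing k u) :
    a ∈ Algebra.adjoin (PowerSeries k) (Set.range u) := by
  induction ha using Algebra.adjoin_induction with
  | mem x hx =>
    rcases hx with rfl | hx
    · rw [← algebraMap_powerSeries_X (k := k)]; exact Subalgebra.algebraMap_mem _ _
    · exact Algebra.subset_adjoin hx
  | algebraMap r =>
    rw [algebraMap_field_laurent, ← algebraMap_powerSeries_C]
    exact Subalgebra.algebraMap_mem _ _
  | add x y _ _ hx hy => exact add_mem hx hy
  | mul x y _ _ hx hy => exact mul_mem hx hy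

lemma polynomial_mem_polyRing (p : Polynomial k) :
    algebraMap (PowerSeries k) (LaurentSeries E) (p : PowerSeries k) ∈ polyRing k u := by
  induction p using Polynomial.induction_on' with
  | add p q hp hq => rw [Polynomial.coe_add, map_add]; exact add_mem hp hq
  | monomial n a =>
    rw [← Polynomial.C_mul_X_pow_eq_monomial, Polynomial.coe_mul, Polynomial.coe_C,
      Polynomial.coe_pow, Polynomial.coe_X, map_mul, map_pow, algebraMap_powerSeries_C,
      algebraMap_powerSeries_X, ← algebraMap_field_laurent]
    exact mul_mem (Subalgebra.algebraMap_mem _ _) (pow_mem unifL_mem_polyRing _)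

/-- Power series coefficients may be truncated to arbitrary order. -/
lemma exists_eq_add_unifL_pow_mul {a : LaurentSeries E}
    (ha : a ∈ Algebra.adjoin (PowerSeries k) (Set.range u)) (N : ℕ) :
    ∃ s ∈ polyRing k u, ∃ b ∈ Algebra.adjoin (PowerSeries k) (Set.range u),
      a = s + unifL E ^ N * b := by
  induction ha using Algebra.adjoin_induction with
  | mem x hx =>
    exact ⟨x, Algebra.subset_adjoin (Set.mem_insert_of_mem _ hx), 0, zero_mem _, by simp⟩
  | algebraMap p =>
    refine ⟨_, polynomial_mem_polyRing (PowerSeries.trunc N p), _,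
      Subalgebra.algebraMap_mem _ (PowerSeries.mk fun i => PowerSeries.coeff (i + N) p), ?_⟩
    conv_lhs => rw [p.eq_X_pow_mul_shift_add_trunc N]
    rw [map_add, map_mul, map_pow, algebraMap_powerSeries_X, add_comm]
  | add x y _ _ hx hy =>
    obtain ⟨s, hs, b, hb, rfl⟩ := hx
    obtain ⟨s', hs', b', hb', rfl⟩ := hy
    exact ⟨_, add_mem hs hs', _, add_mem hb hb', by ring⟩
  | mul x y hx' hy' hx hy =>
    obtain ⟨s, hs, b, hb, h⟩ := hx
    obtain ⟨s', hs', b', hb', h'⟩ := hy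
    exact ⟨_, mul_mem hs hs', _, add_mem (mul_mem hb hy') (mul_mem (polyRing_le hs) hb'),
      by linear_combination y * h + s * h'⟩

variable (k u) in
/-- The localization of `polyRing k u` at the uniformizer. -/
def laurentPolyRing : Subalgebra k (LaurentSeries E) where
  carrier := {f | ∃ n : ℕ, unifL E ^ n * f ∈ polyRing k u}
  mul_mem' := by
    rintro a b ⟨n, hn⟩ ⟨m, hm⟩
    exact ⟨n + m, by convert mul_mem hn hm using 1; ring⟩
  add_mem' := by
    rintro a b ⟨n, hn⟩ ⟨m, hm⟩
    refine ⟨n + m, ?_⟩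
    convert add_mem (mul_mem (pow_mem (unifL_mem_polyRing (k := k) (u := u)) m) hn)
      (mul_mem (pow_mem (unifL_mem_polyRing (k := k) (u := u)) n) hm) using 1
    ring
  algebraMap_mem' r := ⟨0, by rw [pow_zero, one_mul]; exact Subalgebra.algebraMap_mem _ _⟩

lemma polyRing_le_laurentPolyRing : polyRing k u ≤ laurentPolyRing k u :=
  fun f hf => ⟨0, by simpa using hf⟩

lemma laurentPolyRing_le {f : LaurentSeries E} (hf : f ∈ laurentPolyRing k u) :
    f ∈ Algebra.adjoin (LaurentSeries k) (Set.range u) := by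
  obtain ⟨n, hn⟩ := hf
  have h1 : unifL E ^ n * f ∈ Algebra.adjoin (LaurentSeries k) (Set.range u) := by
    refine Algebra.adjoin_induction (p := fun g _ => g ∈
      Algebra.adjoin (LaurentSeries k) (Set.range u)) (fun x hx => Algebra.subset_adjoin hx)
      (fun r => Subalgebra.algebraMap_mem _ (HahnSeries.ofPowerSeries ℤ k r))
      (fun _ _ _ _ => add_mem) (fun _ _ _ _ => mul_mem) (polyRing_le hn)
  have h2 : algebraMap (LaurentSeries k) (LaurentSeries E)
      (HahnSeries.ofPowerSeries ℤ k PowerSeries.X)⁻¹ = (unifL E)⁻¹ := by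
    rw [map_inv₀]; congr 1; exact algebraMap_powerSeries_X
  have h3 : f = algebraMap (LaurentSeries k) (LaurentSeries E)
      (HahnSeries.ofPowerSeries ℤ k PowerSeries.X)⁻¹ ^ n * (unifL E ^ n * f) := by
    rw [h2, inv_pow, inv_mul_cancel_left₀ (pow_ne_zero _ unifL_ne_zero)]
  rw [h3]
  exact mul_mem (pow_mem (Subalgebra.algebraMap_mem _ _) _) h1

/-- Elements with Laurent series coefficients are Laurent polynomials up to elements with power
series coefficients. -/
lemma exists_eq_laurentPoly_add {f : LaurentSeries E}
    (hf : f ∈ Algebra.adjoin (LaurentSeries k) (Set.range u)) :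
    ∃ v ∈ laurentPolyRing k u, ∃ a ∈ Algebra.adjoin (PowerSeries k) (Set.range u), f = v + a := by
  have hf' : f ∈ Submodule.span (LaurentSeries k)
      (Submonoid.closure (Set.range u) : Set (LaurentSeries E)) := by
    rw [← Algebra.adjoin_eq_span]; exact hf
  clear hf
  induction hf' using Submodule.closure_induction with
  | zero => exact ⟨0, zero_mem _, 0, zero_mem _, by simp⟩
  | add x y _ _ hx hy =>
    obtain ⟨s, hs, b, hb, rfl⟩ := hx
    obtain ⟨s', hs', b', hb', rfl⟩ := hy
    exact ⟨_, add_mem hs hs', _, add_mem hb hb', by ring⟩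
  | smul_mem c x hx =>
    obtain ⟨⟨p, ⟨_, n, rfl⟩⟩, hn⟩ := IsLocalization.surj (Submonoid.powers (PowerSeries.X (R := k)))
        c
    replace hn : c * HahnSeries.ofPowerSeries ℤ k (PowerSeries.X ^ n) =
      HahnSeries.ofPowerSeries ℤ k p := hn
    have hn' : algebraMap (LaurentSeries k) (LaurentSeries E) c * unifL E ^ n =
        algebraMap (PowerSeries k) (LaurentSeries E) p := by
      rw [← algebraMap_powerSeries_X (k := k), ← map_pow]
      exact (map_mul _ _ _).symm.trans congr(algebraMap (LaurentSeries k) (LaurentSeries E) $hn)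
    rw [p.eq_X_pow_mul_shift_add_trunc n, map_add, map_mul, map_pow,
      algebraMap_powerSeries_X] at hn'
    set q := algebraMap (PowerSeries k) (LaurentSeries E)
      (PowerSeries.mk fun i => PowerSeries.coeff (i + n) p)
    have hq : q ∈ Algebra.adjoin (PowerSeries k) (Set.range u) := Subalgebra.algebraMap_mem _ _
    have ht := polynomial_mem_polyRing (u := u) (PowerSeries.trunc n p)
    set t := algebraMap (PowerSeries k) (LaurentSeries E) (PowerSeries.trunc n p : PowerSeries k)
    have hxS : x ∈ polyRing k u := by
      refine (Submonoid.closure_le.2 ?_ : _ ≤ (polyRing k u).toSubmonoid) hx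
      exact fun a ha => Algebra.subset_adjoin (Set.mem_insert_of_mem _ ha)
    refine ⟨(algebraMap (LaurentSeries k) (LaurentSeries E) c - q) * x, ⟨n, ?_⟩, q * x,
      mul_mem hq (polyRing_le hxS), ?_⟩
    · convert mul_mem ht hxS using 1
      linear_combination x * hn'
    · rw [Algebra.smul_def]; ring

section Graded

variable {m : ι → ℤ} {c : ι → E} (hu : ∀ l, u l = HahnSeries.single (m l) (c l))
include hu

/-- The homogeneous components of an element of `k⟦ϖ⟧[u]` lie in `k[ϖ, u]`. -/
lemma single_coeff_mem_polyRing {a : LaurentSeries E}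
    (ha : a ∈ Algebra.adjoin (PowerSeries k) (Set.range u)) (n : ℤ) :
    HahnSeries.single n (a.coeff n) ∈ polyRing k u := by
  induction ha using Algebra.adjoin_induction generalizing n with
  | mem x hx =>
    obtain ⟨l, rfl⟩ := hx
    rw [hu, HahnSeries.coeff_single]
    split_ifs with h
    · subst h
      rw [← hu]; exact Algebra.subset_adjoin (Set.mem_insert_of_mem _ ⟨l, rfl⟩)
    · rw [map_zero]; exact zero_mem _
  | algebraMap p =>
    rw [coeff_algebraMap_powerSeries]
    rcases lt_or_ge n 0 with h | h
    · have : (HahnSeries.ofPowerSeries ℤ k p).coeff n = 0 := by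
        rw [HahnSeries.ofPowerSeries_apply]
        refine HahnSeries.embDomain_of_notMem_range ?_
        rintro ⟨j, hj⟩
        have : (j : ℤ) = n := hj
        omega
      rw [this, map_zero, map_zero]; exact zero_mem _
    · lift n to ℕ using h
      have : HahnSeries.single (n : ℤ) (algebraMap k E ((HahnSeries.ofPowerSeries ℤ k p).coeff n)) =
          algebraMap k (LaurentSeries E) ((HahnSeries.ofPowerSeries ℤ k p).coeff n) *
            unifL E ^ n := by
        rw [algebraMap_field_laurent, unifL_pow, HahnSeries.C_apply, HahnSeries.single_mul_single]
        simp
      rw [this]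
      exact mul_mem (Subalgebra.algebraMap_mem _ _) (pow_mem unifL_mem_polyRing _)
  | add x y _ _ hx hy =>
    rw [HahnSeries.coeff_add, HahnSeries.single_add]; exact add_mem (hx n) (hy n)
  | mul x y _ _ hx hy =>
    rw [HahnSeries.coeff_mul]
    have hsum := fun t : Finset (ℤ × ℤ) => map_sum (HahnSeries.single.addMonoidHom n)
      (fun ij : ℤ × ℤ => x.coeff ij.1 * y.coeff ij.2) t
    refine (congrArg (· ∈ polyRing k u) (hsum _)).mpr ?_
    refine sum_mem fun ij hij => ?_
    have : n = ij.1 + ij.2 := by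
      simp only [Finset.mem_antidiagonal] at hij
      exact hij.2.2.symm
    change HahnSeries.single n (x.coeff ij.1 * y.coeff ij.2) ∈ _
    rw [this, ← HahnSeries.single_mul_single]
    exact mul_mem (hx _) (hy _)

/-- The elements of `k[ϖ, u]` are Laurent polynomials. -/
lemma exists_coeff_eq_zero {a : LaurentSeries E} (ha : a ∈ polyRing k u) :
    ∃ N : ℤ, ∀ n, N ≤ n → a.coeff n = 0 := by
  have hs : ∀ (j : ℤ) (r : E), ∃ N : ℤ, ∀ n, N ≤ n →
      (HahnSeries.single j r : LaurentSeries E).coeff n = 0 := fun j r =>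
    ⟨j + 1, fun n hn => HahnSeries.coeff_single_of_ne (by omega)⟩
  induction ha using Algebra.adjoin_induction with
  | mem x hx =>
    rcases hx with rfl | ⟨l, rfl⟩
    · exact hs _ _
    · rw [hu]; exact hs _ _
  | algebraMap r => rw [algebraMap_field_laurent]; exact hs _ _
  | add x y _ _ hx hy =>
    obtain ⟨N, hN⟩ := hx
    obtain ⟨M, hM⟩ := hy
    refine ⟨max N M, fun n hn => ?_⟩
    rw [HahnSeries.coeff_add, hN n ((le_max_left _ _).trans hn),
      hM n ((le_max_right _ _).trans hn), add_zero]
  | mul x y _ _ hx hy =>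
    obtain ⟨N, hN⟩ := hx
    obtain ⟨M, hM⟩ := hy
    refine ⟨N + M, fun n hn => ?_⟩
    rw [HahnSeries.coeff_mul]
    refine Finset.sum_eq_zero fun ij hij => ?_
    simp only [Finset.mem_antidiagonal] at hij
    rcases le_or_gt N ij.1 with h | h
    · rw [hN _ h, zero_mul]
    · rw [hM _ (by have := hij.2.2; omega), mul_zero]

/-- The intersection of `k⟦ϖ⟧[u]` and `k[ϖ, ϖ⁻¹, u]` is `k[ϖ, u]`: a Laurent polynomial is the sum of
its finitely many homogeneous components. -/
lemma mem_polyRing_of_mem {a : LaurentSeries E}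
    (ha : a ∈ Algebra.adjoin (PowerSeries k) (Set.range u)) (ha' : a ∈ laurentPolyRing k u) :
    a ∈ polyRing k u := by
  obtain ⟨m, hm⟩ := ha'
  obtain ⟨N, hN⟩ := exists_coeff_eq_zero hu hm
  have h : a = ∑ n ∈ Finset.Ico a.order N, HahnSeries.single n (a.coeff n) := by
    ext n
    rw [HahnSeries.coeff_sum]
    by_cases h : n ∈ Finset.Ico a.order N
    · rw [Finset.sum_eq_single_of_mem n h fun j _ hj => HahnSeries.coeff_single_of_ne hj.symm,
        HahnSeries.coeff_single_same]
    rw [Finset.sum_eq_zero fun j hj => HahnSeries.coeff_single_of_ne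
      (ne_of_mem_of_not_mem hj h).symm]
    rw [Finset.mem_Ico, not_and_or, not_le, not_lt] at h
    rcases h with h | h
    · exact HahnSeries.coeff_eq_zero_of_lt_order h
    · have h1 := hN (n + m) (by omega)
      rwa [unifL_pow, HahnSeries.coeff_single_mul_add, one_mul] at h1
  rw [h]
  exact sum_mem fun n _ => single_coeff_mem_polyRing hu ha n

/-- An element of `k[ϖ, ϖ⁻¹, u]` that is integral over `k⟦ϖ⟧[u]` is integral over `k[ϖ, u]`. The
coefficients of an equation of degree `d` are truncated modulo `ϖ ^ (m * d)`, where `ϖ ^ m` clears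
the denominators of `v`; the error `g` lies in `k[ϖ, u]` and is absorbed by the constant
coefficient. -/
lemma isIntegral_polyRing {v : LaurentSeries E} (hv : v ∈ laurentPolyRing k u)
    (hint : IsIntegral (Algebra.adjoin (PowerSeries k) (Set.range u)) v) :
    IsIntegral (polyRing k u) v := by
  obtain ⟨d, b, hb, h⟩ := isIntegral_iff_exists_pow_eq_sum.1 hint
  obtain ⟨m, hm⟩ := hv
  have hd : d ≠ 0 := by
    rintro rfl
    simp at h
  choose s hs b' hb' hsb using fun j => exists_eq_add_unifL_pow_mul (hb j) (m * d)
  let g : LaurentSeries E := ∑ j ∈ Finset.range d, unifL E ^ (m * d) * b' j * v ^ j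
  have hg : g = v ^ d - ∑ j ∈ Finset.range d, s j * v ^ j := by
    rw [h, ← Finset.sum_sub_distrib]
    refine Finset.sum_congr rfl fun j _ => ?_
    linear_combination -v ^ j * hsb j
  have hgA : g ∈ Algebra.adjoin (PowerSeries k) (Set.range u) := by
    refine sum_mem fun j hj => ?_
    obtain ⟨r, rfl⟩ := Nat.exists_eq_add_of_lt (Finset.mem_range.1 hj)
    convert mul_mem (mul_mem (polyRing_le (pow_mem unifL_mem_polyRing (m * (r + 1)))) (hb' j))
      (polyRing_le (pow_mem hm j)) using 1
    ring
  have hvL : v ∈ laurentPolyRing k u := ⟨m, hm⟩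
  have hgS : g ∈ polyRing k u := by
    refine mem_polyRing_of_mem hu hgA ?_
    rw [hg]
    exact sub_mem (pow_mem hvL _) (sum_mem fun j _ =>
      mul_mem (polyRing_le_laurentPolyRing (hs j)) (pow_mem hvL _))
  refine isIntegral_iff_exists_pow_eq_sum.2 ⟨d, fun j => s j + if j = 0 then g else 0,
    fun j => ?_, ?_⟩
  · beta_reduce
    split_ifs
    · exact add_mem (hs j) hgS
    · exact add_mem (hs j) (zero_mem _)
  · simp only [add_mul, ite_mul, zero_mul]
    rw [Finset.sum_add_distrib, Finset.sum_ite_eq', if_pos (Finset.mem_range.2 (by omega)),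
      pow_zero, mul_one, hg]
    ring

/-- The integral closure of `k⟦ϖ⟧[u]` in `k((ϖ))[u]` is generated by finitely many elements when
the `u l` are monomials in `ϖ`: it is obtained from the finitely generated ring `k[ϖ, u]`. -/
theorem exists_finset_integral_laurent [CharZero k] [Finite ι] :
    ∃ G : Finset (LaurentSeries E),
      (∀ g ∈ G, g ∈ Algebra.adjoin (LaurentSeries k) (Set.range u)) ∧
      (∀ g ∈ G, IsIntegral (Algebra.adjoin (PowerSeries k) (Set.range u)) g) ∧
      ∀ a ∈ Algebra.adjoin (LaurentSeries k) (Set.range u),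
        IsIntegral (Algebra.adjoin (PowerSeries k) (Set.range u)) a →
        a ∈ Algebra.adjoin (PowerSeries k) (Set.range u ∪ (G : Set (LaurentSeries E))) := by
  have hfg : (polyRing k u).FG := by
    have hfin : (insert (unifL E) (Set.range u)).Finite := (Set.finite_range u).insert _
    exact ⟨hfin.toFinset, by rw [Set.Finite.coe_toFinset]; rfl⟩
  obtain ⟨G, hG, hgen⟩ := exists_finset_integral (polyRing k u) (laurentPolyRing k u) hfg
    (fun f hf => by
      obtain ⟨n, hn⟩ := hf
      exact ⟨_, pow_mem unifL_mem_polyRing n, pow_ne_zero _ unifL_ne_zero, hn⟩)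
    polyRing_le_laurentPolyRing
  refine ⟨G, fun g hg => laurentPolyRing_le (hG g hg).1, fun g hg => ?_, fun a ha hint => ?_⟩
  · obtain ⟨d, b, hb, h⟩ := isIntegral_iff_exists_pow_eq_sum.1 (hG g hg).2
    exact isIntegral_iff_exists_pow_eq_sum.2 ⟨d, b, fun j => polyRing_le (hb j), h⟩
  · obtain ⟨v, hv, b, hb, rfl⟩ := exists_eq_laurentPoly_add ha
    have hle : Algebra.adjoin (PowerSeries k) (Set.range u) ≤
        Algebra.adjoin (PowerSeries k) (Set.range u ∪ (G : Set (LaurentSeries E))) :=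
      Algebra.adjoin_mono Set.subset_union_left
    refine add_mem ?_ (hle hb)
    have hvint : IsIntegral (Algebra.adjoin (PowerSeries k) (Set.range u)) v := by
      have h1 : IsIntegral (Algebra.adjoin (PowerSeries k) (Set.range u)) b :=
        isIntegral_algebraMap (x := (⟨b, hb⟩ : Algebra.adjoin (PowerSeries k) (Set.range u)))
      simpa using hint.sub h1
    have h2 := hgen v hv (isIntegral_polyRing hu hv hvint)
    clear hv hvint hint ha hb
    induction h2 using Submodule.span_induction with
    | mem x hx => exact Algebra.subset_adjoin (Or.inr hx)
    | zero => exact zero_mem _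
    | add x y _ _ hx hy => exact add_mem hx hy
    | smul r x _ hx => exact mul_mem (hle (polyRing_le r.2)) hx

end Graded

end LaurentFiniteness

/-! ### Models with monomial coordinates -/

section Subring

variable {L : Type u} [Field L]

lemma isIntegral_of_subring_le {B C : Subring L} (h : B ≤ C) {a : L} (ha : IsIntegral B a) :
    IsIntegral C a :=
  ha.map_of_comp_eq (Subring.inclusion h) (RingHom.id L) rfl

/-- A subring of a field is integrally closed if and only if it is so within the field of quotients
of its elements. -/
lemma isIntegrallyClosed_subring_iff (B : Subring L) : IsIntegrallyClosed B ↔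
    ∀ a ∈ B, ∀ b ∈ B, b ≠ 0 → IsIntegral B (a / b) → a / b ∈ B := by
  let φ : FractionRing B →ₐ[B] L := IsFractionRing.liftAlgHom (A := B) (R := B)
    (g := Algebra.ofId B L) Subtype.val_injective
  have hφ : Function.Injective φ := φ.toRingHom.injective
  have hval : ∀ b : B, φ (algebraMap B _ b) = b := fun b => φ.commutes b
  rw [isIntegrallyClosed_iff (FractionRing B)]
  constructor
  · intro h a ha b hb hb0 hint
    have hq : φ (algebraMap B _ ⟨a, ha⟩ / algebraMap B _ ⟨b, hb⟩) = a / b := by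
      rw [map_div₀, hval, hval]
    rw [← hq, isIntegral_algHom_iff φ hφ] at hint
    obtain ⟨y, hy⟩ := h hint
    rw [← hq, ← hy, hval]
    exact y.2
  · intro h x hx
    obtain ⟨a, b, hb, rfl⟩ := IsFractionRing.div_surjective (A := B) x
    have hq : φ (algebraMap B _ a / algebraMap B _ b) = a / b := by
      rw [map_div₀, hval, hval]
    rw [← isIntegral_algHom_iff φ hφ, hq] at hx
    have hb0 : (b : L) ≠ 0 := fun h0 => nonZeroDivisors.ne_zero hb (Subtype.ext h0)
    refine ⟨⟨a / b, h a a.2 b b.2 hb0 hx⟩, hφ ?_⟩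
    rw [hq, hval]

/-- The integral closure of a subring in an integrally closed subring is integrally closed. -/
lemma isIntegrallyClosed_of_mem_iff {A K B : Subring L} (hK : IsIntegrallyClosed K)
    (hB : ∀ a, a ∈ B ↔ a ∈ K ∧ IsIntegral A a) : IsIntegrallyClosed B := by
  rw [isIntegrallyClosed_subring_iff] at hK ⊢
  intro a ha b hb hb0 hint
  refine (hB _).2 ⟨hK a ((hB a).1 ha).1 b ((hB b).1 hb).1 hb0
    (isIntegral_of_subring_le (fun c hc => ((hB c).1 hc).1) hint), ?_⟩
  have h1 : IsIntegral (integralClosure A L) (a / b) :=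
    isIntegral_of_subring_le (C := (integralClosure A L).toSubring)
      (fun c hc => ((hB c).1 hc).2) hint
  exact isIntegral_trans (A := integralClosure A L) _ h1

end Subring

section MonomialModel

attribute [local instance] laurentAlgebra powerSeriesAlgebra

/-- The denominators of elements of `k((ϖ))[u]` are cleared by powers of the uniformizer. -/
lemma exists_unifL_pow_mul_mem {k E : Type u} [Field k] [Field E] [Algebra k E] {ι : Type}
    {u : ι → LaurentSeries E} {a : LaurentSeries E}
    (ha : a ∈ Algebra.adjoin (LaurentSeries k) (Set.range u)) :
    ∃ n : ℕ, unifL E ^ n * a ∈ Algebra.adjoin (PowerSeries k) (Set.range u) := by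
  obtain ⟨v, ⟨n, hn⟩, b, hb, rfl⟩ := exists_eq_laurentPoly_add ha
  refine ⟨n, ?_⟩
  rw [mul_add]
  exact add_mem (polyRing_le hn) (mul_mem (polyRing_le (pow_mem unifL_mem_polyRing n)) hb)

/-- A variety over `k((ϖ))` with integrally closed charts has a model for each choice of coordinates
`y l` that are monomials `c ϖ ^ m` and define the same charts over `k((ϖ))`: the charts of the model
are the normalizations of the charts over `k⟦ϖ⟧` that these coordinates define. -/
theorem exists_model_of_monomial {k E : Type u} [Field k] [CharZero k] [Field E] [Algebra k E]
    {Y : Scheme.{u}} {f : Y ⟶ Spec (CommRingCat.of (LaurentSeries k))}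
    {η : Spec (CommRingCat.of (LaurentSeries E)) ⟶ Y}
    (hη : η ≫ f =
      Spec.map (CommRingCat.ofHom (algebraMap (LaurentSeries k) (LaurentSeries E))))
    [IsReduced Y] [IsDominant η] [Y.IsSeparated] [Smooth f] (C : ProjCharts (LaurentSeries k) η)
    {y : C.ι → LaurentSeries E} (hyC : ∀ i, chartRing (LaurentSeries k) y i =
      chartRing (LaurentSeries k) C.x i) (hy0 : ∀ l, y l ≠ 0)
    {m : C.ι → ℤ} {c : C.ι → E} (hy : ∀ l, y l = HahnSeries.single (m l) (c l)) :
    ∃ (M : Model f) (U : C.ι → M.scheme.Opens) (e : ∀ i, ⊤ ≤ (η ≫ M.gen) ⁻¹ᵁ U i),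
      (∀ i, IsAffineOpen (U i)) ∧ (⨆ i, U i = ⊤) ∧ (∀ i, M.gen ⁻¹ᵁ U i = C.U i) ∧
      ∀ i, ∀ a ∈ chartRing (PowerSeries k) y i,
        a ∈ (pull (η ≫ M.gen) (U i) (e i)).range := by
  obtain ⟨i0, -⟩ := C.cover (ptOf η) specializes_rfl
  have : Nonempty C.ι := ⟨i0⟩
  have hu : ∀ i l, y l / y i = HahnSeries.single (m l - m i) (c l / c i) := by
    intro i l
    have hi : c i ≠ 0 := by
      intro h; apply hy0 i; rw [hy, h, map_zero]
    rw [div_eq_iff (hy0 i), hy, hy, HahnSeries.single_mul_single, sub_add_cancel,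
      div_mul_cancel₀ _ hi]
  choose G hG hGint hGgen using fun i => exists_finset_integral_laurent (k := k) (hu i)
  obtain ⟨κ, hκ, z, β, hz, hcov, hiff⟩ := exists_normal_coord (A := PowerSeries k)
    (K := LaurentSeries k) hy0 (fun a => ⟨HahnSeries.ofPowerSeries ℤ k a, rfl⟩) G hG hGint hGgen
  have hmem : ∀ i, ∀ a ∈ chartRing (PowerSeries k) y i,
      a ∈ chartRing (PowerSeries k) z (β i) := by
    intro i a ha
    refine (hiff i a).2 ⟨?_, isIntegral_algebraMap (x := (⟨a, ha⟩ : chartRing _ y i))⟩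
    exact Algebra.adjoin_induction (p := fun g _ => g ∈ chartRing (LaurentSeries k) y i)
      (fun x hx => Algebra.subset_adjoin hx)
      (fun r => Subalgebra.algebraMap_mem _ (HahnSeries.ofPowerSeries ℤ k r))
      (fun _ _ _ _ => add_mem) (fun _ _ _ _ => mul_mem) ha
  obtain ⟨M, U, e, h1, h2, h3, h4⟩ := exists_model hη C z hz β hcov
    (fun i a ha => by rw [← hyC]; exact ((hiff i a).1 ha).1)
    (fun i a ha => by
      rw [← hyC] at ha
      obtain ⟨n, hn⟩ := exists_unifL_pow_mul_mem ha
      refine ⟨n, hmem i _ ?_⟩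
      rw [algebraMap_powerSeries_X]; exact hn)
    (fun i => by
      have hK := isIntegrallyClosed_range_pull f η (C.affine i) (C.mem i)
      rw [C.range_pull i] at hK
      change IsIntegrallyClosed (chartRing (LaurentSeries k) C.x i).toSubring at hK
      rw [← hyC] at hK
      exact isIntegrallyClosed_of_mem_iff (A := (chartRing (PowerSeries k) y i).toSubring) hK
        (fun a => hiff i a))
  exact ⟨M, U, e, h1, h2, h3, fun i a ha => by rw [h4]; exact hmem i a ha⟩

end MonomialModel

/-! ### Charts defined by families of forms -/

section ProductCharts

variable {A : Type u} [CommRing A] {L : Type u} [Field L] [Algebra A L] {Z : Scheme.{u}}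
  {η : Spec (CommRingCat.of L) ⟶ Z} (C : ProjCharts A η)

/-- The section `P / x l ^ d` over the chart `U l` defined by a form `P` of degree `d`. -/
def ProjCharts.sec {d : ℕ} {P : L} (hP : P ∈ forms A C.x d) (l : C.ι) : Γ(Z, C.U l) :=
  (C.exists_pull l (div_mem_chartRing l hP)).choose

lemma ProjCharts.pull_sec {d : ℕ} {P : L} (hP : P ∈ forms A C.x d) (l : C.ι) :
    pull η (C.U l) (C.mem l) (C.sec hP l) = P / C.x l ^ d :=
  (C.exists_pull l (div_mem_chartRing l hP)).choose_spec

lemma ProjCharts.top_le_basicOpen_sec {d : ℕ} {P : L} (hP : P ∈ forms A C.x d) (h0 : P ≠ 0)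
    (l : C.ι) : ⊤ ≤ η ⁻¹ᵁ Z.basicOpen (C.sec hP l) := by
  rw [top_le_preimage_iff, mem_basicOpen_iff_pull_ne_zero (C.mem l), C.pull_sec]
  exact div_ne_zero h0 (pow_ne_zero _ (C.x_ne l))

variable [IsReduced Z] [IsDominant η]

/-- The nonvanishing locus of a form does not depend on the chart. -/
lemma ProjCharts.mem_basicOpen_sec {d : ℕ} {P : L} (hP : P ∈ forms A C.x d) {l l' : C.ι} {z : Z}
    (hz : z ∈ Z.basicOpen (C.sec hP l)) (hz' : z ∈ C.U l') :
    z ∈ Z.basicOpen (C.sec hP l') := by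
  have hzl : z ∈ C.U l := Z.basicOpen_le _ hz
  have e : ⊤ ≤ η ⁻¹ᵁ (C.U l ⊓ C.U l') := top_le_preimage_inf (C.mem l) (C.mem l')
  have h : Z.presheaf.map (homOfLE inf_le_left : C.U l ⊓ C.U l' ⟶ C.U l).op (C.sec hP l) =
      Z.presheaf.map (homOfLE inf_le_right : C.U l ⊓ C.U l' ⟶ C.U l').op (C.sec hP l') *
        Z.presheaf.map (homOfLE inf_le_left : C.U l ⊓ C.U l' ⟶ C.U l).op (C.t l l') ^ d := by
    apply pull_injective (η := η) _ e
    rw [map_mul, map_pow, pull_map, pull_map, pull_map, C.pull_sec, C.pull_sec, C.pull_t, div_pow,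
      div_mul_div_cancel₀ (pow_ne_zero _ (C.x_ne l'))]
  have h2 : z ∈ Z.basicOpen
      (Z.presheaf.map (homOfLE inf_le_left : C.U l ⊓ C.U l' ⟶ C.U l).op (C.sec hP l)) := by
    rw [Scheme.basicOpen_res]; exact ⟨⟨hzl, hz'⟩, hz⟩
  rw [h, Scheme.basicOpen_mul, Scheme.basicOpen_res] at h2
  exact h2.1.2

variable {γ : Type} (Q : γ → L) {D : ℕ} (hQ : ∀ g, Q g ∈ forms A C.x D)
  (h0 : ∀ g, Q g ≠ 0) (hpow : ∀ l, ∃ g, Q g = C.x l ^ D)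

omit [IsReduced Z] [IsDominant η] in
include h0 in
lemma ProjCharts.isSec_prod (l l' : C.ι) (g g' : γ) :
    IsSec η (Z.basicOpen (C.sec (hQ g) l)) ((C.x l' * Q g') / (C.x l * Q g)) := by
  have e := C.top_le_basicOpen_sec (hQ g) (h0 g) l
  have h1 := ((isSec_pull (C.mem l) (C.t l l')).mono (Z.basicOpen_le _) e).mul
    (((isSec_pull (C.mem l) (C.sec (hQ g') l)).mono (Z.basicOpen_le _) e).mul
      (isSec_inv_pull (C.mem l) (C.sec (hQ g) l) e))
  convert h1 using 1
  rw [C.pull_t, C.pull_sec, C.pull_sec]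
  have := C.x_ne l
  have := h0 g
  field_simp

omit [IsReduced Z] [IsDominant η] in
include h0 in
lemma ProjCharts.chartRing_le_prod (l : C.ι) (g : γ) :
    chartRing A C.x l ≤ chartRing A (fun i : C.ι × γ => C.x i.1 * Q i.2) (l, g) := by
  refine Algebra.adjoin_le ?_
  rintro _ ⟨l', rfl⟩
  refine Algebra.subset_adjoin ⟨(l', g), ?_⟩
  exact mul_div_mul_right _ _ (h0 g)

omit [IsReduced Z] [IsDominant η] in
include h0 hpow in
lemma ProjCharts.range_pull_prod (l : C.ι) (g : γ) :
    (pull η (Z.basicOpen (C.sec (hQ g) l)) (C.top_le_basicOpen_sec (hQ g) (h0 g) l)).range =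
      (chartRing A (fun i : C.ι × γ => C.x i.1 * Q i.2) (l, g)).toSubring := by
  have e := C.top_le_basicOpen_sec (hQ g) (h0 g) l
  have hle := C.chartRing_le_prod Q h0 l g
  ext a
  constructor
  · intro ha
    obtain ⟨s, rfl⟩ := ha
    obtain ⟨n, t, ht⟩ := (isSec_pull e s).exists_pow_mul (C.affine l) (C.mem l) (C.sec (hQ g) l)
    obtain ⟨g₀, hg₀⟩ := hpow l
    have h1 : C.x l ^ D / Q g ∈ chartRing A (fun i : C.ι × γ => C.x i.1 * Q i.2) (l, g) := by
      refine Algebra.subset_adjoin ⟨(l, g₀), ?_⟩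
      change C.x l * Q g₀ / (C.x l * Q g) = _
      rw [mul_div_mul_left _ _ (C.x_ne l), hg₀]
    have h2 := mul_mem (pow_mem h1 n) (hle (C.pull_mem l t))
    change pull η _ e s ∈ chartRing A (fun i : C.ι × γ => C.x i.1 * Q i.2) (l, g)
    convert h2 using 1
    rw [ht, C.pull_sec, ← mul_assoc, ← mul_pow, div_mul_div_cancel₀ (h0 g),
      div_self (pow_ne_zero _ (C.x_ne l)), one_pow, one_mul]
  · intro ha
    change a ∈ chartRing A (fun i : C.ι × γ => C.x i.1 * Q i.2) (l, g) at ha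
    induction ha using Algebra.adjoin_induction with
    | mem a ha =>
      obtain ⟨⟨l', g'⟩, rfl⟩ := ha
      obtain ⟨_, s, hs⟩ := C.isSec_prod Q hQ h0 l l' g g'
      exact ⟨s, hs⟩
    | algebraMap r =>
      obtain ⟨s, hs⟩ := C.exists_pull l (Subalgebra.algebraMap_mem _ r)
      obtain ⟨_, t, ht⟩ := (isSec_pull (C.mem l) s).mono (Z.basicOpen_le _) e
      exact ⟨t, ht.trans hs⟩
    | add a b _ _ ha hb => exact add_mem ha hb
    | mul a b _ _ ha hb => exact mul_mem ha hb

/-- Refinement of the charts by the nonvanishing loci of a family of forms of the same degree. The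
coordinates are the products of the old coordinates and the forms. -/
def ProjCharts.prod [Fintype γ] : ProjCharts A η where
  ι := C.ι × γ
  x i := C.x i.1 * Q i.2
  x_ne i := mul_ne_zero (C.x_ne _) (h0 _)
  U i := Z.basicOpen (C.sec (hQ i.2) i.1)
  affine i := (C.affine i.1).basicOpen _
  mem i := C.top_le_basicOpen_sec (hQ i.2) (h0 i.2) i.1
  cover z hz := by
    obtain ⟨l, hl⟩ := C.cover z hz
    obtain ⟨g, hg⟩ := hpow l
    have h1 : C.sec (hQ g) l = 1 := by
      apply pull_injective (η := η) _ (C.mem l)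
      rw [C.pull_sec, map_one, hg, div_self (pow_ne_zero _ (C.x_ne l))]
    refine ⟨(l, g), ?_⟩
    change z ∈ Z.basicOpen (C.sec (hQ g) l)
    rw [h1, Scheme.basicOpen_of_isUnit _ isUnit_one]
    exact hl
  t i j := (C.isSec_prod Q hQ h0 i.1 j.1 i.2 j.2).choose_spec.choose
  pull_t i j := (C.isSec_prod Q hQ h0 i.1 j.1 i.2 j.2).choose_spec.choose_spec
  basicOpen_t := by
    rintro ⟨l, g⟩ ⟨l', g'⟩
    have hs := (C.isSec_prod Q hQ h0 l l' g g').choose_spec.choose_spec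
    set s := (C.isSec_prod Q hQ h0 l l' g g').choose_spec.choose
    change Z.basicOpen s = Z.basicOpen (C.sec (hQ g) l) ⊓ Z.basicOpen (C.sec (hQ g') l')
    have e := C.top_le_basicOpen_sec (hQ g) (h0 g) l
    let W := Z.basicOpen (C.sec (hQ g) l)
    let i : W ⟶ C.U l := homOfLE (Z.basicOpen_le _)
    have h1 : s * Z.presheaf.map i.op (C.sec (hQ g) l) =
        Z.presheaf.map i.op (C.t l l') * Z.presheaf.map i.op (C.sec (hQ g') l) := by
      apply pull_injective (η := η) _ e
      rw [map_mul, map_mul, hs, pull_map, pull_map, pull_map, C.pull_sec, C.pull_sec, C.pull_t]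
      have := C.x_ne l
      have := h0 g
      field_simp
    have h2 := congr(Z.basicOpen $h1)
    rw [Scheme.basicOpen_mul, Scheme.basicOpen_mul, Scheme.basicOpen_res, Scheme.basicOpen_res,
      Scheme.basicOpen_res, C.basicOpen_t] at h2
    have h3 : Z.basicOpen s ⊓ (W ⊓ Z.basicOpen (C.sec (hQ g) l)) = Z.basicOpen s :=
      inf_eq_left.2 (le_inf (Z.basicOpen_le _) (Z.basicOpen_le _))
    rw [← h3]
    refine h2.trans ?_
    ext z
    constructor
    · rintro ⟨⟨hz1, hz2⟩, -, hz3⟩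
      exact ⟨hz1, C.mem_basicOpen_sec (hQ g') hz3 hz2.2⟩
    · rintro ⟨hz1, hz2⟩
      have hzl := Z.basicOpen_le _ hz1
      exact ⟨⟨hz1, hzl, Z.basicOpen_le _ hz2⟩, hz1, C.mem_basicOpen_sec (hQ g') hz2 hzl⟩
  range_pull i := C.range_pull_prod Q hQ h0 hpow i.1 i.2

end ProductCharts

section Nonvanishing

variable {k : Type u} [Field k] {X : Scheme.{u}} {f : X ⟶ Spec (CommRingCat.of k)}

/-- The trivial absolute value on the residue field of a point. -/
def trivialPoint (f : X ⟶ Spec (CommRingCat.of k)) (z : X) : TrivAn f where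
  pt := z
  val := open Classical in 1
  val_base a := by
    classical
    rw [trivialAbs, Valuation.one_apply_def]
    simp

variable {E : Type u} [Field E] [Algebra k E] {η : Spec (CommRingCat.of E) ⟶ X}
  (hη : η ≫ f = Spec.map (CommRingCat.ofHom (algebraMap k E))) (C : ProjCharts k η)
  [IsReduced X] [IsDominant η]

include hη in
/-- Forms without a common zero have maximal norm at least one at each semivaluation: they generate
the unit ideal of each chart. -/
lemma ProjCharts.one_le_sup_nrm {d : ℕ} (S : Finset E) (hS : ∀ P ∈ S, P ∈ forms k C.x d)
    (h : ∀ v : TrivAn f, ∃ P ∈ S, C.nrm v d P ≠ 0) (v : TrivAn f) :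
    1 ≤ S.sup (C.nrm v d) := by
  obtain ⟨j, hj⟩ := C.exists_maxAt' v
  let s : S → Γ(X, C.U j) := fun P => C.sec (hS P P.2) j
  have hspan : Ideal.span (Set.range s) = ⊤ := by
    rw [← (C.affine j).self_le_iSup_basicOpen_iff]
    intro z hz
    obtain ⟨P, hP, h0⟩ := h (trivialPoint f z)
    have hz' : (trivialPoint f z).pt ∈ C.U j := hz
    rw [C.nrm_eq_div _ hz' (hS P hP)] at h0
    have h1 : ((trivialPoint f z).locVal η).abs (P / C.x j ^ d) ≠ 0 := by
      intro h2; rw [h2, zero_div] at h0; exact h0 rfl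
    rw [← C.pull_sec (hS P hP), Berk.locVal_abs_pull η _ hz', Berk.abs_ne_zero_iff] at h1
    exact TopologicalSpace.Opens.mem_iSup.2 ⟨⟨s ⟨P, hP⟩, ⟨P, hP⟩, rfl⟩, h1⟩
  obtain ⟨c, hc⟩ := Ideal.mem_span_range_iff_exists_fun.1 ((Ideal.eq_top_iff_one _).1 hspan)
  have h2 := congr(pull η (C.U j) (C.mem j) $hc)
  rw [map_sum, map_one] at h2
  rw [← (v.locVal η).abs_one, ← h2]
  refine (v.locVal η).abs_sum_le _ _ (fun P _ => ?_) (fun P _ => ?_)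
  · rw [map_mul, C.pull_sec]
    exact mul_mem (hj.mem _ (C.pull_mem j _)) (hj.mem _ (div_mem_chartRing j (hS P P.2)))
  · rw [map_mul, C.pull_sec, (v.locVal η).abs_mul (hj.mem _ (C.pull_mem j _))
      (hj.mem _ (div_mem_chartRing j (hS P P.2)))]
    have h3 : (v.locVal η).abs (pull η (C.U j) (C.mem j) (c P)) ≤ 1 :=
      hj.abs_le_one (fun a => by
        rw [Berk.locVal_abs_algebraMap v hη]; exact trivialAbs_le_one a) (C.pull_mem j _)
    refine (mul_le_of_le_one_left zero_le h3).trans ?_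
    rw [← LocVal.nrm_eq C.x_ne hj (hS P P.2)]
    exact Finset.le_sup (f := C.nrm v d) P.2

variable {C}

include hη in
/-- A nowhere vanishing maximum of norms of forms is a maximum over a family that contains the
powers of the coordinates: these may be added with a large power of the uniformizer. -/
lemma IsFormMax.exists_family {d : ℕ} {h : TrivAn f → ℝ≥0} (hh : IsFormMax C d h)
    (h0 : ∀ v, h v ≠ 0) : ∃ (r : ℕ) (P : Fin r → E) (n : Fin r → ℤ),
      (∀ a, P a ∈ forms k C.x d) ∧ (∀ a, P a ≠ 0) ∧ (∀ l, ∃ a, P a = C.x l ^ d) ∧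
      ∀ v, h v = Finset.univ.sup fun a => C.nrm v d (P a) * expNeg (n a) := by
  classical
  obtain ⟨S, hS, hS'⟩ := hh
  obtain ⟨N, hN⟩ := (S.image Prod.snd).bddAbove
  have hN' : ∀ a ∈ S, a.2 ≤ N := fun a ha => hN (Finset.mem_coe.2 (Finset.mem_image_of_mem _ ha))
  have hNh : ∀ v, expNeg N ≤ h v := by
    intro v
    have h1 := C.one_le_sup_nrm hη (S.image Prod.fst) (d := d)
      (fun P hP => by
        obtain ⟨a, ha, rfl⟩ := Finset.mem_image.1 hP
        exact hS a ha)
      (fun v => by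
        by_contra! h2
        refine h0 v ?_
        rw [hS']
        refine le_antisymm (Finset.sup_le fun a ha => ?_) bot_le
        rw [h2 _ (Finset.mem_image_of_mem _ ha), zero_mul]) v
    rw [Finset.sup_image] at h1
    obtain ⟨a, ha, h2⟩ := (Finset.le_sup_iff (by simp : (⊥ : ℝ≥0) < 1)).1 h1
    rw [hS']
    refine le_trans ?_ (Finset.le_sup (f := fun a : E × ℤ => C.nrm v d a.1 * expNeg a.2) ha)
    exact (expNeg_anti (hN' a ha)).trans (le_mul_of_one_le_left zero_le h2)
  let S' : Finset (E × ℤ) := S.filter (fun a => a.1 ≠ 0) ∪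
    Finset.univ.image fun l => (C.x l ^ d, N)
  let e := S'.equivFin
  have hcase : ∀ a ∈ S', (a ∈ S ∧ a.1 ≠ 0) ∨ ∃ l, a = (C.x l ^ d, N) := by
    intro a ha
    rcases Finset.mem_union.1 ha with h | h
    · exact Or.inl (Finset.mem_filter.1 h)
    · obtain ⟨l, -, rfl⟩ := Finset.mem_image.1 h
      exact Or.inr ⟨l, rfl⟩
  refine ⟨S'.card, fun i => (e.symm i : E × ℤ).1, fun i => (e.symm i : E × ℤ).2,
    fun i => ?_, fun i => ?_, fun l => ?_, fun v => ?_⟩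
  · rcases hcase _ (e.symm i).2 with ⟨h, -⟩ | ⟨l, h⟩
    · exact hS _ h
    · beta_reduce; rw [h]; exact coord_pow_mem_forms l d
  · rcases hcase _ (e.symm i).2 with ⟨-, h⟩ | ⟨l, h⟩
    · exact h
    · beta_reduce; rw [h]; exact pow_ne_zero _ (C.x_ne l)
  · have hl : (C.x l ^ d, N) ∈ S' := Finset.mem_union_right _
      (Finset.mem_image_of_mem _ (Finset.mem_univ l))
    exact ⟨e ⟨_, hl⟩, by beta_reduce; rw [Equiv.symm_apply_apply]⟩
  · apply le_antisymm
    · rw [hS']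
      refine Finset.sup_le fun a ha => ?_
      by_cases ha0 : a.1 = 0
      · obtain ⟨j, hj⟩ := C.exists_maxAt' v
        rw [ProjCharts.nrm, LocVal.nrm_eq C.x_ne hj (hS a ha), ha0, zero_div, LocVal.abs_zero,
          zero_mul]
        exact zero_le
      · have ha' : a ∈ S' := Finset.mem_union_left _ (Finset.mem_filter.2 ⟨ha, ha0⟩)
        refine le_trans (le_of_eq ?_) (Finset.le_sup (Finset.mem_univ (e ⟨a, ha'⟩)))
        beta_reduce
        rw [Equiv.symm_apply_apply]
    · refine Finset.sup_le fun i _ => ?_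
      rcases hcase _ (e.symm i).2 with ⟨h, -⟩ | ⟨l, h⟩
      · rw [hS']
        exact Finset.le_sup (f := fun a : E × ℤ => C.nrm v d a.1 * expNeg a.2) h
      · refine le_trans ?_ (hNh v)
        beta_reduce
        rw [h]
        exact mul_le_of_le_one_left zero_le (C.nrm_le_one hη v (coord_pow_mem_forms l d))

end Nonvanishing

/-! ### Vertical divisors with given local equations -/

section Divisor

lemma IsSec.exists_unit {L : Type u} [Field L] {Z : Scheme.{u}} {η : Spec (CommRingCat.of L) ⟶ Z}
    [IsReduced Z] [IsDominant η] {U : Z.Opens} {g : L} (hg : IsSec η U g) (hg' : IsSec η U g⁻¹)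
    (h0 : g ≠ 0) : ∃ u : (Γ(Z, U))ˣ, ∀ e, pull η U e u = g := by
  obtain ⟨e, s, rfl⟩ := hg
  obtain ⟨_, t, ht⟩ := hg'
  have h : s * t = 1 := by
    apply pull_injective (η := η) _ e
    rw [map_mul, ht, map_one, mul_inv_cancel₀ h0]
  exact ⟨⟨s, t, h, (mul_comm _ _).trans h⟩, fun _ => rfl⟩

variable {k : Type u} [Field k] {Y : Scheme.{u}}
  {f : Y ⟶ Spec (CommRingCat.of (LaurentSeries k))} {L : Type u} [Field L]
  {η : Spec (CommRingCat.of L) ⟶ Y} [IsReduced Y] [IsDominant η] {M : Model f}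
  [IsReduced M.scheme] [IsDominant (η ≫ M.gen)] {ι : Type}

/-- The vertical Cartier divisor with the local equations `g i`. -/
def VerticalCartierDivisor.ofRatios (U : ι → M.scheme.Opens) (hU : ∀ i, IsAffineOpen (U i))
    (hcov : ⨆ i, U i = ⊤) (e : ∀ i, ⊤ ≤ (η ≫ M.gen) ⁻¹ᵁ U i) (g : ι → L) (h0 : ∀ i, g i ≠ 0)
    (hg : ∀ i, IsSec η (M.gen ⁻¹ᵁ U i) (g i)) (hg' : ∀ i, IsSec η (M.gen ⁻¹ᵁ U i) (g i)⁻¹)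
    (hr : ∀ i j, IsSec (η ≫ M.gen) (U i ⊓ U j) (g i / g j)) : VerticalCartierDivisor M where
  ι := ULift ι
  U i := U i.down
  affine i := hU i.down
  cover := by
    rw [← hcov]
    exact Equiv.ulift.iSup_congr fun _ => rfl
  eqn i := ((hg i.down).exists_unit (hg' i.down) (h0 i.down)).choose
  compat i j := by
    have hi := ((hg i.down).exists_unit (hg' i.down) (h0 i.down)).choose_spec
    have hj := ((hg j.down).exists_unit (hg' j.down) (h0 j.down)).choose_spec
    set si := ((hg i.down).exists_unit (hg' i.down) (h0 i.down)).choose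
    set sj := ((hg j.down).exists_unit (hg' j.down) (h0 j.down)).choose
    have e' : ⊤ ≤ (η ≫ M.gen) ⁻¹ᵁ (U i.down ⊓ U j.down) :=
      top_le_preimage_inf (e i.down) (e j.down)
    obtain ⟨t, ht⟩ := (hr i.down j.down).exists_unit (by
      rw [inv_div]
      exact (hr j.down i.down).mono (le_of_eq (inf_comm _ _)) e') (div_ne_zero (h0 _) (h0 _))
    refine ⟨t, ?_⟩
    have e'' : ⊤ ≤ η ⁻¹ᵁ (M.gen ⁻¹ᵁ (U i.down ⊓ U j.down)) := e'
    apply pull_injective (η := η) _ e''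
    refine (pull_map (U := M.gen ⁻¹ᵁ U i.down) e'' _ (si : Γ(Y, M.gen ⁻¹ᵁ U i.down))).trans ?_
    rw [hi, map_mul]
    have h1 := (pull_comp M.gen (U i.down ⊓ U j.down) e''
      (t : Γ(M.scheme, U i.down ⊓ U j.down))).trans (ht e')
    have h2 := (pull_map (U := M.gen ⁻¹ᵁ U j.down) e''
      (homOfLE (M.gen.preimage_mono inf_le_right)).op
      (sj : Γ(Y, M.gen ⁻¹ᵁ U j.down))).trans (hj _)
    refine (div_mul_cancel₀ _ (h0 j.down)).symm.trans ?_
    exact congrArg₂ (· * ·) h1.symm h2.symm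

lemma VerticalCartierDivisor.pull_ofRatios_eqn (U : ι → M.scheme.Opens)
    (hU : ∀ i, IsAffineOpen (U i)) (hcov : ⨆ i, U i = ⊤) (e : ∀ i, ⊤ ≤ (η ≫ M.gen) ⁻¹ᵁ U i)
    (g : ι → L) (h0 : ∀ i, g i ≠ 0) (hg : ∀ i, IsSec η (M.gen ⁻¹ᵁ U i) (g i))
    (hg' : ∀ i, IsSec η (M.gen ⁻¹ᵁ U i) (g i)⁻¹)
    (hr : ∀ i j, IsSec (η ≫ M.gen) (U i ⊓ U j) (g i / g j)) (i : ULift ι) :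
    let D := ofRatios U hU hcov e g h0 hg hg' hr
    ∀ e' : ⊤ ≤ η ⁻¹ᵁ (M.gen ⁻¹ᵁ D.U i),
      pull η (M.gen ⁻¹ᵁ D.U i) e' (D.eqn i : Γ(Y, M.gen ⁻¹ᵁ D.U i)) = g i.down := fun e' =>
  ((hg i.down).exists_unit (hg' i.down) (h0 i.down)).choose_spec e'

end Divisor

section Monomials

attribute [local instance] laurentAlgebra

/-- Rescaling homogeneous coordinates by constants does not change the charts. -/
lemma chartRing_rescale {K L : Type u} [Field K] [Field L] [Algebra K L] {ι : Type} {x y : ι → L}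
    {c : ι → K} (hc : ∀ l, c l ≠ 0) (h : ∀ l, y l = algebraMap K L (c l) * x l) (i : ι) :
    chartRing K y i = chartRing K x i := by
  have key : ∀ {x y : ι → L} {c : ι → K}, (∀ l, y l = algebraMap K L (c l) * x l) →
      chartRing K y i ≤ chartRing K x i := by
    intro x y c h
    refine Algebra.adjoin_le ?_
    rintro _ ⟨l, rfl⟩
    have : y l / y i = algebraMap K L (c l / c i) * (x l / x i) := by
      rw [h, h, map_div₀, mul_div_mul_comm]
    change y l / y i ∈ _
    rw [this]
    exact mul_mem (Subalgebra.algebraMap_mem _ _) (ratio_mem_chartRing i l)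
  refine le_antisymm (key h) (key (c := fun l => (c l)⁻¹) fun l => ?_)
  rw [h, map_inv₀, inv_mul_cancel_left₀ ((map_ne_zero _).2 (hc l))]

variable {k E : Type u} [Field k] [Field E] [Algebra k E]

lemma single_eq_algebraMap_mul (n : ℤ) (a : E) : (HahnSeries.single n a : LaurentSeries E) =
    algebraMap (LaurentSeries k) (LaurentSeries E) (HahnSeries.single n 1) * HahnSeries.C a := by
  have : algebraMap (LaurentSeries k) (LaurentSeries E) (HahnSeries.single n 1) =
      HahnSeries.single n 1 := by
    ext j
    rw [algebraMap_laurent]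
    change algebraMap k E ((HahnSeries.single n (1 : k) : LaurentSeries k).coeff j) = _
    simp only [HahnSeries.coeff_single]
    split_ifs <;> simp
  rw [this, HahnSeries.C_apply, HahnSeries.single_mul_single, add_zero, one_mul]

lemma C_mem_forms {ι : Type*} {x : ι → E} {d : ℕ} {P : E} (hP : P ∈ forms k x d) :
    (HahnSeries.C P : LaurentSeries E) ∈
      forms (LaurentSeries k) (fun l => (HahnSeries.C (x l) : LaurentSeries E)) d := by
  induction d generalizing P with
  | zero =>
    rw [forms, pow_zero] at hP
    obtain ⟨a, rfl⟩ := Submodule.mem_one.1 hP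
    rw [C_algebraMap]
    exact algebraMap_mem_forms (x := fun l => (HahnSeries.C (x l) : LaurentSeries E)) _
  | succ d ih =>
    have hP' : P ∈ forms k x d * Submodule.span k (Set.range x) := by
      rw [forms, ← pow_succ]; exact hP
    refine Submodule.mul_induction_on hP' (fun a ha b hb => ?_) fun a b ha hb => ?_
    · rw [map_mul]
      refine mul_mem_forms (ih ha) ?_
      refine Submodule.span_induction (p := fun b _ => (HahnSeries.C b : LaurentSeries E) ∈
        forms (LaurentSeries k) (fun l => (HahnSeries.C (x l) : LaurentSeries E)) 1)
        ?_ ?_ ?_ ?_ hb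
      · rintro _ ⟨l, rfl⟩
        exact coord_mem_forms (x := fun l => (HahnSeries.C (x l) : LaurentSeries E)) l
      · rw [map_zero]; exact zero_mem _
      · intro a b _ _ ha hb; rw [map_add]; exact add_mem ha hb
      · intro a b _ hb
        rw [Algebra.smul_def, map_mul, C_algebraMap, ← Algebra.smul_def]
        exact Submodule.smul_mem _ _ hb
    · rw [map_add]; exact add_mem ha hb

lemma single_mem_forms {ι : Type*} {x : ι → E} {d : ℕ} {P : E} (hP : P ∈ forms k x d) (n : ℤ) :
    (HahnSeries.single n P : LaurentSeries E) ∈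
      forms (LaurentSeries k) (fun l => (HahnSeries.C (x l) : LaurentSeries E)) d := by
  rw [single_eq_algebraMap_mul (k := k), ← Algebra.smul_def]
  exact Submodule.smul_mem _ _ (C_mem_forms hP)

/-- The ratio of the norms of two forms. -/
lemma ProjCharts.nrm_eq_abs_mul {A L : Type u} [CommRing A] [Field L] [Algebra A L] {Z : Scheme.{u}}
    {η : Spec (CommRingCat.of L) ⟶ Z} (C : ProjCharts A η) {F : Type u} [Field F] {ν : F → ℝ≥0}
    {f : Z ⟶ Spec (CommRingCat.of F)} [IsReduced Z] [IsDominant η] (w : Berk ν f) {d : ℕ} {P Q : L}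
    (hP : P ∈ forms A C.x d) (hQ : Q ∈ forms A C.x d) (h0 : P ≠ 0)
    (hO : Q / P ∈ (w.locVal η).O) :
    C.nrm w d Q = (w.locVal η).abs (Q / P) * C.nrm w d P := by
  obtain ⟨j, hj⟩ := C.exists_maxAt' w
  rw [ProjCharts.nrm, ProjCharts.nrm, LocVal.nrm_eq C.x_ne hj hQ, LocVal.nrm_eq C.x_ne hj hP,
    ← LocVal.abs_mul _ hO (hj.mem _ (div_mem_chartRing j hP)), div_mul_div_cancel₀ h0]

variable {X : Scheme.{u}} {f : X ⟶ Spec (CommRingCat.of k)} {η : Spec (CommRingCat.of E) ⟶ X}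
  (hη : η ≫ f = Spec.map (CommRingCat.ofHom (algebraMap k E))) (C : ProjCharts k η)
  [IsReduced X] [IsDominant η] [IsReduced (baseChange f)] [IsDominant (laurentPoint hη)]

/-- The Gauss extension takes the norm `|P| e^{-n}` at the monomial form `P ϖ ^ n`. -/
lemma nrm_gaussExt_single (v : TrivAn f) {d : ℕ} {P : E} (hP : P ∈ forms k C.x d) (n : ℤ) :
    (C.baseChange hη).nrm (gaussExt v) d (HahnSeries.single n P) = C.nrm v d P * expNeg n := by
  have h := nrm_gaussExt hη C v (single_mem_forms hP n)
  apply le_antisymm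
  · refine h.2 _ fun j => ?_
    rw [HahnSeries.coeff_single]
    split_ifs with hj
    · rw [hj]
    · obtain ⟨i, hi⟩ := C.exists_maxAt' v
      rw [ProjCharts.nrm, LocVal.nrm_eq C.x_ne hi (zero_mem _), zero_div, LocVal.abs_zero, zero_mul]
      exact zero_le
  · have h1 := h.1 n
    rwa [HahnSeries.coeff_single_same] at h1

end Monomials

/-! ### The divisor attached to two families of forms -/

section FormDivisor

attribute [local instance] laurentAlgebra powerSeriesAlgebra

variable {k E : Type u} [Field k] [CharZero k] [Field E] [Algebra k E]
  {X : Scheme.{u}} {f : X ⟶ Spec (CommRingCat.of k)} {η : Spec (CommRingCat.of E) ⟶ X}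
  (hη : η ≫ f = Spec.map (CommRingCat.ofHom (algebraMap k E))) (C : ProjCharts k η)
  [IsReduced X] [IsDominant η] [IsReduced (baseChange f)] [IsDominant (laurentPoint hη)]
  [(baseChange f).IsSeparated] [Smooth (baseChangeStr f)]

/-- For two families of monomials `p a = P a ϖ ^ n a` and `q b = Q b ϖ ^ m b`, where `P a`, `Q b` are
forms of degree `d` without common zeros, there is a model on which the ideals generated by the
`p a` and by the `q b` become invertible after normalization. The quotients of their generators
define a vertical Cartier divisor. -/
theorem exists_divisor_of_forms {r r' d : ℕ} {P : Fin r → E} {Q : Fin r' → E}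
    (n : Fin r → ℤ) (m : Fin r' → ℤ)
    (hP : ∀ a, P a ∈ forms k C.x d) (hP0 : ∀ a, P a ≠ 0) (hPx : ∀ l, ∃ a, P a = C.x l ^ d)
    (hQ : ∀ b, Q b ∈ forms k C.x d) (hQ0 : ∀ b, Q b ≠ 0) (hQx : ∀ l, ∃ b, Q b = C.x l ^ d) :
    let p : Fin r → LaurentSeries E := fun a => HahnSeries.single (n a) (P a)
    let q : Fin r' → LaurentSeries E := fun b => HahnSeries.single (m b) (Q b)
    ∃ (M : Model (baseChangeStr f)) (D : VerticalCartierDivisor M), ∀ i : D.ι, ∃ a b,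
      (∀ e, pull (laurentPoint hη) (M.gen ⁻¹ᵁ D.U i) e
        (D.eqn i : Γ(baseChange f, M.gen ⁻¹ᵁ D.U i)) = q b / p a) ∧
      (∀ a', IsSec (laurentPoint hη ≫ M.gen) (D.U i) (p a' / p a)) ∧
      ∀ b', IsSec (laurentPoint hη ≫ M.gen) (D.U i) (q b' / q b) := by
  intro p q
  have hp0 : ∀ a, p a ≠ 0 := fun a => HahnSeries.single_ne_zero (hP0 a)
  have hq0 : ∀ b, q b ≠ 0 := fun b => HahnSeries.single_ne_zero (hQ0 b)
  have hG0 : ∀ g : Fin r × Fin r', P g.1 * Q g.2 ≠ 0 := fun g => mul_ne_zero (hP0 _) (hQ0 _)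
  let C' : ProjCharts k η := C.prod (fun g : Fin r × Fin r' => P g.1 * Q g.2) (D := d + d)
    (fun g => mul_mem_forms (hP _) (hQ _)) hG0
    (fun l => by
      obtain ⟨a, ha⟩ := hPx l
      obtain ⟨b, hb⟩ := hQx l
      exact ⟨(a, b), by rw [ha, hb, pow_add]⟩)
  let B := C'.baseChange hη
  -- up to constants of `k((ϖ))`, the homogeneous coordinates `x l * p a * q b`: on the corresponding
  -- chart all ratios `p a' / p a` and `q b' / q b` are regular
  let y : C.ι × (Fin r × Fin r') → LaurentSeries E := fun i =>
    HahnSeries.single (n i.2.1 + m i.2.2) (C.x i.1 * (P i.2.1 * Q i.2.2))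
  have hy0 : ∀ i, y i ≠ 0 := fun i => HahnSeries.single_ne_zero (C'.x_ne i)
  have hyC : ∀ i, chartRing (LaurentSeries k) y i = chartRing (LaurentSeries k) B.x i :=
    chartRing_rescale (c := fun i : C.ι × (Fin r × Fin r') =>
      HahnSeries.single (n i.2.1 + m i.2.2) 1) (fun i => HahnSeries.single_ne_zero one_ne_zero)
      (fun i => single_eq_algebraMap_mul _ _)
  have hypq : ∀ l a b, y (l, (a, b)) = HahnSeries.C (C.x l) * (p a * q b) := fun l a b => by
    simp only [y, p, q]
    rw [HahnSeries.single_mul_single, HahnSeries.C_apply, HahnSeries.single_mul_single, zero_add]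
  have hx0 : ∀ l, (HahnSeries.C (C.x l) : LaurentSeries E) ≠ 0 := (C.baseChange hη).x_ne
  obtain ⟨M, U, e, haff, hcov, hgen, hsec⟩ : ∃ (M : Model (baseChangeStr f))
      (U : C.ι × (Fin r × Fin r') → M.scheme.Opens)
      (e : ∀ i, ⊤ ≤ (laurentPoint hη ≫ M.gen) ⁻¹ᵁ U i),
      (∀ i, IsAffineOpen (U i)) ∧ (⨆ i, U i = ⊤) ∧ (∀ i, M.gen ⁻¹ᵁ U i = B.U i) ∧
      ∀ i, ∀ a ∈ chartRing (PowerSeries k) y i,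
        a ∈ (pull (laurentPoint hη ≫ M.gen) (U i) (e i)).range :=
    exists_model_of_monomial (laurentPoint_snd hη) B hyC hy0 (fun _ => rfl)
  have hMred : IsReduced M.scheme := M.normal.isReduced
  have hMdom : IsDominant M.gen := M.isDominant_gen
  have hdom : IsDominant (laurentPoint hη ≫ M.gen) := inferInstance
  have hPr : ∀ l a b a', IsSec (laurentPoint hη ≫ M.gen) (U (l, (a, b))) (p a' / p a) := by
    intro l a b a'
    obtain ⟨s, hs⟩ := hsec (l, (a, b)) _ (ratio_mem_chartRing (x := y) (l, (a, b)) (l, (a', b)))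
    refine ⟨e _, s, hs.trans ?_⟩
    rw [hypq, hypq, mul_div_mul_left _ _ (hx0 l), mul_div_mul_right _ _ (hq0 b)]
  have hQr : ∀ l a b b', IsSec (laurentPoint hη ≫ M.gen) (U (l, (a, b))) (q b' / q b) := by
    intro l a b b'
    obtain ⟨s, hs⟩ := hsec (l, (a, b)) _ (ratio_mem_chartRing (x := y) (l, (a, b)) (l, (a, b')))
    refine ⟨e _, s, hs.trans ?_⟩
    rw [hypq, hypq, mul_div_mul_left _ _ (hx0 l), mul_div_mul_left _ _ (hp0 a)]
  have hK : ∀ (i : C.ι × (Fin r × Fin r')) (c : LaurentSeries k) (g : E), g ∈ chartRing k C'.x i →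
      IsSec (laurentPoint hη) (M.gen ⁻¹ᵁ U i)
        (algebraMap (LaurentSeries k) (LaurentSeries E) c * HahnSeries.C g) := by
    intro i c g hg
    obtain ⟨s, hs⟩ := B.exists_pull i (mul_mem (Subalgebra.algebraMap_mem _ c)
      (C_mem_chartRing C' hg))
    exact (congrArg (fun V => IsSec (laurentPoint hη) V _) (hgen i)).mpr ⟨_, s, hs⟩
  have hdiv : ∀ (i j : ℤ) (a b : E), b ≠ 0 →
      (HahnSeries.single i a / HahnSeries.single j b : LaurentSeries E) =
      algebraMap (LaurentSeries k) (LaurentSeries E) (HahnSeries.single (i - j) 1) *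
        HahnSeries.C (a / b) := by
    intro i j a b hb
    rw [← single_eq_algebraMap_mul, div_eq_iff (HahnSeries.single_ne_zero hb),
      HahnSeries.single_mul_single, sub_add_cancel, div_mul_cancel₀ _ hb]
  -- on the generic fiber, `q b / p a` is a unit on the chart, where `P a` and `Q b` do not vanish
  have hQP : ∀ l a b, IsSec (laurentPoint hη) (M.gen ⁻¹ᵁ U (l, (a, b))) (q b / p a) := by
    intro l a b
    obtain ⟨a₀, ha₀⟩ := hPx l
    rw [hdiv _ _ _ _ (hP0 a)]
    refine hK _ _ _ ?_
    have h1 := mul_mem (C.chartRing_le_prod (fun g : Fin r × Fin r' => P g.1 * Q g.2) hG0 l (a, b)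
      (div_mem_chartRing l (hQ b))) (ratio_mem_chartRing (A := k) (x := C'.x)
        (l, (a, b)) (l, (a₀, b)))
    have h2 : Q b / P a = Q b / C.x l ^ d * (C.x l * (P a₀ * Q b) / (C.x l * (P a * Q b))) := by
      rw [mul_div_mul_left _ _ (C.x_ne l), mul_div_mul_right _ _ (hQ0 b), ha₀,
        div_mul_div_cancel₀ (pow_ne_zero _ (C.x_ne l))]
    rw [h2]
    exact h1
  have hPQ : ∀ l a b, IsSec (laurentPoint hη) (M.gen ⁻¹ᵁ U (l, (a, b))) (q b / p a)⁻¹ := by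
    intro l a b
    obtain ⟨b₀, hb₀⟩ := hQx l
    rw [inv_div, hdiv _ _ _ _ (hQ0 b)]
    refine hK _ _ _ ?_
    have h1 := mul_mem (C.chartRing_le_prod (fun g : Fin r × Fin r' => P g.1 * Q g.2) hG0 l (a, b)
      (div_mem_chartRing l (hP a))) (ratio_mem_chartRing (A := k) (x := C'.x)
        (l, (a, b)) (l, (a, b₀)))
    have h2 : P a / Q b = P a / C.x l ^ d * (C.x l * (P a * Q b₀) / (C.x l * (P a * Q b))) := by
      rw [mul_div_mul_left _ _ (C.x_ne l), mul_div_mul_left _ _ (hP0 a), hb₀,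
        div_mul_div_cancel₀ (pow_ne_zero _ (C.x_ne l))]
    rw [h2]
    exact h1
  -- the ratio of two local equations is the product of `p a' / p a` and `q b / q b'`, hence regular
  have hr : ∀ i j : C.ι × (Fin r × Fin r'), IsSec (laurentPoint hη ≫ M.gen) (U i ⊓ U j)
      ((q i.2.2 / p i.2.1) / (q j.2.2 / p j.2.1)) := by
    rintro ⟨l, a, b⟩ ⟨l', a', b'⟩
    have h1 := top_le_preimage_inf (e (l, (a, b))) (e (l', (a', b')))
    have h2 := ((hPr l a b a').mono inf_le_left h1).mul ((hQr l' a' b' b).mono inf_le_right h1)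
    convert h2 using 1
    have := hp0 a
    have := hp0 a'
    have := hq0 b'
    field_simp
  refine ⟨M, VerticalCartierDivisor.ofRatios U haff hcov e (fun i => q i.2.2 / p i.2.1)
    (fun i => div_ne_zero (hq0 _) (hp0 _)) (fun i => hQP _ _ _) (fun i => hPQ _ _ _) hr, ?_⟩
  rintro ⟨l, a, b⟩
  exact ⟨a, b, VerticalCartierDivisor.pull_ofRatios_eqn U haff hcov e _ _ _ _ hr _,
    hPr l a b, hQr l a b⟩

end FormDivisor

/-! ### Extending PL functions along the Gauss extension -/

section Lift

/-- The maximum of the norms of a family of forms is attained at a form that divides all the others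
in the valuation ring. -/
lemma ProjCharts.sup_nrm_eq {A L : Type u} [CommRing A] [Field L] [Algebra A L] {Z : Scheme.{u}}
    {η : Spec (CommRingCat.of L) ⟶ Z} (C : ProjCharts A η) {F : Type u} [Field F] {ν : F → ℝ≥0}
    {f : Z ⟶ Spec (CommRingCat.of F)} [IsReduced Z] [IsDominant η] (w : Berk ν f) {d r : ℕ}
    {p : Fin r → L} (hp : ∀ a, p a ∈ forms A C.x d) {a : Fin r} (h0 : p a ≠ 0)
    (hO : ∀ a', p a' / p a ∈ (w.locVal η).O ∧ (w.locVal η).abs (p a' / p a) ≤ 1) :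
    (Finset.univ.sup fun a => C.nrm w d (p a)) = C.nrm w d (p a) := by
  refine le_antisymm (Finset.sup_le fun a' _ => ?_)
    (Finset.le_sup (f := fun a => C.nrm w d (p a)) (Finset.mem_univ a))
  rw [C.nrm_eq_abs_mul w (hp a) (hp a') h0 (hO a').1]
  exact mul_le_of_le_one_left zero_le (hO a').2

attribute [local instance] laurentAlgebra

variable {k E : Type u} [Field k] [CharZero k] [Field E] [Algebra k E]
  {X : Scheme.{u}} {f : X ⟶ Spec (CommRingCat.of k)} {η : Spec (CommRingCat.of E) ⟶ X}
  (hη : η ≫ f = Spec.map (CommRingCat.ofHom (algebraMap k E))) (C : ProjCharts k η)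
  [IsReduced X] [IsDominant η] [IsReduced (baseChange f)] [IsDominant (laurentPoint hη)]

omit [CharZero k] [IsReduced X] [IsDominant η] in
/-- A family of forms over `k((ϖ))` that contains monomial multiples of the powers of all
coordinates has no common zero. -/
lemma sup_nrm_single_ne_zero (w : LaurentAn (baseChangeStr f)) {d r : ℕ} {P : Fin r → E}
    (n : Fin r → ℤ) (hPx : ∀ l, ∃ a, P a = C.x l ^ d) :
    (Finset.univ.sup fun a => (C.baseChange hη).nrm w d (HahnSeries.single (n a) (P a))) ≠ 0 := by
  obtain ⟨l, hl⟩ := (C.baseChange hη).exists_maxAt' w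
  obtain ⟨a, ha⟩ := hPx l
  have hform := single_mem_forms (k := k) (coord_pow_mem_forms (A := k) (x := C.x) l d) (n a)
  have h1 : (C.baseChange hη).nrm w d (HahnSeries.single (n a) (P a)) ≠ 0 := by
    rw [ProjCharts.nrm, ha, LocVal.nrm_eq (C.baseChange hη).x_ne hl hform,
      single_eq_algebraMap_mul (k := k), map_pow]
    change (w.locVal (laurentPoint hη)).abs (_ * (C.baseChange hη).x l ^ d /
      (C.baseChange hη).x l ^ d) ≠ 0
    rw [mul_div_cancel_right₀ _ (pow_ne_zero _ ((C.baseChange hη).x_ne l)),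
      Berk.locVal_abs_algebraMap w (laurentPoint_snd hη), laurentAbs,
      if_neg (HahnSeries.single_ne_zero one_ne_zero)]
    exact expNeg_ne_zero _
  have h2 := Finset.le_sup (f := fun a => (C.baseChange hη).nrm w d
    (HahnSeries.single (n a) (P a))) (Finset.mem_univ a)
  exact ((pos_iff_ne_zero.2 h1).trans_le h2).ne'

include hη C in
/-- Rational PL functions on `X` are pulled back from PL functions on `X_K`. -/
theorem exists_mem_PLK_of_mem_PL [X.IsSeparated] [(baseChange f).IsSeparated]
    [Smooth (baseChangeStr f)] {ψ : C(TrivAn f, ℝ)} (hψ : ψ ∈ PL f) :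
    ∃ φ ∈ PLK (baseChangeStr f), ⇑φ ∘ gaussExt = ⇑ψ := by
  obtain ⟨N, d, h₁, h₂, hN, hh₁, hh₂, h₁0, h₂0, hψ⟩ := (mem_PL_iff (C := C) hη ψ).1 hψ
  obtain ⟨r, P, n, hP, hP0, hPx, hPh⟩ := hh₁.exists_family hη h₁0
  obtain ⟨r', Q, m, hQ, hQ0, hQx, hQh⟩ := hh₂.exists_family hη h₂0
  obtain ⟨M, D, hD⟩ := exists_divisor_of_forms hη C n m hP hP0 hPx hQ hQ0 hQx
  let B := C.baseChange hη
  let p : Fin r → LaurentSeries E := fun a => HahnSeries.single (n a) (P a)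
  let q : Fin r' → LaurentSeries E := fun b => HahnSeries.single (m b) (Q b)
  have hp : ∀ a, p a ∈ forms (LaurentSeries k) B.x d := fun a => single_mem_forms (hP a) _
  have hq : ∀ b, q b ∈ forms (LaurentSeries k) B.x d := fun b => single_mem_forms (hQ b) _
  have hp0 : ∀ a, p a ≠ 0 := fun a => HahnSeries.single_ne_zero (hP0 a)
  have hq0 : ∀ b, q b ≠ 0 := fun b => HahnSeries.single_ne_zero (hQ0 b)
  let H₁ : LaurentAn (baseChangeStr f) → ℝ≥0 := fun w => Finset.univ.sup fun a => B.nrm w d (p a)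
  let H₂ : LaurentAn (baseChangeStr f) → ℝ≥0 := fun w => Finset.univ.sup fun b => B.nrm w d (q b)
  have hH₁ : ∀ w, H₁ w ≠ 0 := fun w => sup_nrm_single_ne_zero hη C w n hPx
  have hH₂ : ∀ w, H₂ w ≠ 0 := fun w => sup_nrm_single_ne_zero hη C w m hQx
  have hc₁ : Continuous H₁ := Continuous.finset_sup_apply fun a _ => B.continuous_nrm (hp a)
  have hc₂ : Continuous H₂ := Continuous.finset_sup_apply fun b _ => B.continuous_nrm (hq b)
  let φ : C(LaurentAn (baseChangeStr f), ℝ) :=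
    ⟨fun w => (N : ℝ)⁻¹ * (Real.log (H₁ w) - Real.log (H₂ w)),
      continuous_const.mul (((NNReal.continuous_coe.comp hc₁).log
        fun w => NNReal.coe_ne_zero.2 (hH₁ w)).sub
        ((NNReal.continuous_coe.comp hc₂).log fun w => NNReal.coe_ne_zero.2 (hH₂ w)))⟩
  refine ⟨φ, ⟨M, D, N, hN, fun w i h hred => ?_⟩, ?_⟩
  -- if the center of `w` lies in the chart, `p a` and `q b` have maximal norm in their families, and
  -- the local equation `q b / p a` has absolute value `H₂ w / H₁ w`
  · obtain ⟨a, b, hab, hpa, hqb⟩ := hD i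
    have hsec : ∀ g, IsSec (laurentPoint hη ≫ M.gen) (D.U i) g →
        g ∈ (w.locVal (laurentPoint hη)).O ∧ (w.locVal (laurentPoint hη)).abs g ≤ 1 := by
      intro g hg
      refine ⟨mem_O_of_isSec w h hg, ?_⟩
      obtain ⟨e, s, rfl⟩ := hg
      have e' : ⊤ ≤ laurentPoint hη ⁻¹ᵁ (M.gen ⁻¹ᵁ D.U i) := e
      refine le_trans (le_of_eq ?_) (hred s)
      exact (congrArg _ (pull_comp M.gen (D.U i) e' s).symm).trans
        (Berk.locVal_abs_pull (laurentPoint hη) w h e' _)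
    have e' : ⊤ ≤ laurentPoint hη ⁻¹ᵁ (M.gen ⁻¹ᵁ D.U i) := (hpa a).1
    have h1 : H₁ w = B.nrm w d (p a) := B.sup_nrm_eq w hp (hp0 a) fun a' => hsec _ (hpa a')
    have h2 : H₂ w = B.nrm w d (q b) := B.sup_nrm_eq w hq (hq0 b) fun b' => hsec _ (hqb b')
    have h3 : q b / p a ∈ (w.locVal (laurentPoint hη)).O := by
      rw [Berk.locVal_O]
      change HahnSeries.single (m b) (Q b) / HahnSeries.single (n a) (P a) ∈ _
      rw [← hab e']
      exact pull_mem_locRing h e' _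
    have h4 := B.nrm_eq_abs_mul w (hp a) (hq b) (hp0 a) h3
    have h5 : w.abs (D.eqn i : Γ(baseChange f, M.gen ⁻¹ᵁ D.U i)) h =
        (w.locVal (laurentPoint hη)).abs (q b / p a) := by
      rw [← Berk.locVal_abs_pull (laurentPoint hη) w h e', hab e']
    rw [← h1, ← h2, ← h5] at h4
    change (N : ℝ)⁻¹ * (Real.log (H₁ w) - Real.log (H₂ w)) = _
    have h6 : w.abs (D.eqn i : Γ(baseChange f, M.gen ⁻¹ᵁ D.U i)) h ≠ 0 := by
      intro h0
      rw [h0, zero_mul] at h4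
      exact hH₂ w h4
    rw [h4, NNReal.coe_mul, Real.log_mul (NNReal.coe_ne_zero.2 h6) (NNReal.coe_ne_zero.2 (hH₁ w))]
    ring
  · funext v
    have h1 : H₁ (gaussExt v) = h₁ v := by
      rw [hPh]
      exact Finset.sup_congr rfl fun a _ => nrm_gaussExt_single hη C v (hP a) _
    have h2 : H₂ (gaussExt v) = h₂ v := by
      rw [hQh]
      exact Finset.sup_congr rfl fun b _ => nrm_gaussExt_single hη C v (hQ b) _
    rw [hψ]
    change (N : ℝ)⁻¹ * (Real.log (H₁ (gaussExt v)) - Real.log (H₂ (gaussExt v))) = _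
    rw [h1, h2]

end Lift

/-! ### Real PL functions -/

section RealPL

variable {k : Type u} [Field k] {X : Scheme.{u}} {f : X ⟶ Spec (CommRingCat.of k)}

lemma zero_mem_PLPlus : (0 : C(TrivAn f, ℝ)) ∈ PLPlus f :=
  ⟨0, fun _ _ => 0, fun _ => 0, fun _ => ⟨0, Fin.elim0, Fin.elim0, fun i => i.elim0,
    fun i => i.elim0, fun v => by simp⟩, fun v => by simp⟩

lemma PLPlus_subset_PL : PLPlus f ⊆ PL f := fun φ hφ =>
  ⟨φ, hφ, 0, zero_mem_PLPlus, (sub_zero φ).symm⟩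

lemma PLPlus_subset_PLPlusReal : PLPlus f ⊆ PLPlusReal f := fun φ hφ =>
  ⟨1, fun _ => 1, fun _ => φ, fun _ => zero_le_one, fun _ => hφ, by simp⟩

lemma add_mem_PLPlusReal {φ ψ : C(TrivAn f, ℝ)} (hφ : φ ∈ PLPlusReal f) (hψ : ψ ∈ PLPlusReal f) :
    φ + ψ ∈ PLPlusReal f := by
  obtain ⟨r, c, g, hc, hg, rfl⟩ := hφ
  obtain ⟨r', c', g', hc', hg', rfl⟩ := hψ
  refine ⟨r + r', Fin.append c c', Fin.append g g', fun i => ?_, fun i => ?_, ?_⟩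
  · induction i using Fin.addCases with
    | left i => rw [Fin.append_left]; exact hc i
    | right i => rw [Fin.append_right]; exact hc' i
  · induction i using Fin.addCases with
    | left i => rw [Fin.append_left]; exact hg i
    | right i => rw [Fin.append_right]; exact hg' i
  · rw [Fin.sum_univ_add]
    simp

lemma smul_mem_PLPlusReal {φ : C(TrivAn f, ℝ)} (hφ : φ ∈ PLPlusReal f) {a : ℝ} (ha : 0 ≤ a) :
    a • φ ∈ PLPlusReal f := by
  obtain ⟨r, c, g, hc, hg, rfl⟩ := hφ
  refine ⟨r, fun i => a * c i, g, fun i => mul_nonneg ha (hc i), hg, ?_⟩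
  rw [Finset.smul_sum]
  simp only [mul_smul]

lemma PLPlusReal_subset_RPLPlus : PLPlusReal f ⊆ RPLPlus f := fun φ hφ =>
  ⟨{φ}, Finset.singleton_nonempty φ, fun g hg => by rwa [Finset.mem_singleton.1 hg], by simp⟩

lemma sup_mem_RPLPlus {φ ψ : C(TrivAn f, ℝ)} (hφ : φ ∈ RPLPlus f) (hψ : ψ ∈ RPLPlus f) :
    φ ⊔ ψ ∈ RPLPlus f := by
  classical
  obtain ⟨s, hs, hs', rfl⟩ := hφ
  obtain ⟨t, ht, ht', rfl⟩ := hψ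
  exact ⟨s ∪ t, hs.mono Finset.subset_union_left,
    fun g hg => (Finset.mem_union.1 hg).elim (hs' g) (ht' g), (Finset.sup'_union hs ht id).symm⟩

/-- Induction on functions in `RPLPlus`: they are built from those in `PLPlusReal` by maxima. -/
lemma RPLPlus_induction {p : C(TrivAn f, ℝ) → Prop} (h1 : ∀ φ ∈ PLPlusReal f, p φ)
    (h2 : ∀ φ ψ, p φ → p ψ → p (φ ⊔ ψ)) {φ : C(TrivAn f, ℝ)} (hφ : φ ∈ RPLPlus f) : p φ := by
  obtain ⟨s, hs, hs', rfl⟩ := hφ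
  exact Finset.sup'_induction hs id (fun a ha b hb => h2 a b ha hb) fun g hg => h1 g (hs' g hg)

lemma add_mem_RPLPlus {φ ψ : C(TrivAn f, ℝ)} (hφ : φ ∈ RPLPlus f) (hψ : ψ ∈ RPLPlus f) :
    φ + ψ ∈ RPLPlus f := by
  refine RPLPlus_induction (p := fun φ => φ + ψ ∈ RPLPlus f) (fun φ hφ => ?_)
    (fun φ φ' h h' => ?_) hφ
  · refine RPLPlus_induction (p := fun ψ => φ + ψ ∈ RPLPlus f) (fun ψ hψ => ?_)
      (fun ψ ψ' h h' => ?_) hψ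
    · exact PLPlusReal_subset_RPLPlus (add_mem_PLPlusReal hφ hψ)
    · rw [add_sup]; exact sup_mem_RPLPlus h h'
  · rw [sup_add]; exact sup_mem_RPLPlus h h'

lemma smul_mem_RPLPlus {φ : C(TrivAn f, ℝ)} (hφ : φ ∈ RPLPlus f) {a : ℝ} (ha : 0 ≤ a) :
    a • φ ∈ RPLPlus f := by
  refine RPLPlus_induction (p := fun φ => a • φ ∈ RPLPlus f)
    (fun φ hφ => PLPlusReal_subset_RPLPlus (smul_mem_PLPlusReal hφ ha)) (fun φ ψ h h' => ?_) hφ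
  have : a • (φ ⊔ ψ) = a • φ ⊔ a • ψ := by
    ext v
    simp [mul_max_of_nonneg _ _ ha]
  rw [this]
  exact sup_mem_RPLPlus h h'

lemma PL_subset_RPL : PL f ⊆ RPL f := by
  rintro _ ⟨φ, hφ, ψ, hψ, rfl⟩
  exact ⟨φ, PLPlusReal_subset_RPLPlus (PLPlus_subset_PLPlusReal hφ), ψ,
    PLPlusReal_subset_RPLPlus (PLPlus_subset_PLPlusReal hψ), rfl⟩

variable (f) in
/-- Real PL functions form a vector space. -/
def submoduleRPL : Submodule ℝ C(TrivAn f, ℝ) where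
  carrier := RPL f
  zero_mem' := PL_subset_RPL (PLPlus_subset_PL zero_mem_PLPlus)
  add_mem' := by
    rintro _ _ ⟨a, ha, b, hb, rfl⟩ ⟨c, hc, d, hd, rfl⟩
    exact ⟨_, add_mem_RPLPlus ha hc, _, add_mem_RPLPlus hb hd, by abel⟩
  smul_mem' := by
    rintro c _ ⟨a, ha, b, hb, rfl⟩
    rcases le_total 0 c with hc | hc
    · exact ⟨_, smul_mem_RPLPlus ha hc, _, smul_mem_RPLPlus hb hc, smul_sub _ _ _⟩
    · refine ⟨_, smul_mem_RPLPlus hb (neg_nonneg.2 hc), _, smul_mem_RPLPlus ha (neg_nonneg.2 hc),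
        ?_⟩
      rw [smul_sub, neg_smul, neg_smul]; abel

lemma sup_mem_RPL {φ ψ : C(TrivAn f, ℝ)} (hφ : φ ∈ RPL f) (hψ : ψ ∈ RPL f) : φ ⊔ ψ ∈ RPL f := by
  obtain ⟨a, ha, b, hb, rfl⟩ := hφ
  obtain ⟨c, hc, d, hd, rfl⟩ := hψ
  refine ⟨_, sup_mem_RPLPlus (add_mem_RPLPlus ha hd) (add_mem_RPLPlus hc hb), _,
    add_mem_RPLPlus hb hd, ?_⟩
  rw [sub_eq_add_neg ((a + d) ⊔ (c + b)), sup_add]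
  congr 1 <;> abel

/-- Real PL functions are contained in every space of functions that contains the rational PL
functions and is stable under maxima. -/
lemma RPL_subset {S : Submodule ℝ C(TrivAn f, ℝ)} (hS : PL f ⊆ S)
    (hsup : ∀ φ ∈ S, ∀ ψ ∈ S, φ ⊔ ψ ∈ S) : RPL f ⊆ S := by
  have h : RPLPlus f ⊆ S := fun φ hφ => RPLPlus_induction (p := (· ∈ S)) (fun φ hφ => by
    obtain ⟨r, c, g, -, hg, rfl⟩ := hφ
    exact S.sum_mem fun i _ => S.smul_mem _ (hS (PLPlus_subset_PL (hg i))))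
    (fun φ ψ hφ hψ => hsup φ hφ ψ hψ) hφ
  rintro _ ⟨φ, hφ, ψ, hψ, rfl⟩
  exact S.sub_mem (h hφ) (h hψ)

variable {Y : Scheme.{u}} {g : Y ⟶ Spec (CommRingCat.of (LaurentSeries k))}

lemma PLK_subset_RPLK : PLK g ⊆ RPLK g := fun _ hφ =>
  Submodule.mem_sInf.2 fun _ hS => hS.1 hφ

lemma sup_mem_RPLK {φ ψ : C(LaurentAn g, ℝ)} (hφ : φ ∈ RPLK g) (hψ : ψ ∈ RPLK g) :
    φ ⊔ ψ ∈ RPLK g :=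
  Submodule.mem_sInf.2 fun S hS =>
    hS.2 _ (Submodule.mem_sInf.1 hφ S hS) _ (Submodule.mem_sInf.1 hψ S hS)

/-- Pullback along a map compares the real PL functions as soon as it compares the rational ones. -/
lemma image_RPLK_eq {σ : TrivAn f → LaurentAn g}
    (h : (fun φ : C(LaurentAn g, ℝ) => ⇑φ ∘ σ) '' PLK g =
      (fun ψ : C(TrivAn f, ℝ) => ⇑ψ) '' PL f) :
    (fun φ : C(LaurentAn g, ℝ) => ⇑φ ∘ σ) '' (RPLK g : Set C(LaurentAn g, ℝ)) =
      (fun ψ : C(TrivAn f, ℝ) => ⇑ψ) '' RPL f := by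
  apply Set.Subset.antisymm
  · let S : Submodule ℝ C(LaurentAn g, ℝ) :=
      { carrier := {φ | ∃ ψ ∈ submoduleRPL f, ⇑ψ = ⇑φ ∘ σ}
        zero_mem' := ⟨0, zero_mem _, rfl⟩
        add_mem' := by
          rintro a b ⟨a', ha', ha⟩ ⟨b', hb', hb⟩
          exact ⟨a' + b', add_mem ha' hb', by rw [ContinuousMap.coe_add, ha, hb]; rfl⟩
        smul_mem' := by
          rintro c a ⟨a', ha', ha⟩
          exact ⟨c • a', Submodule.smul_mem _ c ha', by rw [ContinuousMap.coe_smul, ha]; rfl⟩ }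
    have hle : RPLK g ≤ S := by
      refine sInf_le ⟨fun φ hφ => ?_, ?_⟩
      · have h1 : ⇑φ ∘ σ ∈ (fun ψ : C(TrivAn f, ℝ) => ⇑ψ) '' PL f := by
          rw [← h]; exact ⟨φ, hφ, rfl⟩
        obtain ⟨ψ, hψ, h2⟩ := h1
        exact ⟨ψ, PL_subset_RPL hψ, h2⟩
      · rintro a ⟨a', ha', ha⟩ b ⟨b', hb', hb⟩
        exact ⟨a' ⊔ b', sup_mem_RPL ha' hb', by rw [ContinuousMap.coe_sup, ha, hb]; rfl⟩
    rintro _ ⟨φ, hφ, rfl⟩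
    exact hle hφ
  · let S : Submodule ℝ C(TrivAn f, ℝ) :=
      { carrier := {ψ | ∃ φ ∈ RPLK g, ⇑φ ∘ σ = ⇑ψ}
        zero_mem' := ⟨0, zero_mem _, rfl⟩
        add_mem' := by
          rintro a b ⟨a', ha', ha⟩ ⟨b', hb', hb⟩
          exact ⟨a' + b', add_mem ha' hb', by rw [ContinuousMap.coe_add a b, ← ha, ← hb]; rfl⟩
        smul_mem' := by
          rintro c a ⟨a', ha', ha⟩
          exact ⟨c • a', Submodule.smul_mem _ c ha', by rw [ContinuousMap.coe_smul c a, ← ha]; rfl⟩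
            }
    have hle : RPL f ⊆ S := by
      refine RPL_subset (fun ψ hψ => ?_) ?_
      · have h1 : ⇑ψ ∈ (fun φ : C(LaurentAn g, ℝ) => ⇑φ ∘ σ) '' PLK g := by
          rw [h]; exact ⟨ψ, hψ, rfl⟩
        obtain ⟨φ, hφ, h2⟩ := h1
        exact ⟨φ, PLK_subset_RPLK hφ, h2⟩
      · rintro a ⟨a', ha', ha⟩ b ⟨b', hb', hb⟩
        exact ⟨a' ⊔ b', sup_mem_RPLK ha' hb', by rw [ContinuousMap.coe_sup a b, ← ha, ← hb]; rfl⟩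
    rintro _ ⟨ψ, hψ, rfl⟩
    exact hle hψ

end RealPL

/-! ### Comparison of PL functions -/

section Generic

lemma isDominant_fromSpecResidueField_genericPoint (X : Scheme.{u}) [IsIntegral X] :
    IsDominant (X.fromSpecResidueField (genericPoint X)) := by
  refine ⟨?_⟩
  rw [DenseRange, Scheme.range_fromSpecResidueField]
  exact (dense_iff_closure_eq).2 (genericPoint_closure X)

lemma isSeparated_baseChange {k : Type u} [Field k] {X : Scheme.{u}}
    {f : X ⟶ Spec (CommRingCat.of k)} [X.IsSeparated] : (baseChange f).IsSeparated := by
  have h1 : IsSeparated f := inferInstance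
  have h2 : IsSeparated (baseChangeStr f) := inferInstance
  have h3 : IsSeparated (baseChangeStr f ≫ terminal.from _) := inferInstance
  rw [terminal.comp_from] at h3
  exact ⟨h3⟩

variable {k : Type u} [Field k] [CharZero k] {X : Scheme.{u}} {f : X ⟶ Spec (CommRingCat.of k)}

/-- The comparison of rational PL functions, with the generic point of `X` as dominant point. -/
lemma image_PLK_eq (hX : IsSmoothProjectiveVariety f) :
    (fun φ : C(LaurentAn (baseChangeStr f), ℝ) => ⇑φ ∘ gaussExt) '' PLK (baseChangeStr f) =
      (fun ψ : C(TrivAn f, ℝ) => ⇑ψ) '' PL f := by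
  have hint := hX.integral
  have hsm := hX.smooth
  have : IsIntegral X := GeometricallyIntegral.isIntegral_of_subsingleton f
  have : IsIntegral (baseChange f) :=
    pullback_of_geometrically hint.geometrically_isIntegral _ (specLaurent k)
  have : X.IsSeparated := hX.projective.isSeparated
  have : (baseChange f).IsSeparated := isSeparated_baseChange
  let _ : Algebra k (X.residueField (genericPoint X)) := (toResidueField f _).toAlgebra
  let η : Spec (CommRingCat.of (X.residueField (genericPoint X))) ⟶ X :=
    X.fromSpecResidueField (genericPoint X)
  have hη : η ≫ f = Spec.map (CommRingCat.ofHom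
      (algebraMap k (X.residueField (genericPoint X)))) := (Spec.map_preimage _).symm
  have : IsDominant η := isDominant_fromSpecResidueField_genericPoint X
  obtain ⟨C⟩ := hX.projective.exists_projCharts η hη
  have : IsDominant (laurentPoint hη) := isDominant_laurentPoint hη C
  have : Smooth (baseChangeStr f) := inferInstance
  apply Set.Subset.antisymm
  · rintro _ ⟨φ, hφ, rfl⟩
    exact exists_mem_PL_of_mem_PLK hη C hφ
  · rintro _ ⟨ψ, hψ, rfl⟩
    exact exists_mem_PLK_of_mem_PL hη C hψ

end Generic

end NAPL

end

theorem mainTheorem12 {k : Type u} [Field k] [IsAlgClosed k] [CharZero k] {X : Scheme.{u}}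
    (f : X ⟶ Spec (CommRingCat.of k)) (hX : NAPL.IsSmoothProjectiveVariety f) :
    (fun φ : C(NAPL.LaurentAn (NAPL.baseChangeStr f), ℝ) => ⇑φ ∘ NAPL.gaussExt) ''
        NAPL.PLK (NAPL.baseChangeStr f) =
      (fun ψ : C(NAPL.TrivAn f, ℝ) => ⇑ψ) '' NAPL.PL f ∧
    (fun φ : C(NAPL.LaurentAn (NAPL.baseChangeStr f), ℝ) => ⇑φ ∘ NAPL.gaussExt) ''
        (NAPL.RPLK (NAPL.baseChangeStr f) : Set C(NAPL.LaurentAn (NAPL.baseChangeStr f), ℝ)) =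
      (fun ψ : C(NAPL.TrivAn f, ℝ) => ⇑ψ) '' NAPL.RPL f := by
  have h := NAPL.image_PLK_eq hX
  exact ⟨h, NAPL.image_RPLK_eq h⟩
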